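/- Let $(\mathcal V,\otimes,I,c)$ be a braided monoidal category that has coreflexive equalizers and reflexive coequalizers, and suppose that each functor $X\otimes-$ preserves coreflexive equalizers. Let $\mathrm{Comod}\,\mathcal V$ be the monoidal bicategory whose objects are the comonoids in $\mathcal V$, whose 1-cells $M:C\nrightarrow D$ are the comodules (objects of $\mathcal V$ with commuting left $C$- and right $D$-coactions), whose 2-cells are the comodule maps, and in which the composite $N\circ M$ of $M:C\nrightarrow D$ and $N:D\nrightarrow E$ is the equalizer $M\otimes_D N$ of $M\otimes N\rightrightarrows M\otimes D\otimes N$. Write $C^o=(C,c\delta,\epsilon)$ for the opposite of a comonoid $C=(C,\delta,\epsilon)$ and $e:C\otimes C^o\nrightarrow I$, $n:I\nrightarrow C^o\otimes C$ for the comodules carried by $C$ that exhibit $C^o$ as a right bidual of $C$; thus $C^o\otimes C$ is a monoidale with multiplication $p=C^o\otimes e\otimes C$ and unit $n$. A right $C^o\otimes C'$-comodule is regarded by biduality as a comodule $C\nrightarrow C'$ when products $X\otimes_{C'}-$ and $-\otimes_C X$ are formed. For comodules $X_i:C_{i-1}^o\otimes C_i\nrightarrow C_{i-1}^o\otimes C_i$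 ($1\le i\le n$, $n\ge1$) let $T_n(X_1,\dots,X_n):C_0^o\otimes C_n\nrightarrow C_0^o\otimes C_n$ be the left Kan extension of $(C_0^o\otimes e\otimes\cdots\otimes e\otimes C_n)\circ(X_1\otimes\cdots\otimes X_n)$ along $C_0^o\otimes e\otimes\cdots\otimes e\otimes C_n$, when it exists. Equivalently, $T_n(X_1,\dots,X_n)$ is universal among such comodules $Y$ with a map $X_1\otimes_{C_1}\cdots\otimes_{C_{n-1}}X_n\to Y$ that respects the left and right $C_0^o$- and $C_n$-coactions and, for $0<i<n$, equalizes the left coaction by $C_i$ (induced from $X_i$) and the left coaction by $C_i^o$ (induced from $X_{i+1}$). For a partition $m=m_1+\cdots+m_n$ the universal properties give a map $\beta:T_m(X_{11},\dots,X_{nm_n})\to T_n(T_{m_1}(X_{11},\dots),\dots,T_{m_n}(X_{n1},\dots))$. If the $X_i$ are comonads, $T_n(X_1,\dots,X_n)$ is a comonad in the unique way that makes the universal 2-cell a comonad map. A quantum category $(A,C)$ is a monoidal comonad $A$ on $C^o\otimes C$: a comonad $A$ on $C^o\otimes C$ in $\mathrm{Comod}\,\mathcal V$ with 2-cells $\mu:p\circ(A\otimes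 A)\Rightarrow A\circ p$ and $\eta:n\Rightarrow A\circ n$ that are comonad maps and satisfy the associativity law and the two unit laws. A quantum module $M:(A,C)\to(A',C')$ is a comonad $M$ on $C^o\otimes C'$ with a 2-cell $\alpha:(C^o\otimes e\otimes e\otimes C')\circ(A\otimes M\otimes A')\Rightarrow M\circ(C^o\otimes e\otimes e\otimes C')$, equivalently a map $T_3(A,M,A')\to M$, that is a comonad map and is associative and unital; $\alpha_l$ and $\alpha_r$ are the left and right actions of $A$ and $A'$ obtained from $\alpha$ with the unit of the other quantum category. A map of quantum modules is a comodule map that respects the actions and the comonad structures. For $M_1:(A_1,C_1)\to(A_2,C_2)$ and $M_2:(A_2,C_2)\to(A_3,C_3)$, the composite $M_1\bullet M_2$ is the coequalizer of $$T_3(M_1,A_2,M_2)\rightrightarrows T_2(M_1,M_2),$$ with the two maps $T_2(M_1,\alpha_l)\beta_{1+2}$ and $T_2(\alpha_r,M_2)\beta_{2+1}$, in the category of comonads on $C_1^o\otimes C_3$ in $\mathrm{Comod}\,\mathcal V$ (comonad maps over the identity of $C_1^o\otimes C_3$), with the action of $(A_1,A_3)$ induced from the left action on $M_1$ and the right action on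 $M_2$. Let $\mathcal X$ be a class of comodules of the form $X:C^o\otimes C'\nrightarrow C^o\otimes C'$, for varying comonoids $C,C'$, such that 1. if $X_1,\dots,X_n$ ($n\ge 1$) are in $\mathcal X$, then the left Kan extension $T_n(X_1,\dots,X_n)$ exists; 2. if the $X_{ij}$ are in $\mathcal X$, then $\beta$ is an isomorphism for every partition $m=m_1+\cdots+m_n$ with all $m_i>0$; 3. if $X:C^o\otimes C'\nrightarrow C^o\otimes C'$ is in $\mathcal X$, then the functors $X\otimes_{C'}-:\mathrm{Comod}\,\mathcal V(C',I)\to\mathcal V$ and $-\otimes_C X:\mathrm{Comod}\,\mathcal V(I,C)\to\mathcal V$ preserve reflexive coequalizers; 4. if $X:C^o\otimes C'\nrightarrow C^o\otimes C'$ and $Y:C'^o\otimes C''\nrightarrow C'^o\otimes C''$ are in $\mathcal X$, then so is $X\otimes_{C'}Y:C^o\otimes C''\nrightarrow C^o\otimes C''$; 5. if $X$ is in $\mathcal X$ and $X\to Y$ is an epimorphism of comodules, then $Y$ is in $\mathcal X$. Consider the quantum categories, and the quantum modules between them, whose underlying comodules $C^o\otimes C'\nrightarrow C^o\otimes C'$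 are in $\mathcal X$. With these as objects and 1-cells, and with the maps of quantum modules as 2-cells, they form a bicategory under the composition $\bullet$: all these composites exist and are again quantum modules with underlying comodule in $\mathcal X$; the identity of $(A,C)$ is $A$ acting on itself by its multiplication; whiskering is induced by $T_2$; the associativity constraint is induced by the identity of $M_1\otimes_{C_2}M_2\otimes_{C_3}M_3$; and the unit constraints $A\bullet M\cong M\cong M\bullet A'$ are induced by $\alpha_l$ and $\alpha_r$. -/

import Mathlib

open CategoryTheory MonoidalCategory Limits

universe v u

set_option linter.unusedSectionVars false
set_option linter.unusedTactic false
set_option linter.unusedVariables false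

namespace QuantumModules

variable {V : Type u} [Category.{v} V] [MonoidalCategory V]

/-- A comodule `C ⇸ D` between comonoids: an object with a left `C`-coaction and a right
`D`-coaction that commute. These are the 1-cells from `C` to `D` of the bicategory `Comod 𝒱`,
i.e. the coalgebras for the comonad `C ⊗ - ⊗ D`. -/
structure Comodule (C D : Comon V) where
  X : V
  left : X ⟶ C.X ⊗ X
  right : X ⟶ X ⊗ D.X
  left_counit : left ≫ C.comon.counit ▷ X = (λ_ X).inv
  left_coassoc : left ≫ C.X ◁ left = left ≫ C.comon.comul ▷ X ≫ (α_ _ _ _).hom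
  right_counit : right ≫ X ◁ D.comon.counit = (ρ_ X).inv
  right_coassoc : right ≫ right ▷ D.X = right ≫ X ◁ D.comon.comul ≫ (α_ _ _ _).inv
  left_right : left ≫ C.X ◁ right = right ≫ left ▷ D.X ≫ (α_ _ _ _).hom

namespace Comodule

/-- Maps of comodules: the 2-cells of `Comod 𝒱`. -/
@[ext]
structure Hom {C D : Comon V} (M N : Comodule C D) where
  hom : M.X ⟶ N.X
  left_comm : hom ≫ N.left = M.left ≫ C.X ◁ hom
  right_comm : hom ≫ N.right = M.right ≫ hom ▷ D.X

instance (C D : Comon V) : Category (Comodule C D) where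
  Hom M N := Hom M N
  id M := ⟨𝟙 M.X, by simp, by simp⟩
  comp f g := ⟨f.hom ≫ g.hom, by simp [Hom.left_comm, reassoc_of% Hom.left_comm],
    by simp [Hom.right_comm, reassoc_of% Hom.right_comm]⟩

@[ext]
lemma hom_ext {C D : Comon V} {M N : Comodule C D} {f g : M ⟶ N} (h : f.hom = g.hom) : f = g :=
  Hom.ext h

@[simp] lemma id_hom {C D : Comon V} (M : Comodule C D) : Hom.hom (𝟙 M) = 𝟙 M.X := rfl
@[simp] lemma comp_hom {C D : Comon V} {M N P : Comodule C D} (f : M ⟶ N) (g : N ⟶ P) :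
    (f ≫ g).hom = f.hom ≫ g.hom := rfl

/-- The identity comodule `C ⇸ C`. -/
def one (C : Comon V) : Comodule C C where
  X := C.X
  left := C.comon.comul
  right := C.comon.comul
  left_counit := C.comon.counit_comul
  left_coassoc := C.comon.comul_assoc
  right_counit := C.comon.comul_counit
  right_coassoc := by have := C.comon.comul_assoc; simp [reassoc_of% this]
  left_right := C.comon.comul_assoc

section comp

variable {C D E : Comon V}

/-- The first map of the pair whose equalizer is `M ⊗_D N`. -/
def balL (M : Comodule C D) (N : Comodule D E) : M.X ⊗ N.X ⟶ M.X ⊗ (D.X ⊗ N.X) :=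
  M.right ▷ N.X ≫ (α_ _ _ _).hom

/-- The second map of the pair whose equalizer is `M ⊗_D N`. -/
def balR (M : Comodule C D) (N : Comodule D E) : M.X ⊗ N.X ⟶ M.X ⊗ (D.X ⊗ N.X) :=
  M.X ◁ N.left

instance (M : Comodule C D) (N : Comodule D E) : IsCoreflexivePair (balL M N) (balR M N) :=
  IsCoreflexivePair.mk' (M.X ◁ (D.comon.counit ▷ N.X ≫ (λ_ _).hom))
    (by
      have := congrArg (fun t => t ▷ N.X) M.right_counit
      simp only [comp_whiskerRight] at this
      simp [balL]
      rw [← associator_naturality_middle_assoc, reassoc_of% this]; simp)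
    (by simp only [balR, ← whiskerLeft_comp, reassoc_of% left_counit]; simp)

variable [HasCoreflexiveEqualizers V]

/-- The object of the composite: the (coreflexive) equalizer of `M ⊗ N ⇉ M ⊗ D ⊗ N`. -/
noncomputable def cot (M : Comodule C D) (N : Comodule D E) : V := equalizer (balL M N) (balR M N)

noncomputable def ι (M : Comodule C D) (N : Comodule D E) : cot M N ⟶ M.X ⊗ N.X :=
  equalizer.ι _ _

lemma ι_cond (M : Comodule C D) (N : Comodule D E) :
    ι M N ≫ M.right ▷ N.X ≫ (α_ _ _ _).hom = ι M N ≫ M.X ◁ N.left := equalizer.condition _ _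

instance (M : Comodule C D) (N : Comodule D E) : Mono (ι M N) := equalizer.ι_mono

noncomputable def lift (M : Comodule C D) (N : Comodule D E) {W : V} (t : W ⟶ M.X ⊗ N.X)
    (h : t ≫ M.right ▷ N.X ≫ (α_ _ _ _).hom = t ≫ M.X ◁ N.left) : W ⟶ cot M N :=
  equalizer.lift (f := balL M N) (g := balR M N) t h

@[simp]
lemma lift_ι (M : Comodule C D) (N : Comodule D E) {W : V} (t : W ⟶ M.X ⊗ N.X)
    (h : t ≫ M.right ▷ N.X ≫ (α_ _ _ _).hom = t ≫ M.X ◁ N.left) :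
    lift M N t h ≫ ι M N = t :=
  equalizer.lift_ι (f := balL M N) (g := balR M N) t h

section left
variable [∀ X : V, Comonad.PreservesLimitOfIsCoreflexivePair (tensorLeft X)]

noncomputable def isLimL (Z : V) (M : Comodule C D) (N : Comodule D E) :=
  isLimitForkMapOfIsLimit (tensorLeft Z) _ (equalizerIsEqualizer (balL M N) (balR M N))

instance (Z : V) (M : Comodule C D) (N : Comodule D E) : Mono (Z ◁ ι M N) :=
  mono_of_isLimit_fork (isLimL Z M N)

noncomputable def liftL (Z : V) (M : Comodule C D) (N : Comodule D E) {W : V}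
    (t : W ⟶ Z ⊗ (M.X ⊗ N.X))
    (h : t ≫ Z ◁ (M.right ▷ N.X ≫ (α_ _ _ _).hom) = t ≫ Z ◁ (M.X ◁ N.left)) :
    W ⟶ Z ⊗ cot M N :=
  Fork.IsLimit.lift (isLimL Z M N) t h

@[simp]
lemma liftL_ι (Z : V) (M : Comodule C D) (N : Comodule D E) {W : V}
    (t : W ⟶ Z ⊗ (M.X ⊗ N.X))
    (h : t ≫ Z ◁ (M.right ▷ N.X ≫ (α_ _ _ _).hom) = t ≫ Z ◁ (M.X ◁ N.left)) :
    liftL Z M N t h ≫ Z ◁ ι M N = t := Fork.IsLimit.lift_ι (isLimL Z M N)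

instance (Y Z : V) (M : Comodule C D) (N : Comodule D E) : Mono (Y ◁ Z ◁ ι M N) := by
  have : Y ◁ Z ◁ ι M N = (α_ _ _ _).inv ≫ (Y ⊗ Z) ◁ ι M N ≫ (α_ _ _ _).hom := by simp
  rw [this]; infer_instance

end left

section right
variable [BraidedCategory V] [∀ X : V, Comonad.PreservesLimitOfIsCoreflexivePair (tensorLeft X)]

instance (Z : V) : Comonad.PreservesLimitOfIsCoreflexivePair (tensorRight Z) where
  out _ _ _ _ _ := preservesLimit_of_natIso _ (BraidedCategory.tensorLeftIsoTensorRight Z)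

noncomputable def isLimR (Z : V) (M : Comodule C D) (N : Comodule D E) :=
  isLimitForkMapOfIsLimit (tensorRight Z) _ (equalizerIsEqualizer (balL M N) (balR M N))

instance (Z : V) (M : Comodule C D) (N : Comodule D E) : Mono (ι M N ▷ Z) :=
  mono_of_isLimit_fork (isLimR Z M N)

noncomputable def liftR (Z : V) (M : Comodule C D) (N : Comodule D E) {W : V}
    (t : W ⟶ (M.X ⊗ N.X) ⊗ Z)
    (h : t ≫ (M.right ▷ N.X ≫ (α_ _ _ _).hom) ▷ Z = t ≫ (M.X ◁ N.left) ▷ Z) :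
    W ⟶ cot M N ⊗ Z :=
  Fork.IsLimit.lift (isLimR Z M N) t h

@[simp]
lemma liftR_ι (Z : V) (M : Comodule C D) (N : Comodule D E) {W : V}
    (t : W ⟶ (M.X ⊗ N.X) ⊗ Z)
    (h : t ≫ (M.right ▷ N.X ≫ (α_ _ _ _).hom) ▷ Z = t ≫ (M.X ◁ N.left) ▷ Z) :
    liftR Z M N t h ≫ ι M N ▷ Z = t := Fork.IsLimit.lift_ι (isLimR Z M N)

instance (Y Z : V) (M : Comodule C D) (N : Comodule D E) : Mono (ι M N ▷ Y ▷ Z) := by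
  have : ι M N ▷ Y ▷ Z = (α_ _ _ _).hom ≫ ι M N ▷ (Y ⊗ Z) ≫ (α_ _ _ _).inv := by simp
  rw [this]; infer_instance

instance (Y Z : V) (M : Comodule C D) (N : Comodule D E) : Mono (Y ◁ ι M N ▷ Z) := by
  have : Y ◁ ι M N ▷ Z = Y ◁ (β_ _ _).hom ≫ Y ◁ Z ◁ ι M N ≫ Y ◁ (β_ _ _).inv := by
    rw [← whiskerLeft_comp, ← whiskerLeft_comp, ← BraidedCategory.braiding_naturality_left_assoc,
      Iso.hom_inv_id, Category.comp_id]
  rw [this]; infer_instance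

lemma comp_left_aux (M : Comodule C D) (N : Comodule D E) :
    (ι M N ≫ M.left ▷ N.X ≫ (α_ _ _ _).hom) ≫ C.X ◁ (M.right ▷ N.X ≫ (α_ _ _ _).hom) =
    (ι M N ≫ M.left ▷ N.X ≫ (α_ _ _ _).hom) ≫ C.X ◁ (M.X ◁ N.left) :=
  calc _ = ι M N ⊗≫ (M.left ≫ C.X ◁ M.right) ▷ N.X ⊗≫ 𝟙 _ := by monoidal
    _ = (ι M N ≫ M.right ▷ N.X ≫ (α_ _ _ _).hom) ⊗≫ M.left ▷ (D.X ⊗ N.X) ⊗≫ 𝟙 _ := by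
      rw [M.left_right]; monoidal
    _ = ι M N ⊗≫ (M.X ◁ N.left ≫ M.left ▷ (D.X ⊗ N.X)) ⊗≫ 𝟙 _ := by
      rw [ι_cond]; monoidal
    _ = _ := by rw [whisker_exchange]; monoidal

lemma comp_right_aux (M : Comodule C D) (N : Comodule D E) :
    (ι M N ≫ M.X ◁ N.right ≫ (α_ _ _ _).inv) ≫ (M.right ▷ N.X ≫ (α_ _ _ _).hom) ▷ E.X =
    (ι M N ≫ M.X ◁ N.right ≫ (α_ _ _ _).inv) ≫ (M.X ◁ N.left) ▷ E.X :=
  calc _ = ι M N ⊗≫ (M.X ◁ N.right ≫ M.right ▷ (N.X ⊗ E.X)) ⊗≫ 𝟙 _ := by monoidal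
    _ = (ι M N ≫ M.right ▷ N.X ≫ (α_ _ _ _).hom) ⊗≫ (M.X ⊗ D.X) ◁ N.right ⊗≫ 𝟙 _ := by
      rw [whisker_exchange]; monoidal
    _ = ι M N ⊗≫ M.X ◁ (N.left ≫ D.X ◁ N.right) ⊗≫ 𝟙 _ := by
      rw [ι_cond]; monoidal
    _ = _ := by rw [N.left_right]; monoidal

noncomputable def compLeft (M : Comodule C D) (N : Comodule D E) : cot M N ⟶ C.X ⊗ cot M N :=
  liftL C.X M N (ι M N ≫ M.left ▷ N.X ≫ (α_ _ _ _).hom) (comp_left_aux M N)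

noncomputable def compRight (M : Comodule C D) (N : Comodule D E) : cot M N ⟶ cot M N ⊗ E.X :=
  liftR E.X M N (ι M N ≫ M.X ◁ N.right ≫ (α_ _ _ _).inv) (comp_right_aux M N)

lemma compLeft_ι (M : Comodule C D) (N : Comodule D E) :
    compLeft M N ≫ C.X ◁ ι M N = ι M N ≫ M.left ▷ N.X ≫ (α_ _ _ _).hom := liftL_ι ..

lemma compRight_ι (M : Comodule C D) (N : Comodule D E) :
    compRight M N ≫ ι M N ▷ E.X = ι M N ≫ M.X ◁ N.right ≫ (α_ _ _ _).inv := liftR_ι ..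

/-- The composite comodule `C ⇸ E` of `M : C ⇸ D` and `N : D ⇸ E`, carried by the equalizer
`M ⊗_D N`, with the left coaction of `M` and the right coaction of `N`. -/
noncomputable def comp (M : Comodule C D) (N : Comodule D E) : Comodule C E where
  X := cot M N
  left := compLeft M N
  right := compRight M N
  left_counit := by
    rw [← cancel_mono ((λ_ _).hom ≫ ι M N)]
    calc _ = (compLeft M N ≫ C.X ◁ ι M N) ≫ C.comon.counit ▷ _ ≫ (λ_ _).hom := by
          simp only [Category.assoc]; rw [whisker_exchange_assoc]; monoidal
      _ = ι M N ≫ (M.left ≫ C.comon.counit ▷ M.X) ▷ N.X ⊗≫ 𝟙 _ := by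
          rw [compLeft_ι]; monoidal
      _ = _ := by rw [left_counit]; monoidal
  left_coassoc := by
    rw [← cancel_mono (C.X ◁ C.X ◁ ι M N)]
    calc _ = compLeft M N ≫ C.X ◁ (compLeft M N ≫ C.X ◁ ι M N) := by simp
      _ = (compLeft M N ≫ C.X ◁ ι M N) ≫ C.X ◁ (M.left ▷ N.X ≫ (α_ _ _ _).hom) := by
          rw [compLeft_ι]; simp [reassoc_of% compLeft_ι]
      _ = ι M N ≫ (M.left ≫ C.X ◁ M.left) ▷ N.X ⊗≫ 𝟙 _ := by
          rw [compLeft_ι]; monoidal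
      _ = (ι M N ≫ M.left ▷ N.X ≫ (α_ _ _ _).hom) ≫ C.comon.comul ▷ _ ≫ (α_ _ _ _).hom := by
          rw [left_coassoc]; monoidal
      _ = _ := by
          rw [← compLeft_ι, Category.assoc, whisker_exchange_assoc]; monoidal
  right_counit := by
    rw [← cancel_mono ((ρ_ _).hom ≫ ι M N)]
    calc _ = (compRight M N ≫ ι M N ▷ E.X) ≫ _ ◁ E.comon.counit ≫ (ρ_ _).hom := by
          simp only [Category.assoc]; rw [← whisker_exchange_assoc]; monoidal
      _ = ι M N ≫ M.X ◁ (N.right ≫ N.X ◁ E.comon.counit) ⊗≫ 𝟙 _ := by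
          rw [compRight_ι]; monoidal
      _ = _ := by rw [right_counit]; monoidal
  right_coassoc := by
    rw [← cancel_mono (ι M N ▷ E.X ▷ E.X)]
    calc _ = compRight M N ≫ (compRight M N ≫ ι M N ▷ E.X) ▷ E.X := by simp
      _ = (compRight M N ≫ ι M N ▷ E.X) ≫ (M.X ◁ N.right ≫ (α_ _ _ _).inv) ▷ E.X := by
          rw [compRight_ι]; simp [reassoc_of% compRight_ι]
      _ = ι M N ≫ M.X ◁ (N.right ≫ N.right ▷ E.X) ⊗≫ 𝟙 _ := by
          rw [compRight_ι]; monoidal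
      _ = (ι M N ≫ M.X ◁ N.right ≫ (α_ _ _ _).inv) ≫ _ ◁ E.comon.comul ≫ (α_ _ _ _).inv := by
          rw [right_coassoc]; monoidal
      _ = _ := by
          rw [← compRight_ι, Category.assoc, ← whisker_exchange_assoc]; monoidal
  left_right := by
    rw [← cancel_mono (C.X ◁ ι M N ▷ E.X)]
    calc _ = compLeft M N ≫ C.X ◁ (compRight M N ≫ ι M N ▷ E.X) := by simp
      _ = (compLeft M N ≫ C.X ◁ ι M N) ≫ C.X ◁ (M.X ◁ N.right ≫ (α_ _ _ _).inv) := by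
          rw [compRight_ι]; simp
      _ = ι M N ⊗≫ (M.left ▷ N.X ≫ (C.X ⊗ M.X) ◁ N.right) ⊗≫ 𝟙 _ := by
          rw [compLeft_ι]; monoidal
      _ = (compRight M N ≫ ι M N ▷ E.X) ≫ (M.left ▷ N.X ≫ (α_ _ _ _).hom) ▷ E.X ≫
            (α_ _ _ _).hom := by
          rw [compRight_ι, ← whisker_exchange]; monoidal
      _ = compRight M N ≫ (compLeft M N ≫ C.X ◁ ι M N) ▷ E.X ≫ (α_ _ _ _).hom := by
          rw [compLeft_ι]; simp
      _ = _ := by simp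

/-! From here on the composite is only used through the following interface. -/

/-- The inclusion `M ⊗_D N ⟶ M ⊗ N`. -/
noncomputable def inc (M : Comodule C D) (N : Comodule D E) : (comp M N).X ⟶ M.X ⊗ N.X := ι M N

lemma inc_cond (M : Comodule C D) (N : Comodule D E) :
    inc M N ≫ M.right ▷ N.X ≫ (α_ _ _ _).hom = inc M N ≫ M.X ◁ N.left := ι_cond M N

instance (M : Comodule C D) (N : Comodule D E) : Mono (inc M N) :=
  inferInstanceAs (Mono (ι M N))

instance (Z : V) (M : Comodule C D) (N : Comodule D E) : Mono (Z ◁ inc M N) :=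
  inferInstanceAs (Mono (Z ◁ ι M N))

instance (Z : V) (M : Comodule C D) (N : Comodule D E) : Mono (inc M N ▷ Z) :=
  inferInstanceAs (Mono (ι M N ▷ Z))

instance (Y Z : V) (M : Comodule C D) (N : Comodule D E) : Mono (Y ◁ inc M N ▷ Z) :=
  inferInstanceAs (Mono (Y ◁ ι M N ▷ Z))

instance (Y Z : V) (M : Comodule C D) (N : Comodule D E) : Mono (inc M N ▷ Y ▷ Z) :=
  inferInstanceAs (Mono (ι M N ▷ Y ▷ Z))

instance (Y Z : V) (M : Comodule C D) (N : Comodule D E) : Mono (Y ◁ Z ◁ inc M N) :=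
  inferInstanceAs (Mono (Y ◁ Z ◁ ι M N))

lemma comp_left_inc (M : Comodule C D) (N : Comodule D E) :
    (comp M N).left ≫ C.X ◁ inc M N = inc M N ≫ M.left ▷ N.X ≫ (α_ _ _ _).hom :=
  compLeft_ι M N

lemma comp_right_inc (M : Comodule C D) (N : Comodule D E) :
    (comp M N).right ≫ inc M N ▷ E.X = inc M N ≫ M.X ◁ N.right ≫ (α_ _ _ _).inv :=
  compRight_ι M N

/-- Factor a map through `M ⊗_D N`. -/
noncomputable def fac (M : Comodule C D) (N : Comodule D E) {W : V} (t : W ⟶ M.X ⊗ N.X)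
    (h : t ≫ M.right ▷ N.X ≫ (α_ _ _ _).hom = t ≫ M.X ◁ N.left) : W ⟶ (comp M N).X :=
  lift M N t h

lemma fac_inc (M : Comodule C D) (N : Comodule D E) {W : V} (t : W ⟶ M.X ⊗ N.X)
    (h : t ≫ M.right ▷ N.X ≫ (α_ _ _ _).hom = t ≫ M.X ◁ N.left) :
    fac M N t h ≫ inc M N = t := lift_ι ..

/-- Factor a map through `Z ⊗ (M ⊗_D N)`. -/
noncomputable def facL (Z : V) (M : Comodule C D) (N : Comodule D E) {W : V}
    (t : W ⟶ Z ⊗ (M.X ⊗ N.X))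
    (h : t ≫ Z ◁ (M.right ▷ N.X ≫ (α_ _ _ _).hom) = t ≫ Z ◁ (M.X ◁ N.left)) :
    W ⟶ Z ⊗ (comp M N).X := liftL Z M N t h

lemma facL_inc (Z : V) (M : Comodule C D) (N : Comodule D E) {W : V}
    (t : W ⟶ Z ⊗ (M.X ⊗ N.X))
    (h : t ≫ Z ◁ (M.right ▷ N.X ≫ (α_ _ _ _).hom) = t ≫ Z ◁ (M.X ◁ N.left)) :
    facL Z M N t h ≫ Z ◁ inc M N = t := liftL_ι ..

/-- Factor a map through `(M ⊗_D N) ⊗ Z`. -/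
noncomputable def facR (Z : V) (M : Comodule C D) (N : Comodule D E) {W : V}
    (t : W ⟶ (M.X ⊗ N.X) ⊗ Z)
    (h : t ≫ (M.right ▷ N.X ≫ (α_ _ _ _).hom) ▷ Z = t ≫ (M.X ◁ N.left) ▷ Z) :
    W ⟶ (comp M N).X ⊗ Z := liftR Z M N t h

lemma facR_inc (Z : V) (M : Comodule C D) (N : Comodule D E) {W : V}
    (t : W ⟶ (M.X ⊗ N.X) ⊗ Z)
    (h : t ≫ (M.right ▷ N.X ≫ (α_ _ _ _).hom) ▷ Z = t ≫ (M.X ◁ N.left) ▷ Z) :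
    facR Z M N t h ≫ inc M N ▷ Z = t := liftR_ι ..

lemma compMap_aux {M M' : Comodule C D} {N N' : Comodule D E} (f : M ⟶ M') (g : N ⟶ N') :
    (inc M N ≫ f.hom ▷ N.X ≫ M'.X ◁ g.hom) ≫ M'.right ▷ N'.X ≫ (α_ _ _ _).hom =
    (inc M N ≫ f.hom ▷ N.X ≫ M'.X ◁ g.hom) ≫ M'.X ◁ N'.left :=
  calc _ = inc M N ⊗≫ ((f.hom ≫ M'.right) ▷ N.X ≫ (M'.X ⊗ D.X) ◁ g.hom) ⊗≫ 𝟙 _ := by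
          have := whisker_exchange M'.right g.hom
          simp only [Category.assoc]
          rw [reassoc_of% this]; monoidal
      _ = (inc M N ≫ M.right ▷ N.X ≫ (α_ _ _ _).hom) ⊗≫ f.hom ▷ (D.X ⊗ N.X) ≫
            M'.X ◁ D.X ◁ g.hom := by
          rw [f.right_comm]; monoidal
      _ = inc M N ≫ f.hom ▷ N.X ≫ M'.X ◁ (N.left ≫ D.X ◁ g.hom) := by
          rw [inc_cond]
          have := whisker_exchange f.hom N.left
          simp only [whiskerLeft_comp]
          rw [← reassoc_of% this]; monoidal
      _ = _ := by rw [← g.left_comm]; simp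

noncomputable def compMapHom {M M' : Comodule C D} {N N' : Comodule D E} (f : M ⟶ M') (g : N ⟶ N') :
    (comp M N).X ⟶ (comp M' N').X :=
  fac M' N' (inc M N ≫ f.hom ▷ N.X ≫ M'.X ◁ g.hom) (compMap_aux f g)

lemma compMapHom_inc {M M' : Comodule C D} {N N' : Comodule D E} (f : M ⟶ M') (g : N ⟶ N') :
    compMapHom f g ≫ inc M' N' = inc M N ≫ f.hom ▷ N.X ≫ M'.X ◁ g.hom := fac_inc ..

lemma compMapHom_left {M M' : Comodule C D} {N N' : Comodule D E} (f : M ⟶ M') (g : N ⟶ N') :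
    compMapHom f g ≫ (comp M' N').left = (comp M N).left ≫ C.X ◁ compMapHom f g := by
  rw [← cancel_mono (C.X ◁ inc M' N')]
  calc _ = (compMapHom f g ≫ inc M' N') ≫ M'.left ▷ N'.X ≫ (α_ _ _ _).hom := by simp [comp_left_inc]
    _ = inc M N ≫ f.hom ▷ N.X ≫ M'.left ▷ N.X ≫ (C.X ⊗ M'.X) ◁ g.hom ≫ (α_ _ _ _).hom := by
      rw [compMapHom_inc]; simp only [Category.assoc]; rw [whisker_exchange_assoc]
    _ = inc M N ≫ (f.hom ≫ M'.left) ▷ N.X ≫ (C.X ⊗ M'.X) ◁ g.hom ≫ (α_ _ _ _).hom := by simp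
    _ = ((comp M N).left ≫ C.X ◁ inc M N) ≫ C.X ◁ (f.hom ▷ N.X ≫ M'.X ◁ g.hom) := by
      rw [f.left_comm, comp_left_inc]; simp
    _ = (comp M N).left ≫ C.X ◁ (compMapHom f g ≫ inc M' N') := by rw [compMapHom_inc]; simp
    _ = _ := by simp

lemma compMapHom_right {M M' : Comodule C D} {N N' : Comodule D E} (f : M ⟶ M') (g : N ⟶ N') :
    compMapHom f g ≫ (comp M' N').right = (comp M N).right ≫ compMapHom f g ▷ E.X := by
  rw [← cancel_mono (inc M' N' ▷ E.X)]
  calc _ = (compMapHom f g ≫ inc M' N') ≫ M'.X ◁ N'.right ≫ (α_ _ _ _).inv := by simp [comp_right_inc]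
    _ = inc M N ≫ f.hom ▷ N.X ≫ M'.X ◁ (g.hom ≫ N'.right) ≫ (α_ _ _ _).inv := by
      rw [compMapHom_inc]; simp
    _ = inc M N ≫ M.X ◁ N.right ≫ f.hom ▷ (N.X ⊗ E.X) ≫ M'.X ◁ (g.hom ▷ E.X) ≫
          (α_ _ _ _).inv := by
      rw [g.right_comm, whiskerLeft_comp, whisker_exchange_assoc]; simp
    _ = ((comp M N).right ≫ inc M N ▷ E.X) ≫ (f.hom ▷ N.X ≫ M'.X ◁ g.hom) ▷ E.X := by
      rw [comp_right_inc]; monoidal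
    _ = (comp M N).right ≫ (compMapHom f g ≫ inc M' N') ▷ E.X := by rw [compMapHom_inc]; simp
    _ = _ := by simp

/-- Horizontal composition of 2-cells. -/
noncomputable def compMap {M M' : Comodule C D} {N N' : Comodule D E} (f : M ⟶ M') (g : N ⟶ N') :
    comp M N ⟶ comp M' N' where
  hom := compMapHom f g
  left_comm := compMapHom_left f g
  right_comm := compMapHom_right f g

lemma compMap_id (M : Comodule C D) (N : Comodule D E) : compMap (𝟙 M) (𝟙 N) = 𝟙 (comp M N) := by
  ext
  change compMapHom (𝟙 M) (𝟙 N) = 𝟙 ((comp M N).X)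
  rw [← cancel_mono (inc M N), compMapHom_inc]; simp

lemma compMap_comp {M M' M'' : Comodule C D} {N N' N'' : Comodule D E}
    (f : M ⟶ M') (f' : M' ⟶ M'') (g : N ⟶ N') (g' : N' ⟶ N'') :
    compMap (f ≫ f') (g ≫ g') = compMap f g ≫ compMap f' g' := by
  ext
  change compMapHom (f ≫ f') (g ≫ g') = compMapHom f g ≫ compMapHom f' g'
  rw [← cancel_mono (inc M'' N''), compMapHom_inc, Category.assoc, compMapHom_inc, reassoc_of% compMapHom_inc]
  simp [whisker_exchange_assoc]

noncomputable def unitLMap (N : Comodule C D) : N.X ⟶ (comp (one C) N).X :=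
  fac (one C) N N.left N.left_coassoc.symm

lemma unitLMap_inc (N : Comodule C D) : unitLMap N ≫ inc (one C) N = N.left := fac_inc ..

/-- The left unit constraint `N ⟶ C ⊗_C N`, given by the coaction. -/
noncomputable def unitL (N : Comodule C D) : N ⟶ comp (one C) N where
  hom := unitLMap N
  left_comm := by
    change unitLMap N ≫ (comp (one C) N).left = N.left ≫ C.X ◁ unitLMap N
    rw [← cancel_mono (C.X ◁ inc (one C) N), Category.assoc, comp_left_inc, reassoc_of% unitLMap_inc,
      Category.assoc, ← whiskerLeft_comp, unitLMap_inc]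
    exact N.left_coassoc.symm
  right_comm := by
    change unitLMap N ≫ (comp (one C) N).right = N.right ≫ unitLMap N ▷ D.X
    rw [← cancel_mono (inc (one C) N ▷ D.X), Category.assoc, comp_right_inc, reassoc_of% unitLMap_inc,
      Category.assoc, ← comp_whiskerRight, unitLMap_inc]
    exact ((reassoc_of% N.left_right) (α_ _ _ _).inv).trans (by simp [one])

noncomputable def unitRMap (N : Comodule C D) : N.X ⟶ (comp N (one D)).X :=
  fac N (one D) N.right (((reassoc_of% N.right_coassoc) (α_ _ _ _).hom).trans (by simp [one]))

lemma unitRMap_inc (N : Comodule C D) : unitRMap N ≫ inc N (one D) = N.right := fac_inc ..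

/-- The right unit constraint `N ⟶ N ⊗_D D`, given by the coaction. -/
noncomputable def unitR (N : Comodule C D) : N ⟶ comp N (one D) where
  hom := unitRMap N
  left_comm := by
    change unitRMap N ≫ (comp N (one D)).left = N.left ≫ C.X ◁ unitRMap N
    rw [← cancel_mono (C.X ◁ inc N (one D)), Category.assoc, comp_left_inc, reassoc_of% unitRMap_inc,
      Category.assoc, ← whiskerLeft_comp, unitRMap_inc]
    exact N.left_right.symm
  right_comm := by
    change unitRMap N ≫ (comp N (one D)).right = N.right ≫ unitRMap N ▷ D.X
    rw [← cancel_mono (inc N (one D) ▷ D.X), Category.assoc, comp_right_inc, reassoc_of% unitRMap_inc,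
      Category.assoc, ← comp_whiskerRight, unitRMap_inc]
    exact N.right_coassoc.symm

variable {F : Comon V}

lemma assoc_aux₁ (M : Comodule C D) (N : Comodule D E) (L : Comodule E F) :
    (inc M (comp N L) ≫ M.X ◁ inc N L ≫ (α_ _ _ _).inv) ≫
      (M.right ▷ N.X ≫ (α_ _ _ _).hom) ▷ L.X =
    (inc M (comp N L) ≫ M.X ◁ inc N L ≫ (α_ _ _ _).inv) ≫ (M.X ◁ N.left) ▷ L.X := by
  have h := inc_cond M (comp N L)
  change _ = inc M (comp N L) ≫ M.X ◁ (comp N L).left at h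
  calc _ = inc M (comp N L) ⊗≫ (M.X ◁ inc N L ≫ M.right ▷ (N.X ⊗ L.X)) ⊗≫ 𝟙 _ := by monoidal
    _ = (inc M (comp N L) ≫ M.right ▷ _ ≫ (α_ _ _ _).hom) ⊗≫ M.X ◁ D.X ◁ inc N L ⊗≫ 𝟙 _ := by
      rw [whisker_exchange]; monoidal
    _ = inc M (comp N L) ≫ M.X ◁ ((comp N L).left ≫ D.X ◁ inc N L) ⊗≫ 𝟙 _ := by
      rw [h]; monoidal
    _ = _ := by rw [comp_left_inc]; monoidal

noncomputable def assocPre (M : Comodule C D) (N : Comodule D E) (L : Comodule E F) :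
    (comp M (comp N L)).X ⟶ (comp M N).X ⊗ L.X :=
  facR L.X M N (inc M (comp N L) ≫ M.X ◁ inc N L ≫ (α_ _ _ _).inv) (assoc_aux₁ M N L)

lemma assocPre_inc (M : Comodule C D) (N : Comodule D E) (L : Comodule E F) :
    assocPre M N L ≫ inc M N ▷ L.X = inc M (comp N L) ≫ M.X ◁ inc N L ≫ (α_ _ _ _).inv := facR_inc ..

lemma assoc_aux₂ (M : Comodule C D) (N : Comodule D E) (L : Comodule E F) :
    assocPre M N L ≫ (comp M N).right ▷ L.X ≫ (α_ _ _ _).hom =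
      assocPre M N L ≫ (comp M N).X ◁ L.left := by
  change assocPre M N L ≫ (comp M N).right ▷ L.X ≫ (α_ _ _ _).hom =
      assocPre M N L ≫ (comp M N).X ◁ L.left
  rw [← cancel_mono (inc M N ▷ (E.X ⊗ L.X))]
  calc _ = assocPre M N L ≫ ((comp M N).right ≫ inc M N ▷ E.X) ▷ L.X ≫ (α_ _ _ _).hom := by
        simp
    _ = (assocPre M N L ≫ inc M N ▷ L.X) ≫ (M.X ◁ N.right ≫ (α_ _ _ _).inv) ▷ L.X ≫
          (α_ _ _ _).hom := by
        rw [comp_right_inc]; simp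
    _ = inc M (comp N L) ≫ M.X ◁ (inc N L ≫ N.right ▷ L.X ≫ (α_ _ _ _).hom) ≫ (α_ _ _ _).inv := by
        rw [assocPre_inc]; simp
    _ = (assocPre M N L ≫ inc M N ▷ L.X) ≫ (M.X ⊗ N.X) ◁ L.left := by
        rw [assocPre_inc, inc_cond]; simp
    _ = _ := by rw [Category.assoc, Category.assoc, whisker_exchange]

noncomputable def assocMap (M : Comodule C D) (N : Comodule D E) (L : Comodule E F) :
    (comp M (comp N L)).X ⟶ (comp (comp M N) L).X :=
  fac (comp M N) L (assocPre M N L) (assoc_aux₂ M N L)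

lemma assocMap_inc (M : Comodule C D) (N : Comodule D E) (L : Comodule E F) :
    assocMap M N L ≫ inc (comp M N) L ≫ inc M N ▷ L.X =
      inc M (comp N L) ≫ M.X ◁ inc N L ≫ (α_ _ _ _).inv := by
  rw [← assocPre_inc, assocMap, reassoc_of% fac_inc]

instance (M : Comodule C D) (N : Comodule D E) (L : Comodule E F) :
    Mono (inc (comp M N) L ≫ inc M N ▷ L.X) := mono_comp' inferInstance (inferInstanceAs (Mono (inc M N ▷ L.X)))

instance (Z : V) (M : Comodule C D) (N : Comodule D E) (L : Comodule E F) :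
    Mono (Z ◁ inc (comp M N) L ≫ Z ◁ inc M N ▷ L.X) :=
  mono_comp' inferInstance (inferInstanceAs (Mono (Z ◁ inc M N ▷ L.X)))

instance (Z : V) (M : Comodule C D) (N : Comodule D E) (L : Comodule E F) :
    Mono (inc (comp M N) L ▷ Z ≫ inc M N ▷ L.X ▷ Z) :=
  mono_comp' inferInstance (inferInstanceAs (Mono (inc M N ▷ L.X ▷ Z)))

/-- The associativity constraint `M ⊗_D (N ⊗_E L) ⟶ (M ⊗_D N) ⊗_E L`, the identity of
`M ⊗ N ⊗ L` restricted. -/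
noncomputable def assocInv (M : Comodule C D) (N : Comodule D E) (L : Comodule E F) :
    comp M (comp N L) ⟶ comp (comp M N) L where
  hom := assocMap M N L
  left_comm := by
    change assocMap M N L ≫ (comp (comp M N) L).left = (comp M (comp N L)).left ≫ C.X ◁ assocMap M N L
    rw [← cancel_mono (C.X ◁ inc (comp M N) L ≫ C.X ◁ inc M N ▷ L.X)]
    calc _ = assocMap M N L ≫ ((comp (comp M N) L).left ≫ C.X ◁ inc (comp M N) L) ≫
              C.X ◁ inc M N ▷ L.X := by simp
      _ = assocMap M N L ≫ inc (comp M N) L ≫ ((comp M N).left ≫ C.X ◁ inc M N) ▷ L.X ≫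
            (α_ _ _ _).hom := by
          rw [comp_left_inc]
          change assocMap M N L ≫ (inc (comp M N) L ≫ (comp M N).left ▷ L.X ≫ _) ≫ _ = _
          simp
      _ = (assocMap M N L ≫ inc (comp M N) L ≫ inc M N ▷ L.X) ≫
            (M.left ▷ N.X ≫ (α_ _ _ _).hom) ▷ L.X ≫ (α_ _ _ _).hom := by
          rw [comp_left_inc]; simp
      _ = inc M (comp N L) ≫ (M.X ◁ inc N L ≫ M.left ▷ (N.X ⊗ L.X)) ⊗≫ 𝟙 _ := by
          rw [assocMap_inc]; monoidal
      _ = ((comp M (comp N L)).left ≫ C.X ◁ inc M (comp N L)) ≫ C.X ◁ (M.X ◁ inc N L ≫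
            (α_ _ _ _).inv) := by
          rw [comp_left_inc, whisker_exchange]; monoidal
      _ = (comp M (comp N L)).left ≫ C.X ◁ (assocMap M N L ≫ inc (comp M N) L ≫ inc M N ▷ L.X) := by
          rw [assocMap_inc]; simp
      _ = _ := by simp
  right_comm := by
    change assocMap M N L ≫ (comp (comp M N) L).right = (comp M (comp N L)).right ≫ assocMap M N L ▷ F.X
    rw [← cancel_mono (inc (comp M N) L ▷ F.X ≫ inc M N ▷ L.X ▷ F.X)]
    calc _ = assocMap M N L ≫ ((comp (comp M N) L).right ≫ inc (comp M N) L ▷ F.X) ≫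
              inc M N ▷ L.X ▷ F.X := by simp
      _ = assocMap M N L ≫ inc (comp M N) L ≫ ((comp M N).X ◁ L.right ≫ inc M N ▷ (L.X ⊗ F.X)) ≫
            (α_ _ _ _).inv := by
          rw [comp_right_inc]
          change assocMap M N L ≫ (inc (comp M N) L ≫ (comp M N).X ◁ L.right ≫ _) ≫ _ = _
          simp
      _ = (assocMap M N L ≫ inc (comp M N) L ≫ inc M N ▷ L.X) ≫ _ ◁ L.right ≫ (α_ _ _ _).inv := by
          rw [whisker_exchange]; simp
      _ = inc M (comp N L) ≫ M.X ◁ (inc N L ≫ N.X ◁ L.right ≫ (α_ _ _ _).inv) ⊗≫ 𝟙 _ := by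
          rw [assocMap_inc]; monoidal
      _ = (inc M (comp N L) ≫ M.X ◁ (comp N L).right ≫ (α_ _ _ _).inv) ≫ (M.X ◁ inc N L ≫
            (α_ _ _ _).inv) ▷ F.X := by
          rw [← comp_right_inc]; monoidal
      _ = (comp M (comp N L)).right ≫ (inc M (comp N L) ≫ M.X ◁ inc N L ≫ (α_ _ _ _).inv) ▷ F.X := by
          have := comp_right_inc M (comp N L)
          change _ = inc M (comp N L) ≫ M.X ◁ (comp N L).right ≫ _ at this
          rw [← this]; simp
      _ = (comp M (comp N L)).right ≫ (assocMap M N L ≫ inc (comp M N) L ≫ inc M N ▷ L.X) ▷ F.X := by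
          rw [assocMap_inc]
      _ = _ := by simp

end right
end comp
end Comodule

open Comodule

variable [BraidedCategory V]

/-- The opposite comonoid `C^o = (C, c δ, ε)`. -/
def opp (C : Comon V) : Comon V where
  X := C.X
  comon :=
    { counit := C.comon.counit
      comul := C.comon.comul ≫ (β_ C.X C.X).hom
      counit_comul := by
        have := C.comon.comul_counit
        rw [Category.assoc, ← BraidedCategory.braiding_naturality_right, reassoc_of% this]
        simp
      comul_counit := by
        have := C.comon.counit_comul
        rw [Category.assoc, ← BraidedCategory.braiding_naturality_left, reassoc_of% this]
        simp
      comul_assoc := by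
        have h := C.comon.comul_assoc
        have e1 := BraidedCategory.braiding_naturality_left C.comon.comul C.X
        have e2 := BraidedCategory.braiding_naturality_right C.X C.comon.comul
        simp only [comp_whiskerRight, whiskerLeft_comp, Category.assoc]
        rw [← reassoc_of% e1, ← reassoc_of% e2, reassoc_of% h]
        have yb := BraidedCategory.yang_baxter C.X C.X C.X
        simp only [BraidedCategory.braiding_tensor_left_hom, BraidedCategory.braiding_tensor_right_hom,
          Category.assoc, Iso.hom_inv_id_assoc]
        have yb' := congrArg (fun t => (α_ _ _ _).hom ≫ t) yb
        simp at yb'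
        simp [yb'] }

/-- The comonoid `C^o ⊗ D`, the tensor product of comonoids in the braided category `𝒱`
(see `opTensor_eq`). -/
def opTensor (C D : Comon V) : Comon V where
  X := C.X ⊗ D.X
  comon :=
    { counit := (C.comon.counit ⊗ₘ D.comon.counit) ≫ (λ_ _).hom
      comul := ((C.comon.comul ≫ (β_ C.X C.X).hom) ⊗ₘ D.comon.comul) ≫ tensorμ C.X C.X D.X D.X
      counit_comul := by
        have h := ComonObj.counit_comul ((opp C).X ⊗ D.X)
        rwa [Comon.tensorObj_comul] at h
      comul_counit := by
        have h := ComonObj.comul_counit ((opp C).X ⊗ D.X)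
        rwa [Comon.tensorObj_comul] at h
      comul_assoc := by
        have h := ComonObj.comul_assoc ((opp C).X ⊗ D.X)
        rwa [Comon.tensorObj_comul] at h }

lemma comonObj_ext {X : V} (a b : ComonObj X) (h : a.counit = b.counit)
    (h' : a.comul = b.comul) : a = b := by
  cases a; cases b; cases h; cases h'; rfl

lemma opTensor_eq (C D : Comon V) : opTensor C D = (opp C ⊗ D : Comon V) := by
  have h := Comon.tensorObj_comul (opp C).X D.X
  have e : (opTensor C D).comon = (opp C ⊗ D : Comon V).comon := comonObj_ext _ _ rfl h.symm
  exact congrArg (fun k => ({ X := C.X ⊗ D.X, comon := k } : Comon V)) e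

/-- The projection `C^o ⊗ D ⟶ C^o`, the counit on `D`. -/
def p₁ (C D : Comon V) : (opTensor C D).X ⟶ C.X := C.X ◁ D.comon.counit ≫ (ρ_ _).hom

/-- The projection `C^o ⊗ D ⟶ D`, the counit on `C`. -/
def p₂ (C D : Comon V) : (opTensor C D).X ⟶ D.X := C.comon.counit ▷ D.X ≫ (λ_ _).hom

section tm
variable {A B : V} (a : A ⟶ A ⊗ A) (b : B ⟶ B ⊗ B) (e : A ⟶ 𝟙_ V) (e' : B ⟶ 𝟙_ V)

lemma tm₁ (h : b ≫ e' ▷ B = (λ_ _).inv) :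
    ((a ⊗ₘ b) ≫ tensorμ A A B B) ≫ ((A ◁ e' ≫ (ρ_ _).hom) ⊗ₘ (A ◁ e' ≫ (ρ_ _).hom)) =
    (A ◁ e' ≫ (ρ_ _).hom) ≫ a := by
  have h2 : b ≫ (e' ⊗ₘ e') = e' ≫ (λ_ _).inv := by
    rw [MonoidalCategory.tensorHom_def, reassoc_of% h, ← leftUnitor_inv_naturality]
  rw [← tensorHom_comp_tensorHom, ← id_tensorHom, Category.assoc, ← tensorμ_natural_assoc,
    tensorHom_comp_tensorHom_assoc, h2, id_tensorHom_id, Category.comp_id]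
  have := tensor_right_unitality A A
  have h3 : (a ⊗ₘ e' ≫ (λ_ (𝟙_ V)).inv) = (a ⊗ₘ e') ≫ (A ⊗ A) ◁ (λ_ (𝟙_ V)).inv := by
    rw [← id_tensorHom, tensorHom_comp_tensorHom, Category.comp_id]
  rw [h3, Category.assoc, ← this, MonoidalCategory.tensorHom_def', Category.assoc,
    rightUnitor_naturality, id_tensorHom, Category.assoc]

lemma tm₂ (h : a ≫ e ▷ A = (λ_ _).inv) :
    ((a ⊗ₘ b) ≫ tensorμ A A B B) ≫ ((e ▷ B ≫ (λ_ _).hom) ⊗ₘ (e ▷ B ≫ (λ_ _).hom)) =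
    (e ▷ B ≫ (λ_ _).hom) ≫ b := by
  have h2 : a ≫ (e ⊗ₘ e) = e ≫ (λ_ _).inv := by
    rw [MonoidalCategory.tensorHom_def, reassoc_of% h, ← leftUnitor_inv_naturality]
  rw [← tensorHom_comp_tensorHom, ← tensorHom_id, Category.assoc, ← tensorμ_natural_assoc,
    tensorHom_comp_tensorHom_assoc, h2, id_tensorHom_id, Category.comp_id]
  have := tensor_left_unitality B B
  have h3 : (e ≫ (λ_ (𝟙_ V)).inv ⊗ₘ b) = (e ⊗ₘ b) ≫ (λ_ (𝟙_ V)).inv ▷ (B ⊗ B) := by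
    rw [← tensorHom_id, tensorHom_comp_tensorHom, Category.comp_id]
  rw [h3, Category.assoc, ← this, MonoidalCategory.tensorHom_def, Category.assoc,
    leftUnitor_naturality, tensorHom_id, Category.assoc]

lemma tm₁₂ (h : a ≫ A ◁ e = (ρ_ _).inv) (h' : b ≫ e' ▷ B = (λ_ _).inv) :
    ((a ⊗ₘ b) ≫ tensorμ A A B B) ≫ ((A ◁ e' ≫ (ρ_ _).hom) ⊗ₘ (e ▷ B ≫ (λ_ _).hom)) =
    𝟙 _ := by
  rw [← tensorHom_comp_tensorHom, ← tensorHom_id, ← id_tensorHom, Category.assoc,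
    ← tensorμ_natural_assoc, tensorHom_comp_tensorHom_assoc, id_tensorHom, h, tensorHom_id, h']
  simp only [tensorμ, braiding_tensorUnit_left]
  monoidal

lemma tm₂₁ (h : a ≫ e ▷ A = (λ_ _).inv) (h' : b ≫ B ◁ e' = (ρ_ _).inv) :
    ((a ⊗ₘ b) ≫ tensorμ A A B B) ≫ ((e ▷ B ≫ (λ_ _).hom) ⊗ₘ (A ◁ e' ≫ (ρ_ _).hom)) =
    (β_ A B).hom := by
  rw [← tensorHom_comp_tensorHom, ← tensorHom_id, ← id_tensorHom, Category.assoc,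
    ← tensorμ_natural_assoc, tensorHom_comp_tensorHom_assoc, id_tensorHom, h', tensorHom_id, h]
  simp only [tensorμ]
  monoidal

end tm

lemma p₁_counit (C D : Comon V) : p₁ C D ≫ C.comon.counit = (opTensor C D).comon.counit := by
  change (C.X ◁ D.comon.counit ≫ (ρ_ _).hom) ≫ C.comon.counit =
    (C.comon.counit ⊗ₘ D.comon.counit) ≫ (λ_ _).hom
  rw [MonoidalCategory.tensorHom_def']
  monoidal

lemma p₂_counit (C D : Comon V) : p₂ C D ≫ D.comon.counit = (opTensor C D).comon.counit := by
  change (C.comon.counit ▷ D.X ≫ (λ_ _).hom) ≫ D.comon.counit =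
    (C.comon.counit ⊗ₘ D.comon.counit) ≫ (λ_ _).hom
  rw [MonoidalCategory.tensorHom_def]
  monoidal

lemma comul_p₁ (C D : Comon V) :
    (opTensor C D).comon.comul ≫ (p₁ C D ⊗ₘ p₁ C D) =
      p₁ C D ≫ C.comon.comul ≫ (β_ C.X C.X).hom :=
  tm₁ _ _ _ D.comon.counit_comul

lemma comul_p₂ (C D : Comon V) :
    (opTensor C D).comon.comul ≫ (p₂ C D ⊗ₘ p₂ C D) = p₂ C D ≫ D.comon.comul :=
  tm₂ _ _ _ (opp C).comon.counit_comul

lemma comul_p₁_p₂ (C D : Comon V) :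
    (opTensor C D).comon.comul ≫ (p₁ C D ⊗ₘ p₂ C D) = 𝟙 (C.X ⊗ D.X) :=
  tm₁₂ _ _ _ _ (opp C).comon.comul_counit D.comon.counit_comul

lemma comul_p₂_p₁ (C D : Comon V) :
    (opTensor C D).comon.comul ≫ (p₂ C D ⊗ₘ p₁ C D) = (β_ C.X D.X).hom :=
  tm₂₁ _ _ _ _ (opp C).comon.counit_comul D.comon.comul_counit

/-- The comodules `C^o ⊗ D ⇸ C^o ⊗ D`. -/
abbrev Cell (C D : Comon V) := Comodule (opTensor C D) (opTensor C D)

namespace Cell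
variable {C D : Comon V}

/-- The right `C^o`-coaction. -/
def r₁ (X : Cell C D) : X.X ⟶ X.X ⊗ C.X := X.right ≫ X.X ◁ p₁ C D
/-- The right `D`-coaction. -/
def r₂ (X : Cell C D) : X.X ⟶ X.X ⊗ D.X := X.right ≫ X.X ◁ p₂ C D
/-- The left `C^o`-coaction. -/
def l₁ (X : Cell C D) : X.X ⟶ C.X ⊗ X.X := X.left ≫ p₁ C D ▷ X.X
/-- The left `D`-coaction. -/
def l₂ (X : Cell C D) : X.X ⟶ D.X ⊗ X.X := X.left ≫ p₂ C D ▷ X.X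

section aux
lemma braid_aux {A B X : V} (r : X ⟶ X ⊗ (A ⊗ B)) :
    (r ≫ X ◁ (β_ A B).hom ≫ (α_ _ _ _).inv) ≫ (β_ A (X ⊗ B)).inv =
      (r ≫ (α_ _ _ _).inv) ≫ (β_ A X).inv ▷ B ≫ (α_ _ _ _).hom := by
  rw [BraidedCategory.braiding_tensor_right_inv]; simp

variable {K : Comon V} {A B : V} {X : V} (f : K.X ⟶ A) (g : K.X ⟶ B)

lemma right_aux (r : X ⟶ X ⊗ K.X) (h : r ≫ r ▷ K.X = r ≫ X ◁ K.comon.comul ≫ (α_ _ _ _).inv) :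
    (r ≫ X ◁ g) ≫ (r ≫ X ◁ f) ▷ B = r ≫ X ◁ (K.comon.comul ≫ (f ⊗ₘ g)) ≫ (α_ _ _ _).inv :=
  calc _ = r ≫ (X ◁ g ≫ r ▷ B) ≫ (X ◁ f) ▷ B := by simp
    _ = (r ≫ r ▷ K.X) ≫ (X ⊗ K.X) ◁ g ≫ (X ◁ f) ▷ B := by rw [whisker_exchange]; simp
    _ = r ≫ X ◁ (K.comon.comul ≫ K.X ◁ g ≫ f ▷ B) ≫ (α_ _ _ _).inv := by rw [h]; simp
    _ = _ := by rw [← MonoidalCategory.tensorHom_def']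

lemma left_aux (l : X ⟶ K.X ⊗ X) (h : l ≫ K.X ◁ l = l ≫ K.comon.comul ▷ X ≫ (α_ _ _ _).hom) :
    (l ≫ f ▷ X) ≫ A ◁ (l ≫ g ▷ X) = l ≫ (K.comon.comul ≫ (f ⊗ₘ g)) ▷ X ≫ (α_ _ _ _).hom :=
  calc _ = l ≫ (f ▷ X ≫ A ◁ l) ≫ A ◁ (g ▷ X) := by simp
    _ = (l ≫ K.X ◁ l) ≫ f ▷ (K.X ⊗ X) ≫ A ◁ (g ▷ X) := by rw [← whisker_exchange]; simp
    _ = l ≫ (K.comon.comul ≫ f ▷ K.X ≫ A ◁ g) ▷ X ≫ (α_ _ _ _).hom := by rw [h]; simp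
    _ = _ := by rw [← MonoidalCategory.tensorHom_def]

end aux

lemma r₁_r₁ (X : Cell C D) : r₁ X ≫ r₁ X ▷ C.X =
    r₁ X ≫ X.X ◁ (C.comon.comul ≫ (β_ C.X C.X).hom) ≫ (α_ _ _ _).inv := by
  refine (right_aux (p₁ C D) (p₁ C D) X.right X.right_coassoc).trans ?_
  rw [comul_p₁]; simp [r₁]

lemma r₂_r₂ (X : Cell C D) : r₂ X ≫ r₂ X ▷ D.X =
    r₂ X ≫ X.X ◁ D.comon.comul ≫ (α_ _ _ _).inv := by
  refine (right_aux (p₂ C D) (p₂ C D) X.right X.right_coassoc).trans ?_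
  rw [comul_p₂]; simp [r₂]

lemma r₂_r₁ (X : Cell C D) : r₂ X ≫ r₁ X ▷ D.X = X.right ≫ (α_ X.X C.X D.X).inv := by
  refine (right_aux (p₁ C D) (p₂ C D) X.right X.right_coassoc).trans ?_
  rw [comul_p₁_p₂]
  exact congrArg (fun t => X.right ≫ t)
    ((congrArg (fun t => t ≫ (α_ _ _ _).inv) (whiskerLeft_id X.X (C.X ⊗ D.X))).trans
      (Category.id_comp _))

lemma r₁_r₂ (X : Cell C D) : r₁ X ≫ r₂ X ▷ C.X =
    X.right ≫ X.X ◁ (β_ C.X D.X).hom ≫ (α_ X.X D.X C.X).inv := by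
  refine (right_aux (p₂ C D) (p₁ C D) X.right X.right_coassoc).trans ?_
  rw [comul_p₂_p₁]

lemma l₁_l₁ (X : Cell C D) : l₁ X ≫ C.X ◁ l₁ X =
    l₁ X ≫ (C.comon.comul ≫ (β_ C.X C.X).hom) ▷ X.X ≫ (α_ _ _ _).hom := by
  refine (left_aux (p₁ C D) (p₁ C D) X.left X.left_coassoc).trans ?_
  rw [comul_p₁]; simp [l₁]

lemma l₂_l₂ (X : Cell C D) : l₂ X ≫ D.X ◁ l₂ X = l₂ X ≫ D.comon.comul ▷ X.X ≫ (α_ _ _ _).hom := by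
  refine (left_aux (p₂ C D) (p₂ C D) X.left X.left_coassoc).trans ?_
  rw [comul_p₂]; simp [l₂]

lemma r₁_counit (X : Cell C D) : r₁ X ≫ X.X ◁ C.comon.counit = (ρ_ _).inv := by
  rw [r₁, Category.assoc, ← whiskerLeft_comp, p₁_counit]; exact X.right_counit

lemma r₂_counit (X : Cell C D) : r₂ X ≫ X.X ◁ D.comon.counit = (ρ_ _).inv := by
  rw [r₂, Category.assoc, ← whiskerLeft_comp, p₂_counit]; exact X.right_counit

lemma l₁_counit (X : Cell C D) : l₁ X ≫ C.comon.counit ▷ X.X = (λ_ _).inv := by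
  rw [l₁, Category.assoc, ← comp_whiskerRight, p₁_counit]; exact X.left_counit

lemma l₂_counit (X : Cell C D) : l₂ X ≫ D.comon.counit ▷ X.X = (λ_ _).inv := by
  rw [l₂, Category.assoc, ← comp_whiskerRight, p₂_counit]; exact X.left_counit

/-- left and right coactions commute, for all ways of projecting -/
lemma left_right_aux (X : Cell C D) {A B : V} (f : (opTensor C D).X ⟶ A)
    (g : (opTensor C D).X ⟶ B) :
    (X.left ≫ f ▷ X.X) ≫ A ◁ (X.right ≫ X.X ◁ g) =
      (X.right ≫ X.X ◁ g) ≫ (X.left ≫ f ▷ X.X) ▷ B ≫ (α_ _ _ _).hom :=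
  calc _ = X.left ≫ (f ▷ X.X ≫ A ◁ X.right) ≫ A ◁ X.X ◁ g := by simp
    _ = (X.left ≫ _ ◁ X.right) ≫ f ▷ (X.X ⊗ (opTensor C D).X) ≫ A ◁ X.X ◁ g := by
      rw [← whisker_exchange]; simp
    _ = X.right ≫ (X.left ▷ (opTensor C D).X ≫ (_ ⊗ X.X) ◁ g) ≫ f ▷ X.X ▷ B ≫ (α_ _ _ _).hom := by
      rw [X.left_right, ← whisker_exchange]; simp
    _ = _ := by rw [← whisker_exchange]; simp

/-- The left `C`-coaction obtained from the right `C^o`-coaction by biduality. -/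
def flatLeft (X : Cell C D) : X.X ⟶ C.X ⊗ X.X := r₁ X ≫ (β_ C.X X.X).inv

/-- A comodule `C^o ⊗ D ⇸ C^o ⊗ D` regarded, through its right coaction and biduality, as a
comodule `C ⇸ D`. -/
def flat (X : Cell C D) : Comodule C D where
  X := X.X
  left := flatLeft X
  right := r₂ X
  left_counit := by
    have := r₁_counit X
    rw [flatLeft, Category.assoc, ← BraidedCategory.braiding_inv_naturality_right, reassoc_of% this]
    simp
  left_coassoc := by
    have h := r₁_r₁ X
    have n1 : ∀ {A B : V} (f : A ⟶ B), (β_ C.X A).inv ≫ C.X ◁ f = f ▷ C.X ≫ (β_ C.X B).inv :=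
      fun f => (BraidedCategory.braiding_inv_naturality_left f C.X).symm
    have n2 : ∀ {A B : V} (f : A ⟶ B), (β_ A X.X).inv ≫ f ▷ X.X = X.X ◁ f ≫ (β_ B X.X).inv :=
      fun f => (BraidedCategory.braiding_inv_naturality_right X.X f).symm
    have n3 : X.X ◁ (β_ C.X C.X).hom ≫ (α_ X.X C.X C.X).inv ≫ (β_ C.X X.X).inv ▷ C.X ≫
        (α_ C.X X.X C.X).hom ≫ C.X ◁ (β_ C.X X.X).inv ≫ (α_ C.X C.X X.X).inv =
        (β_ (C.X ⊗ C.X) X.X).inv ≫ (β_ C.X C.X).hom ▷ X.X := by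
      rw [n2, BraidedCategory.braiding_tensor_left_inv]
    calc _ = (r₁ X ≫ r₁ X ▷ C.X) ≫ (β_ C.X X.X).inv ▷ C.X ≫ (β_ C.X _).inv := by
            rw [flatLeft, Category.assoc, n1]; simp
      _ = r₁ X ≫ X.X ◁ C.comon.comul ≫ (β_ (C.X ⊗ C.X) X.X).inv ≫ (α_ _ _ _).hom := by
            rw [h, BraidedCategory.braiding_tensor_right_inv]; simp [reassoc_of% n3]
      _ = _ := by rw [flatLeft, Category.assoc, reassoc_of% n2]
  right_counit := r₂_counit X
  right_coassoc := r₂_r₂ X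
  left_right := by
    have n1 : ∀ {A B : V} (f : A ⟶ B), (β_ C.X A).inv ≫ C.X ◁ f = f ▷ C.X ≫ (β_ C.X B).inv :=
      fun f => (BraidedCategory.braiding_inv_naturality_left f C.X).symm
    have h := r₁_r₂ X
    have h' := r₂_r₁ X
    calc _ = (r₁ X ≫ r₂ X ▷ C.X) ≫ (β_ C.X _).inv := by
            rw [flatLeft, Category.assoc, n1]; simp
      _ = (r₂ X ≫ r₁ X ▷ D.X) ≫ (β_ C.X X.X).inv ▷ D.X ≫ (α_ _ _ _).hom := by
            rw [h, h']
            exact braid_aux X.right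
      _ = _ := by rw [flatLeft]; simp

/-- Comodule maps are also maps of the flattened comodules. -/
def flatMap {X Y : Cell C D} (f : X ⟶ Y) : flat X ⟶ flat Y where
  hom := f.hom
  left_comm := by
    change f.hom ≫ (Y.right ≫ _ ◁ p₁ C D) ≫ (β_ C.X Y.X).inv =
      ((X.right ≫ _ ◁ p₁ C D) ≫ (β_ C.X X.X).inv) ≫ C.X ◁ f.hom
    have h := f.right_comm
    have w := whisker_exchange f.hom (p₁ C D)
    simp only [Category.assoc]
    rw [reassoc_of% h, ← reassoc_of% w, BraidedCategory.braiding_inv_naturality_left]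
  right_comm := by
    change f.hom ≫ (Y.right ≫ _ ◁ p₂ C D) = (X.right ≫ _ ◁ p₂ C D) ≫ f.hom ▷ D.X
    have h := f.right_comm
    have w := whisker_exchange f.hom (p₂ C D)
    simp only [Category.assoc]
    rw [reassoc_of% h, ← w]

end Cell

/-- A further left coaction of a comonoid `K` on a comodule `M : C ⇸ D`, commuting with the
coactions of `C` and `D`. -/
structure LeftCoaction (K : Comon V) {C D : Comon V} (M : Comodule C D) where
  act : M.X ⟶ K.X ⊗ M.X
  counit : act ≫ K.comon.counit ▷ M.X = (λ_ M.X).inv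
  coassoc : act ≫ K.X ◁ act = act ≫ K.comon.comul ▷ M.X ≫ (α_ _ _ _).hom
  comm_right : act ≫ K.X ◁ M.right = M.right ≫ act ▷ D.X ≫ (α_ _ _ _).hom
  comm_left : act ≫ K.X ◁ M.left =
    M.left ≫ C.X ◁ act ≫ (α_ _ _ _).inv ≫ (β_ C.X K.X).hom ▷ M.X ≫ (α_ _ _ _).hom

namespace Cell
variable {C D : Comon V}

lemma flat_comm_left (X : Cell C D) {A : V} (f : (opTensor C D).X ⟶ A) :
    (X.left ≫ f ▷ X.X) ≫ A ◁ flatLeft X =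
      flatLeft X ≫ C.X ◁ (X.left ≫ f ▷ X.X) ≫ (α_ _ _ _).inv ≫ (β_ C.X A).hom ▷ X.X ≫
        (α_ _ _ _).hom := by
  have h := left_right_aux X f (p₁ C D)
  have n1 := BraidedCategory.braiding_inv_naturality_left (X.left ≫ f ▷ X.X) C.X
  change _ = r₁ X ≫ _ at h
  calc _ = ((X.left ≫ f ▷ X.X) ≫ A ◁ r₁ X) ≫ A ◁ (β_ C.X X.X).inv := by rw [flatLeft]; simp
    _ = r₁ X ≫ (X.left ≫ f ▷ X.X) ▷ C.X ≫ (α_ _ _ _).hom ≫ A ◁ (β_ C.X X.X).inv := by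
      rw [r₁, h]; simp [r₁]
    _ = (r₁ X ≫ (X.left ≫ f ▷ X.X) ▷ C.X ≫ (β_ C.X (A ⊗ X.X)).inv) ≫ (α_ _ _ _).inv ≫
          (β_ C.X A).hom ▷ X.X ≫ (α_ _ _ _).hom := by
      rw [BraidedCategory.braiding_tensor_right_inv]
      simp
    _ = _ := by rw [n1, flatLeft]; simp

/-- The left `C^o`-coaction of a comodule `C^o ⊗ D ⇸ C^o ⊗ D`. -/
def s (X : Cell C D) : LeftCoaction (opp C) (flat X) where
  act := l₁ X
  counit := l₁_counit X
  coassoc := l₁_l₁ X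
  comm_right := left_right_aux X (p₁ C D) (p₂ C D)
  comm_left := flat_comm_left X (p₁ C D)

/-- The left `D`-coaction of a comodule `C^o ⊗ D ⇸ C^o ⊗ D`. -/
def t (X : Cell C D) : LeftCoaction D (flat X) where
  act := l₂ X
  counit := l₂_counit X
  coassoc := l₂_l₂ X
  comm_right := left_right_aux X (p₂ C D) (p₂ C D)
  comm_left := flat_comm_left X (p₂ C D)

end Cell

section comp
variable [HasCoreflexiveEqualizers V]
  [∀ X : V, Comonad.PreservesLimitOfIsCoreflexivePair (tensorLeft X)]
variable {C D E K : Comon V}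

namespace LeftCoaction

lemma compL_aux {M : Comodule C D} (a : LeftCoaction K M) (N : Comodule D E) :
    (inc M N ≫ a.act ▷ N.X ≫ (α_ _ _ _).hom) ≫ K.X ◁ (M.right ▷ N.X ≫ (α_ _ _ _).hom) =
    (inc M N ≫ a.act ▷ N.X ≫ (α_ _ _ _).hom) ≫ K.X ◁ (M.X ◁ N.left) :=
  calc _ = inc M N ⊗≫ (a.act ≫ K.X ◁ M.right) ▷ N.X ⊗≫ 𝟙 _ := by monoidal
    _ = (inc M N ≫ M.right ▷ N.X ≫ (α_ _ _ _).hom) ⊗≫ a.act ▷ (D.X ⊗ N.X) ⊗≫ 𝟙 _ := by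
      rw [a.comm_right]; monoidal
    _ = inc M N ⊗≫ (M.X ◁ N.left ≫ a.act ▷ (D.X ⊗ N.X)) ⊗≫ 𝟙 _ := by
      rw [inc_cond]; monoidal
    _ = _ := by rw [whisker_exchange]; monoidal

/-- The map underlying `compL`. -/
noncomputable def compLMap {M : Comodule C D} (a : LeftCoaction K M) (N : Comodule D E) :
    (comp M N).X ⟶ K.X ⊗ (comp M N).X :=
  facL K.X M N (inc M N ≫ a.act ▷ N.X ≫ (α_ _ _ _).hom) (compL_aux a N)

lemma compLMap_inc {M : Comodule C D} (a : LeftCoaction K M) (N : Comodule D E) :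
    compLMap a N ≫ K.X ◁ inc M N = inc M N ≫ a.act ▷ N.X ≫ (α_ _ _ _).hom := facL_inc ..

/-- The coaction on `M ⊗_D N` induced by a coaction on `M`. -/
noncomputable def compL {M : Comodule C D} (a : LeftCoaction K M) (N : Comodule D E) :
    LeftCoaction K (comp M N) where
  act := compLMap a N
  counit := by
    rw [← cancel_mono ((λ_ _).hom ≫ inc M N)]
    calc _ = (compLMap a N ≫ K.X ◁ inc M N) ≫ K.comon.counit ▷ _ ≫ (λ_ _).hom := by
          simp only [Category.assoc]; rw [whisker_exchange_assoc]; monoidal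
      _ = inc M N ≫ (a.act ≫ K.comon.counit ▷ M.X) ▷ N.X ⊗≫ 𝟙 _ := by
          rw [compLMap_inc]; monoidal
      _ = _ := by rw [a.counit]; monoidal
  coassoc := by
    rw [← cancel_mono (K.X ◁ K.X ◁ inc M N)]
    calc _ = compLMap a N ≫ K.X ◁ (compLMap a N ≫ K.X ◁ inc M N) := by simp
      _ = (compLMap a N ≫ K.X ◁ inc M N) ≫ K.X ◁ (a.act ▷ N.X ≫ (α_ _ _ _).hom) := by
          rw [compLMap_inc]; simp [reassoc_of% compLMap_inc]
      _ = inc M N ≫ (a.act ≫ K.X ◁ a.act) ▷ N.X ⊗≫ 𝟙 _ := by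
          rw [compLMap_inc]; monoidal
      _ = (inc M N ≫ a.act ▷ N.X ≫ (α_ _ _ _).hom) ≫ K.comon.comul ▷ _ ≫ (α_ _ _ _).hom := by
          rw [a.coassoc]; monoidal
      _ = _ := by
          rw [← compLMap_inc, Category.assoc, whisker_exchange_assoc]; monoidal
  comm_right := by
    rw [← cancel_mono (K.X ◁ inc M N ▷ E.X)]
    calc _ = compLMap a N ≫ K.X ◁ ((comp M N).right ≫ inc M N ▷ E.X) := by simp
      _ = (compLMap a N ≫ K.X ◁ inc M N) ≫ K.X ◁ (M.X ◁ N.right ≫ (α_ _ _ _).inv) := by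
          rw [comp_right_inc]; simp
      _ = inc M N ⊗≫ (a.act ▷ N.X ≫ (K.X ⊗ M.X) ◁ N.right) ⊗≫ 𝟙 _ := by
          rw [compLMap_inc]; monoidal
      _ = ((comp M N).right ≫ inc M N ▷ E.X) ≫ (a.act ▷ N.X ≫ (α_ _ _ _).hom) ▷ E.X ≫
            (α_ _ _ _).hom := by
          rw [comp_right_inc, ← whisker_exchange]; monoidal
      _ = (comp M N).right ≫ (compLMap a N ≫ K.X ◁ inc M N) ▷ E.X ≫ (α_ _ _ _).hom := by
          rw [compLMap_inc]; simp
      _ = _ := by simp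
  comm_left := by
    rw [← cancel_mono (K.X ◁ C.X ◁ inc M N)]
    calc _ = compLMap a N ≫ K.X ◁ ((comp M N).left ≫ C.X ◁ inc M N) := by simp
      _ = (compLMap a N ≫ K.X ◁ inc M N) ≫ K.X ◁ (M.left ▷ N.X ≫ (α_ _ _ _).hom) := by
          rw [comp_left_inc]; simp
      _ = inc M N ≫ (a.act ≫ K.X ◁ M.left) ▷ N.X ⊗≫ 𝟙 _ := by
          rw [compLMap_inc]; monoidal
      _ = (inc M N ≫ M.left ▷ N.X ≫ (α_ _ _ _).hom) ≫ C.X ◁ (a.act ▷ N.X ≫ (α_ _ _ _).hom) ≫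
            (α_ _ _ _).inv ≫ (β_ C.X K.X).hom ▷ _ ≫ (α_ _ _ _).hom := by
          rw [a.comm_left]; monoidal
      _ = (comp M N).left ≫ C.X ◁ (inc M N ≫ a.act ▷ N.X ≫ (α_ _ _ _).hom) ≫
            (α_ _ _ _).inv ≫ (β_ C.X K.X).hom ▷ _ ≫ (α_ _ _ _).hom := by
          rw [← comp_left_inc]; simp
      _ = (comp M N).left ≫ C.X ◁ compLMap a N ≫ (α_ _ _ _).inv ≫
            ((C.X ⊗ K.X) ◁ inc M N ≫ (β_ C.X K.X).hom ▷ _) ≫ (α_ _ _ _).hom := by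
          rw [← compLMap_inc]; monoidal
      _ = _ := by rw [whisker_exchange]; monoidal

lemma compR_aux (M : Comodule C D) {N : Comodule D E} (b : LeftCoaction K N) :
    (inc M N ≫ M.X ◁ b.act ≫ (α_ _ _ _).inv ≫ (β_ M.X K.X).hom ▷ N.X ≫ (α_ _ _ _).hom) ≫
      K.X ◁ (M.right ▷ N.X ≫ (α_ _ _ _).hom) =
    (inc M N ≫ M.X ◁ b.act ≫ (α_ _ _ _).inv ≫ (β_ M.X K.X).hom ▷ N.X ≫ (α_ _ _ _).hom) ≫
      K.X ◁ (M.X ◁ N.left) := by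
  have n1 := BraidedCategory.braiding_naturality_left M.right K.X
  calc _ = inc M N ≫ M.X ◁ b.act ⊗≫ ((β_ M.X K.X).hom ≫ K.X ◁ M.right) ▷ N.X ⊗≫ 𝟙 _ := by monoidal
    _ = inc M N ≫ (M.X ◁ b.act ≫ M.right ▷ (K.X ⊗ N.X)) ⊗≫
          (β_ (M.X ⊗ D.X) K.X).hom ▷ N.X ⊗≫ 𝟙 _ := by rw [← n1]; monoidal
    _ = (inc M N ≫ M.right ▷ N.X ≫ (α_ _ _ _).hom) ⊗≫ (M.X ⊗ D.X) ◁ b.act ⊗≫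
          (β_ (M.X ⊗ D.X) K.X).hom ▷ N.X ⊗≫ 𝟙 _ := by rw [whisker_exchange]; monoidal
    _ = inc M N ≫ M.X ◁ (N.left ≫ D.X ◁ b.act ≫ (α_ _ _ _).inv ≫ (β_ D.X K.X).hom ▷ N.X ≫
          (α_ _ _ _).hom) ⊗≫ (β_ M.X K.X).hom ▷ (D.X ⊗ N.X) ⊗≫ 𝟙 _ := by
        rw [inc_cond, BraidedCategory.braiding_tensor_left_hom]; monoidal
    _ = inc M N ≫ M.X ◁ b.act ⊗≫ ((M.X ⊗ K.X) ◁ N.left ≫ (β_ M.X K.X).hom ▷ (D.X ⊗ N.X)) ⊗≫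
          𝟙 _ := by rw [← b.comm_left]; monoidal
    _ = _ := by rw [whisker_exchange]; monoidal

/-- The map underlying `compR`. -/
noncomputable def compRMap (M : Comodule C D) {N : Comodule D E} (b : LeftCoaction K N) :
    (comp M N).X ⟶ K.X ⊗ (comp M N).X :=
  facL K.X M N (inc M N ≫ M.X ◁ b.act ≫ (α_ _ _ _).inv ≫ (β_ M.X K.X).hom ▷ N.X ≫
    (α_ _ _ _).hom) (compR_aux M b)

lemma compRMap_inc (M : Comodule C D) {N : Comodule D E} (b : LeftCoaction K N) :
    compRMap M b ≫ K.X ◁ inc M N = inc M N ≫ M.X ◁ b.act ≫ (α_ _ _ _).inv ≫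
      (β_ M.X K.X).hom ▷ N.X ≫ (α_ _ _ _).hom := facL_inc ..

/-- The coaction on `M ⊗_D N` induced by a coaction on `N`, moved across `M` by the braiding. -/
noncomputable def compR (M : Comodule C D) {N : Comodule D E} (b : LeftCoaction K N) :
    LeftCoaction K (comp M N) where
  act := compRMap M b
  counit := by
    have n1 := BraidedCategory.braiding_naturality_right M.X K.comon.counit
    rw [← cancel_mono ((λ_ _).hom ≫ inc M N)]
    calc _ = (compRMap M b ≫ K.X ◁ inc M N) ≫ K.comon.counit ▷ _ ≫ (λ_ _).hom := by
          simp only [Category.assoc]; rw [whisker_exchange_assoc]; monoidal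
      _ = inc M N ≫ M.X ◁ b.act ⊗≫ ((β_ M.X K.X).hom ≫ K.comon.counit ▷ M.X) ▷ N.X ⊗≫ 𝟙 _ := by
          rw [compRMap_inc]; monoidal
      _ = inc M N ≫ M.X ◁ (b.act ≫ K.comon.counit ▷ N.X) ⊗≫
            (β_ M.X (𝟙_ V)).hom ▷ N.X ⊗≫ 𝟙 _ := by
          rw [← n1]; monoidal
      _ = _ := by rw [b.counit, braiding_tensorUnit_right]; monoidal
  coassoc := by
    have n1 := BraidedCategory.braiding_naturality_right M.X K.comon.comul
    rw [← cancel_mono (K.X ◁ K.X ◁ inc M N)]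
    calc _ = compRMap M b ≫ K.X ◁ (compRMap M b ≫ K.X ◁ inc M N) := by simp
      _ = (compRMap M b ≫ K.X ◁ inc M N) ≫ K.X ◁ (M.X ◁ b.act ≫ (α_ _ _ _).inv ≫
            (β_ M.X K.X).hom ▷ N.X ≫ (α_ _ _ _).hom) := by
          rw [compRMap_inc]; simp [reassoc_of% compRMap_inc]
      _ = inc M N ≫ M.X ◁ b.act ⊗≫ ((β_ M.X K.X).hom ▷ N.X ≫ (K.X ⊗ M.X) ◁ b.act) ⊗≫
            K.X ◁ (β_ M.X K.X).hom ▷ N.X ⊗≫ 𝟙 _ := by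
          rw [compRMap_inc]; monoidal
      _ = inc M N ≫ M.X ◁ (b.act ≫ K.X ◁ b.act) ⊗≫ (β_ M.X K.X).hom ▷ (K.X ⊗ N.X) ⊗≫
            K.X ◁ (β_ M.X K.X).hom ▷ N.X ⊗≫ 𝟙 _ := by
          rw [← whisker_exchange]; monoidal
      _ = inc M N ≫ M.X ◁ b.act ⊗≫ (M.X ◁ K.comon.comul ≫ (β_ M.X (K.X ⊗ K.X)).hom) ▷ N.X ⊗≫
            𝟙 _ := by
          rw [b.coassoc, BraidedCategory.braiding_tensor_right_hom]; monoidal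
      _ = (inc M N ≫ M.X ◁ b.act ≫ (α_ _ _ _).inv ≫ (β_ M.X K.X).hom ▷ N.X ≫
            (α_ _ _ _).hom) ≫ K.comon.comul ▷ _ ≫ (α_ _ _ _).hom := by
          rw [n1]; monoidal
      _ = _ := by
          rw [← compRMap_inc, Category.assoc, whisker_exchange_assoc]; monoidal
  comm_right := by
    rw [← cancel_mono (K.X ◁ inc M N ▷ E.X)]
    calc _ = compRMap M b ≫ K.X ◁ ((comp M N).right ≫ inc M N ▷ E.X) := by simp
      _ = (compRMap M b ≫ K.X ◁ inc M N) ≫ K.X ◁ (M.X ◁ N.right ≫ (α_ _ _ _).inv) := by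
          rw [comp_right_inc]; simp
      _ = inc M N ≫ M.X ◁ b.act ⊗≫ ((β_ M.X K.X).hom ▷ N.X ≫ (K.X ⊗ M.X) ◁ N.right) ⊗≫ 𝟙 _ := by
          rw [compRMap_inc]; monoidal
      _ = inc M N ≫ M.X ◁ (b.act ≫ K.X ◁ N.right) ⊗≫ (β_ M.X K.X).hom ▷ (N.X ⊗ E.X) ⊗≫ 𝟙 _ := by
          rw [← whisker_exchange]; monoidal
      _ = ((comp M N).right ≫ inc M N ▷ E.X) ≫ (M.X ◁ b.act ≫ (α_ _ _ _).inv ≫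
            (β_ M.X K.X).hom ▷ N.X ≫ (α_ _ _ _).hom) ▷ E.X ≫ (α_ _ _ _).hom := by
          rw [comp_right_inc, b.comm_right]; monoidal
      _ = (comp M N).right ≫ (compRMap M b ≫ K.X ◁ inc M N) ▷ E.X ≫ (α_ _ _ _).hom := by
          rw [compRMap_inc]; simp
      _ = _ := by simp
  comm_left := by
    have n1 := BraidedCategory.braiding_naturality_left M.left K.X
    rw [← cancel_mono (K.X ◁ C.X ◁ inc M N)]
    calc _ = compRMap M b ≫ K.X ◁ ((comp M N).left ≫ C.X ◁ inc M N) := by simp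
      _ = (compRMap M b ≫ K.X ◁ inc M N) ≫ K.X ◁ (M.left ▷ N.X ≫ (α_ _ _ _).hom) := by
          rw [comp_left_inc]; simp
      _ = inc M N ≫ M.X ◁ b.act ⊗≫ ((β_ M.X K.X).hom ≫ K.X ◁ M.left) ▷ N.X ⊗≫ 𝟙 _ := by
          rw [compRMap_inc]; monoidal
      _ = inc M N ≫ (M.X ◁ b.act ≫ M.left ▷ (K.X ⊗ N.X)) ⊗≫
            (β_ (C.X ⊗ M.X) K.X).hom ▷ N.X ⊗≫ 𝟙 _ := by
          rw [← n1]; monoidal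
      _ = (inc M N ≫ M.left ▷ N.X ≫ (α_ _ _ _).hom) ≫ C.X ◁ (M.X ◁ b.act ≫ (α_ _ _ _).inv ≫
            (β_ M.X K.X).hom ▷ N.X ≫ (α_ _ _ _).hom) ≫
            (α_ _ _ _).inv ≫ (β_ C.X K.X).hom ▷ _ ≫ (α_ _ _ _).hom := by
          rw [whisker_exchange, BraidedCategory.braiding_tensor_left_hom]; monoidal
      _ = (comp M N).left ≫ C.X ◁ (inc M N ≫ M.X ◁ b.act ≫ (α_ _ _ _).inv ≫
            (β_ M.X K.X).hom ▷ N.X ≫ (α_ _ _ _).hom) ≫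
            (α_ _ _ _).inv ≫ (β_ C.X K.X).hom ▷ _ ≫ (α_ _ _ _).hom := by
          rw [← comp_left_inc]; simp
      _ = (comp M N).left ≫ C.X ◁ compRMap M b ≫ (α_ _ _ _).inv ≫
            ((C.X ⊗ K.X) ◁ inc M N ≫ (β_ C.X K.X).hom ▷ _) ≫ (α_ _ _ _).hom := by
          rw [← compRMap_inc]; monoidal
      _ = _ := by rw [whisker_exchange]; monoidal

end LeftCoaction
end comp

namespace Cell
variable {C D : Comon V}
lemma flatMap_id (X : Cell C D) : flatMap (𝟙 X) = 𝟙 (flat X) := rfl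
lemma flatMap_comp {X Y Z : Cell C D} (f : X ⟶ Y) (g : Y ⟶ Z) :
    flatMap (f ≫ g) = flatMap f ≫ flatMap g := rfl
end Cell

/-- A comodule `C ⇸ D` with further left coactions by `C^o`, by `D`, and by pairs `K j`, `(K j)^o`
of comonoids indexed by `j : J`. -/
structure MultiComodule (C D : Comon V) where
  M : Comodule C D
  s : LeftCoaction (opp C) M
  t : LeftCoaction D M
  J : Type
  K : J → Comon V
  l₁ : ∀ j, LeftCoaction (K j) M
  l₂ : ∀ j, LeftCoaction (opp (K j)) M

/-- Strings `X₁, …, Xₙ`, `n ≥ 1`, of comodules `Xᵢ : C_{i-1}^o ⊗ Cᵢ ⇸ C_{i-1}^o ⊗ Cᵢ`; the string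
is a term of type `Path C₀ Cₙ`. -/
inductive Path : Comon V → Comon V → Type (max u v)
  | single {C D : Comon V} (X : Cell C D) : Path C D
  | cons {C D E : Comon V} (X : Cell C D) (p : Path D E) : Path C E

namespace Path

/-- The string `X, Y`. -/
abbrev two {C D E : Comon V} (X : Cell C D) (Y : Cell D E) : Path C E := cons X (single Y)

/-- The string `X, Y, Z`. -/
abbrev three {C D E F : Comon V} (X : Cell C D) (Y : Cell D E) (Z : Cell E F) : Path C F :=
  cons X (two Y Z)

/-- Concatenation of strings. -/
def append : {C D E : Comon V} → Path C D → Path D E → Path C E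
  | _, _, _, single X, q => cons X q
  | _, _, _, cons X p, q => cons X (p.append q)

/-- All members of the string are in the class `𝒳`. -/
def All (𝒳 : ∀ C D : Comon V, Cell C D → Prop) : {C D : Comon V} → Path C D → Prop
  | _, _, single X => 𝒳 _ _ X
  | _, _, cons X p => 𝒳 _ _ X ∧ p.All 𝒳

end Path

section
variable [HasCoreflexiveEqualizers V]
  [∀ X : V, Comonad.PreservesLimitOfIsCoreflexivePair (tensorLeft X)]

namespace MultiComodule

/-- A single comodule `C^o ⊗ D ⇸ C^o ⊗ D`. -/
def ofCell {C D : Comon V} (X : Cell C D) : MultiComodule C D where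
  M := X.flat
  s := X.s
  t := X.t
  J := Empty
  K := Empty.elim
  l₁ j := j.elim
  l₂ j := j.elim

/-- `X ⊗_D P` with the induced coactions: `C^o` through `X`, the right-hand end through `P`, and for
the middle comonoid `D` the pair of the `D`-coaction of `X` and the `D^o`-coaction of `P`. -/
noncomputable def consCell {C D E : Comon V} (X : Cell C D) (P : MultiComodule D E) :
    MultiComodule C E where
  M := comp X.flat P.M
  s := X.s.compL P.M
  t := P.t.compR X.flat
  J := Option P.J
  K
    | none => D
    | some j => P.K j
  l₁
    | none => X.t.compL P.M
    | some j => (P.l₁ j).compR X.flat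
  l₂
    | none => P.s.compR X.flat
    | some j => (P.l₂ j).compR X.flat

end MultiComodule

namespace Path

/-- The composite `(C₀^o ⊗ e ⊗ ⋯ ⊗ e ⊗ Cₙ) ∘ (X₁ ⊗ ⋯ ⊗ Xₙ)`: it is carried by the iterated
equalizer `X₁ ⊗_{C₁} ⋯ ⊗_{C_{n-1}} Xₙ`, with the right coactions by `C₀^o` and `Cₙ` (the former
written as a left `C₀`-coaction), the left coactions by `C₀^o` and `Cₙ`, and for `0 < i < n` the
left coactions by `Cᵢ` (through `Xᵢ`) and by `Cᵢ^o` (through `X_{i+1}`). -/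
noncomputable def multi : {C D : Comon V} → Path C D → MultiComodule C D
  | _, _, single X => .ofCell X
  | _, _, cons X p => .consCell X p.multi

/-- The comodule `X₁ ⊗_{C₁} ⋯ ⊗_{C_{n-1}} Xₙ : C₀ ⇸ Cₙ`. -/
noncomputable abbrev dom {C D : Comon V} (p : Path C D) : Comodule C D := p.multi.M

/-- Rebracketing of a concatenated string into two blocks. -/
noncomputable def appendHom : {C D E : Comon V} → (p : Path C D) → (q : Path D E) →
    ((p.append q).dom ⟶ comp p.dom q.dom)
  | _, _, _, single X, q => 𝟙 (comp X.flat q.dom)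
  | _, _, _, cons X p, q => compMap (𝟙 X.flat) (appendHom p q) ≫ assocInv X.flat p.dom q.dom

end Path

/-- The 2-cells `E ∘ (X₁ ⊗ ⋯ ⊗ Xₙ) ⇒ Y ∘ E` of `Comod 𝒱`, where `E = C₀^o ⊗ e ⊗ ⋯ ⊗ e ⊗ Cₙ`. The
composite `Y ∘ E` is `C₁ ⊗ ⋯ ⊗ C_{n-1} ⊗ Y` with the cofree left `Cᵢ`- and `Cᵢ^o`-coactions, so a
2-cell is a map `f` from `X₁ ⊗_{C₁} ⋯ ⊗_{C_{n-1}} Xₙ` to `Y` (the composite of the 2-cell with the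
counits of the `Cᵢ`) that respects the left and right coactions by `C₀^o` and `Cₙ` and that gives
equal maps to `Cᵢ ⊗ Y` after the left coactions by `Cᵢ` and by `Cᵢ^o`. -/
structure IsCell₂ {C D : Comon V} (p : Path C D) (Y : Cell C D) (f : p.dom ⟶ Y.flat) : Prop where
  s_comm : p.multi.s.act ≫ (opp C).X ◁ f.hom = f.hom ≫ Y.s.act
  t_comm : p.multi.t.act ≫ D.X ◁ f.hom = f.hom ≫ Y.t.act
  balanced : ∀ j, (p.multi.l₁ j).act ≫ (p.multi.K j).X ◁ f.hom =
    (p.multi.l₂ j).act ≫ (opp (p.multi.K j)).X ◁ f.hom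

/-- `T`, with the 2-cell `u`, is the left Kan extension `Tₙ(X₁, …, Xₙ)` of
`E ∘ (X₁ ⊗ ⋯ ⊗ Xₙ)` along `E = C₀^o ⊗ e ⊗ ⋯ ⊗ e ⊗ Cₙ`. -/
structure IsLan {C D : Comon V} (p : Path C D) (T : Cell C D) (u : p.dom ⟶ T.flat) : Prop where
  cell : IsCell₂ p T u
  desc : ∀ (Y : Cell C D) (f : p.dom ⟶ Y.flat), IsCell₂ p Y f →
    ∃! φ : T ⟶ Y, u ≫ Cell.flatMap φ = f

/-- A partition of a string into nonempty blocks, with for each block `p` a comodule `T` and a map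
from `p` to `T`. The second string consists of the comodules `T`. -/
inductive Subst : {C D : Comon V} → Path C D → Path C D → Type (max u v)
  | single {C D : Comon V} {p : Path C D} {T : Cell C D} (f : p.dom ⟶ T.flat) :
      Subst p (.single T)
  | cons {C D E : Comon V} {p : Path C D} {T : Cell C D} (f : p.dom ⟶ T.flat)
      {q r : Path D E} (σ : Subst q r) : Subst (p.append q) (.cons T r)

namespace Subst

/-- Apply the maps on the blocks side by side. -/
noncomputable def map : {C D : Comon V} → {p r : Path C D} → Subst p r → (p.dom ⟶ r.dom)
  | _, _, _, _, single f => f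
  | _, _, _, _, cons (p := p) f (q := q) σ => Path.appendHom p q ≫ compMap f σ.map

/-- Every block carries its left Kan extension. -/
def AllLan : {C D : Comon V} → {p r : Path C D} → Subst p r → Prop
  | _, _, _, _, single (p := p) (T := T) f => IsLan p T f
  | _, _, _, _, cons (p := p) (T := T) f σ => IsLan p T f ∧ σ.AllLan

end Subst

section functors

/-- The functor `X ⊗_D - : Comod 𝒱(D, I) ⥤ 𝒱`. -/
noncomputable def tensorOnRight {C D : Comon V} (X : Comodule C D) :
    Comodule D (Comon.trivial V) ⥤ V where
  obj N := (comp X N).X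
  map f := (compMap (𝟙 X) f).hom
  map_id N := by rw [compMap_id]; rfl
  map_comp f g := by
    rw [← comp_hom, ← compMap_comp, Category.comp_id]

/-- The functor `- ⊗_C X : Comod 𝒱(I, C) ⥤ 𝒱`. -/
noncomputable def tensorOnLeft {C D : Comon V} (X : Comodule C D) :
    Comodule (Comon.trivial V) C ⥤ V where
  obj N := (comp N X).X
  map f := (compMap f (𝟙 X)).hom
  map_id N := by rw [compMap_id]; rfl
  map_comp f g := by
    rw [← comp_hom, ← compMap_comp, Category.comp_id]

end functors

/-- `Z` is `X ⊗_D Y` as a comodule `C^o ⊗ E ⇸ C^o ⊗ E`: a comodule of this form is determined by its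
right coactions (i.e. by `Z.flat`) and its left coactions by `C^o` and by `E`. -/
structure IsTensor {C D E : Comon V} (X : Cell C D) (Y : Cell D E) (Z : Cell C E)
    (e : comp X.flat Y.flat ≅ Z.flat) : Prop where
  s_comm : (X.s.compL Y.flat).act ≫ (opp C).X ◁ e.hom.hom = e.hom.hom ≫ Z.s.act
  t_comm : (Y.t.compR X.flat).act ≫ E.X ◁ e.hom.hom = e.hom.hom ≫ Z.t.act

/-- The conditions on the class `𝒳`. -/
structure Admissible (𝒳 : ∀ C D : Comon V, Cell C D → Prop) : Prop where
  /-- The Kan extensions `Tₙ(X₁, …, Xₙ)`, `n ≥ 1`, exist for `Xᵢ` in `𝒳`. -/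
  lan : ∀ {C D : Comon V} (p : Path C D), p.All 𝒳 →
    ∃ (T : Cell C D) (u : p.dom ⟶ T.flat), IsLan p T u
  /-- For every partition into nonempty blocks of a string in `𝒳`, the comparison map
  `β : T_m(X₁₁, …) ⟶ T_n(T_{m₁}(X₁₁, …), …, T_{mₙ}(…))` is an isomorphism. -/
  assoc : ∀ {C D : Comon V} (p r : Path C D) (σ : Subst p r), p.All 𝒳 → σ.AllLan →
    ∀ (T T' : Cell C D) (u : p.dom ⟶ T.flat) (u' : r.dom ⟶ T'.flat), IsLan p T u → IsLan r T' u' →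
      ∃ β : T ≅ T', u ≫ Cell.flatMap β.hom = σ.map ≫ u'
  /-- `X ⊗_D -` preserves reflexive coequalizers. -/
  tensor_right : ∀ {C D : Comon V} (X : Cell C D), 𝒳 C D X →
    Monad.PreservesColimitOfIsReflexivePair (tensorOnRight X.flat)
  /-- `- ⊗_C X` preserves reflexive coequalizers. -/
  tensor_left : ∀ {C D : Comon V} (X : Cell C D), 𝒳 C D X →
    Monad.PreservesColimitOfIsReflexivePair (tensorOnLeft X.flat)
  /-- `𝒳` is closed under `X ⊗_D Y`. -/
  tensor : ∀ {C D E : Comon V} (X : Cell C D) (Y : Cell D E) (Z : Cell C E)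
    (e : comp X.flat Y.flat ≅ Z.flat), IsTensor X Y Z e → 𝒳 C D X → 𝒳 D E Y → 𝒳 C E Z
  /-- `𝒳` is closed under epimorphic images. -/
  epi : ∀ {C D : Comon V} (X Y : Cell C D) (f : X ⟶ Y), Epi f → 𝒳 C D X → 𝒳 C D Y

end

section
variable [HasCoreflexiveEqualizers V]
  [∀ X : V, Comonad.PreservesLimitOfIsCoreflexivePair (tensorLeft X)]

/-- The structure of a comonad in `Comod 𝒱` on a comodule `D ⇸ D`. -/
structure ComonadStr {D : Comon V} (M : Comodule D D) where
  comul : M ⟶ comp M M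
  counit : M ⟶ one D
  counit_left : comul ≫ compMap counit (𝟙 M) = unitL M
  counit_right : comul ≫ compMap (𝟙 M) counit = unitR M
  coassoc : comul ≫ compMap (𝟙 M) comul ≫ assocInv M M M = comul ≫ compMap comul (𝟙 M)

namespace ComonadStr

/-- The comultiplication as a map in `𝒱`. -/
noncomputable def Δ {D : Comon V} {M : Comodule D D} (k : ComonadStr M) : M.X ⟶ M.X ⊗ M.X :=
  k.comul.hom ≫ inc M M

/-- The counit, followed by that of the base, as a map in `𝒱`. -/
def ε {D : Comon V} {M : Comodule D D} (k : ComonadStr M) : M.X ⟶ 𝟙_ V :=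
  k.counit.hom ≫ D.comon.counit

/-- Maps of comonads on a fixed comonoid. -/
structure IsMap {D : Comon V} {M N : Comodule D D} (k : ComonadStr M) (l : ComonadStr N)
    (f : M ⟶ N) : Prop where
  comul : f ≫ l.comul = k.comul ≫ compMap f f
  counit : f ≫ l.counit = k.counit

lemma IsMap.id {D : Comon V} {M : Comodule D D} (k : ComonadStr M) : IsMap k k (𝟙 M) :=
  ⟨by rw [compMap_id, Category.id_comp, Category.comp_id], Category.id_comp _⟩

lemma IsMap.comp {D : Comon V} {L M N : Comodule D D} {j : ComonadStr L} {k : ComonadStr M}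
    {l : ComonadStr N} {f : L ⟶ M} {g : M ⟶ N} (hf : IsMap j k f) (hg : IsMap k l g) :
    IsMap j l (f ≫ g) :=
  ⟨by rw [Category.assoc, hg.comul, ← Category.assoc, hf.comul, Category.assoc, ← compMap_comp],
    by rw [Category.assoc, hg.counit, hf.counit]⟩

end ComonadStr

/-- The objects of `Comon Comod 𝒱(D, D)`: comonads on `D`. -/
structure ComonadOn (D : Comon V) where
  M : Comodule D D
  str : ComonadStr M

namespace ComonadOn
variable {D : Comon V}

/-- The maps of `Comon Comod 𝒱(D, D)`. -/
@[ext]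
structure Hom (M N : ComonadOn D) where
  hom : M.M ⟶ N.M
  isMap : ComonadStr.IsMap M.str N.str hom

instance : Category (ComonadOn D) where
  Hom M N := Hom M N
  id M := ⟨𝟙 M.M, .id _⟩
  comp f g := ⟨f.hom ≫ g.hom, f.isMap.comp g.isMap⟩
  id_comp _ := Hom.ext (Category.id_comp _)
  comp_id _ := Hom.ext (Category.comp_id _)
  assoc _ _ _ := Hom.ext (Category.assoc _ _ _)

end ComonadOn

namespace Path

/-- Comonad structures on all members of a string. -/
def Comonads : {C D : Comon V} → Path C D → Type v
  | _, _, single X => ComonadStr X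
  | _, _, cons X p => ComonadStr X × p.Comonads

/-- The object `X₁ ⊗ (X₂ ⊗ …)`. -/
def obj : {C D : Comon V} → Path C D → V
  | _, _, single X => X.X
  | _, _, cons X p => X.X ⊗ p.obj

/-- The inclusion `X₁ ⊗_{C₁} (X₂ ⊗_{C₂} ⋯) ⟶ X₁ ⊗ (X₂ ⊗ ⋯)`. -/
noncomputable def incl : {C D : Comon V} → (p : Path C D) → (p.dom.X ⟶ p.obj)
  | _, _, single X => 𝟙 X.X
  | _, _, cons X p => inc X.flat p.dom ≫ X.X ◁ p.incl

/-- The comultiplication of the tensor product comonad `X₁ ⊗ (X₂ ⊗ ⋯)`, as a map in `𝒱`. -/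
noncomputable def Δ : {C D : Comon V} → (p : Path C D) → p.Comonads → (p.obj ⟶ p.obj ⊗ p.obj)
  | _, _, single _, k => ComonadStr.Δ k
  | _, _, cons X p, k => (k.1.Δ ⊗ₘ p.Δ k.2) ≫ tensorμ X.X X.X p.obj p.obj

/-- The counit of the tensor product comonad `X₁ ⊗ (X₂ ⊗ ⋯)`, as a map in `𝒱`. -/
noncomputable def ε : {C D : Comon V} → (p : Path C D) → p.Comonads → (p.obj ⟶ 𝟙_ V)
  | _, _, single _, k => ComonadStr.ε k
  | _, _, cons _ p, k => (k.1.ε ⊗ₘ p.ε k.2) ≫ (λ_ _).hom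

end Path

/-- The 2-cell `f : E ∘ T ⇒ Y ∘ E`, where `T = X₁ ⊗ ⋯ ⊗ Xₙ` and `E = C₀^o ⊗ e ⊗ ⋯ ⊗ e ⊗ Cₙ`, makes `E`
a map of comonads from `T` to `Y`. Here `E ∘ T` is carried by `p.dom`, the map `d` is
`E ∘ δ_T : E ∘ T ⟶ E ∘ T ∘ T`, seen in `T ⊗ (E ∘ T)`; the map `w` is `d` followed by
`f ∘ T : E ∘ T ∘ T ⟶ Y ∘ E ∘ T`, seen in `(E ∘ T) ⊗ Y`; and the last equation says that `w` followed
by `Y ∘ f` equals `f` followed by `δ_Y ∘ E`. The maps `d` and `w` exist and are unique for every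
2-cell `f`. -/
structure IsComonadCell {C D : Comon V} (p : Path C D) (k : p.Comonads) (Y : Cell C D)
    (y : ComonadStr Y) (f : p.dom ⟶ Y.flat) : Prop where
  comul : ∃ (d : p.dom.X ⟶ p.obj ⊗ p.dom.X) (w : p.dom.X ⟶ p.dom.X ⊗ Y.X),
    d ≫ p.obj ◁ p.incl = p.incl ≫ p.Δ k ∧
    w ≫ p.incl ▷ Y.X = d ≫ p.obj ◁ f.hom ∧
    w ≫ f.hom ▷ Y.X = f.hom ≫ y.Δ
  counit : f.hom ≫ y.ε = p.incl ≫ p.ε k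

variable (V) in
/-- A quantum category `(A, C)`: a monoidal comonad `A` on `C^o ⊗ C`. The multiplication `μ` is a
2-cell `p ∘ (A ⊗ A) ⇒ A ∘ p` with `p = C^o ⊗ e ⊗ C`, equivalently a map `T₂(A, A) ⟶ A`. The unit `η` is
a 2-cell `n ⇒ A ∘ n`, equivalently a map `T₀() ⟶ A`; the composite `A ∘ n` is the equalizer of the left
`C`- and `C^o`-coactions `A ⇉ C ⊗ A`, so that `η` is a map `C ⟶ A` equalizing them. -/
structure QuantumCategory where
  C : Comon V
  A : Cell C C
  str : ComonadStr A
  μ : (Path.two A A).dom ⟶ A.flat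
  μ_cell : IsCell₂ (.two A A) A μ
  μ_comonad : IsComonadCell (.two A A) (str, str) A str μ
  η : one C ⟶ A.flat
  η_cell : η.hom ≫ A.t.act = η.hom ≫ A.s.act
  η_comul : η.hom ≫ str.Δ = (η.hom ≫ A.t.act) ≫ η.hom ▷ A.X
  η_counit : η.hom ≫ str.ε = C.comon.counit
  mul_assoc : (Subst.cons (p := .two A A) μ (.single (p := .single A) (𝟙 A.flat))).map ≫ μ =
    (Subst.cons (p := .single A) (𝟙 A.flat) (.single (p := .two A A) μ)).map ≫ μ
  one_mul : (unitL A.flat ≫ compMap η (𝟙 A.flat)) ≫ μ = 𝟙 A.flat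
  mul_one : (unitR A.flat ≫ compMap (𝟙 A.flat) η) ≫ μ = 𝟙 A.flat

namespace QuantumCategory

/-- `N ⟶ A ⊗_C N`, induced by `η`. -/
noncomputable def etaL (a : QuantumCategory V) {D : Comon V} (N : Comodule a.C D) :
    N ⟶ comp a.A.flat N := unitL N ≫ compMap a.η (𝟙 N)

/-- `N ⟶ N ⊗_C A`, induced by `η`. -/
noncomputable def etaR (a : QuantumCategory V) {D : Comon V} (N : Comodule D a.C) :
    N ⟶ comp N a.A.flat := unitR N ≫ compMap (𝟙 N) a.η

end QuantumCategory

/-- A comonad `M` on `C^o ⊗ C_b` (`C` the comonoid of `a`, `C_b` that of `b`) with a candidate action map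
`α`, from which `T₃(A, M, B) ⟶ M` is obtained. -/
structure QModuleData (a b : QuantumCategory V) where
  M : Cell a.C b.C
  str : ComonadStr M
  α : (Path.three a.A M b.A).dom ⟶ M.flat

/-- `α` is an action of the pair `(A, B)` on the comonad `M`: it is a 2-cell and a comonad map, and it is
associative and unital. -/
structure IsQModule {a b : QuantumCategory V} (m : QModuleData a b) : Prop where
  cell : IsCell₂ (.three a.A m.M b.A) m.M m.α
  comonad : IsComonadCell (.three a.A m.M b.A) (a.str, m.str, b.str) m.M m.str m.α
  assoc : (Subst.cons (p := .two a.A a.A) a.μ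
      (.cons (p := .single m.M) (𝟙 m.M.flat) (.single (p := .two b.A b.A) b.μ))).map ≫ m.α =
    (Subst.cons (p := .single a.A) (𝟙 a.A.flat)
      (.cons (p := .three a.A m.M b.A) m.α (.single (p := .single b.A) (𝟙 b.A.flat)))).map ≫ m.α
  unit : b.etaR m.M.flat ≫ a.etaL (comp m.M.flat b.A.flat) ≫ m.α = 𝟙 m.M.flat

/-- Quantum modules from `a` to `b`. -/
structure QModule (a b : QuantumCategory V) extends QModuleData a b where
  isQModule : IsQModule toQModuleData

lemma square_comp {𝒞 : Type*} [Category* 𝒞] {P Q R X Y Z : 𝒞} {x : P ⟶ X} {f : X ⟶ Y} {F : P ⟶ Q}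
    {y : Q ⟶ Y} {g : Y ⟶ Z} {G : Q ⟶ R} {z : R ⟶ Z} (h : x ≫ f = F ≫ y) (h' : y ≫ g = G ≫ z) :
    x ≫ f ≫ g = (F ≫ G) ≫ z := by
  rw [← Category.assoc, h, Category.assoc, h', Category.assoc]

namespace QModule
variable {a b : QuantumCategory V}

/-- The left action `T₂(A, M) ⟶ M`, before Kan extension. -/
noncomputable def αL (m : QModule a b) : (Path.two a.A m.M).dom ⟶ m.M.flat :=
  compMap (𝟙 a.A.flat) (b.etaR m.M.flat) ≫ m.α

/-- The right action `T₂(M, B) ⟶ M`, before Kan extension. -/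
noncomputable def αR (m : QModule a b) : (Path.two m.M b.A).dom ⟶ m.M.flat :=
  a.etaL (comp m.M.flat b.A.flat) ≫ m.α

/-- Maps of quantum modules: comodule maps that respect the action and the comonad structure. -/
@[ext]
structure Hom (m n : QModule a b) where
  hom : m.M ⟶ n.M
  isMap : ComonadStr.IsMap m.str n.str hom
  action : m.α ≫ Cell.flatMap hom =
    compMap (𝟙 a.A.flat) (compMap (Cell.flatMap hom) (𝟙 b.A.flat)) ≫ n.α

instance : Category (QModule a b) where
  Hom m n := Hom m n
  id m := ⟨𝟙 m.M, .id _, by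
    rw [Cell.flatMap_id, compMap_id, compMap_id]
    exact (Category.comp_id _).trans (Category.id_comp _).symm⟩
  comp {l m n} f g := ⟨f.hom ≫ g.hom, f.isMap.comp g.isMap, by
    have e : compMap (𝟙 a.A.flat) (compMap (Cell.flatMap (f.hom ≫ g.hom)) (𝟙 b.A.flat)) =
        compMap (𝟙 a.A.flat) (compMap (Cell.flatMap f.hom) (𝟙 b.A.flat)) ≫
          compMap (𝟙 a.A.flat) (compMap (Cell.flatMap g.hom) (𝟙 b.A.flat)) := by
      rw [← compMap_comp, ← compMap_comp, Category.comp_id, Category.comp_id, Cell.flatMap_comp]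
    exact (square_comp f.action g.action).trans (congrArg (fun t => t ≫ n.α) e.symm)⟩
  id_comp _ := Hom.ext (Category.id_comp _)
  comp_id _ := Hom.ext (Category.comp_id _)
  assoc _ _ _ := Hom.ext (Category.assoc _ _ _)

end QModule

/-- A quantum category acting on itself on both sides by its multiplication. -/
noncomputable def unitData (a : QuantumCategory V) : QModuleData a a where
  M := a.A
  str := a.str
  α := compMap (𝟙 a.A.flat) a.μ ≫ a.μ

/-- `Q`, with `q`, is the composite `M • N` of `m = M` and `n = N`. First, with `T₃(M, B, N)` and
`T₂(M, N)` carrying the comonad structures for which their universal 2-cells are comonad maps, `Q` is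
the coequalizer in `Comon Comod 𝒱(C₁^o ⊗ C₃, C₁^o ⊗ C₃)` of the pair `T₃(M, B, N) ⇉ T₂(M, N)` given by the
left action on `N` and by the right action on `M`, and `q` is the universal 2-cell of `T₂(M, N)`
followed by the coequalizer map. Second, the action on `Q` is induced by the left action on `M` and the
right action on `N`. -/
structure IsBullet {a b c : QuantumCategory V} (m : QModule a b) (n : QModule b c)
    (Q : QModule a c) (q : (Path.two m.M n.M).dom ⟶ Q.M.flat) : Prop where
  coequalizer : ∃ (T₃ T₂ : ComonadOn (opTensor a.C c.C))
    (u₃ : (Path.three m.M b.A n.M).dom ⟶ Cell.flat T₃.M)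
    (u₂ : (Path.two m.M n.M).dom ⟶ Cell.flat T₂.M)
    (d₀ d₁ : T₃ ⟶ T₂) (π : T₂ ⟶ ComonadOn.mk Q.M Q.str) (h : d₀ ≫ π = d₁ ≫ π),
    IsLan (.three m.M b.A n.M) T₃.M u₃ ∧
    IsComonadCell (.three m.M b.A n.M) (m.str, b.str, n.str) T₃.M T₃.str u₃ ∧
    IsLan (.two m.M n.M) T₂.M u₂ ∧
    IsComonadCell (.two m.M n.M) (m.str, n.str) T₂.M T₂.str u₂ ∧
    u₃ ≫ Cell.flatMap d₀.hom = compMap (𝟙 m.M.flat) n.αL ≫ u₂ ∧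
    u₃ ≫ Cell.flatMap d₁.hom =
      (Subst.cons (p := .two m.M b.A) m.αR (.single (p := .single n.M) (𝟙 n.M.flat))).map ≫ u₂ ∧
    u₂ ≫ Cell.flatMap π.hom = q ∧
    Nonempty (IsColimit (Cofork.ofπ π h))
  action : (Subst.cons (p := .single a.A) (𝟙 a.A.flat)
      (.cons (p := .two m.M n.M) q (.single (p := .single c.A) (𝟙 c.A.flat)))).map ≫ Q.α =
    (Subst.cons (p := .two a.A m.M) m.αL (.single (p := .two n.M c.A) n.αR)).map ≫ q

/-- Quantum categories with underlying comodule in `𝒳`. -/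
structure QCatIn (𝒳 : ∀ C D : Comon V, Cell C D → Prop) where
  cat : QuantumCategory V
  mem : 𝒳 cat.C cat.C cat.A

/-- Quantum modules with underlying comodule in `𝒳`. -/
structure QModIn (𝒳 : ∀ C D : Comon V, Cell C D → Prop) (a b : QCatIn 𝒳) where
  mod : QModule a.cat b.cat
  mem : 𝒳 a.cat.C b.cat.C mod.M

instance (𝒳 : ∀ C D : Comon V, Cell C D → Prop) (a b : QCatIn 𝒳) : Category (QModIn 𝒳 a b) where
  Hom m n := m.mod ⟶ n.mod
  id m := 𝟙 m.mod
  comp {l m n} f g := CategoryStruct.comp (obj := QModule a.cat b.cat) f g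
  id_comp {m n} f := Category.id_comp (obj := QModule a.cat b.cat) f
  comp_id {m n} f := Category.comp_id (obj := QModule a.cat b.cat) f
  assoc {k l m n} f g h := Category.assoc (obj := QModule a.cat b.cat) f g h
end

universe w₁ w₂ w₃ in
/-- A bicategory with prescribed objects, prescribed categories of 1-cells and 2-cells and
prescribed unit 1-cells. -/
structure BicategoryOn (B : Type w₁) (H : B → B → Type w₂) [∀ a b, Category.{w₃} (H a b)]
    (unit : ∀ a, H a a) where
  comp {a b c : B} (f : H a b) (g : H b c) : H a c
  whiskerLeft {a b c : B} (f : H a b) {g h : H b c} (η : g ⟶ h) : comp f g ⟶ comp f h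
  whiskerRight {a b c : B} {f g : H a b} (η : f ⟶ g) (h : H b c) : comp f h ⟶ comp g h
  associator {a b c d : B} (f : H a b) (g : H b c) (h : H c d) :
    comp (comp f g) h ≅ comp f (comp g h)
  leftUnitor {a b : B} (f : H a b) : comp (unit a) f ≅ f
  rightUnitor {a b : B} (f : H a b) : comp f (unit b) ≅ f
  whiskerLeft_id {a b c : B} (f : H a b) (g : H b c) : whiskerLeft f (𝟙 g) = 𝟙 (comp f g)
  whiskerLeft_comp {a b c : B} (f : H a b) {g h i : H b c} (η : g ⟶ h) (θ : h ⟶ i) :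
    whiskerLeft f (η ≫ θ) = whiskerLeft f η ≫ whiskerLeft f θ
  id_whiskerLeft {a b : B} {f g : H a b} (η : f ⟶ g) :
    whiskerLeft (unit a) η = (leftUnitor f).hom ≫ η ≫ (leftUnitor g).inv
  comp_whiskerLeft {a b c d : B} (f : H a b) (g : H b c) {h h' : H c d} (η : h ⟶ h') :
    whiskerLeft (comp f g) η =
      (associator f g h).hom ≫ whiskerLeft f (whiskerLeft g η) ≫ (associator f g h').inv
  id_whiskerRight {a b c : B} (f : H a b) (g : H b c) : whiskerRight (𝟙 f) g = 𝟙 (comp f g)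
  comp_whiskerRight {a b c : B} {f g h : H a b} (η : f ⟶ g) (θ : g ⟶ h) (i : H b c) :
    whiskerRight (η ≫ θ) i = whiskerRight η i ≫ whiskerRight θ i
  whiskerRight_id {a b : B} {f g : H a b} (η : f ⟶ g) :
    whiskerRight η (unit b) = (rightUnitor f).hom ≫ η ≫ (rightUnitor g).inv
  whiskerRight_comp {a b c d : B} {f f' : H a b} (η : f ⟶ f') (g : H b c) (h : H c d) :
    whiskerRight η (comp g h) =
      (associator f g h).inv ≫ whiskerRight (whiskerRight η g) h ≫ (associator f' g h).hom
  whisker_assoc {a b c d : B} (f : H a b) {g g' : H b c} (η : g ⟶ g') (h : H c d) :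
    whiskerRight (whiskerLeft f η) h =
      (associator f g h).hom ≫ whiskerLeft f (whiskerRight η h) ≫ (associator f g' h).inv
  whisker_exchange {a b c : B} {f g : H a b} {h i : H b c} (η : f ⟶ g) (θ : h ⟶ i) :
    whiskerLeft f θ ≫ whiskerRight η i = whiskerRight η h ≫ whiskerLeft g θ
  pentagon {a b c d e : B} (f : H a b) (g : H b c) (h : H c d) (i : H d e) :
    whiskerRight (associator f g h).hom i ≫
        (associator f (comp g h) i).hom ≫ whiskerLeft f (associator g h i).hom =
      (associator (comp f g) h i).hom ≫ (associator f g (comp h i)).hom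
  triangle {a b c : B} (f : H a b) (g : H b c) :
    (associator f (unit b) g).hom ≫ whiskerLeft f (leftUnitor g).hom =
      whiskerRight (rightUnitor f).hom g

universe w₁ w₂ w₃ in
/-- Such a bicategory is a bicategory in the sense of Mathlib. -/
abbrev BicategoryOn.toBicategory {B : Type w₁} {H : B → B → Type w₂}
    [∀ a b, Category.{w₃} (H a b)] {unit : ∀ a, H a a} (S : BicategoryOn B H unit) :
    Bicategory B where
  Hom a b := H a b
  id a := unit a
  comp f g := S.comp f g
  homCategory a b := inferInstanceAs (Category (H a b))
  whiskerLeft := S.whiskerLeft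
  whiskerRight := S.whiskerRight
  associator := S.associator
  leftUnitor := S.leftUnitor
  rightUnitor := S.rightUnitor
  whiskerLeft_id := S.whiskerLeft_id
  whiskerLeft_comp := S.whiskerLeft_comp
  id_whiskerLeft := S.id_whiskerLeft
  comp_whiskerLeft := S.comp_whiskerLeft
  id_whiskerRight := S.id_whiskerRight
  comp_whiskerRight := S.comp_whiskerRight
  whiskerRight_id := S.whiskerRight_id
  whiskerRight_comp := S.whiskerRight_comp
  whisker_assoc := S.whisker_assoc
  whisker_exchange := S.whisker_exchange
  pentagon := S.pentagon
  triangle := S.triangle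

end QuantumModules

open QuantumModules

namespace QuantumModules
open Comodule

variable {V : Type u} [Category.{v} V] [MonoidalCategory V]

namespace Comodule

section iso
variable {C D : Comon V}

/-- A comodule map that is invertible in `𝒱` is an isomorphism of comodules. -/
def isoOfInv {M N : Comodule C D} (f : M ⟶ N) (g : N.X ⟶ M.X) (h : f.hom ≫ g = 𝟙 _)
    (h' : g ≫ f.hom = 𝟙 _) : M ≅ N where
  hom := f
  inv :=
    { hom := g
      left_comm := by
        have := f.left_comm
        calc g ≫ M.left = g ≫ (M.left ≫ C.X ◁ f.hom) ≫ C.X ◁ g := by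
              rw [Category.assoc, ← whiskerLeft_comp, h]; simp
          _ = _ := by rw [← this, Category.assoc, reassoc_of% h']
      right_comm := by
        have := f.right_comm
        calc g ≫ M.right = g ≫ (M.right ≫ f.hom ▷ D.X) ≫ g ▷ D.X := by
              rw [Category.assoc, ← comp_whiskerRight, h]; simp
          _ = _ := by rw [← this, Category.assoc, reassoc_of% h'] }
  hom_inv_id := hom_ext h
  inv_hom_id := hom_ext h'

end iso

variable [BraidedCategory V] [HasCoreflexiveEqualizers V]
  [∀ X : V, Comonad.PreservesLimitOfIsCoreflexivePair (tensorLeft X)]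
variable {C D E F : Comon V}

lemma compMap_inc {M M' : Comodule C D} {N N' : Comodule D E} (f : M ⟶ M') (g : N ⟶ N') :
    (compMap f g).hom ≫ inc M' N' = inc M N ≫ f.hom ▷ N.X ≫ M'.X ◁ g.hom := compMapHom_inc f g

/-- The inclusion `C ⊗_C N ⟶ C ⊗ N`. -/
noncomputable def oneInc (N : Comodule C D) : (comp (one C) N).X ⟶ C.X ⊗ N.X := inc (one C) N

/-- The inclusion `N ⊗_D D ⟶ N ⊗ D`. -/
noncomputable def incOne (N : Comodule C D) : (comp N (one D)).X ⟶ N.X ⊗ D.X := inc N (one D)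

lemma oneInc_cond (N : Comodule C D) :
    oneInc N ≫ C.comon.comul ▷ N.X ≫ (α_ _ _ _).hom = oneInc N ≫ C.X ◁ N.left :=
  inc_cond (one C) N

lemma incOne_cond (N : Comodule C D) :
    incOne N ≫ N.right ▷ D.X ≫ (α_ _ _ _).hom = incOne N ≫ N.X ◁ D.comon.comul :=
  inc_cond N (one D)

lemma unitL_inc (N : Comodule C D) : (unitL N).hom ≫ oneInc N = N.left := unitLMap_inc N

lemma unitR_inc (N : Comodule C D) : (unitR N).hom ≫ incOne N = N.right := unitRMap_inc N

lemma compMap_oneInc {M M' : Comodule C D} (f : M ⟶ M') :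
    (compMap (𝟙 (one C)) f).hom ≫ oneInc M' = oneInc M ≫ C.X ◁ f.hom :=
  (compMap_inc (𝟙 (one C)) f).trans
    (congrArg (inc (one C) M ≫ ·) (by rw [id_hom, id_whiskerRight, Category.id_comp]; rfl))

lemma compMap_incOne {M M' : Comodule C D} (f : M ⟶ M') :
    (compMap f (𝟙 (one D))).hom ≫ incOne M' = incOne M ≫ f.hom ▷ D.X :=
  (compMap_inc f (𝟙 (one D))).trans
    (congrArg (inc M (one D) ≫ ·) (by rw [id_hom, whiskerLeft_id, Category.comp_id]; rfl))

lemma assocInv_inc (M : Comodule C D) (N : Comodule D E) (L : Comodule E F) :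
    (assocInv M N L).hom ≫ inc (comp M N) L ≫ inc M N ▷ L.X =
      inc M (comp N L) ≫ M.X ◁ inc N L ≫ (α_ _ _ _).inv := assocMap_inc M N L

/-- Maps into `M ⊗_D N` are determined by their composites with the inclusion. -/
lemma comp_ext {M : Comodule C D} {N : Comodule D E} {W : V} {f g : W ⟶ (comp M N).X}
    (h : f ≫ inc M N = g ≫ inc M N) : f = g := (cancel_mono _).1 h

lemma comp_ext₃ {M : Comodule C D} {N : Comodule D E} {L : Comodule E F} {W : V}
    {f g : W ⟶ (comp (comp M N) L).X}
    (h : f ≫ inc (comp M N) L ≫ inc M N ▷ L.X = g ≫ inc (comp M N) L ≫ inc M N ▷ L.X) : f = g :=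
  (cancel_mono (inc (comp M N) L ≫ inc M N ▷ L.X)).1 h

lemma comp_ext₃' {M : Comodule C D} {N : Comodule D E} {L : Comodule E F} {W : V}
    {f g : W ⟶ (comp M (comp N L)).X}
    (h : f ≫ inc M (comp N L) ≫ M.X ◁ inc N L = g ≫ inc M (comp N L) ≫ M.X ◁ inc N L) : f = g :=
  comp_ext ((cancel_mono (M.X ◁ inc N L)).1 (by simpa using h))

lemma assocHom_aux₁ (M : Comodule C D) (N : Comodule D E) (L : Comodule E F) :
    (inc (comp M N) L ≫ inc M N ▷ L.X ≫ (α_ _ _ _).hom) ≫ M.X ◁ (N.right ▷ L.X ≫ (α_ _ _ _).hom) =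
    (inc (comp M N) L ≫ inc M N ▷ L.X ≫ (α_ _ _ _).hom) ≫ M.X ◁ (N.X ◁ L.left) := by
  have h := inc_cond (comp M N) L
  have h' := comp_right_inc M N
  calc _ = inc (comp M N) L ≫ (inc M N ≫ M.X ◁ N.right ≫ (α_ _ _ _).inv) ▷ L.X ⊗≫ 𝟙 _ := by monoidal
    _ = (inc (comp M N) L ≫ (comp M N).right ▷ L.X ≫ (α_ _ _ _).hom) ≫
          inc M N ▷ (E.X ⊗ L.X) ≫ (α_ _ _ _).hom := by rw [← h']; monoidal
    _ = inc (comp M N) L ≫ ((comp M N).X ◁ L.left ≫ inc M N ▷ (E.X ⊗ L.X)) ≫ (α_ _ _ _).hom := by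
      rw [h]; monoidal
    _ = _ := by rw [whisker_exchange]; monoidal

/-- The inverse of the associativity constraint, in `𝒱`. -/
noncomputable def assocHomMap (M : Comodule C D) (N : Comodule D E) (L : Comodule E F) :
    (comp (comp M N) L).X ⟶ (comp M (comp N L)).X :=
  fac M (comp N L) (facL M.X N L _ (assocHom_aux₁ M N L)) (by
    have h : facL M.X N L _ (assocHom_aux₁ M N L) ≫ M.X ◁ inc N L = _ := facL_inc ..
    generalize facL M.X N L _ (assocHom_aux₁ M N L) = k at h ⊢
    have h₂ := comp_left_inc N L
    rw [← cancel_mono (M.X ◁ D.X ◁ inc N L)]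
    calc _ = (k ≫ M.right ▷ (comp N L).X ≫
              (M.X ⊗ D.X) ◁ inc N L) ≫ (α_ _ _ _).hom := by monoidal
      _ = inc (comp M N) L ≫ (inc M N ≫ M.right ▷ N.X ≫ (α_ _ _ _).hom) ▷ L.X ⊗≫ 𝟙 _ := by
        rw [← whisker_exchange, reassoc_of% h]; monoidal
      _ = (inc (comp M N) L ≫ inc M N ▷ L.X ≫ (α_ _ _ _).hom) ≫ M.X ◁ (N.left ▷ L.X ≫
            (α_ _ _ _).hom) := by rw [inc_cond]; monoidal
      _ = k ≫ M.X ◁ (inc N L ≫ N.left ▷ L.X ≫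
            (α_ _ _ _).hom) := by rw [← h]; monoidal
      _ = _ := by rw [← h₂]; monoidal)

lemma assocHomMap_inc (M : Comodule C D) (N : Comodule D E) (L : Comodule E F) :
    assocHomMap M N L ≫ inc M (comp N L) ≫ M.X ◁ inc N L =
      inc (comp M N) L ≫ inc M N ▷ L.X ≫ (α_ _ _ _).hom := by
  rw [assocHomMap, reassoc_of% fac_inc, facL_inc]

noncomputable def assocIso (M : Comodule C D) (N : Comodule D E) (L : Comodule E F) :
    comp M (comp N L) ≅ comp (comp M N) L :=
  isoOfInv (assocInv M N L) (assocHomMap M N L)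
    (comp_ext₃' (by
      have := assocInv_inc M N L
      rw [Category.assoc, assocHomMap_inc, reassoc_of% this]; simp))
    (comp_ext₃ (by
      have := assocHomMap_inc M N L
      rw [Category.assoc, assocInv_inc, reassoc_of% this]; simp))

noncomputable def unitLIso (N : Comodule C D) : N ≅ comp (one C) N :=
  isoOfInv (unitL N) (oneInc N ≫ C.comon.counit ▷ N.X ≫ (λ_ _).hom)
    (by rw [reassoc_of% unitL_inc, reassoc_of% N.left_counit]; simp)
    (comp_ext (by
      change (((oneInc N ≫ C.comon.counit ▷ N.X ≫ (λ_ _).hom) ≫ (unitL N).hom) ≫ oneInc N) =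
        𝟙 _ ≫ oneInc N
      have h := oneInc_cond N
      have h' := C.comon.counit_comul
      rw [Category.assoc, Category.assoc, Category.assoc, unitL_inc, Category.id_comp]
      calc _ = oneInc N ≫ (C.comon.counit ▷ N.X ≫ 𝟙_ V ◁ N.left) ≫ (λ_ _).hom := by monoidal
        _ = (oneInc N ≫ C.X ◁ N.left) ≫ C.comon.counit ▷ (C.X ⊗ N.X) ≫ (λ_ _).hom := by
          rw [← whisker_exchange]; simp
        _ = oneInc N ≫ (C.comon.comul ≫ C.comon.counit ▷ C.X) ▷ N.X ⊗≫ 𝟙 _ := by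
          rw [← h]; monoidal
        _ = _ := by rw [h']; monoidal))

noncomputable def unitRIso (N : Comodule C D) : N ≅ comp N (one D) :=
  isoOfInv (unitR N) (incOne N ≫ N.X ◁ D.comon.counit ≫ (ρ_ _).hom)
    (by rw [reassoc_of% unitR_inc, reassoc_of% N.right_counit]; simp)
    (comp_ext (by
      change (((incOne N ≫ N.X ◁ D.comon.counit ≫ (ρ_ _).hom) ≫ (unitR N).hom) ≫ incOne N) =
        𝟙 _ ≫ incOne N
      have h := incOne_cond N
      have h' := D.comon.comul_counit
      rw [Category.assoc, Category.assoc, Category.assoc, unitR_inc, Category.id_comp]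
      calc _ = incOne N ≫ (N.X ◁ D.comon.counit ≫ N.right ▷ 𝟙_ V) ≫ (ρ_ _).hom := by monoidal
        _ = (incOne N ≫ N.right ▷ D.X ≫ (α_ _ _ _).hom) ≫
              N.X ◁ D.X ◁ D.comon.counit ⊗≫ 𝟙 _ := by
          rw [whisker_exchange]; monoidal
        _ = incOne N ≫ N.X ◁ (D.comon.comul ≫ D.X ◁ D.comon.counit) ⊗≫ 𝟙 _ := by
          rw [h]; monoidal
        _ = _ := by rw [h']; monoidal))

end Comodule

/-- The objects of the bicategory of comonoids and comodules. -/
def ComodBicat (V : Type u) [Category.{v} V] [MonoidalCategory V] := Comon V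

variable [BraidedCategory V] [HasCoreflexiveEqualizers V]
  [∀ X : V, Comonad.PreservesLimitOfIsCoreflexivePair (tensorLeft X)]

section
variable {C D E F G : Comon V}

lemma assocInv_naturality {M M' : Comodule C D} {N N' : Comodule D E} {L L' : Comodule E F}
    (f : M ⟶ M') (g : N ⟶ N') (h : L ⟶ L') :
    compMap f (compMap g h) ≫ assocInv M' N' L' = assocInv M N L ≫ compMap (compMap f g) h := by
  ext
  refine comp_ext₃ ?_
  have e₁ := compMap_inc (compMap f g) h
  have e₂ := compMap_inc f g
  have e₃ := compMap_inc f (compMap g h)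
  have e₄ := compMap_inc g h
  simp only [comp_hom, Category.assoc, assocInv_inc]
  rw [reassoc_of% e₃, reassoc_of% e₁]
  calc _ = inc M (comp N L) ≫ f.hom ▷ _ ≫ M'.X ◁ ((compMap g h).hom ≫ inc N' L') ≫
        (α_ _ _ _).inv := by monoidal
    _ = inc M (comp N L) ≫ (f.hom ▷ _ ≫ M'.X ◁ inc N L) ≫ M'.X ◁ (g.hom ▷ L.X ≫
          N'.X ◁ h.hom) ≫ (α_ _ _ _).inv := by rw [e₄]; monoidal
    _ = (inc M (comp N L) ≫ M.X ◁ inc N L ≫ (α_ _ _ _).inv) ≫ (f.hom ▷ N.X ≫ M'.X ◁ g.hom) ▷ L.X ≫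
          (M'.X ⊗ N'.X) ◁ h.hom := by rw [← whisker_exchange]; monoidal
    _ = (assocInv M N L).hom ≫ inc (comp M N) L ≫ (inc M N ≫ f.hom ▷ N.X ≫ M'.X ◁ g.hom) ▷ L.X ≫
          (M'.X ⊗ N'.X) ◁ h.hom := by rw [← assocInv_inc]; monoidal
    _ = (assocInv M N L).hom ≫ inc (comp M N) L ≫ (compMap f g).hom ▷ L.X ≫
          (inc M' N' ▷ L.X ≫ (M'.X ⊗ N'.X) ◁ h.hom) := by rw [← e₂]; monoidal
    _ = _ := by rw [← whisker_exchange]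

lemma unitL_naturality {M N : Comodule C D} (f : M ⟶ N) :
    f ≫ unitL N = unitL M ≫ compMap (𝟙 _) f := by
  ext
  refine comp_ext ?_
  change (f.hom ≫ (unitL N).hom) ≫ oneInc N = ((unitL M).hom ≫ (compMap (𝟙 _) f).hom) ≫ oneInc N
  rw [Category.assoc, Category.assoc, unitL_inc, compMap_oneInc, reassoc_of% unitL_inc,
    f.left_comm]

lemma unitR_naturality {M N : Comodule C D} (f : M ⟶ N) :
    f ≫ unitR N = unitR M ≫ compMap f (𝟙 _) := by
  ext
  refine comp_ext ?_
  change (f.hom ≫ (unitR N).hom) ≫ incOne N = ((unitR M).hom ≫ (compMap f (𝟙 _)).hom) ≫ incOne N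
  rw [Category.assoc, Category.assoc, unitR_inc, compMap_incOne, reassoc_of% unitR_inc,
    f.right_comm]

lemma assocInv_pentagon (M : Comodule C D) (N : Comodule D E) (L : Comodule E F)
    (K : Comodule F G) :
    compMap (𝟙 M) (assocInv N L K) ≫ assocInv M (comp N L) K ≫ compMap (assocInv M N L) (𝟙 K) =
      assocInv M N (comp L K) ≫ assocInv (comp M N) L K := by
  ext
  rw [← cancel_mono (inc (comp (comp M N) L) K ≫ inc (comp M N) L ▷ K.X ≫ inc M N ▷ L.X ▷ K.X)]
  have e₁ := compMap_inc (assocInv M N L) (𝟙 K)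
  have e₂ := assocInv_inc M N L
  have e₃ := compMap_inc (𝟙 M) (assocInv N L K)
  have e₄ := assocInv_inc M (comp N L) K
  have e₅ := assocInv_inc N L K
  have e₆ := assocInv_inc (comp M N) L K
  have e₇ := assocInv_inc M N (comp L K)
  calc _ = (compMap (𝟙 M) (assocInv N L K)).hom ≫ (assocInv M (comp N L) K).hom ≫
        inc (comp M (comp N L)) K ≫ ((assocInv M N L).hom ≫ inc (comp M N) L ≫ inc M N ▷ L.X) ▷ K.X := by
          simp only [comp_hom, Category.assoc]
          rw [reassoc_of% e₁]; simp
    _ = (compMap (𝟙 M) (assocInv N L K)).hom ≫ ((assocInv M (comp N L) K).hom ≫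
        inc (comp M (comp N L)) K ≫ inc M (comp N L) ▷ K.X) ≫
          (M.X ◁ inc N L ≫ (α_ _ _ _).inv) ▷ K.X := by rw [e₂]; simp
    _ = inc M _ ≫ M.X ◁ ((assocInv N L K).hom ≫ inc (comp N L) K ≫ inc N L ▷ K.X) ⊗≫ 𝟙 _ := by
          rw [e₄, ← Category.assoc, ← Category.assoc, e₃, id_hom]; monoidal
    _ = inc M _ ≫ M.X ◁ (inc N _ ≫ N.X ◁ inc L K) ⊗≫ 𝟙 _ := by rw [e₅]; monoidal
    _ = (inc M _ ≫ M.X ◁ inc N _ ≫ (α_ _ _ _).inv) ≫ _ ◁ inc L K ≫ (α_ _ _ _).inv := by monoidal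
    _ = (assocInv M N (comp L K)).hom ≫ inc (comp M N) _ ≫ (inc M N ▷ _ ≫ _ ◁ inc L K) ≫
          (α_ _ _ _).inv := by rw [← e₇]; simp
    _ = (assocInv M N (comp L K)).hom ≫ (inc (comp M N) _ ≫ _ ◁ inc L K ≫ (α_ _ _ _).inv) ≫
          inc M N ▷ L.X ▷ K.X := by rw [← whisker_exchange]; simp
    _ = _ := by rw [← e₆]; simp

lemma assocInv_triangle (M : Comodule C D) (N : Comodule D E) :
    compMap (𝟙 M) (unitL N) ≫ assocInv M (one D) N = compMap (unitR M) (𝟙 N) := by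
  ext
  refine comp_ext₃ ?_
  have e₁ := compMap_inc (𝟙 M) (unitL N)
  have e₂ := compMap_inc (unitR M) (𝟙 N)
  have e₃ := inc_cond M N
  rw [comp_hom, Category.assoc, assocInv_inc, reassoc_of% e₁, reassoc_of% e₂]
  have e₄ : inc M N ≫ M.X ◁ ((unitL N).hom ≫ oneInc N) ≫ (α_ M.X D.X N.X).inv =
      inc M N ≫ ((unitR M).hom ≫ incOne M) ▷ N.X := by
    rw [unitL_inc, unitR_inc, ← Category.assoc, ← e₃]; simp
  refine Eq.trans ?_ (e₄.trans ?_)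
  · rw [id_hom, id_whiskerRight, Category.id_comp, whiskerLeft_comp, Category.assoc]; rfl
  · rw [id_hom, whiskerLeft_id, Category.id_comp, comp_whiskerRight]; rfl

end

/-- Whiskering of an isomorphism of comodules. -/
noncomputable def whiskerLeftComodIso {C D E : Comon V} (M : Comodule C D) {N N' : Comodule D E} (e : N ≅ N') :
    comp M N ≅ comp M N' where
  hom := compMap (𝟙 M) e.hom
  inv := compMap (𝟙 M) e.inv
  hom_inv_id := by rw [← compMap_comp, e.hom_inv_id, Category.id_comp, compMap_id]
  inv_hom_id := by rw [← compMap_comp, e.inv_hom_id, Category.id_comp, compMap_id]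

/-- Whiskering of an isomorphism of comodules. -/
noncomputable def whiskerRightComodIso {C D E : Comon V} {M M' : Comodule C D} (e : M ≅ M') (N : Comodule D E) :
    comp M N ≅ comp M' N where
  hom := compMap e.hom (𝟙 N)
  inv := compMap e.inv (𝟙 N)
  hom_inv_id := by rw [← compMap_comp, e.hom_inv_id, Category.id_comp, compMap_id]
  inv_hom_id := by rw [← compMap_comp, e.inv_hom_id, Category.id_comp, compMap_id]

/-- The comonoid underlying an object. -/
def ComodBicat.of (C : ComodBicat V) : Comon V := C

noncomputable instance : CategoryStruct (ComodBicat V) where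
  Hom C D := Comodule C.of D.of
  id C := one C.of
  comp M N := comp M N

instance (C D : ComodBicat V) : Category (C ⟶ D) :=
  inferInstanceAs (Category (Comodule C.of D.of))

noncomputable instance : Bicategory (ComodBicat V) where
  whiskerLeft M _ _ g := compMap (𝟙 M) g
  whiskerRight f N := compMap f (𝟙 N)
  associator M N L := (assocIso M N L).symm
  leftUnitor N := (unitLIso N).symm
  rightUnitor N := (unitRIso N).symm
  whiskerLeft_id M N := compMap_id M N
  whiskerLeft_comp M _ _ _ f g := by
    rw [← compMap_comp, Category.comp_id]
  id_whiskerLeft {_ _ M N} f :=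
    (Iso.eq_inv_comp (unitLIso M)).2 (unitL_naturality f).symm
  comp_whiskerLeft M N L L' f := by
    have := assocInv_naturality (𝟙 M) (𝟙 N) f
    rw [compMap_id] at this
    exact (Iso.eq_inv_comp (assocIso M N L)).2 this.symm
  id_whiskerRight M N := compMap_id M N
  comp_whiskerRight f g N := by
    rw [← compMap_comp, Category.comp_id]
  whiskerRight_id {_ _ M N} f :=
    (Iso.eq_inv_comp (unitRIso M)).2 (unitR_naturality f).symm
  whiskerRight_comp {_ _ _ _ M M'} f N L := by
    have := assocInv_naturality f (𝟙 N) (𝟙 L)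
    rw [compMap_id] at this
    exact ((Iso.eq_comp_inv (assocIso M' N L)).2 this).trans (Category.assoc _ _ _)
  whisker_assoc M N N' f L := by
    have := assocInv_naturality (𝟙 M) f (𝟙 L)
    exact (Iso.eq_inv_comp (assocIso M N L)).2 this.symm
  whisker_exchange f g := by
    rw [← compMap_comp, ← compMap_comp, Category.id_comp, Category.comp_id, Category.id_comp,
      Category.comp_id]
  pentagon M N L K := by
    have h := assocInv_pentagon M N L K
    have : ((whiskerLeftComodIso M (assocIso N L K) ≪≫ assocIso M (comp N L) K ≪≫
        whiskerRightComodIso (assocIso M N L) K).symm.hom =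
        (assocIso M N (comp L K) ≪≫ assocIso (comp M N) L K).symm.hom) :=
      congrArg (fun e => Iso.hom (Iso.symm e)) (Iso.ext h)
    exact (Category.assoc _ _ _).symm.trans this
  triangle M N := by
    have h := assocInv_triangle M N
    have : (whiskerLeftComodIso M (unitLIso N) ≪≫ assocIso M (one _) N).symm.hom =
        (whiskerRightComodIso (unitRIso M) N).symm.hom :=
      congrArg (fun e => Iso.hom (Iso.symm e)) (Iso.ext h)
    exact this

end QuantumModules

namespace QuantumModules
open Comodule

variable {V : Type u} [Category.{v} V] [MonoidalCategory V] [BraidedCategory V]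

/-- A map `M ⟶ K ⊗ M` that commutes with the coactions of a comodule `M : C ⇸ D`. -/
structure Coact (K : V) {C D : Comon V} (M : Comodule C D) where
  act : M.X ⟶ K ⊗ M.X
  comm_right : act ≫ K ◁ M.right = M.right ≫ act ▷ D.X ≫ (α_ _ _ _).hom
  comm_left : act ≫ K ◁ M.left =
    M.left ≫ C.X ◁ act ≫ (α_ _ _ _).inv ≫ (β_ C.X K).hom ▷ M.X ≫ (α_ _ _ _).hom

/-- The map underlying a coaction. -/
def LeftCoaction.toCoact {K C D : Comon V} {M : Comodule C D} (a : LeftCoaction K M) :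
    Coact K.X M := ⟨a.act, a.comm_right, a.comm_left⟩

/-- A map `φ` is equivariant for `a` and `b`. -/
def Coact.Eqv {K : V} {C D : Comon V} {M N : Comodule C D} (a : Coact K M) (φ : M ⟶ N)
    (b : Coact K N) : Prop := a.act ≫ K ◁ φ.hom = φ.hom ≫ b.act

lemma Coact.Eqv.comp {K : V} {C D : Comon V} {M N L : Comodule C D} {a : Coact K M} {φ : M ⟶ N}
    {b : Coact K N} {ψ : N ⟶ L} {c : Coact K L} (h : a.Eqv φ b) (h' : b.Eqv ψ c) :
    a.Eqv (φ ≫ ψ) c := by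
  rw [Eqv] at *
  rw [comp_hom, whiskerLeft_comp, reassoc_of% h, h', Category.assoc]

lemma Coact.Eqv.inv {K : V} {C D : Comon V} {M N : Comodule C D} {a : Coact K M} {e : M ≅ N}
    {b : Coact K N} (h : a.Eqv e.hom b) : b.Eqv e.inv a := by
  have h₁ : e.hom.hom ≫ e.inv.hom = 𝟙 _ := congrArg Hom.hom e.hom_inv_id
  have h₂ : e.inv.hom ≫ e.hom.hom = 𝟙 _ := congrArg Hom.hom e.inv_hom_id
  rw [Eqv] at *
  calc _ = e.inv.hom ≫ (e.hom.hom ≫ b.act) ≫ K ◁ e.inv.hom := by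
        rw [Category.assoc, reassoc_of% h₂]
    _ = _ := by rw [← h, Category.assoc, ← whiskerLeft_comp, h₁, whiskerLeft_id, Category.comp_id]

/-- A pair of coactions by the same object. -/
structure CoactPair {C D : Comon V} (M : Comodule C D) where
  K : V
  l₁ : Coact K M
  l₂ : Coact K M

namespace CoactPair
variable {C D : Comon V} {M N L : Comodule C D}

/-- `φ` equalizes the two coactions. -/
def Bal (x : CoactPair M) (φ : M ⟶ N) : Prop :=
  x.l₁.act ≫ x.K ◁ φ.hom = x.l₂.act ≫ x.K ◁ φ.hom

/-- `φ` is equivariant for both coactions. -/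
inductive Rel (φ : M ⟶ N) : CoactPair M → CoactPair N → Prop
  | mk {K : V} {a b : Coact K M} {a' b' : Coact K N} (h : a.Eqv φ a') (h' : b.Eqv φ b') :
    Rel φ ⟨K, a, b⟩ ⟨K, a', b'⟩

lemma Rel.comp {φ : M ⟶ N} {ψ : N ⟶ L} {x : CoactPair M} {y : CoactPair N} {z : CoactPair L}
    (h : Rel φ x y) (h' : Rel ψ y z) : Rel (φ ≫ ψ) x z := by
  cases h with | mk h₁ h₂ => cases h' with | mk h₃ h₄ => exact ⟨h₁.comp h₃, h₂.comp h₄⟩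

lemma Rel.inv {e : M ≅ N} {x : CoactPair M} {y : CoactPair N} (h : Rel e.hom x y) :
    Rel e.inv y x := by
  cases h with | mk h₁ h₂ => exact ⟨h₁.inv, h₂.inv⟩

lemma Rel.bal {φ : M ⟶ N} {ψ : N ⟶ L} {x : CoactPair M} {y : CoactPair N} (h : Rel φ x y)
    (h' : y.Bal ψ) : x.Bal (φ ≫ ψ) := by
  cases h with | mk h₁ h₂ =>
  rw [Coact.Eqv] at h₁ h₂
  simp only [Bal] at *
  rw [comp_hom, whiskerLeft_comp, reassoc_of% h₁, h', reassoc_of% h₂]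

lemma Bal.comp {φ : M ⟶ N} {x : CoactPair M} (h : x.Bal φ) (ψ : N ⟶ L) : x.Bal (φ ≫ ψ) := by
  rw [Bal] at *
  rw [comp_hom, whiskerLeft_comp, reassoc_of% h]

end CoactPair

/-- A comodule `C ⇸ D` with coactions of `C` and `D` and a set of pairs of coactions. -/
structure Multi (C D : Comon V) where
  M : Comodule C D
  s : Coact C.X M
  t : Coact D.X M
  pairs : Set (CoactPair M)

namespace Multi
variable {C D : Comon V}

/-- Maps that respect the coactions and, for each pair of coactions, either equalize it or are
equivariant. -/
structure IsMor (P Q : Multi C D) (φ : P.M ⟶ Q.M) : Prop where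
  s : P.s.Eqv φ Q.s
  t : P.t.Eqv φ Q.t
  pairs : ∀ x ∈ P.pairs, (∃ y ∈ Q.pairs, x.Rel φ y) ∨ x.Bal φ

lemma IsMor.comp {P Q R : Multi C D} {φ : P.M ⟶ Q.M} {ψ : Q.M ⟶ R.M} (h : IsMor P Q φ)
    (h' : IsMor Q R ψ) : IsMor P R (φ ≫ ψ) where
  s := h.s.comp h'.s
  t := h.t.comp h'.t
  pairs x hx := by
    rcases h.pairs x hx with ⟨y, hy, hxy⟩ | hb
    · rcases h'.pairs y hy with ⟨z, hz, hyz⟩ | hb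
      · exact .inl ⟨z, hz, hxy.comp hyz⟩
      · exact .inr (hxy.bal hb)
    · exact .inr (hb.comp _)

lemma Coact.Eqv.id {K : V} {M : Comodule C D} (a : Coact K M) : a.Eqv (𝟙 M) a := by
  simp [Coact.Eqv]

lemma IsMor.id (P : Multi C D) : IsMor P P (𝟙 P.M) :=
  ⟨Coact.Eqv.id _, Coact.Eqv.id _,
    fun x hx => .inl ⟨x, hx, ⟨Coact.Eqv.id x.l₁, Coact.Eqv.id x.l₂⟩⟩⟩

end Multi

/-- A single comodule `C^o ⊗ D ⇸ C^o ⊗ D`. -/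
abbrev Cell.multi {C D : Comon V} (X : Cell C D) : Multi C D := ⟨X.flat, X.s.toCoact, X.t.toCoact, ∅⟩

/-- The coactions of a `MultiComodule`. -/
def MultiComodule.toMulti {C D : Comon V} (P : MultiComodule C D) : Multi C D :=
  ⟨P.M, P.s.toCoact, P.t.toCoact, {x | ∃ j, x = ⟨(P.K j).X, (P.l₁ j).toCoact, (P.l₂ j).toCoact⟩}⟩

variable [HasCoreflexiveEqualizers V]
  [∀ X : V, Comonad.PreservesLimitOfIsCoreflexivePair (tensorLeft X)]

namespace Coact
variable {K : V} {C D E F : Comon V}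

lemma compL_aux {M : Comodule C D} (a : Coact K M) (N : Comodule D E) :
    (inc M N ≫ a.act ▷ N.X ≫ (α_ _ _ _).hom) ≫ K ◁ (M.right ▷ N.X ≫ (α_ _ _ _).hom) =
    (inc M N ≫ a.act ▷ N.X ≫ (α_ _ _ _).hom) ≫ K ◁ (M.X ◁ N.left) :=
  calc _ = inc M N ⊗≫ (a.act ≫ K ◁ M.right) ▷ N.X ⊗≫ 𝟙 _ := by monoidal
    _ = (inc M N ≫ M.right ▷ N.X ≫ (α_ _ _ _).hom) ⊗≫ a.act ▷ (D.X ⊗ N.X) ⊗≫ 𝟙 _ := by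
      rw [a.comm_right]; monoidal
    _ = inc M N ⊗≫ (M.X ◁ N.left ≫ a.act ▷ (D.X ⊗ N.X)) ⊗≫ 𝟙 _ := by
      rw [inc_cond]; monoidal
    _ = _ := by rw [whisker_exchange]; monoidal

/-- The map underlying `compL`. -/
noncomputable def compLMap {M : Comodule C D} (a : Coact K M) (N : Comodule D E) :
    (comp M N).X ⟶ K ⊗ (comp M N).X :=
  facL K M N (inc M N ≫ a.act ▷ N.X ≫ (α_ _ _ _).hom) (compL_aux a N)

lemma compLMap_inc {M : Comodule C D} (a : Coact K M) (N : Comodule D E) :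
    compLMap a N ≫ K ◁ inc M N = inc M N ≫ a.act ▷ N.X ≫ (α_ _ _ _).hom := facL_inc ..

/-- The coaction on `M ⊗_D N` induced by a coaction on `M`. -/
noncomputable def compL {M : Comodule C D} (a : Coact K M) (N : Comodule D E) :
    Coact K (comp M N) where
  act := compLMap a N
  comm_right := by
    rw [← cancel_mono (K ◁ inc M N ▷ E.X)]
    calc _ = compLMap a N ≫ K ◁ ((comp M N).right ≫ inc M N ▷ E.X) := by simp
      _ = (compLMap a N ≫ K ◁ inc M N) ≫ K ◁ (M.X ◁ N.right ≫ (α_ _ _ _).inv) := by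
          rw [comp_right_inc]; simp
      _ = inc M N ⊗≫ (a.act ▷ N.X ≫ (K ⊗ M.X) ◁ N.right) ⊗≫ 𝟙 _ := by
          rw [compLMap_inc]; monoidal
      _ = ((comp M N).right ≫ inc M N ▷ E.X) ≫ (a.act ▷ N.X ≫ (α_ _ _ _).hom) ▷ E.X ≫
            (α_ _ _ _).hom := by
          rw [comp_right_inc, ← whisker_exchange]; monoidal
      _ = (comp M N).right ≫ (compLMap a N ≫ K ◁ inc M N) ▷ E.X ≫ (α_ _ _ _).hom := by
          rw [compLMap_inc]; simp
      _ = _ := by simp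
  comm_left := by
    rw [← cancel_mono (K ◁ C.X ◁ inc M N)]
    calc _ = compLMap a N ≫ K ◁ ((comp M N).left ≫ C.X ◁ inc M N) := by simp
      _ = (compLMap a N ≫ K ◁ inc M N) ≫ K ◁ (M.left ▷ N.X ≫ (α_ _ _ _).hom) := by
          rw [comp_left_inc]; simp
      _ = inc M N ≫ (a.act ≫ K ◁ M.left) ▷ N.X ⊗≫ 𝟙 _ := by
          rw [compLMap_inc]; monoidal
      _ = (inc M N ≫ M.left ▷ N.X ≫ (α_ _ _ _).hom) ≫ C.X ◁ (a.act ▷ N.X ≫ (α_ _ _ _).hom) ≫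
            (α_ _ _ _).inv ≫ (β_ C.X K).hom ▷ _ ≫ (α_ _ _ _).hom := by
          rw [a.comm_left]; monoidal
      _ = (comp M N).left ≫ C.X ◁ (inc M N ≫ a.act ▷ N.X ≫ (α_ _ _ _).hom) ≫
            (α_ _ _ _).inv ≫ (β_ C.X K).hom ▷ _ ≫ (α_ _ _ _).hom := by
          rw [← comp_left_inc]; simp
      _ = (comp M N).left ≫ C.X ◁ compLMap a N ≫ (α_ _ _ _).inv ≫
            ((C.X ⊗ K) ◁ inc M N ≫ (β_ C.X K).hom ▷ _) ≫ (α_ _ _ _).hom := by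
          rw [← compLMap_inc]; monoidal
      _ = _ := by rw [whisker_exchange]; monoidal

lemma compL_inc {M : Comodule C D} (a : Coact K M) (N : Comodule D E) :
    (compL a N).act ≫ K ◁ inc M N = inc M N ≫ a.act ▷ N.X ≫ (α_ _ _ _).hom := compLMap_inc a N

lemma compR_aux (M : Comodule C D) {N : Comodule D E} (b : Coact K N) :
    (inc M N ≫ M.X ◁ b.act ≫ (α_ _ _ _).inv ≫ (β_ M.X K).hom ▷ N.X ≫ (α_ _ _ _).hom) ≫
      K ◁ (M.right ▷ N.X ≫ (α_ _ _ _).hom) =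
    (inc M N ≫ M.X ◁ b.act ≫ (α_ _ _ _).inv ≫ (β_ M.X K).hom ▷ N.X ≫ (α_ _ _ _).hom) ≫
      K ◁ (M.X ◁ N.left) := by
  have n1 := BraidedCategory.braiding_naturality_left M.right K
  calc _ = inc M N ≫ M.X ◁ b.act ⊗≫ ((β_ M.X K).hom ≫ K ◁ M.right) ▷ N.X ⊗≫ 𝟙 _ := by monoidal
    _ = inc M N ≫ (M.X ◁ b.act ≫ M.right ▷ (K ⊗ N.X)) ⊗≫
          (β_ (M.X ⊗ D.X) K).hom ▷ N.X ⊗≫ 𝟙 _ := by rw [← n1]; monoidal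
    _ = (inc M N ≫ M.right ▷ N.X ≫ (α_ _ _ _).hom) ⊗≫ (M.X ⊗ D.X) ◁ b.act ⊗≫
          (β_ (M.X ⊗ D.X) K).hom ▷ N.X ⊗≫ 𝟙 _ := by rw [whisker_exchange]; monoidal
    _ = inc M N ≫ M.X ◁ (N.left ≫ D.X ◁ b.act ≫ (α_ _ _ _).inv ≫ (β_ D.X K).hom ▷ N.X ≫
          (α_ _ _ _).hom) ⊗≫ (β_ M.X K).hom ▷ (D.X ⊗ N.X) ⊗≫ 𝟙 _ := by
        rw [inc_cond, BraidedCategory.braiding_tensor_left_hom]; monoidal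
    _ = inc M N ≫ M.X ◁ b.act ⊗≫ ((M.X ⊗ K) ◁ N.left ≫ (β_ M.X K).hom ▷ (D.X ⊗ N.X)) ⊗≫
          𝟙 _ := by rw [← b.comm_left]; monoidal
    _ = _ := by rw [whisker_exchange]; monoidal

/-- The map underlying `compR`. -/
noncomputable def compRMap (M : Comodule C D) {N : Comodule D E} (b : Coact K N) :
    (comp M N).X ⟶ K ⊗ (comp M N).X :=
  facL K M N (inc M N ≫ M.X ◁ b.act ≫ (α_ _ _ _).inv ≫ (β_ M.X K).hom ▷ N.X ≫
    (α_ _ _ _).hom) (compR_aux M b)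

lemma compRMap_inc (M : Comodule C D) {N : Comodule D E} (b : Coact K N) :
    compRMap M b ≫ K ◁ inc M N = inc M N ≫ M.X ◁ b.act ≫ (α_ _ _ _).inv ≫
      (β_ M.X K).hom ▷ N.X ≫ (α_ _ _ _).hom := facL_inc ..

/-- The coaction on `M ⊗_D N` induced by a coaction on `N`, moved across `M` by the braiding. -/
noncomputable def compR (M : Comodule C D) {N : Comodule D E} (b : Coact K N) :
    Coact K (comp M N) where
  act := compRMap M b
  comm_right := by
    rw [← cancel_mono (K ◁ inc M N ▷ E.X)]
    calc _ = compRMap M b ≫ K ◁ ((comp M N).right ≫ inc M N ▷ E.X) := by simp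
      _ = (compRMap M b ≫ K ◁ inc M N) ≫ K ◁ (M.X ◁ N.right ≫ (α_ _ _ _).inv) := by
          rw [comp_right_inc]; simp
      _ = inc M N ≫ M.X ◁ b.act ⊗≫ ((β_ M.X K).hom ▷ N.X ≫ (K ⊗ M.X) ◁ N.right) ⊗≫ 𝟙 _ := by
          rw [compRMap_inc]; monoidal
      _ = inc M N ≫ M.X ◁ (b.act ≫ K ◁ N.right) ⊗≫ (β_ M.X K).hom ▷ (N.X ⊗ E.X) ⊗≫ 𝟙 _ := by
          rw [← whisker_exchange]; monoidal
      _ = ((comp M N).right ≫ inc M N ▷ E.X) ≫ (M.X ◁ b.act ≫ (α_ _ _ _).inv ≫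
            (β_ M.X K).hom ▷ N.X ≫ (α_ _ _ _).hom) ▷ E.X ≫ (α_ _ _ _).hom := by
          rw [comp_right_inc, b.comm_right]; monoidal
      _ = (comp M N).right ≫ (compRMap M b ≫ K ◁ inc M N) ▷ E.X ≫ (α_ _ _ _).hom := by
          rw [compRMap_inc]; simp
      _ = _ := by simp
  comm_left := by
    have n1 := BraidedCategory.braiding_naturality_left M.left K
    rw [← cancel_mono (K ◁ C.X ◁ inc M N)]
    calc _ = compRMap M b ≫ K ◁ ((comp M N).left ≫ C.X ◁ inc M N) := by simp
      _ = (compRMap M b ≫ K ◁ inc M N) ≫ K ◁ (M.left ▷ N.X ≫ (α_ _ _ _).hom) := by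
          rw [comp_left_inc]; simp
      _ = inc M N ≫ M.X ◁ b.act ⊗≫ ((β_ M.X K).hom ≫ K ◁ M.left) ▷ N.X ⊗≫ 𝟙 _ := by
          rw [compRMap_inc]; monoidal
      _ = inc M N ≫ (M.X ◁ b.act ≫ M.left ▷ (K ⊗ N.X)) ⊗≫
            (β_ (C.X ⊗ M.X) K).hom ▷ N.X ⊗≫ 𝟙 _ := by
          rw [← n1]; monoidal
      _ = (inc M N ≫ M.left ▷ N.X ≫ (α_ _ _ _).hom) ≫ C.X ◁ (M.X ◁ b.act ≫ (α_ _ _ _).inv ≫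
            (β_ M.X K).hom ▷ N.X ≫ (α_ _ _ _).hom) ≫
            (α_ _ _ _).inv ≫ (β_ C.X K).hom ▷ _ ≫ (α_ _ _ _).hom := by
          rw [whisker_exchange, BraidedCategory.braiding_tensor_left_hom]; monoidal
      _ = (comp M N).left ≫ C.X ◁ (inc M N ≫ M.X ◁ b.act ≫ (α_ _ _ _).inv ≫
            (β_ M.X K).hom ▷ N.X ≫ (α_ _ _ _).hom) ≫
            (α_ _ _ _).inv ≫ (β_ C.X K).hom ▷ _ ≫ (α_ _ _ _).hom := by
          rw [← comp_left_inc]; simp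
      _ = (comp M N).left ≫ C.X ◁ compRMap M b ≫ (α_ _ _ _).inv ≫
            ((C.X ⊗ K) ◁ inc M N ≫ (β_ C.X K).hom ▷ _) ≫ (α_ _ _ _).hom := by
          rw [← compRMap_inc]; monoidal
      _ = _ := by rw [whisker_exchange]; monoidal

lemma compR_inc (M : Comodule C D) {N : Comodule D E} (b : Coact K N) :
    (compR M b).act ≫ K ◁ inc M N = inc M N ≫ M.X ◁ b.act ≫ (α_ _ _ _).inv ≫
      (β_ M.X K).hom ▷ N.X ≫ (α_ _ _ _).hom := compRMap_inc M b

lemma compL_map {M M' : Comodule C D} {N N' : Comodule D E} (a : Coact K M) (φ : M ⟶ M')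
    (ψ : N ⟶ N') : ((compL a N).act ≫ K ◁ (compMap φ ψ).hom) ≫ K ◁ inc M' N' =
      inc M N ≫ (a.act ≫ K ◁ φ.hom) ▷ N.X ≫ (α_ _ _ _).hom ≫ K ◁ M'.X ◁ ψ.hom :=
  calc _ = (compL a N).act ≫ K ◁ ((compMap φ ψ).hom ≫ inc M' N') := by simp
    _ = ((compL a N).act ≫ K ◁ inc M N) ≫ K ◁ (φ.hom ▷ N.X ≫ M'.X ◁ ψ.hom) := by
      rw [compMap_inc]; simp
    _ = _ := by rw [compL_inc]; simp

lemma compR_map {M M' : Comodule C D} {N N' : Comodule D E} (φ : M ⟶ M') (b : Coact K N)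
    (ψ : N ⟶ N') : ((compR M b).act ≫ K ◁ (compMap φ ψ).hom) ≫ K ◁ inc M' N' =
      inc M N ≫ φ.hom ▷ N.X ≫ M'.X ◁ (b.act ≫ K ◁ ψ.hom) ≫ (α_ _ _ _).inv ≫
        (β_ M'.X K).hom ▷ N'.X ≫ (α_ _ _ _).hom := by
  have n := BraidedCategory.braiding_naturality_left φ.hom K
  calc _ = (compR M b).act ≫ K ◁ ((compMap φ ψ).hom ≫ inc M' N') := by simp
    _ = ((compR M b).act ≫ K ◁ inc M N) ≫ K ◁ (φ.hom ▷ N.X ≫ M'.X ◁ ψ.hom) := by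
      rw [compMap_inc]; simp
    _ = inc M N ≫ M.X ◁ b.act ⊗≫ ((β_ M.X K).hom ≫ K ◁ φ.hom) ▷ N.X ⊗≫
          K ◁ M'.X ◁ ψ.hom := by
      rw [Category.assoc, ← Category.assoc, compR_inc]; monoidal
    _ = inc M N ≫ (M.X ◁ b.act ≫ φ.hom ▷ (K ⊗ N.X)) ⊗≫ ((β_ M'.X K).hom ▷ N.X ≫
          (K ⊗ M'.X) ◁ ψ.hom) ⊗≫ 𝟙 _ := by
      rw [← n]; monoidal
    _ = _ := by rw [whisker_exchange, ← whisker_exchange (β_ M'.X K).hom]; monoidal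

lemma Eqv.compL {M M' : Comodule C D} {N N' : Comodule D E} {a : Coact K M} {φ : M ⟶ M'}
    {a' : Coact K M'} (h : a.Eqv φ a') (ψ : N ⟶ N') : (a.compL N).Eqv (compMap φ ψ) (a'.compL N') := by
  rw [Eqv] at *
  rw [← cancel_mono (K ◁ inc M' N'), compL_map, h, Category.assoc, compL_inc]
  have := compMap_inc φ ψ
  rw [reassoc_of% this, whisker_exchange_assoc]
  simp

lemma Eqv.compR {M M' : Comodule C D} {N N' : Comodule D E} (φ : M ⟶ M') {b : Coact K N}
    {ψ : N ⟶ N'} {b' : Coact K N'} (h : b.Eqv ψ b') :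
    (b.compR M).Eqv (compMap φ ψ) (b'.compR M') := by
  rw [Eqv] at *
  rw [← cancel_mono (K ◁ inc M' N'), compR_map, h, Category.assoc, compR_inc]
  have := compMap_inc φ ψ
  rw [reassoc_of% this]
  simp

lemma eqv_of_eq_LL {M : Comodule C D} (a : Coact K M) (N : Comodule D E) (L : Comodule E F) :
    (a.compL (comp N L)).Eqv (assocInv M N L) ((a.compL N).compL L) := by
  rw [Eqv, ← cancel_mono (K ◁ inc (comp M N) L ≫ K ◁ inc M N ▷ L.X)]
  have e := assocInv_inc M N L
  have e₁ := compL_inc a N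
  have e₂ := compL_inc (a.compL N) L
  have e₃ := compL_inc a (comp N L)
  calc _ = (a.compL (comp N L)).act ≫ K ◁ ((assocInv M N L).hom ≫ inc (comp M N) L ≫
        inc M N ▷ L.X) := by simp
    _ = ((a.compL (comp N L)).act ≫ K ◁ inc M _) ≫ K ◁ (M.X ◁ inc N L ≫ (α_ _ _ _).inv) := by
      rw [e]; simp
    _ = inc M _ ≫ (a.act ▷ _ ≫ (K ⊗ M.X) ◁ inc N L) ⊗≫ 𝟙 _ := by rw [e₃]; monoidal
    _ = (inc M _ ≫ M.X ◁ inc N L ≫ (α_ _ _ _).inv) ≫ (a.act ▷ N.X ≫ (α_ _ _ _).hom) ▷ L.X ≫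
          (α_ _ _ _).hom := by rw [← whisker_exchange]; monoidal
    _ = (assocInv M N L).hom ≫ inc (comp M N) L ≫ (inc M N ≫ a.act ▷ N.X ≫ (α_ _ _ _).hom) ▷ L.X ≫
          (α_ _ _ _).hom := by rw [← e]; simp
    _ = (assocInv M N L).hom ≫ (inc (comp M N) L ≫ (a.compL N).act ▷ L.X ≫ (α_ _ _ _).hom) ≫
          K ◁ inc M N ▷ L.X := by rw [← e₁]; simp
    _ = _ := by rw [← e₂]; simp

lemma eqv_of_eq_RL (M : Comodule C D) {N : Comodule D E} (b : Coact K N) (L : Comodule E F) :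
    ((b.compL L).compR M).Eqv (assocInv M N L) ((b.compR M).compL L) := by
  rw [Eqv, ← cancel_mono (K ◁ inc (comp M N) L ≫ K ◁ inc M N ▷ L.X)]
  have e := assocInv_inc M N L
  have e₁ := compR_inc M b
  have e₂ := compL_inc (b.compR M) L
  have e₃ := compR_inc M (b.compL L)
  have e₄ := compL_inc b L
  calc _ = ((b.compL L).compR M).act ≫ K ◁ ((assocInv M N L).hom ≫ inc (comp M N) L ≫
        inc M N ▷ L.X) := by simp
    _ = (((b.compL L).compR M).act ≫ K ◁ inc M _) ≫ K ◁ (M.X ◁ inc N L ≫ (α_ _ _ _).inv) := by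
      rw [e]; simp
    _ = inc M _ ≫ M.X ◁ (b.compL L).act ⊗≫ ((β_ M.X K).hom ▷ (comp N L).X ≫ (K ⊗ M.X) ◁ inc N L) ⊗≫ 𝟙 _ := by
      rw [e₃]; monoidal
    _ = inc M _ ≫ M.X ◁ ((b.compL L).act ≫ K ◁ inc N L) ⊗≫ (β_ M.X K).hom ▷ (N.X ⊗ L.X) ⊗≫ 𝟙 _ := by
      rw [← whisker_exchange]; monoidal
    _ = (inc M _ ≫ M.X ◁ inc N L ≫ (α_ _ _ _).inv) ≫ (M.X ◁ b.act ≫ (α_ _ _ _).inv ≫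
          (β_ M.X K).hom ▷ N.X ≫ (α_ _ _ _).hom) ▷ L.X ≫ (α_ _ _ _).hom := by
      rw [e₄]; monoidal
    _ = (assocInv M N L).hom ≫ inc (comp M N) L ≫ (inc M N ≫ M.X ◁ b.act ≫ (α_ _ _ _).inv ≫
          (β_ M.X K).hom ▷ N.X ≫ (α_ _ _ _).hom) ▷ L.X ≫ (α_ _ _ _).hom := by rw [← e]; simp
    _ = (assocInv M N L).hom ≫ (inc (comp M N) L ≫ (b.compR M).act ▷ L.X ≫ (α_ _ _ _).hom) ≫
          K ◁ inc M N ▷ L.X := by rw [← e₁]; simp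
    _ = _ := by rw [← e₂]; simp

lemma eqv_of_eq_RR (M : Comodule C D) (N : Comodule D E) {L : Comodule E F} (c : Coact K L) :
    ((c.compR N).compR M).Eqv (assocInv M N L) (c.compR (comp M N)) := by
  rw [Eqv, ← cancel_mono (K ◁ inc (comp M N) L ≫ K ◁ inc M N ▷ L.X)]
  have e := assocInv_inc M N L
  have e₁ := compR_inc N c
  have e₂ := compR_inc (comp M N) c
  have e₃ := compR_inc M (c.compR N)
  have n := BraidedCategory.braiding_naturality_left (inc M N) K
  calc _ = ((c.compR N).compR M).act ≫ K ◁ ((assocInv M N L).hom ≫ inc (comp M N) L ≫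
        inc M N ▷ L.X) := by simp
    _ = (((c.compR N).compR M).act ≫ K ◁ inc M _) ≫ K ◁ (M.X ◁ inc N L ≫ (α_ _ _ _).inv) := by
      rw [e]; simp
    _ = inc M _ ≫ M.X ◁ (c.compR N).act ⊗≫ ((β_ M.X K).hom ▷ (comp N L).X ≫ (K ⊗ M.X) ◁ inc N L) ⊗≫ 𝟙 _ := by
      rw [e₃]; monoidal
    _ = inc M _ ≫ M.X ◁ ((c.compR N).act ≫ K ◁ inc N L) ⊗≫ (β_ M.X K).hom ▷ (N.X ⊗ L.X) ⊗≫ 𝟙 _ := by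
      rw [← whisker_exchange]; monoidal
    _ = (inc M _ ≫ M.X ◁ inc N L ≫ (α_ _ _ _).inv) ≫ (M.X ⊗ N.X) ◁ c.act ≫ (α_ _ _ _).inv ≫
          (β_ (M.X ⊗ N.X) K).hom ▷ L.X ≫ (α_ _ _ _).hom := by
      rw [e₁, BraidedCategory.braiding_tensor_left_hom]; monoidal
    _ = (assocInv M N L).hom ≫ inc (comp M N) L ≫ (inc M N ▷ L.X ≫ (M.X ⊗ N.X) ◁ c.act) ≫
          (α_ _ _ _).inv ≫ (β_ (M.X ⊗ N.X) K).hom ▷ L.X ≫ (α_ _ _ _).hom := by rw [← e]; simp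
    _ = (assocInv M N L).hom ≫ inc (comp M N) L ≫ (comp M N).X ◁ c.act ≫ (α_ _ _ _).inv ≫
          (inc M N ▷ K ≫ (β_ (M.X ⊗ N.X) K).hom) ▷ L.X ≫ (α_ _ _ _).hom := by
      rw [← whisker_exchange]; simp
    _ = (assocInv M N L).hom ≫ (inc (comp M N) L ≫ (comp M N).X ◁ c.act ≫ (α_ _ _ _).inv ≫
          (β_ (comp M N).X K).hom ▷ L.X ≫ (α_ _ _ _).hom) ≫ K ◁ inc M N ▷ L.X := by rw [n]; simp
    _ = _ := by rw [← e₂]; simp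

end Coact

namespace CoactPair
variable {C D E F : Comon V}

/-- The pair on `M ⊗_D N` induced by a pair on `M`. -/
noncomputable abbrev compL {M : Comodule C D} (x : CoactPair M) (N : Comodule D E) :
    CoactPair (comp M N) := ⟨x.K, x.l₁.compL N, x.l₂.compL N⟩

/-- The pair on `M ⊗_D N` induced by a pair on `N`. -/
noncomputable abbrev compR (M : Comodule C D) {N : Comodule D E} (x : CoactPair N) :
    CoactPair (comp M N) := ⟨x.K, x.l₁.compR M, x.l₂.compR M⟩

lemma Rel.compL {M M' : Comodule C D} {N N' : Comodule D E} {x : CoactPair M} {y : CoactPair M'}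
    {φ : M ⟶ M'} (h : Rel φ x y) (ψ : N ⟶ N') : Rel (compMap φ ψ) (x.compL N) (y.compL N') := by
  cases h with | mk h₁ h₂ => exact ⟨h₁.compL ψ, h₂.compL ψ⟩

lemma Rel.compR {M M' : Comodule C D} {N N' : Comodule D E} {x : CoactPair N} {y : CoactPair N'}
    (φ : M ⟶ M') {ψ : N ⟶ N'} (h : Rel ψ x y) : Rel (compMap φ ψ) (x.compR M) (y.compR M') := by
  cases h with | mk h₁ h₂ => exact ⟨h₁.compR φ, h₂.compR φ⟩

lemma Bal.compL {M M' : Comodule C D} {N N' : Comodule D E} {x : CoactPair M}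
    {φ : M ⟶ M'} (h : x.Bal φ) (ψ : N ⟶ N') : (x.compL N).Bal (compMap φ ψ) := by
  rw [Bal] at *
  change (x.l₁.compL N).act ≫ x.K ◁ _ = (x.l₂.compL N).act ≫ x.K ◁ _
  rw [← cancel_mono (x.K ◁ inc M' N'), Coact.compL_map, h, Coact.compL_map]

lemma Bal.compR {M M' : Comodule C D} {N N' : Comodule D E} {x : CoactPair N} (φ : M ⟶ M')
    {ψ : N ⟶ N'} (h : x.Bal ψ) : (x.compR M).Bal (compMap φ ψ) := by
  rw [Bal] at *
  change (x.l₁.compR M).act ≫ x.K ◁ _ = (x.l₂.compR M).act ≫ x.K ◁ _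
  rw [← cancel_mono (x.K ◁ inc M' N'), Coact.compR_map, h, Coact.compR_map]

end CoactPair

namespace Multi
variable {C D E F : Comon V}

/-- `P ⊗_D Q`; the coactions by the middle comonoid become a pair. -/
noncomputable abbrev tensor (P : Multi C D) (Q : Multi D E) : Multi C E where
  M := comp P.M Q.M
  s := P.s.compL Q.M
  t := Q.t.compR P.M
  pairs := {z | (∃ x ∈ P.pairs, z = x.compL Q.M) ∨ z = ⟨D.X, P.t.compL Q.M, Q.s.compR P.M⟩ ∨
    ∃ y ∈ Q.pairs, z = y.compR P.M}

lemma IsMor.tensor {P P' : Multi C D} {Q Q' : Multi D E} {φ : P.M ⟶ P'.M} {ψ : Q.M ⟶ Q'.M}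
    (h : IsMor P P' φ) (h' : IsMor Q Q' ψ) :
    IsMor (P.tensor Q) (P'.tensor Q') (compMap φ ψ) where
  s := h.s.compL ψ
  t := h'.t.compR φ
  pairs z hz := by
    rcases hz with ⟨x, hx, rfl⟩ | rfl | ⟨y, hy, rfl⟩
    · rcases h.pairs x hx with ⟨y, hy, hxy⟩ | hb
      · exact .inl ⟨_, .inl ⟨y, hy, rfl⟩, hxy.compL ψ⟩
      · exact .inr (hb.compL ψ)
    · exact .inl ⟨_, .inr (.inl rfl), ⟨h.t.compL ψ, h'.s.compR φ⟩⟩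
    · rcases h'.pairs y hy with ⟨z, hz, hyz⟩ | hb
      · exact .inl ⟨_, .inr (.inr ⟨z, hz, rfl⟩), hyz.compR φ⟩
      · exact .inr (hb.compR φ)

lemma IsMor.assocInv (P : Multi C D) (Q : Multi D E) (R : Multi E F) :
    IsMor (P.tensor (Q.tensor R)) ((P.tensor Q).tensor R) (assocInv P.M Q.M R.M) where
  s := Coact.eqv_of_eq_LL ..
  t := Coact.eqv_of_eq_RR ..
  pairs z hz := by
    left
    rcases hz with ⟨x, hx, rfl⟩ | rfl | ⟨y, ⟨x, hx, rfl⟩ | rfl | ⟨x, hx, rfl⟩, rfl⟩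
    · exact ⟨_, .inl ⟨_, .inl ⟨x, hx, rfl⟩, rfl⟩, ⟨Coact.eqv_of_eq_LL .., Coact.eqv_of_eq_LL ..⟩⟩
    · exact ⟨_, .inl ⟨_, .inr (.inl rfl), rfl⟩, ⟨Coact.eqv_of_eq_LL .., Coact.eqv_of_eq_RL ..⟩⟩
    · exact ⟨_, .inl ⟨_, .inr (.inr ⟨x, hx, rfl⟩), rfl⟩,
        ⟨Coact.eqv_of_eq_RL .., Coact.eqv_of_eq_RL ..⟩⟩
    · exact ⟨_, .inr (.inl rfl), ⟨Coact.eqv_of_eq_RL .., Coact.eqv_of_eq_RR ..⟩⟩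
    · exact ⟨_, .inr (.inr ⟨x, hx, rfl⟩), ⟨Coact.eqv_of_eq_RR .., Coact.eqv_of_eq_RR ..⟩⟩

lemma IsMor.assocHom (P : Multi C D) (Q : Multi D E) (R : Multi E F) :
    IsMor ((P.tensor Q).tensor R) (P.tensor (Q.tensor R)) (assocIso P.M Q.M R.M).inv where
  s := (Coact.eqv_of_eq_LL ..).inv
  t := (Coact.eqv_of_eq_RR ..).inv
  pairs z hz := by
    left
    rcases hz with ⟨y, ⟨x, hx, rfl⟩ | rfl | ⟨x, hx, rfl⟩, rfl⟩ | rfl | ⟨x, hx, rfl⟩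
    · exact ⟨_, .inl ⟨x, hx, rfl⟩, .inv ⟨Coact.eqv_of_eq_LL .., Coact.eqv_of_eq_LL ..⟩⟩
    · exact ⟨_, .inr (.inl rfl), .inv ⟨Coact.eqv_of_eq_LL .., Coact.eqv_of_eq_RL ..⟩⟩
    · exact ⟨_, .inr (.inr ⟨_, .inl ⟨x, hx, rfl⟩, rfl⟩),
        .inv ⟨Coact.eqv_of_eq_RL .., Coact.eqv_of_eq_RL ..⟩⟩
    · exact ⟨_, .inr (.inr ⟨_, .inr (.inl rfl), rfl⟩),
        .inv ⟨Coact.eqv_of_eq_RL .., Coact.eqv_of_eq_RR ..⟩⟩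
    · exact ⟨_, .inr (.inr ⟨_, .inr (.inr ⟨x, hx, rfl⟩), rfl⟩),
        .inv ⟨Coact.eqv_of_eq_RR .., Coact.eqv_of_eq_RR ..⟩⟩

end Multi

lemma MultiComodule.consCell_toMulti {C D E : Comon V} (X : Cell C D) (P : MultiComodule D E) :
    (consCell X P).toMulti = X.multi.tensor P.toMulti := by
  have : (consCell X P).toMulti.pairs = (X.multi.tensor P.toMulti).pairs := by
    ext z
    constructor
    · rintro ⟨_ | j, rfl⟩
      · exact .inr (.inl rfl)
      · exact .inr (.inr ⟨_, ⟨j, rfl⟩, rfl⟩)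
    · rintro (⟨x, hx, _⟩ | rfl | ⟨_, ⟨j, rfl⟩, rfl⟩)
      · exact hx.elim
      · exact ⟨none, rfl⟩
      · exact ⟨some j, rfl⟩
  exact congrArg (Multi.mk (consCell X P).M (consCell X P).s.toCoact (consCell X P).t.toCoact) this

lemma MultiComodule.ofCell_toMulti {C D : Comon V} (X : Cell C D) :
    (ofCell X).toMulti = X.multi := by
  have : (ofCell X).toMulti.pairs = ∅ := Set.eq_empty_of_forall_notMem fun _ ⟨j, _⟩ => j.elim
  exact congrArg (Multi.mk X.flat X.s.toCoact X.t.toCoact) this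

/-- The coactions of a string. -/
noncomputable def Path.mc {C D : Comon V} (p : Path C D) : Multi C D := p.multi.toMulti

lemma Path.single_mc {C D : Comon V} (X : Cell C D) : (Path.single X).mc = X.multi :=
  MultiComodule.ofCell_toMulti X

lemma Path.cons_mc {C D E : Comon V} (X : Cell C D) (p : Path D E) :
    (Path.cons X p).mc = X.multi.tensor p.mc := MultiComodule.consCell_toMulti X p.multi

lemma isCell₂_iff {C D : Comon V} {p : Path C D} {Y : Cell C D} {f : p.dom ⟶ Y.flat} :
    IsCell₂ p Y f ↔ p.mc.IsMor Y.multi f := by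
  constructor
  · intro h
    refine ⟨h.s_comm, h.t_comm, ?_⟩
    rintro _ ⟨j, rfl⟩
    exact .inr (h.balanced j)
  · intro h
    refine ⟨h.s, h.t, fun j => ?_⟩
    rcases h.pairs _ ⟨j, rfl⟩ with ⟨_, hy, _⟩ | hb
    · exact hy.elim
    · exact hb

end QuantumModules

namespace QuantumModules
open Comodule

variable {V : Type u} [Category.{v} V] [MonoidalCategory V] [BraidedCategory V]

section comul
variable {A A' A'' B B' B'' : V}

lemma tensorμ_proj_right₂ (a : A ⟶ A ⊗ A'') (b : B ⟶ B' ⊗ B'') (e : A'' ⟶ 𝟙_ V)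
    (h : a ≫ A ◁ e = (ρ_ _).inv) :
    ((a ⊗ₘ b) ≫ tensorμ A A'' B' B'') ≫ (A ⊗ B') ◁ (e ▷ B'' ≫ (λ_ _).hom) =
      A ◁ b ≫ (α_ _ _ _).inv := by
  have n := BraidedCategory.braiding_naturality_left e B'
  calc _ = A ◁ b ≫ a ▷ (B' ⊗ B'') ⊗≫ A ◁ ((β_ A'' B').hom ≫ B' ◁ e) ▷ B'' ⊗≫ 𝟙 _ := by
        rw [MonoidalCategory.tensorHom_def']; simp only [tensorμ]; monoidal
    _ = A ◁ b ≫ (a ≫ A ◁ e) ▷ (B' ⊗ B'') ⊗≫ A ◁ (β_ (𝟙_ V) B').hom ▷ B'' ⊗≫ 𝟙 _ := by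
        rw [← n]; monoidal
    _ = _ := by rw [h, braiding_tensorUnit_left]; monoidal

lemma tensorμ_proj_right₁ (a : A ⟶ A' ⊗ A'') (b : B ⟶ B ⊗ B'') (e' : B'' ⟶ 𝟙_ V)
    (h : b ≫ B ◁ e' = (ρ_ _).inv) :
    ((a ⊗ₘ b) ≫ tensorμ A' A'' B B'') ≫ (A' ⊗ B) ◁ (A'' ◁ e' ≫ (ρ_ _).hom) =
      a ▷ B ≫ (α_ _ _ _).hom ≫ A' ◁ (β_ A'' B).hom ≫ (α_ _ _ _).inv := by
  calc _ = a ▷ B ⊗≫ (A' ⊗ A'') ◁ b ⊗≫ A' ◁ ((β_ A'' B).hom ▷ B'' ≫ (B ⊗ A'') ◁ e') ⊗≫ 𝟙 _ := by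
        rw [MonoidalCategory.tensorHom_def]; simp only [tensorμ]; monoidal
    _ = a ▷ B ⊗≫ (A' ⊗ A'') ◁ (b ≫ B ◁ e') ⊗≫ A' ◁ (β_ A'' B).hom ⊗≫ 𝟙 _ := by
        rw [← whisker_exchange]; monoidal
    _ = _ := by rw [h]; monoidal

lemma tensorμ_proj_left₁ (a : A ⟶ A' ⊗ A'') (b : B ⟶ B' ⊗ B) (e' : B' ⟶ 𝟙_ V)
    (h : b ≫ e' ▷ B = (λ_ _).inv) :
    ((a ⊗ₘ b) ≫ tensorμ A' A'' B' B) ≫ (A' ◁ e' ≫ (ρ_ _).hom) ▷ (A'' ⊗ B) =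
      a ▷ B ≫ (α_ _ _ _).hom := by
  have n := BraidedCategory.braiding_naturality_right A'' e'
  calc _ = a ▷ B ⊗≫ (A' ⊗ A'') ◁ b ⊗≫ A' ◁ ((β_ A'' B').hom ≫ e' ▷ A'') ▷ B ⊗≫ 𝟙 _ := by
        rw [MonoidalCategory.tensorHom_def]; simp only [tensorμ]; monoidal
    _ = a ▷ B ⊗≫ (A' ⊗ A'') ◁ (b ≫ e' ▷ B) ⊗≫ A' ◁ (β_ A'' (𝟙_ V)).hom ▷ B ⊗≫ 𝟙 _ := by
        rw [← n]; monoidal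
    _ = _ := by rw [h, braiding_tensorUnit_right]; monoidal

lemma tensorμ_proj_left₂ (a : A ⟶ A' ⊗ A) (b : B ⟶ B' ⊗ B'') (e : A' ⟶ 𝟙_ V)
    (h : a ≫ e ▷ A = (λ_ _).inv) :
    ((a ⊗ₘ b) ≫ tensorμ A' A B' B'') ≫ (e ▷ B' ≫ (λ_ _).hom) ▷ (A ⊗ B'') =
      A ◁ b ≫ (α_ _ _ _).inv ≫ (β_ A B').hom ▷ B'' ≫ (α_ _ _ _).hom := by
  calc _ = A ◁ b ≫ a ▷ (B' ⊗ B'') ⊗≫ (A' ◁ (β_ A B').hom ≫ e ▷ (B' ⊗ A)) ▷ B'' ⊗≫ 𝟙 _ := by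
        rw [MonoidalCategory.tensorHom_def']; simp only [tensorμ]; monoidal
    _ = A ◁ b ≫ (a ≫ e ▷ A) ▷ (B' ⊗ B'') ⊗≫ (β_ A B').hom ▷ B'' ⊗≫ 𝟙 _ := by
        rw [whisker_exchange]; monoidal
    _ = _ := by rw [h]; monoidal

end comul

section oneCast
variable (C D : Comon V)

/-- `C ⊗ D` as the object carrying the flattened identity comodule. -/
def oneCast : C.X ⊗ D.X ⟶ (Cell.flat (one (opTensor C D))).X := 𝟙 (C.X ⊗ D.X)

lemma oneCast_right : oneCast C D ≫ (Cell.flat (one (opTensor C D))).right =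
    C.X ◁ D.comon.comul ≫ (α_ _ _ _).inv ≫ oneCast C D ▷ D.X := by
  have h := tensorμ_proj_right₂ _ D.comon.comul _ (opp C).comon.comul_counit
  exact (Category.id_comp _).trans (h.trans (by
    change _ = C.X ◁ D.comon.comul ≫ (α_ _ _ _).inv ≫ (𝟙 (C.X ⊗ D.X)) ▷ D.X
    simp; rfl))

lemma oneCast_left : oneCast C D ≫ (Cell.flat (one (opTensor C D))).left =
    C.comon.comul ▷ D.X ≫ (α_ _ _ _).hom ≫ C.X ◁ oneCast C D := by
  have h := tensorμ_proj_right₁ (C.comon.comul ≫ (β_ C.X C.X).hom) D.comon.comul _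
    D.comon.comul_counit
  refine (Category.id_comp _).trans ((congrArg (· ≫ (β_ C.X (C.X ⊗ D.X)).inv) h).trans ?_)
  change _ = C.comon.comul ▷ D.X ≫ (α_ _ _ _).hom ≫ C.X ◁ (𝟙 (C.X ⊗ D.X))
  rw [BraidedCategory.braiding_tensor_right_inv]
  have e : C.X ◁ (β_ C.X D.X).hom ≫ C.X ◁ (β_ C.X D.X).inv = 𝟙 _ := by
    rw [← whiskerLeft_comp, Iso.hom_inv_id, whiskerLeft_id]
  have e' : (C.comon.comul ≫ (β_ C.X C.X).hom) ▷ D.X ≫ (β_ C.X C.X).inv ▷ D.X =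
      C.comon.comul ▷ D.X := by
    rw [← comp_whiskerRight, Category.assoc, Iso.hom_inv_id, Category.comp_id]
  simp only [Category.assoc, Iso.inv_hom_id_assoc, Iso.hom_inv_id_assoc, reassoc_of% e,
    reassoc_of% e', whiskerLeft_id, Category.comp_id]

lemma oneCast_s : oneCast C D ≫ (Cell.multi (one (opTensor C D))).s.act =
    (C.comon.comul ≫ (β_ C.X C.X).hom) ▷ D.X ≫ (α_ _ _ _).hom ≫ C.X ◁ oneCast C D := by
  have h := tensorμ_proj_left₁ (C.comon.comul ≫ (β_ C.X C.X).hom) D.comon.comul _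
    D.comon.counit_comul
  refine (Category.id_comp _).trans (h.trans ?_)
  change _ = _ ▷ D.X ≫ (α_ _ _ _).hom ≫ C.X ◁ (𝟙 (C.X ⊗ D.X))
  simp

lemma oneCast_t : oneCast C D ≫ (Cell.multi (one (opTensor C D))).t.act =
    C.X ◁ D.comon.comul ≫ (α_ _ _ _).inv ≫ (β_ C.X D.X).hom ▷ D.X ≫ (α_ _ _ _).hom ≫
      D.X ◁ oneCast C D := by
  have h := tensorμ_proj_left₂ (C.comon.comul ≫ (β_ C.X C.X).hom) D.comon.comul _
    (opp C).comon.counit_comul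
  refine (Category.id_comp _).trans (h.trans ?_)
  change _ = C.X ◁ D.comon.comul ≫ (α_ _ _ _).inv ≫ (β_ C.X D.X).hom ▷ D.X ≫ (α_ _ _ _).hom ≫
    D.X ◁ (𝟙 (C.X ⊗ D.X))
  simp

lemma oneCast_counit : oneCast C D ≫ (opTensor C D).comon.counit =
    (C.comon.counit ⊗ₘ D.comon.counit) ≫ (λ_ _).hom := Category.id_comp _

end oneCast

variable [HasCoreflexiveEqualizers V]
  [∀ X : V, Comonad.PreservesLimitOfIsCoreflexivePair (tensorLeft X)]

section flatInc
variable {C D : Comon V}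

lemma comp_right_proj {K L : Comon V} (X : Comodule K K) (Y : Comodule K L) {A : V} (g : L.X ⟶ A) :
    ((comp X Y).right ≫ (comp X Y).X ◁ g) ≫ inc X Y ▷ A =
      inc X Y ≫ X.X ◁ (Y.right ≫ Y.X ◁ g) ≫ (α_ _ _ _).inv := by
  have := comp_right_inc X Y
  rw [Category.assoc, whisker_exchange, reassoc_of% this]
  simp

lemma comp_left_proj {K L : Comon V} (X : Comodule K K) (Y : Comodule K L) {A : V} (g : K.X ⟶ A) :
    ((comp X Y).left ≫ g ▷ (comp X Y).X) ≫ A ◁ inc X Y =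
      inc X Y ≫ (X.left ≫ g ▷ X.X) ▷ Y.X ≫ (α_ _ _ _).hom := by
  have := comp_left_inc X Y
  rw [Category.assoc, ← whisker_exchange, reassoc_of% this]
  simp

/-- The inclusion `X ⊗_{C^o ⊗ D} Y ⟶ X ⊗ Y`. -/
noncomputable def flatInc (X Y : Cell C D) : (Cell.flat (comp X Y)).X ⟶ X.flat.X ⊗ Y.flat.X := inc X Y

instance (X Y : Cell C D) : Mono (flatInc X Y) := inferInstanceAs (Mono (inc X Y))

instance (Z : V) (X Y : Cell C D) : Mono (Z ◁ flatInc X Y) := inferInstanceAs (Mono (Z ◁ inc X Y))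

instance (Z : V) (X Y : Cell C D) : Mono (flatInc X Y ▷ Z) := inferInstanceAs (Mono (inc X Y ▷ Z))

lemma flatInc_right (X Y : Cell C D) : (Cell.flat (comp X Y)).right ≫ flatInc X Y ▷ D.X =
    flatInc X Y ≫ X.flat.X ◁ Y.flat.right ≫ (α_ _ _ _).inv := comp_right_proj X Y (p₂ C D)

lemma flatInc_left (X Y : Cell C D) : (Cell.flat (comp X Y)).left ≫ C.X ◁ flatInc X Y =
    flatInc X Y ≫ X.flat.X ◁ Y.flat.left ≫ (α_ _ _ _).inv ≫ (β_ C.X X.flat.X).inv ▷ Y.flat.X ≫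
      (α_ _ _ _).hom := by
  have h := comp_right_proj X Y (p₁ C D)
  have n := BraidedCategory.braiding_inv_naturality_left (inc X Y) C.X
  change (((comp X Y).right ≫ (comp X Y).X ◁ p₁ C D) ≫ (β_ C.X (comp X Y).X).inv) ≫ C.X ◁ inc X Y =
    inc X Y ≫ X.X ◁ ((Y.right ≫ Y.X ◁ p₁ C D) ≫ (β_ C.X Y.X).inv) ≫ (α_ _ _ _).inv ≫
      (β_ C.X X.X).inv ▷ Y.X ≫ (α_ _ _ _).hom
  rw [Category.assoc, ← n, ← Category.assoc, h, BraidedCategory.braiding_tensor_right_inv]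
  simp only [whiskerLeft_comp, Category.assoc, Iso.inv_hom_id_assoc]

lemma flatInc_s (X Y : Cell C D) : (Cell.multi (comp X Y)).s.act ≫ C.X ◁ flatInc X Y =
    flatInc X Y ≫ X.multi.s.act ▷ Y.flat.X ≫ (α_ _ _ _).hom := comp_left_proj X Y (p₁ C D)

lemma flatInc_t (X Y : Cell C D) : (Cell.multi (comp X Y)).t.act ≫ D.X ◁ flatInc X Y =
    flatInc X Y ≫ X.multi.t.act ▷ Y.flat.X ≫ (α_ _ _ _).hom := comp_left_proj X Y (p₂ C D)

lemma flat_left_braid (X : Cell C D) : X.flat.left ≫ (β_ C.X X.flat.X).hom = X.r₁ := by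
  change (X.r₁ ≫ (β_ C.X X.X).inv) ≫ (β_ C.X X.X).hom = X.r₁
  simp

lemma cell_right (X : Cell C D) : X.right = X.r₂ ≫ X.r₁ ▷ D.X ≫ (α_ X.X C.X D.X).hom := by
  have h := X.r₂_r₁
  rw [← Category.assoc]
  refine Eq.symm ((congrArg (· ≫ (α_ X.X C.X D.X).hom) h).trans ?_)
  refine (Category.assoc _ _ _).trans ?_
  refine (congrArg (X.right ≫ ·) (Iso.inv_hom_id (α_ X.X C.X D.X))).trans ?_
  exact Category.comp_id X.right

lemma cell_left (X : Cell C D) : X.left = X.l₁ ≫ C.X ◁ X.l₂ ≫ (α_ C.X D.X X.X).inv := by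
  have h := Cell.left_aux (p₁ C D) (p₂ C D) X.left X.left_coassoc
  have h' : (X.l₁ ≫ C.X ◁ X.l₂) ≫ (α_ C.X D.X X.X).inv = X.left := by
    change ((X.left ≫ p₁ C D ▷ X.X) ≫ C.X ◁ (X.left ≫ p₂ C D ▷ X.X)) ≫ (α_ C.X D.X X.X).inv = X.left
    rw [h, comul_p₁_p₂, Category.assoc, Category.assoc]
    refine (congrArg (X.left ≫ ·) ?_).trans (Category.comp_id _)
    refine (congrArg (_ ≫ ·) (Iso.hom_inv_id (α_ C.X D.X X.X))).trans ?_
    exact (Category.comp_id _).trans (id_whiskerRight _ _)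
  rw [← Category.assoc]; exact h'.symm

/-- A map into `X ⊗ Y` that is balanced for `C^o` and for `D` is balanced for `C^o ⊗ D`. -/
lemma flatFac_aux (X Y : Cell C D) {W : V} (z : W ⟶ X.X ⊗ Y.X)
    (h₁ : z ≫ X.r₁ ▷ Y.X ≫ (α_ _ _ _).hom = z ≫ X.X ◁ Y.l₁)
    (h₂ : z ≫ X.r₂ ▷ Y.X ≫ (α_ _ _ _).hom = z ≫ X.X ◁ Y.l₂) :
    z ≫ X.right ▷ Y.X ≫ (α_ _ _ _).hom = z ≫ X.X ◁ Y.left := by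
  have e : z ≫ (X.r₂ ≫ X.r₁ ▷ D.X ≫ (α_ X.X C.X D.X).hom) ▷ Y.X ≫ (α_ X.X (C.X ⊗ D.X) Y.X).hom =
      z ≫ X.X ◁ (Y.l₁ ≫ C.X ◁ Y.l₂ ≫ (α_ C.X D.X Y.X).inv) :=
    calc _ = (z ≫ X.r₂ ▷ Y.X ≫ (α_ _ _ _).hom) ≫ X.r₁ ▷ (D.X ⊗ Y.X) ⊗≫ 𝟙 _ := by monoidal
      _ = (z ≫ (X.X ◁ Y.l₂ ≫ X.r₁ ▷ (D.X ⊗ Y.X))) ⊗≫ 𝟙 _ := by rw [h₂]; monoidal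
      _ = (z ≫ X.r₁ ▷ Y.X ≫ (α_ _ _ _).hom) ≫ X.X ◁ C.X ◁ Y.l₂ ⊗≫ 𝟙 _ := by
        rw [whisker_exchange]; monoidal
      _ = _ := by rw [h₁]; monoidal
  rw [cell_right, cell_left]
  exact e

/-- Factor a map through `X ⊗_{C^o ⊗ D} Y`. -/
noncomputable def flatFac (X Y : Cell C D) {W : V} (z : W ⟶ X.flat.X ⊗ Y.flat.X)
    (h₁ : z ≫ (X.flat.left ≫ (β_ C.X X.flat.X).hom) ▷ Y.flat.X ≫ (α_ _ _ _).hom =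
      z ≫ X.flat.X ◁ Y.multi.s.act)
    (h₂ : z ≫ X.flat.right ▷ Y.flat.X ≫ (α_ _ _ _).hom = z ≫ X.flat.X ◁ Y.multi.t.act) :
    W ⟶ (Cell.flat (comp X Y)).X :=
  fac X Y z (flatFac_aux X Y z (by rw [flat_left_braid] at h₁; exact h₁) h₂)

lemma flatFac_inc (X Y : Cell C D) {W : V} (z : W ⟶ X.flat.X ⊗ Y.flat.X) (h₁ h₂) :
    flatFac X Y z h₁ h₂ ≫ flatInc X Y = z := fac_inc ..

lemma flatMap_compMap_inc {X X' Y Y' : Cell C D} (f : X ⟶ X') (g : Y ⟶ Y') :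
    (Cell.flatMap (compMap f g)).hom ≫ flatInc X' Y' =
      flatInc X Y ≫ (Cell.flatMap f).hom ▷ Y.flat.X ≫ X'.flat.X ◁ (Cell.flatMap g).hom :=
  compMap_inc f g

lemma flatMap_assocInv_inc (X Y Z : Cell C D) :
    (Cell.flatMap (assocInv X Y Z)).hom ≫ flatInc (comp X Y) Z ≫ flatInc X Y ▷ Z.flat.X =
      flatInc X (comp Y Z) ≫ X.flat.X ◁ flatInc Y Z ≫ (α_ _ _ _).inv := assocInv_inc X Y Z

lemma flatMap_isMor {X Y : Cell C D} (f : X ⟶ Y) : X.multi.IsMor Y.multi (Cell.flatMap f) where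
  s := by
    change (X.left ≫ p₁ C D ▷ X.X) ≫ C.X ◁ f.hom = f.hom ≫ Y.left ≫ p₁ C D ▷ Y.X
    have := f.left_comm
    rw [reassoc_of% this, Category.assoc, ← whisker_exchange]
  t := by
    change (X.left ≫ p₂ C D ▷ X.X) ≫ D.X ◁ f.hom = f.hom ≫ Y.left ≫ p₂ C D ▷ Y.X
    have := f.left_comm
    rw [reassoc_of% this, Category.assoc, ← whisker_exchange]
  pairs x hx := hx.elim

lemma Cell.hom_left_of_flat {X Y : Cell C D} (g : X.X ⟶ Y.X) (h₁ : X.l₁ ≫ C.X ◁ g = g ≫ Y.l₁)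
    (h₂ : X.l₂ ≫ D.X ◁ g = g ≫ Y.l₂) :
    g ≫ Y.left = X.left ≫ (opTensor C D).X ◁ g := by
  rw [cell_left X, cell_left Y]
  change g ≫ Y.l₁ ≫ C.X ◁ Y.l₂ ≫ (α_ C.X D.X Y.X).inv =
    (X.l₁ ≫ C.X ◁ X.l₂ ≫ (α_ C.X D.X X.X).inv) ≫ (C.X ⊗ D.X) ◁ g
  rw [← reassoc_of% h₁, ← whiskerLeft_comp_assoc, ← h₂]; simp

lemma Cell.hom_right_of_flat {X Y : Cell C D} (g : X.X ⟶ Y.X) (h₁ : g ≫ Y.r₁ = X.r₁ ≫ g ▷ C.X)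
    (h₂ : g ≫ Y.r₂ = X.r₂ ≫ g ▷ D.X) :
    g ≫ Y.right = X.right ≫ g ▷ (opTensor C D).X := by
  rw [cell_right X, cell_right Y]
  change g ≫ Y.r₂ ≫ Y.r₁ ▷ D.X ≫ (α_ Y.X C.X D.X).hom =
    (X.r₂ ≫ X.r₁ ▷ D.X ≫ (α_ X.X C.X D.X).hom) ≫ g ▷ (C.X ⊗ D.X)
  rw [reassoc_of% h₂, ← comp_whiskerRight_assoc, h₁]; simp

lemma Cell.hom_r₁_of_flat {X Y : Cell C D} (g : X.X ⟶ Y.X)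
    (e : g ≫ (Y.r₁ ≫ (β_ C.X Y.X).inv) = (X.r₁ ≫ (β_ C.X X.X).inv) ≫ C.X ◁ g) :
    g ≫ Y.r₁ = X.r₁ ≫ g ▷ C.X := by
  rw [Category.assoc, ← BraidedCategory.braiding_inv_naturality_left] at e
  rw [← cancel_mono (β_ C.X Y.X).inv]; simpa using e

/-- A map of the flattened comodules that respects the left coactions. -/
def Cell.homOfFlat {X Y : Cell C D} (f : X.flat ⟶ Y.flat) (h : X.multi.IsMor Y.multi f) : X ⟶ Y where
  hom := f.hom
  left_comm := Cell.hom_left_of_flat (X := X) (Y := Y) f.hom h.s h.t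
  right_comm := Cell.hom_right_of_flat (X := X) (Y := Y) f.hom
    (Cell.hom_r₁_of_flat (X := X) (Y := Y) f.hom f.left_comm) f.right_comm

lemma Cell.flatMap_injective {X Y : Cell C D} {f g : X ⟶ Y} (h : flatMap f = flatMap g) : f = g :=
  Comodule.hom_ext (M := X) (N := Y)
    (show f.hom = g.hom from congrArg (fun k : X.flat ⟶ Y.flat => k.hom) h)

end flatInc

end QuantumModules

namespace QuantumModules
open Comodule

variable {V : Type u} [Category.{v} V] [MonoidalCategory V] [BraidedCategory V]

/-- The maps `κ₁` and `κ₂` out of the comonoid `O` represent a pair of coactions on an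
`O`-comodule embedded in `O`. -/
structure RepPair {C D : Comon V} {M : Comodule C D} (O : Comon V) (i : M.X ⟶ O.X)
    (d : M.X ⟶ O.X ⊗ M.X) (x : CoactPair M) (κ₁ κ₂ : O.X ⟶ x.K) : Prop where
  l₁ : x.l₁.act = d ≫ κ₁ ▷ M.X
  l₂ : x.l₂.act = d ≫ κ₂ ▷ M.X
  eq : i ≫ O.comon.comul ≫ O.X ◁ κ₁ = i ≫ O.comon.comul ≫ O.X ◁ κ₂

/-- An embedding of `P` in a comonoid `O`, as a left `O`-comodule, such that all coactions on `P`
are represented by maps out of `O`, and such that `P` is cut out by its pairs of coactions. -/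
structure Amb {C D : Comon V} (P : Multi C D) where
  O : Comon V
  i : P.M.X ⟶ O.X
  d : P.M.X ⟶ O.X ⊗ P.M.X
  κs : O.X ⟶ C.X
  κt : O.X ⟶ D.X
  mono : ∀ A Z : V, Mono (A ◁ i ▷ Z)
  d_i : d ≫ O.X ◁ i = i ≫ O.comon.comul
  s_eq : P.s.act = d ≫ κs ▷ P.M.X
  t_eq : P.t.act = d ≫ κt ▷ P.M.X
  right_i : P.M.right ≫ i ▷ D.X = i ≫ O.comon.comul ≫ O.X ◁ κt
  left_i : P.M.left ≫ (β_ C.X P.M.X).hom ≫ i ▷ C.X = i ≫ O.comon.comul ≫ O.X ◁ κs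
  pairs : ∀ x ∈ P.pairs, ∃ κ₁ κ₂, RepPair O i d x κ₁ κ₂
  lift : ∀ {W A Z : V} (z : W ⟶ A ⊗ (O.X ⊗ Z)), (∀ x ∈ P.pairs, ∀ κ₁ κ₂, RepPair O i d x κ₁ κ₂ →
    z ≫ A ◁ ((O.comon.comul ≫ O.X ◁ κ₁) ▷ Z) = z ≫ A ◁ ((O.comon.comul ≫ O.X ◁ κ₂) ▷ Z)) →
    ∃ z' : W ⟶ A ⊗ (P.M.X ⊗ Z), z' ≫ A ◁ i ▷ Z = z

namespace Amb
variable {C D : Comon V} {P : Multi C D} (a : Amb P)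

instance (A Z : V) : Mono (A ◁ a.i ▷ Z) := a.mono A Z

instance (Z : V) : Mono (a.i ▷ Z) := by
  have : a.i ▷ Z = (λ_ _).inv ≫ 𝟙_ V ◁ a.i ▷ Z ≫ (λ_ _).hom := by simp
  rw [this]; infer_instance

instance (A : V) : Mono (A ◁ a.i) := by
  have : A ◁ a.i = A ◁ (ρ_ _).inv ≫ A ◁ a.i ▷ 𝟙_ V ≫ A ◁ (ρ_ _).hom := by
    simp
  rw [this]; infer_instance

instance (A B : V) : Mono (A ◁ B ◁ a.i) := by
  have : A ◁ B ◁ a.i = (α_ _ _ _).inv ≫ (A ⊗ B) ◁ a.i ≫ (α_ _ _ _).hom := by simp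
  rw [this]; infer_instance

/-- The counit of `O` restricted to `P`. -/
def e : P.M.X ⟶ 𝟙_ V := a.i ≫ a.O.comon.counit

lemma lift₀ {W Z : V} (z : W ⟶ a.O.X ⊗ Z) (h : ∀ x ∈ P.pairs, ∀ κ₁ κ₂,
    RepPair a.O a.i a.d x κ₁ κ₂ → z ≫ (a.O.comon.comul ≫ a.O.X ◁ κ₁) ▷ Z =
      z ≫ (a.O.comon.comul ≫ a.O.X ◁ κ₂) ▷ Z) : ∃ z' : W ⟶ P.M.X ⊗ Z, z' ≫ a.i ▷ Z = z := by
  obtain ⟨z', hz⟩ := a.lift (z ≫ (λ_ _).inv) (fun x hx κ₁ κ₂ hr => by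
    have := h x hx κ₁ κ₂ hr
    rw [Category.assoc, Category.assoc, ← leftUnitor_inv_naturality, ← leftUnitor_inv_naturality,
      reassoc_of% this])
  exact ⟨z' ≫ (λ_ _).hom, by
    rw [Category.assoc, ← leftUnitor_naturality, reassoc_of% hz]; simp⟩

lemma d_coassoc : a.d ≫ a.O.X ◁ a.d = a.d ≫ a.O.comon.comul ▷ P.M.X ≫ (α_ _ _ _).hom := by
  rw [← cancel_mono (a.O.X ◁ a.O.X ◁ a.i)]
  calc _ = a.d ≫ a.O.X ◁ (a.d ≫ a.O.X ◁ a.i) := by simp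
    _ = a.i ≫ a.O.comon.comul ≫ a.O.comon.comul ▷ a.O.X ≫ (α_ _ _ _).hom := by
      rw [a.d_i, whiskerLeft_comp, reassoc_of% a.d_i, a.O.comon.comul_assoc]
    _ = _ := by
      rw [← reassoc_of% a.d_i, whisker_exchange_assoc]; simp

lemma right_d : P.M.right ≫ a.d ▷ D.X ≫ (α_ _ _ _).hom = a.d ≫ a.O.X ◁ P.M.right := by
  rw [← cancel_mono (a.O.X ◁ a.i ▷ D.X)]
  calc _ = P.M.right ≫ (a.d ≫ a.O.X ◁ a.i) ▷ D.X ≫ (α_ _ _ _).hom := by simp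
    _ = (P.M.right ≫ a.i ▷ D.X) ≫ a.O.comon.comul ▷ D.X ≫ (α_ _ _ _).hom := by rw [a.d_i]; simp
    _ = a.i ≫ (a.O.comon.comul ≫ a.O.comon.comul ▷ a.O.X ≫ (α_ _ _ _).hom) ≫
          a.O.X ◁ a.O.X ◁ a.κt := by
      rw [a.right_i]; simp only [Category.assoc]; rw [whisker_exchange_assoc]; simp
    _ = a.d ≫ a.O.X ◁ (P.M.right ≫ a.i ▷ D.X) := by
      rw [← a.O.comon.comul_assoc, a.right_i, whiskerLeft_comp, reassoc_of% a.d_i]; simp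
    _ = _ := by simp

lemma left_d : P.M.left ≫ C.X ◁ a.d ≫ (α_ _ _ _).inv ≫ (β_ C.X a.O.X).hom ▷ P.M.X ≫
    (α_ _ _ _).hom = a.d ≫ a.O.X ◁ P.M.left := by
  have n := BraidedCategory.braiding_naturality_right C.X a.d
  have h : (P.M.left ≫ (β_ C.X P.M.X).hom) ≫ a.d ▷ C.X ≫ (α_ _ _ _).hom =
      a.d ≫ a.O.X ◁ (P.M.left ≫ (β_ C.X P.M.X).hom) := by
    rw [← cancel_mono (a.O.X ◁ a.i ▷ C.X)]
    calc _ = P.M.left ≫ (β_ C.X P.M.X).hom ≫ (a.d ≫ a.O.X ◁ a.i) ▷ C.X ≫ (α_ _ _ _).hom := by simp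
      _ = (P.M.left ≫ (β_ C.X P.M.X).hom ≫ a.i ▷ C.X) ≫ a.O.comon.comul ▷ C.X ≫
            (α_ _ _ _).hom := by rw [a.d_i]; simp
      _ = a.i ≫ (a.O.comon.comul ≫ a.O.comon.comul ▷ a.O.X ≫ (α_ _ _ _).hom) ≫
            a.O.X ◁ a.O.X ◁ a.κs := by
        rw [a.left_i]; simp only [Category.assoc]; rw [whisker_exchange_assoc]; simp
      _ = a.d ≫ a.O.X ◁ (P.M.left ≫ (β_ C.X P.M.X).hom ≫ a.i ▷ C.X) := by
        rw [← a.O.comon.comul_assoc, a.left_i, whiskerLeft_comp, reassoc_of% a.d_i]; simp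
      _ = _ := by simp
  rw [← cancel_mono (a.O.X ◁ (β_ C.X P.M.X).hom)]
  refine Eq.trans ?_ (h.trans (by simp))
  simp only [Category.assoc]
  rw [← reassoc_of% n, BraidedCategory.braiding_tensor_right_hom]
  simp

section w
variable {Y Y' Y'' : Cell C D} {f : P.M ⟶ Y.flat} {g : P.M ⟶ Y'.flat} {h : P.M ⟶ Y''.flat}

lemma exists_w (hf : P.IsMor Y.multi f) :
    ∃ w : P.M.X ⟶ P.M.X ⊗ Y.flat.X, w ≫ a.i ▷ Y.flat.X = a.d ≫ a.O.X ◁ f.hom := by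
  apply a.lift₀
  intro x hx κ₁ κ₂ hr
  have hb : x.l₁.act ≫ x.K ◁ f.hom = x.l₂.act ≫ x.K ◁ f.hom := by
    rcases hf.pairs x hx with ⟨_, hy, _⟩ | hb
    · exact hy.elim
    · exact hb
  have key : ∀ κ : a.O.X ⟶ x.K, (a.d ≫ a.O.X ◁ f.hom) ≫ (a.O.comon.comul ≫ a.O.X ◁ κ) ▷ Y.flat.X =
      a.d ≫ a.O.X ◁ ((a.d ≫ κ ▷ P.M.X) ≫ x.K ◁ f.hom) ≫ (α_ _ _ _).inv := fun κ =>
    calc _ = (a.d ≫ a.O.comon.comul ▷ P.M.X ≫ (α_ _ _ _).hom) ≫ (α_ _ _ _).inv ≫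
          (a.O.X ⊗ a.O.X) ◁ f.hom ≫ (a.O.X ◁ κ) ▷ Y.flat.X := by
          simp only [Category.assoc, Iso.hom_inv_id_assoc, comp_whiskerRight]
          rw [whisker_exchange_assoc]
      _ = _ := by
        rw [← d_coassoc, whisker_exchange]; simp
  rw [key, key, ← hr.l₁, ← hr.l₂, hb]

/-- The right coaction of `Y` on `P` induced by `f : P ⟶ Y`. -/
noncomputable def w (hf : P.IsMor Y.multi f) : P.M.X ⟶ P.M.X ⊗ Y.flat.X := (a.exists_w hf).choose

lemma w_i (hf : P.IsMor Y.multi f) : a.w hf ≫ a.i ▷ Y.flat.X = a.d ≫ a.O.X ◁ f.hom :=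
  (a.exists_w hf).choose_spec

lemma w_unique (hf : P.IsMor Y.multi f) {w : P.M.X ⟶ P.M.X ⊗ Y.flat.X}
    (hw : w ≫ a.i ▷ Y.flat.X = a.d ≫ a.O.X ◁ f.hom) : a.w hf = w := by
  rw [← cancel_mono (a.i ▷ Y.flat.X), hw, w_i]

lemma w_d (hf : P.IsMor Y.multi f) :
    a.w hf ≫ a.d ▷ Y.flat.X ≫ (α_ _ _ _).hom = a.d ≫ a.O.X ◁ a.w hf := by
  rw [← cancel_mono (a.O.X ◁ a.i ▷ Y.flat.X)]
  calc _ = a.w hf ≫ (a.d ≫ a.O.X ◁ a.i) ▷ Y.flat.X ≫ (α_ _ _ _).hom := by simp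
    _ = (a.w hf ≫ a.i ▷ Y.flat.X) ≫ a.O.comon.comul ▷ Y.flat.X ≫ (α_ _ _ _).hom := by
      rw [a.d_i]; simp
    _ = (a.d ≫ a.O.comon.comul ▷ P.M.X ≫ (α_ _ _ _).hom) ≫ a.O.X ◁ a.O.X ◁ f.hom := by
      rw [a.w_i]; simp only [Category.assoc]; rw [whisker_exchange_assoc]; simp
    _ = a.d ≫ a.O.X ◁ (a.w hf ≫ a.i ▷ Y.flat.X) := by rw [← d_coassoc, a.w_i]; simp
    _ = _ := by simp

lemma w_κ (hf : P.IsMor Y.multi f) {K : V} (κ : a.O.X ⟶ K) {r : P.M.X ⟶ P.M.X ⊗ K}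
    (hr : r ≫ a.i ▷ K = a.i ≫ a.O.comon.comul ≫ a.O.X ◁ κ) {s : Y.flat.X ⟶ K ⊗ Y.flat.X}
    (hs : f.hom ≫ s = (a.d ≫ κ ▷ P.M.X) ≫ K ◁ f.hom) :
    a.w hf ≫ r ▷ Y.flat.X ≫ (α_ _ _ _).hom = a.w hf ≫ P.M.X ◁ s := by
  rw [← cancel_mono (a.i ▷ (K ⊗ Y.flat.X))]
  calc _ = a.w hf ≫ (r ≫ a.i ▷ K) ▷ Y.flat.X ≫ (α_ _ _ _).hom := by simp
    _ = (a.w hf ≫ a.i ▷ Y.flat.X) ≫ (a.O.comon.comul ≫ a.O.X ◁ κ) ▷ Y.flat.X ≫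
          (α_ _ _ _).hom := by rw [hr]; simp
    _ = (a.d ≫ a.O.comon.comul ▷ P.M.X ≫ (α_ _ _ _).hom) ≫ a.O.X ◁ (κ ▷ P.M.X ≫ K ◁ f.hom) := by
      rw [w_i]; simp only [Category.assoc, comp_whiskerRight]; rw [whisker_exchange_assoc]
      rw [← whisker_exchange]; simp
    _ = a.d ≫ a.O.X ◁ (f.hom ≫ s) := by rw [← d_coassoc, hs]; simp
    _ = (a.w hf ≫ a.i ▷ Y.flat.X) ≫ a.O.X ◁ s := by rw [w_i]; simp
    _ = _ := by rw [Category.assoc, Category.assoc, whisker_exchange]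

lemma w_t (hf : P.IsMor Y.multi f) : a.w hf ≫ P.M.right ▷ Y.flat.X ≫ (α_ _ _ _).hom =
    a.w hf ≫ P.M.X ◁ Y.multi.t.act :=
  a.w_κ hf a.κt a.right_i (by rw [← a.t_eq]; exact hf.t.symm)

lemma w_s (hf : P.IsMor Y.multi f) :
    a.w hf ≫ (P.M.left ≫ (β_ C.X P.M.X).hom) ▷ Y.flat.X ≫ (α_ _ _ _).hom =
      a.w hf ≫ P.M.X ◁ Y.multi.s.act :=
  a.w_κ hf a.κs (by rw [Category.assoc]; exact a.left_i) (by rw [← a.s_eq]; exact hf.s.symm)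

lemma w_right (hf : P.IsMor Y.multi f) : P.M.right ≫ a.w hf ▷ D.X ≫ (α_ _ _ _).hom =
    a.w hf ≫ P.M.X ◁ Y.flat.right := by
  rw [← cancel_mono (a.i ▷ (Y.flat.X ⊗ D.X))]
  calc _ = P.M.right ≫ (a.w hf ≫ a.i ▷ Y.flat.X) ▷ D.X ≫ (α_ _ _ _).hom := by simp
    _ = (P.M.right ≫ a.d ▷ D.X ≫ (α_ _ _ _).hom) ≫ a.O.X ◁ f.hom ▷ D.X := by rw [w_i]; simp
    _ = a.d ≫ a.O.X ◁ (P.M.right ≫ f.hom ▷ D.X) := by rw [right_d]; simp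
    _ = (a.w hf ≫ a.i ▷ Y.flat.X) ≫ a.O.X ◁ Y.flat.right := by rw [← f.right_comm, w_i]; simp
    _ = _ := by rw [Category.assoc, Category.assoc, whisker_exchange]

lemma w_left (hf : P.IsMor Y.multi f) : P.M.left ≫ C.X ◁ a.w hf ≫ (α_ _ _ _).inv ≫
    (β_ C.X P.M.X).hom ▷ Y.flat.X ≫ (α_ _ _ _).hom = a.w hf ≫ P.M.X ◁ Y.flat.left := by
  have n := BraidedCategory.braiding_naturality_right C.X a.i
  rw [← cancel_mono (a.i ▷ (C.X ⊗ Y.flat.X))]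
  calc _ = P.M.left ≫ C.X ◁ a.w hf ≫ (α_ _ _ _).inv ≫ ((β_ C.X P.M.X).hom ≫ a.i ▷ C.X) ▷ Y.flat.X ≫
          (α_ _ _ _).hom := by simp
    _ = P.M.left ≫ C.X ◁ (a.w hf ≫ a.i ▷ Y.flat.X) ≫ (α_ _ _ _).inv ≫
          (β_ C.X a.O.X).hom ▷ Y.flat.X ≫ (α_ _ _ _).hom := by rw [← n]; monoidal
    _ = P.M.left ≫ C.X ◁ a.d ≫ (α_ _ _ _).inv ≫ ((C.X ⊗ a.O.X) ◁ f.hom ≫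
          (β_ C.X a.O.X).hom ▷ Y.flat.X) ≫ (α_ _ _ _).hom := by rw [w_i]; simp
    _ = (P.M.left ≫ C.X ◁ a.d ≫ (α_ _ _ _).inv ≫ (β_ C.X a.O.X).hom ▷ P.M.X ≫
          (α_ _ _ _).hom) ≫ a.O.X ◁ C.X ◁ f.hom := by rw [whisker_exchange]; simp
    _ = a.d ≫ a.O.X ◁ (P.M.left ≫ C.X ◁ f.hom) := by rw [left_d]; simp
    _ = (a.w hf ≫ a.i ▷ Y.flat.X) ≫ a.O.X ◁ Y.flat.left := by rw [← f.left_comm, w_i]; simp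
    _ = _ := by rw [Category.assoc, Category.assoc, whisker_exchange]

lemma w_comp (hf : P.IsMor Y.multi f) (b : Y ⟶ Y') (h : P.IsMor Y'.multi (f ≫ Cell.flatMap b)) :
    a.w h = a.w hf ≫ P.M.X ◁ (Cell.flatMap b).hom := by
  apply w_unique
  rw [Category.assoc, whisker_exchange, reassoc_of% a.w_i hf]; simp

end w

section conv
variable [HasCoreflexiveEqualizers V]
  [∀ X : V, Comonad.PreservesLimitOfIsCoreflexivePair (tensorLeft X)]
variable {Y Y' Y'' : Cell C D} {f : P.M ⟶ Y.flat} {g : P.M ⟶ Y'.flat} {h : P.M ⟶ Y''.flat}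

/-- The map underlying `conv`. -/
noncomputable def convMap (hg : P.IsMor Y'.multi g) (hf : P.IsMor Y.multi f) :
    P.M.X ⟶ (Cell.flat (comp Y' Y)).X :=
  flatFac Y' Y (a.w hf ≫ g.hom ▷ Y.flat.X)
    (by
      have n := BraidedCategory.braiding_naturality_right C.X g.hom
      have := g.left_comm
      calc _ = a.w hf ≫ (g.hom ≫ Y'.flat.left ≫ (β_ C.X Y'.flat.X).hom) ▷ Y.flat.X ≫
            (α_ _ _ _).hom := by simp
        _ = (a.w hf ≫ (P.M.left ≫ (β_ C.X P.M.X).hom) ▷ Y.flat.X ≫ (α_ _ _ _).hom) ≫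
            g.hom ▷ (C.X ⊗ Y.flat.X) := by
          rw [reassoc_of% this, n]; simp
        _ = _ := by rw [a.w_s, Category.assoc, Category.assoc, whisker_exchange])
    (by
      calc _ = a.w hf ≫ (g.hom ≫ Y'.flat.right) ▷ Y.flat.X ≫ (α_ _ _ _).hom := by simp
        _ = (a.w hf ≫ P.M.right ▷ Y.flat.X ≫ (α_ _ _ _).hom) ≫ g.hom ▷ (D.X ⊗ Y.flat.X) := by
          rw [g.right_comm]; simp
        _ = _ := by rw [a.w_t, Category.assoc, Category.assoc, whisker_exchange])

lemma convMap_inc (hg : P.IsMor Y'.multi g) (hf : P.IsMor Y.multi f) :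
    a.convMap hg hf ≫ flatInc Y' Y = a.w hf ≫ g.hom ▷ Y.flat.X := flatFac_inc ..

/-- The convolution of two maps out of `P`. -/
noncomputable def conv (hg : P.IsMor Y'.multi g) (hf : P.IsMor Y.multi f) :
    P.M ⟶ Cell.flat (comp Y' Y) where
  hom := a.convMap hg hf
  left_comm := by
    have n := BraidedCategory.braiding_inv_naturality_left g.hom C.X
    rw [← cancel_mono (C.X ◁ flatInc Y' Y)]
    calc _ = a.convMap hg hf ≫ (Cell.flat (comp Y' Y)).left ≫ C.X ◁ flatInc Y' Y := by simp
      _ = a.w hf ≫ (g.hom ▷ Y.flat.X ≫ Y'.flat.X ◁ Y.flat.left) ≫ (α_ _ _ _).inv ≫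
            (β_ C.X Y'.flat.X).inv ▷ Y.flat.X ≫ (α_ _ _ _).hom := by
        rw [flatInc_left, reassoc_of% a.convMap_inc hg hf]; simp
      _ = (a.w hf ≫ P.M.X ◁ Y.flat.left) ≫ (α_ _ _ _).inv ≫
            (g.hom ▷ C.X ≫ (β_ C.X Y'.flat.X).inv) ▷ Y.flat.X ≫ (α_ _ _ _).hom := by
        rw [← whisker_exchange]; monoidal
      _ = P.M.left ≫ C.X ◁ a.w hf ≫ (α_ _ _ _).inv ≫ ((β_ C.X P.M.X).hom ≫ (β_ C.X P.M.X).inv ≫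
            C.X ◁ g.hom) ▷ Y.flat.X ≫ (α_ _ _ _).hom := by
        rw [n, ← a.w_left]; simp
      _ = P.M.left ≫ C.X ◁ (a.convMap hg hf ≫ flatInc Y' Y) := by
        rw [convMap_inc, Iso.hom_inv_id_assoc]; simp
      _ = _ := by simp
  right_comm := by
    rw [← cancel_mono (flatInc Y' Y ▷ D.X)]
    calc _ = a.convMap hg hf ≫ (Cell.flat (comp Y' Y)).right ≫ flatInc Y' Y ▷ D.X := by simp
      _ = a.w hf ≫ (g.hom ▷ Y.flat.X ≫ Y'.flat.X ◁ Y.flat.right) ≫ (α_ _ _ _).inv := by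
        rw [flatInc_right, reassoc_of% a.convMap_inc hg hf]; simp
      _ = (a.w hf ≫ P.M.X ◁ Y.flat.right) ≫ g.hom ▷ (Y.flat.X ⊗ D.X) ≫ (α_ _ _ _).inv := by
        rw [← whisker_exchange]; simp
      _ = P.M.right ≫ (a.convMap hg hf ≫ flatInc Y' Y) ▷ D.X := by
        rw [← a.w_right, convMap_inc]; simp
      _ = _ := by simp

lemma conv_inc (hg : P.IsMor Y'.multi g) (hf : P.IsMor Y.multi f) :
    (a.conv hg hf).hom ≫ flatInc Y' Y = a.w hf ≫ g.hom ▷ Y.flat.X := a.convMap_inc hg hf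

lemma conv_act (hg : P.IsMor Y'.multi g) (hf : P.IsMor Y.multi f) {K : V} (κ : a.O.X ⟶ K) :
    (a.d ≫ κ ▷ P.M.X) ≫ K ◁ ((a.conv hg hf).hom ≫ flatInc Y' Y) =
      a.w hf ≫ ((a.d ≫ κ ▷ P.M.X) ≫ K ◁ g.hom) ▷ Y.flat.X ≫ (α_ _ _ _).hom := by
  calc _ = (a.d ≫ a.O.X ◁ a.w hf) ≫ κ ▷ _ ≫ K ◁ g.hom ▷ Y.flat.X := by
        rw [conv_inc, Category.assoc, Category.assoc, whisker_exchange_assoc]; simp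
    _ = _ := by rw [← w_d]; simp

lemma conv_cell (hg : P.IsMor Y'.multi g) (hf : P.IsMor Y.multi f) :
    P.IsMor (Cell.multi (comp Y' Y)) (a.conv hg hf) where
  s := by
    rw [Coact.Eqv, ← cancel_mono (C.X ◁ flatInc Y' Y)]
    refine (Category.assoc _ _ _).trans ?_
    rw [← whiskerLeft_comp, a.s_eq, conv_act, ← a.s_eq, show _ = _ from hg.s]
    calc _ = (a.w hf ≫ g.hom ▷ Y.flat.X) ≫ Y'.multi.s.act ▷ Y.flat.X ≫ (α_ _ _ _).hom := by simp
      _ = (a.conv hg hf).hom ≫ (Cell.multi (comp Y' Y)).s.act ≫ C.X ◁ flatInc Y' Y := by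
        rw [← conv_inc, Category.assoc, flatInc_s]
      _ = _ := (Category.assoc _ _ _).symm
  t := by
    rw [Coact.Eqv, ← cancel_mono (D.X ◁ flatInc Y' Y)]
    refine (Category.assoc _ _ _).trans ?_
    rw [← whiskerLeft_comp, a.t_eq, conv_act, ← a.t_eq, show _ = _ from hg.t]
    calc _ = (a.w hf ≫ g.hom ▷ Y.flat.X) ≫ Y'.multi.t.act ▷ Y.flat.X ≫ (α_ _ _ _).hom := by simp
      _ = (a.conv hg hf).hom ≫ (Cell.multi (comp Y' Y)).t.act ≫ D.X ◁ flatInc Y' Y := by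
        rw [← conv_inc, Category.assoc, flatInc_t]
      _ = _ := (Category.assoc _ _ _).symm
  pairs x hx := by
    obtain ⟨κ₁, κ₂, hr⟩ := a.pairs x hx
    have hb : x.l₁.act ≫ x.K ◁ g.hom = x.l₂.act ≫ x.K ◁ g.hom := by
      rcases hg.pairs x hx with ⟨_, hy, _⟩ | hb
      · exact hy.elim
      · exact hb
    right
    rw [CoactPair.Bal, ← cancel_mono (x.K ◁ flatInc Y' Y), Category.assoc, Category.assoc,
      ← whiskerLeft_comp, hr.l₁, hr.l₂, conv_act, conv_act, ← hr.l₁, ← hr.l₂, hb]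

lemma conv_comp (hg : P.IsMor Y'.multi g) (hf : P.IsMor Y.multi f) {Z Z' : Cell C D} (b' : Y' ⟶ Z')
    (b : Y ⟶ Z) (hg' : P.IsMor Z'.multi (g ≫ Cell.flatMap b'))
    (hf' : P.IsMor Z.multi (f ≫ Cell.flatMap b)) :
    a.conv hg' hf' = a.conv hg hf ≫ Cell.flatMap (compMap b' b) := by
  ext
  rw [← cancel_mono (flatInc Z' Z), conv_inc, w_comp a hf b hf', comp_hom (a.conv hg hf)]
  simp only [Category.assoc, comp_hom]
  rw [flatMap_compMap_inc, reassoc_of% a.conv_inc hg hf]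
  simp [whisker_exchange_assoc, whisker_exchange]

lemma conv_assoc (hh : P.IsMor Y''.multi h) (hg : P.IsMor Y'.multi g) (hf : P.IsMor Y.multi f) :
    a.conv hh (a.conv_cell hg hf) ≫ Cell.flatMap (assocInv Y'' Y' Y) =
      a.conv (a.conv_cell hh hg) hf := by
  have e : a.w (a.conv_cell hg hf) ≫ P.M.X ◁ flatInc Y' Y =
      a.w hf ≫ a.w hg ▷ Y.flat.X ≫ (α_ _ _ _).hom := by
    rw [← cancel_mono (a.i ▷ (Y'.flat.X ⊗ Y.flat.X))]
    calc _ = (a.w (a.conv_cell hg hf) ≫ a.i ▷ _) ≫ a.O.X ◁ flatInc Y' Y := by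
          rw [Category.assoc, Category.assoc, whisker_exchange]
      _ = (a.d ≫ a.O.X ◁ a.w hf) ≫ a.O.X ◁ g.hom ▷ Y.flat.X := by
          rw [w_i, Category.assoc, ← whiskerLeft_comp, a.conv_inc hg hf]; simp
      _ = a.w hf ≫ (a.d ≫ a.O.X ◁ g.hom) ▷ Y.flat.X ≫ (α_ _ _ _).hom := by rw [← w_d]; simp
      _ = _ := by rw [← a.w_i hg]; simp
  ext
  rw [← cancel_mono (flatInc (comp Y'' Y') Y), ← cancel_mono (flatInc Y'' Y' ▷ Y.flat.X)]
  calc _ = (a.conv hh (a.conv_cell hg hf)).hom ≫ (Cell.flatMap (assocInv Y'' Y' Y)).hom ≫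
        flatInc (comp Y'' Y') Y ≫ flatInc Y'' Y' ▷ Y.flat.X := by simp
    _ = (a.w (a.conv_cell hg hf) ≫ P.M.X ◁ flatInc Y' Y) ≫ h.hom ▷ _ ≫ (α_ _ _ _).inv := by
      rw [flatMap_assocInv_inc, reassoc_of% a.conv_inc hh, ← whisker_exchange_assoc]; simp
    _ = a.w hf ≫ (a.w hg ≫ h.hom ▷ Y'.flat.X) ▷ Y.flat.X := by rw [e]; simp
    _ = _ := by
      rw [← a.conv_inc hh hg, comp_whiskerRight, ← reassoc_of% a.conv_inc (a.conv_cell hh hg) hf]; simp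

end conv

section kap

lemma i_right : a.i ≫ a.κt = P.M.right ≫ a.e ▷ D.X ≫ (λ_ _).hom := by
  calc _ = a.i ≫ (a.O.comon.comul ≫ a.O.comon.counit ▷ a.O.X) ≫ (λ_ _).hom ≫ a.κt := by
        rw [a.O.comon.counit_comul]; simp
    _ = (a.i ≫ a.O.comon.comul ≫ a.O.X ◁ a.κt) ≫ a.O.comon.counit ▷ D.X ≫ (λ_ _).hom := by
      simp only [Category.assoc]; rw [← leftUnitor_naturality, whisker_exchange_assoc]
    _ = _ := by rw [← a.right_i]; simp [e]

lemma i_left : a.i ≫ a.κs = P.M.left ≫ C.X ◁ a.e ≫ (ρ_ _).hom := by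
  calc _ = a.i ≫ (a.O.comon.comul ≫ a.O.comon.counit ▷ a.O.X) ≫ (λ_ _).hom ≫ a.κs := by
        rw [a.O.comon.counit_comul]; simp
    _ = (a.i ≫ a.O.comon.comul ≫ a.O.X ◁ a.κs) ≫ a.O.comon.counit ▷ C.X ≫ (λ_ _).hom := by
      simp only [Category.assoc]; rw [← leftUnitor_naturality, whisker_exchange_assoc]
    _ = P.M.left ≫ ((β_ C.X P.M.X).hom ≫ a.e ▷ C.X) ≫ (λ_ _).hom := by
      rw [← a.left_i]; simp [e]
    _ = _ := by
      rw [← BraidedCategory.braiding_naturality_right, braiding_tensorUnit_right]; simp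

lemma act_e {K : V} (κ : a.O.X ⟶ K) : (a.d ≫ κ ▷ P.M.X) ≫ K ◁ a.e = a.i ≫ κ ≫ (ρ_ _).inv := by
  calc _ = (a.d ≫ a.O.X ◁ a.i) ≫ a.O.X ◁ a.O.comon.counit ≫ κ ▷ 𝟙_ V := by
        rw [Category.assoc, ← whisker_exchange]; simp [e]
    _ = _ := by
      have := a.O.comon.comul_counit
      rw [a.d_i, Category.assoc, reassoc_of% this]; simp

/-- The map underlying `kap`, before identification of the target. -/
def kap₀ : P.M.X ⟶ C.X ⊗ D.X := P.M.right ≫ (P.M.left ≫ C.X ◁ a.e ≫ (ρ_ _).hom) ▷ D.X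

lemma kap₀_eq : a.kap₀ = a.i ≫ a.O.comon.comul ≫ a.κs ▷ _ ≫ C.X ◁ a.κt := by
  rw [kap₀, ← i_left, comp_whiskerRight, reassoc_of% a.right_i, whisker_exchange]

lemma kap₀_right : a.kap₀ ≫ C.X ◁ D.comon.comul ≫ (α_ _ _ _).inv = P.M.right ≫ a.kap₀ ▷ D.X := by
  have := P.M.right_coassoc
  rw [kap₀, Category.assoc, ← whisker_exchange_assoc]
  simp only [comp_whiskerRight]
  rw [reassoc_of% this]
  simp

lemma kap₀_left : a.kap₀ ≫ C.comon.comul ▷ D.X ≫ (α_ _ _ _).hom = P.M.left ≫ C.X ◁ a.kap₀ := by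
  have h := P.M.left_coassoc
  have h' := P.M.left_right
  calc _ = P.M.right ≫ (P.M.left ≫ (C.X ◁ a.e ≫ (ρ_ _).hom) ≫ C.comon.comul) ▷ D.X ≫
        (α_ _ _ _).hom := by simp [kap₀]
    _ = P.M.right ≫ ((P.M.left ≫ C.comon.comul ▷ P.M.X ≫ (α_ _ _ _).hom) ≫ C.X ◁ C.X ◁ a.e ≫
          C.X ◁ (ρ_ _).hom) ▷ D.X ≫ (α_ _ _ _).hom := by
      congr 3
      simp only [Category.assoc]
      rw [← rightUnitor_naturality, whisker_exchange_assoc]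
      simp
    _ = (P.M.right ≫ P.M.left ▷ D.X ≫ (α_ _ _ _).hom) ≫ C.X ◁ (P.M.left ≫ C.X ◁ a.e ≫
          (ρ_ _).hom) ▷ D.X := by
      rw [← h]; simp
    _ = _ := by rw [← h', kap₀]; simp

lemma kap₀_act {K : V} (κ : a.O.X ⟶ K) (x : Coact K P.M) (hx : x.act = a.d ≫ κ ▷ P.M.X) :
    x.act ≫ K ◁ a.kap₀ = P.M.right ≫ (P.M.left ≫ C.X ◁ (a.i ≫ κ)) ▷ D.X ≫
      (β_ C.X K).hom ▷ D.X ≫ (α_ _ _ _).hom := by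
  have h := a.act_e κ
  rw [← hx] at h
  calc _ = (x.act ≫ K ◁ P.M.right) ≫ K ◁ (P.M.left ≫ C.X ◁ a.e ≫ (ρ_ _).hom) ▷ D.X := by
        rw [kap₀]; simp
    _ = P.M.right ≫ ((x.act ≫ K ◁ P.M.left) ≫ K ◁ (C.X ◁ a.e ≫ (ρ_ _).hom)) ▷ D.X ≫
          (α_ _ _ _).hom := by
      rw [x.comm_right]; simp
    _ = P.M.right ≫ (P.M.left ≫ C.X ◁ x.act ≫ (α_ _ _ _).inv ≫ ((β_ C.X K).hom ▷ P.M.X ≫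
          (K ⊗ C.X) ◁ a.e) ≫ (ρ_ _).hom) ▷ D.X ≫ (α_ _ _ _).hom := by
      rw [x.comm_left]; simp
    _ = P.M.right ≫ (P.M.left ≫ C.X ◁ (x.act ≫ K ◁ a.e ≫ (ρ_ _).hom) ≫ (β_ C.X K).hom) ▷ D.X ≫
          (α_ _ _ _).hom := by
      rw [← whisker_exchange]; simp
    _ = _ := by rw [reassoc_of% h, Iso.inv_hom_id, Category.comp_id]; monoidal

variable [HasCoreflexiveEqualizers V]
  [∀ X : V, Comonad.PreservesLimitOfIsCoreflexivePair (tensorLeft X)]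

/-- The map from `P` to the identity comodule given by the counit. -/
noncomputable def kap : P.M ⟶ Cell.flat (one (opTensor C D)) where
  hom := a.kap₀ ≫ oneCast C D
  left_comm := by
    rw [Category.assoc, oneCast_left, whiskerLeft_comp, ← reassoc_of% a.kap₀_left]
  right_comm := by
    rw [Category.assoc, oneCast_right, comp_whiskerRight, ← reassoc_of% a.kap₀_right]

lemma kap_hom : a.kap.hom = a.kap₀ ≫ oneCast C D := rfl

lemma kap_cell : P.IsMor (Cell.multi (one (opTensor C D))) a.kap where
  s := by
    have h := P.M.left_coassoc
    rw [Coact.Eqv, kap_hom, whiskerLeft_comp, reassoc_of% a.kap₀_act a.κs P.s a.s_eq]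
    refine Eq.trans ?_ (Category.assoc _ _ _).symm
    rw [oneCast_s, i_left]
    have h' : P.M.left ≫ C.X ◁ (P.M.left ≫ C.X ◁ a.e ≫ (ρ_ _).hom) =
        (P.M.left ≫ C.X ◁ a.e ≫ (ρ_ _).hom) ≫ C.comon.comul := by
      rw [whiskerLeft_comp, reassoc_of% h]
      simp only [Category.assoc]
      rw [← rightUnitor_naturality, whisker_exchange_assoc]
      simp
    rw [h', kap₀]
    simp
  t := by
    have h := P.M.right_coassoc
    have h₂ := P.M.left_right
    rw [Coact.Eqv, kap_hom, whiskerLeft_comp, reassoc_of% a.kap₀_act a.κt P.t a.t_eq]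
    refine Eq.trans ?_ (Category.assoc _ _ _).symm
    rw [oneCast_t, i_right, reassoc_of% a.kap₀_right]
    have h' : P.M.left ≫ C.X ◁ (P.M.right ≫ a.e ▷ D.X ≫ (λ_ _).hom) = a.kap₀ := by
      rw [whiskerLeft_comp, reassoc_of% h₂, kap₀]
      monoidal
    rw [h']
  pairs x hx := by
    right
    obtain ⟨κ₁, κ₂, hr⟩ := a.pairs x hx
    have e₀ : ∀ κ : a.O.X ⟶ x.K, a.i ≫ κ = (a.i ≫ a.O.comon.comul ≫ a.O.X ◁ κ) ≫
        a.O.comon.counit ▷ x.K ≫ (λ_ _).hom := fun κ => by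
      have := a.O.comon.counit_comul
      simp only [Category.assoc]
      rw [whisker_exchange_assoc, leftUnitor_naturality, reassoc_of% this]
      simp
    have e₁ : a.i ≫ κ₁ = a.i ≫ κ₂ := by rw [e₀ κ₁, e₀ κ₂, hr.eq]
    rw [CoactPair.Bal, kap_hom, whiskerLeft_comp, reassoc_of% a.kap₀_act κ₁ x.l₁ hr.l₁,
      reassoc_of% a.kap₀_act κ₂ x.l₂ hr.l₂, e₁]

variable {Y : Cell C D} {f : P.M ⟶ Y.flat}

lemma conv_kap_left (hf : P.IsMor Y.multi f) :
    a.conv a.kap_cell hf = f ≫ Cell.flatMap (unitL Y) := by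
  ext
  rw [← cancel_mono (flatInc (one (opTensor C D)) Y), conv_inc]
  have e : (f ≫ Cell.flatMap (unitL Y)).hom ≫ flatInc (one (opTensor C D)) Y =
      (f.hom ≫ Y.multi.s.act ≫ C.X ◁ Y.multi.t.act ≫ (α_ _ _ _).inv) ≫
        oneCast C D ▷ Y.flat.X := by
    have h₁ : (Cell.flatMap (unitL Y)).hom ≫ flatInc (one (opTensor C D)) Y = Y.left := unitL_inc Y
    refine (Category.assoc _ _ _).trans ((congrArg (f.hom ≫ ·) h₁).trans ?_)
    refine (congrArg (f.hom ≫ ·) (cell_left Y)).trans ?_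
    refine Eq.trans ?_ (congrArg (_ ≫ ·) (id_whiskerRight _ _).symm)
    exact (Category.comp_id _).symm
  rw [e, kap_hom, comp_whiskerRight, ← Category.assoc]
  congr 1
  calc _ = (a.w hf ≫ a.i ▷ Y.flat.X) ≫ (a.O.comon.comul ≫ a.κs ▷ _ ≫ C.X ◁ a.κt) ▷ Y.flat.X := by
        rw [kap₀_eq]; simp
    _ = (a.d ≫ a.O.comon.comul ▷ _ ≫ (α_ _ _ _).hom) ≫ a.κs ▷ _ ≫
          C.X ◁ (a.O.X ◁ f.hom ≫ a.κt ▷ _) ≫ (α_ _ _ _).inv := by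
      rw [w_i]
      simp only [Category.assoc, comp_whiskerRight]
      rw [whisker_exchange_assoc, whisker_exchange_assoc]
      monoidal
    _ = (a.d ≫ a.O.X ◁ ((a.d ≫ a.κt ▷ _) ≫ D.X ◁ f.hom) ≫ a.κs ▷ _) ≫ (α_ _ _ _).inv := by
      rw [← a.d_coassoc, Category.assoc, whisker_exchange_assoc, whisker_exchange a.κt]
      simp only [whiskerLeft_comp, Category.assoc]
      rw [whisker_exchange_assoc, whisker_exchange_assoc, whisker_exchange_assoc]
    _ = (a.d ≫ a.κs ▷ _ ≫ C.X ◁ f.hom) ≫ C.X ◁ Y.multi.t.act ≫ (α_ _ _ _).inv := by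
      rw [← a.t_eq, show _ = _ from hf.t, whisker_exchange]; simp
    _ = _ := by
      have := hf.s
      rw [Coact.Eqv, a.s_eq, Category.assoc] at this
      rw [this]; simp

lemma conv_kap_right (hf : P.IsMor Y.multi f) :
    a.conv hf a.kap_cell = f ≫ Cell.flatMap (unitR Y) := by
  ext
  rw [← cancel_mono (flatInc Y (one (opTensor C D))), conv_inc]
  have e : (f ≫ Cell.flatMap (unitR Y)).hom ≫ flatInc Y (one (opTensor C D)) =
      (f.hom ≫ Y.flat.right ≫ (Y.flat.left ≫ (β_ C.X Y.flat.X).hom) ▷ D.X ≫ (α_ _ _ _).hom) ≫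
        Y.flat.X ◁ oneCast C D := by
    have h₁ : (Cell.flatMap (unitR Y)).hom ≫ flatInc Y (one (opTensor C D)) = Y.right :=
      unitR_inc Y
    refine (Category.assoc _ _ _).trans ((congrArg (f.hom ≫ ·) h₁).trans ?_)
    rw [flat_left_braid]
    refine (congrArg (f.hom ≫ ·) (cell_right Y)).trans ?_
    refine Eq.trans ?_ (congrArg (_ ≫ ·) (whiskerLeft_id _ _).symm)
    exact (Category.comp_id _).symm
  have n := BraidedCategory.braiding_naturality_right C.X f.hom
  have e' : a.w a.kap_cell = (P.M.right ≫ (P.M.left ≫ (β_ C.X P.M.X).hom) ▷ D.X ≫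
      (α_ _ _ _).hom) ≫ P.M.X ◁ oneCast C D := by
    apply w_unique
    calc _ = P.M.right ≫ (P.M.left ≫ (β_ C.X P.M.X).hom ≫ a.i ▷ C.X) ▷ D.X ≫ (α_ _ _ _).hom ≫
          a.O.X ◁ oneCast C D := by
          rw [Category.assoc, whisker_exchange]; simp
      _ = (P.M.right ≫ a.i ▷ D.X) ≫ (a.O.comon.comul ≫ a.O.X ◁ a.κs) ▷ D.X ≫ (α_ _ _ _).hom ≫
          a.O.X ◁ oneCast C D := by
        rw [a.left_i]; simp
      _ = a.i ≫ (a.O.comon.comul ≫ a.O.comon.comul ▷ a.O.X ≫ (α_ _ _ _).hom) ≫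
            a.O.X ◁ (a.O.X ◁ a.κt ≫ a.κs ▷ _) ≫ a.O.X ◁ oneCast C D := by
        rw [a.right_i]
        simp only [Category.assoc, comp_whiskerRight]
        rw [whisker_exchange_assoc]
        monoidal
      _ = (a.i ≫ a.O.comon.comul) ≫ a.O.X ◁ (a.O.comon.comul ≫ a.κs ▷ _ ≫ C.X ◁ a.κt ≫
            oneCast C D) := by
        rw [← a.O.comon.comul_assoc, whisker_exchange]; simp
      _ = _ := by
        rw [← a.d_i, kap_hom, kap₀_eq]; simp
  rw [e, e', Category.assoc, whisker_exchange, ← Category.assoc]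
  congr 1
  have hl := f.left_comm
  have hr := f.right_comm
  calc _ = P.M.right ≫ (P.M.left ≫ ((β_ C.X P.M.X).hom ≫ f.hom ▷ C.X)) ▷ D.X ≫
        (α_ _ _ _).hom := by simp
    _ = _ := by
      rw [← n, ← reassoc_of% hl, reassoc_of% hr]; simp

end kap

end Amb

end QuantumModules

namespace QuantumModules
open Comodule

variable {V : Type u} [Category.{v} V] [MonoidalCategory V] [BraidedCategory V]

/-- The tensor product of comonoids. -/
def tensorComon (A B : Comon V) : Comon V where
  X := A.X ⊗ B.X
  comon :=
    { counit := (A.comon.counit ⊗ₘ B.comon.counit) ≫ (λ_ _).hom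
      comul := (A.comon.comul ⊗ₘ B.comon.comul) ≫ tensorμ A.X A.X B.X B.X
      counit_comul := by
        have h := ComonObj.counit_comul (A.X ⊗ B.X)
        rwa [Comon.tensorObj_comul] at h
      comul_counit := by
        have h := ComonObj.comul_counit (A.X ⊗ B.X)
        rwa [Comon.tensorObj_comul] at h
      comul_assoc := by
        have h := ComonObj.comul_assoc (A.X ⊗ B.X)
        rwa [Comon.tensorObj_comul] at h }

variable [HasCoreflexiveEqualizers V]
  [∀ X : V, Comonad.PreservesLimitOfIsCoreflexivePair (tensorLeft X)]

section base

namespace ComonadStr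
variable {D : Comon V} {M : Comodule D D} (k : ComonadStr M)

/-- The counit of a comonad as a map to `D`. -/
def κ : M.X ⟶ D.X := k.counit.hom

lemma Δ_κ_left : k.Δ ≫ k.κ ▷ M.X = M.left := by
  have h := congrArg (fun f => Hom.hom f ≫ oneInc M) k.counit_left
  rw [unitL_inc] at h
  refine Eq.trans ?_ h
  have e : (compMap k.counit (𝟙 M)).hom ≫ oneInc M = inc M M ≫ k.κ ▷ M.X :=
    (compMap_inc k.counit (𝟙 M)).trans (by rw [id_hom, whiskerLeft_id, Category.comp_id]; rfl)
  rw [comp_hom, Category.assoc, e, Δ, Category.assoc]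

lemma Δ_κ_right : k.Δ ≫ M.X ◁ k.κ = M.right := by
  have h := congrArg (fun f => Hom.hom f ≫ incOne M) k.counit_right
  rw [unitR_inc] at h
  refine Eq.trans ?_ h
  have e : (compMap (𝟙 M) k.counit).hom ≫ incOne M = inc M M ≫ M.X ◁ k.κ :=
    (compMap_inc (𝟙 M) k.counit).trans (by rw [id_hom, id_whiskerRight, Category.id_comp]; rfl)
  rw [comp_hom, Category.assoc, e, Δ, Category.assoc]

lemma ε_eq : k.ε = k.κ ≫ D.comon.counit := rfl

lemma Δ_assoc : k.Δ ≫ M.X ◁ k.Δ = k.Δ ≫ k.Δ ▷ M.X ≫ (α_ _ _ _).hom := by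
  have h := congrArg (fun f => Hom.hom f ≫ inc (comp M M) M ≫ inc M M ▷ M.X ≫ (α_ _ _ _).hom)
    k.coassoc
  have e₁ := compMap_inc (𝟙 M) k.comul
  have e₂ := compMap_inc k.comul (𝟙 M)
  have e₃ := assocInv_inc M M M
  simp only [comp_hom, Category.assoc] at h
  rw [reassoc_of% e₃, reassoc_of% e₁, reassoc_of% e₂] at h
  simpa [Δ] using h

/-- The comonoid carried by a comonad. -/
noncomputable def comon : Comon V where
  X := M.X
  comon :=
    { counit := k.ε
      comul := k.Δ
      counit_comul := by
        rw [ε_eq, comp_whiskerRight, reassoc_of% k.Δ_κ_left, M.left_counit]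
      comul_counit := by
        rw [ε_eq, whiskerLeft_comp, reassoc_of% k.Δ_κ_right, M.right_counit]
      comul_assoc := k.Δ_assoc }

end ComonadStr

/-- A comonad as a comonoid. -/
noncomputable def Cell.comon {C D : Comon V} (X : Cell C D) (k : ComonadStr X) : Comon V where
  X := X.flat.X
  comon := k.comon.comon

lemma Cell.comon_right {C D : Comon V} (X : Cell C D) (k : ComonadStr X) {A : V}
    (p : (opTensor C D).X ⟶ A) : k.Δ ≫ X.X ◁ (k.κ ≫ p) = X.right ≫ X.X ◁ p := by
  rw [whiskerLeft_comp, reassoc_of% k.Δ_κ_right]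

lemma Cell.comon_left {C D : Comon V} (X : Cell C D) (k : ComonadStr X) {A : V}
    (p : (opTensor C D).X ⟶ A) : k.Δ ≫ (k.κ ≫ p) ▷ X.X = X.left ≫ p ▷ X.X := by
  rw [comp_whiskerRight, reassoc_of% k.Δ_κ_left]

/-- A comonad embeds in itself. -/
noncomputable def Cell.amb {C D : Comon V} (X : Cell C D) (k : ComonadStr X) : Amb X.multi where
  O := X.comon k
  i := 𝟙 X.flat.X
  d := (X.comon k).comon.comul
  κs := k.κ ≫ p₁ C D
  κt := k.κ ≫ p₂ C D
  mono A Z := by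
    change Mono (A ◁ (𝟙 X.flat.X) ▷ Z)
    rw [id_whiskerRight, whiskerLeft_id]; infer_instance
  d_i := (congrArg (_ ≫ ·) (whiskerLeft_id _ _)).trans
    ((Category.comp_id _).trans (Category.id_comp _).symm)
  s_eq := (X.comon_left k (p₁ C D)).symm
  t_eq := (X.comon_left k (p₂ C D)).symm
  right_i := by
    refine Eq.trans ?_ (Category.id_comp _).symm
    refine Eq.trans ?_ (X.comon_right k (p₂ C D)).symm
    change _ ≫ (𝟙 X.flat.X) ▷ D.X = _
    rw [id_whiskerRight, Category.comp_id]; rfl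
  left_i := by
    refine Eq.trans ?_ (Category.id_comp _).symm
    refine Eq.trans ?_ (X.comon_right k (p₁ C D)).symm
    refine Eq.trans ?_ (flat_left_braid X)
    change _ ≫ _ ≫ (𝟙 X.flat.X) ▷ C.X = _
    rw [id_whiskerRight, Category.comp_id]
  pairs x hx := hx.elim
  lift {W A Z} z _ := ⟨z, (congrArg (fun g => z ≫ A ◁ g) (id_whiskerRight _ _)).trans
    ((congrArg (z ≫ ·) (whiskerLeft_id _ _)).trans (Category.comp_id _))⟩

end base

section tensorLift
variable {C D E : Comon V} {P R : Comodule C D} {Q S : Comodule D E} {N₁ N₂ : V}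
  (w₁ : P.X ⟶ N₁ ⊗ R.X) (w₂ : Q.X ⟶ N₂ ⊗ S.X)

/-- Tensor product of maps `w₁` and `w₂` commuting with the coactions of the middle comonoid. -/
noncomputable def tensorLift
    (h₁ : P.right ≫ w₁ ▷ D.X ≫ (α_ _ _ _).hom = w₁ ≫ N₁ ◁ R.right)
    (h₂ : Q.left ≫ D.X ◁ w₂ ≫ (α_ _ _ _).inv ≫ (β_ D.X N₂).hom ▷ S.X ≫ (α_ _ _ _).hom =
      w₂ ≫ N₂ ◁ S.left) : (comp P Q).X ⟶ (N₁ ⊗ N₂) ⊗ (comp R S).X :=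
  facL (N₁ ⊗ N₂) R S (inc P Q ≫ (w₁ ⊗ₘ w₂) ≫ tensorμ N₁ R.X N₂ S.X) (by
    have n := BraidedCategory.braiding_naturality_left R.right N₂
    calc _ = inc P Q ≫ w₁ ▷ Q.X ≫ (N₁ ⊗ R.X) ◁ w₂ ⊗≫
            N₁ ◁ ((β_ R.X N₂).hom ≫ N₂ ◁ R.right) ▷ S.X ⊗≫ 𝟙 _ := by
          rw [MonoidalCategory.tensorHom_def]; simp only [tensorμ]; monoidal
      _ = inc P Q ≫ w₁ ▷ Q.X ⊗≫ N₁ ◁ (R.X ◁ w₂ ≫ R.right ▷ (N₂ ⊗ S.X)) ⊗≫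
            N₁ ◁ (β_ (R.X ⊗ D.X) N₂).hom ▷ S.X ⊗≫ 𝟙 _ := by
          rw [← n]; monoidal
      _ = inc P Q ≫ (w₁ ≫ N₁ ◁ R.right) ▷ Q.X ⊗≫ N₁ ◁ (R.X ⊗ D.X) ◁ w₂ ⊗≫
            N₁ ◁ (β_ (R.X ⊗ D.X) N₂).hom ▷ S.X ⊗≫ 𝟙 _ := by
          rw [whisker_exchange]; monoidal
      _ = (inc P Q ≫ P.right ▷ Q.X ≫ (α_ _ _ _).hom) ≫ w₁ ▷ (D.X ⊗ Q.X) ⊗≫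
            N₁ ◁ (R.X ⊗ D.X) ◁ w₂ ⊗≫
            N₁ ◁ (β_ (R.X ⊗ D.X) N₂).hom ▷ S.X ⊗≫ 𝟙 _ := by
          rw [← h₁]; monoidal
      _ = inc P Q ≫ (P.X ◁ Q.left ≫ w₁ ▷ (D.X ⊗ Q.X)) ⊗≫
            N₁ ◁ R.X ◁ (D.X ◁ w₂ ≫ (α_ _ _ _).inv ≫ (β_ D.X N₂).hom ▷ S.X ≫ (α_ _ _ _).hom) ⊗≫
            N₁ ◁ (β_ R.X N₂).hom ▷ (D.X ⊗ S.X) ⊗≫ 𝟙 _ := by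
          rw [inc_cond, BraidedCategory.braiding_tensor_left_hom]; monoidal
      _ = inc P Q ≫ w₁ ▷ Q.X ⊗≫ N₁ ◁ R.X ◁ (Q.left ≫ D.X ◁ w₂ ≫ (α_ _ _ _).inv ≫
            (β_ D.X N₂).hom ▷ S.X ≫ (α_ _ _ _).hom) ⊗≫
            N₁ ◁ (β_ R.X N₂).hom ▷ (D.X ⊗ S.X) ⊗≫ 𝟙 _ := by
          rw [whisker_exchange]; monoidal
      _ = inc P Q ≫ w₁ ▷ Q.X ⊗≫ N₁ ◁ R.X ◁ w₂ ⊗≫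
            N₁ ◁ ((R.X ⊗ N₂) ◁ S.left ≫ (β_ R.X N₂).hom ▷ (D.X ⊗ S.X)) ⊗≫ 𝟙 _ := by
          rw [h₂]; monoidal
      _ = _ := by
          rw [whisker_exchange, MonoidalCategory.tensorHom_def]; simp only [tensorμ]; monoidal)

lemma tensorLift_inc (h₁ h₂) : tensorLift w₁ w₂ h₁ h₂ ≫ (N₁ ⊗ N₂) ◁ inc R S =
    inc P Q ≫ (w₁ ⊗ₘ w₂) ≫ tensorμ N₁ R.X N₂ S.X := facL_inc ..

end tensorLift

/-- Factor a map through `A ⊗ (M ⊗_D N) ⊗ Z`. -/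
lemma exists_facLR {C D E : Comon V} (M : Comodule C D) (N : Comodule D E) {W A Z : V}
    (t : W ⟶ A ⊗ ((M.X ⊗ N.X) ⊗ Z))
    (h : t ≫ A ◁ (M.right ▷ N.X ≫ (α_ _ _ _).hom) ▷ Z = t ≫ A ◁ (M.X ◁ N.left) ▷ Z) :
    ∃ t' : W ⟶ A ⊗ ((comp M N).X ⊗ Z), t' ≫ A ◁ inc M N ▷ Z = t := by
  have n : ∀ {X X' : V} (f : X ⟶ X'), A ◁ f ▷ Z ≫ A ◁ (β_ X' Z).hom ≫ (α_ _ _ _).inv =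
      (A ◁ (β_ X Z).hom ≫ (α_ _ _ _).inv) ≫ (A ⊗ Z) ◁ f := fun f => by
    have := BraidedCategory.braiding_naturality_left f Z
    rw [← whiskerLeft_comp_assoc, this]; simp
  have n' : ∀ {X X' : V} (f : X ⟶ X'), ((α_ A Z X).hom ≫ A ◁ (β_ X Z).inv) ≫ A ◁ f ▷ Z =
      (A ⊗ Z) ◁ f ≫ (α_ _ _ _).hom ≫ A ◁ (β_ X' Z).inv := fun f => by
    have := BraidedCategory.braiding_inv_naturality_right Z f
    rw [Category.assoc, ← whiskerLeft_comp, ← this]; monoidal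
  let s := facL (A ⊗ Z) M N (t ≫ A ◁ (β_ _ _).hom ≫ (α_ _ _ _).inv) (by
    rw [Category.assoc, ← n, Category.assoc, ← n, reassoc_of% h])
  have hs : s ≫ (A ⊗ Z) ◁ inc M N = t ≫ A ◁ (β_ _ _).hom ≫ (α_ _ _ _).inv := facL_inc ..
  refine ⟨s ≫ (α_ _ _ _).hom ≫ A ◁ (β_ _ _).inv, ?_⟩
  rw [Category.assoc, n', reassoc_of% hs, Iso.inv_hom_id_assoc, ← whiskerLeft_comp, Iso.hom_inv_id,
    whiskerLeft_id, Category.comp_id]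

lemma tensorμ_comp {A B N₁ N₂ R S N₁' N₂' R' S' : V} (w₁ : A ⟶ N₁ ⊗ R) (w₂ : B ⟶ N₂ ⊗ S)
    (f : N₁ ⟶ N₁') (g : N₂ ⟶ N₂') (h : R ⟶ R') (k : S ⟶ S') :
    ((w₁ ⊗ₘ w₂) ≫ tensorμ N₁ R N₂ S) ≫ ((f ⊗ₘ g) ⊗ₘ (h ⊗ₘ k)) =
      ((w₁ ≫ (f ⊗ₘ h)) ⊗ₘ (w₂ ≫ (g ⊗ₘ k))) ≫ tensorμ N₁' R' N₂' S' := by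
  rw [Category.assoc, ← tensorμ_natural, tensorHom_comp_tensorHom_assoc]

namespace Amb
variable {C D E : Comon V} {P : Multi C D} {Q : Multi D E} (a : Amb P) (b : Amb Q)

lemma d_counit : a.d ≫ a.O.comon.counit ▷ P.M.X = (λ_ _).inv := by
  have := a.O.comon.counit_comul
  rw [← cancel_mono (𝟙_ V ◁ a.i), Category.assoc, ← whisker_exchange, reassoc_of% a.d_i, this]
  simp

/-- The embedding of `P ⊗_D Q`. -/
noncomputable def tensorI : (comp P.M Q.M).X ⟶ a.O.X ⊗ b.O.X :=
  inc P.M Q.M ≫ a.i ▷ Q.M.X ≫ a.O.X ◁ b.i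

/-- The comultiplication of the tensor product. -/
def tensorΔ : a.O.X ⊗ b.O.X ⟶ (a.O.X ⊗ b.O.X) ⊗ (a.O.X ⊗ b.O.X) :=
  (a.O.comon.comul ⊗ₘ b.O.comon.comul) ≫ tensorμ a.O.X a.O.X b.O.X b.O.X

/-- The coaction of the tensor product on `P ⊗_D Q`. -/
noncomputable def tensorD : (comp P.M Q.M).X ⟶ (a.O.X ⊗ b.O.X) ⊗ (comp P.M Q.M).X :=
  tensorLift a.d b.d a.right_d b.left_d

lemma tensorD_inc : a.tensorD b ≫ (a.O.X ⊗ b.O.X) ◁ inc P.M Q.M =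
    inc P.M Q.M ≫ (a.d ⊗ₘ b.d) ≫ tensorμ a.O.X P.M.X b.O.X Q.M.X := tensorLift_inc ..

lemma tensorD_tensorI : a.tensorD b ≫ (a.O.X ⊗ b.O.X) ◁ a.tensorI b =
    a.tensorI b ≫ a.tensorΔ b := by
  have h := tensorμ_comp a.d b.d (𝟙 _) (𝟙 _) a.i b.i
  rw [id_tensorHom_id, id_tensorHom, id_tensorHom, id_tensorHom, a.d_i, b.d_i,
    Category.assoc] at h
  rw [tensorI, ← MonoidalCategory.tensorHom_def, whiskerLeft_comp, reassoc_of% a.tensorD_inc b, h,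
    Category.assoc, tensorΔ, tensorHom_comp_tensorHom_assoc]

/-- A map out of the first factor. -/
def kL {K : V} (κ : a.O.X ⟶ K) : a.O.X ⊗ b.O.X ⟶ K :=
  (a.O.X ◁ b.O.comon.counit ≫ (ρ_ _).hom) ≫ κ

/-- A map out of the second factor. -/
def kR {K : V} (κ : b.O.X ⟶ K) : a.O.X ⊗ b.O.X ⟶ K :=
  (a.O.comon.counit ▷ b.O.X ≫ (λ_ _).hom) ≫ κ

lemma tensorΔ_kL {K : V} (κ : a.O.X ⟶ K) : a.tensorΔ b ≫ (a.O.X ⊗ b.O.X) ◁ a.kL b κ =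
    (a.O.comon.comul ≫ a.O.X ◁ κ) ▷ b.O.X ≫ (α_ _ _ _).hom ≫ a.O.X ◁ (β_ K b.O.X).hom ≫
      (α_ _ _ _).inv := by
  have h := tensorμ_proj_right₁ a.O.comon.comul b.O.comon.comul _ b.O.comon.comul_counit
  have n := BraidedCategory.braiding_naturality_left κ b.O.X
  rw [kL, whiskerLeft_comp, tensorΔ, Category.assoc, reassoc_of% h]
  calc _ = a.O.comon.comul ▷ _ ≫ (α_ _ _ _).hom ≫ a.O.X ◁ ((β_ a.O.X b.O.X).hom ≫ b.O.X ◁ κ) ≫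
        (α_ _ _ _).inv := by monoidal
    _ = _ := by rw [← n]; monoidal

lemma tensorΔ_kR {K : V} (κ : b.O.X ⟶ K) : a.tensorΔ b ≫ (a.O.X ⊗ b.O.X) ◁ a.kR b κ =
    a.O.X ◁ (b.O.comon.comul ≫ b.O.X ◁ κ) ≫ (α_ _ _ _).inv := by
  have h := tensorμ_proj_right₂ a.O.comon.comul b.O.comon.comul _ a.O.comon.comul_counit
  rw [kR, whiskerLeft_comp, tensorΔ, Category.assoc, reassoc_of% h]
  simp

lemma tensorD_kL {K : V} (κ : a.O.X ⟶ K) (x : Coact K P.M) (hx : x.act = a.d ≫ κ ▷ P.M.X) :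
    (x.compL Q.M).act = a.tensorD b ≫ a.kL b κ ▷ (comp P.M Q.M).X := by
  have h := tensorμ_proj_left₁ a.d b.d _ b.d_counit
  rw [← cancel_mono (K ◁ inc P.M Q.M), Coact.compL_inc, Category.assoc, ← whisker_exchange,
    reassoc_of% a.tensorD_inc b, kL, comp_whiskerRight, reassoc_of% h, hx]
  simp

lemma tensorD_kR {K : V} (κ : b.O.X ⟶ K) (x : Coact K Q.M) (hx : x.act = b.d ≫ κ ▷ Q.M.X) :
    (x.compR P.M).act = a.tensorD b ≫ a.kR b κ ▷ (comp P.M Q.M).X := by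
  have h := tensorμ_proj_left₂ a.d b.d _ a.d_counit
  have n := BraidedCategory.braiding_naturality_right P.M.X κ
  rw [← cancel_mono (K ◁ inc P.M Q.M), Coact.compR_inc, Category.assoc, ← whisker_exchange,
    reassoc_of% a.tensorD_inc b, kR, comp_whiskerRight, reassoc_of% h, hx]
  calc _ = inc P.M Q.M ≫ P.M.X ◁ b.d ≫ (α_ _ _ _).inv ≫ (P.M.X ◁ κ ≫ (β_ P.M.X K).hom) ▷ Q.M.X ≫
        (α_ _ _ _).hom := by monoidal
    _ = _ := by rw [n]; monoidal

lemma tensor_right_i : (comp P.M Q.M).right ≫ a.tensorI b ▷ E.X =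
    a.tensorI b ≫ a.tensorΔ b ≫ (a.O.X ⊗ b.O.X) ◁ a.kR b b.κt := by
  have h := comp_right_inc P.M Q.M
  rw [tensorΔ_kR, tensorI, comp_whiskerRight, reassoc_of% h]
  calc _ = inc P.M Q.M ≫ (P.M.X ◁ Q.M.right ≫ a.i ▷ (Q.M.X ⊗ E.X)) ≫ a.O.X ◁ b.i ▷ E.X ≫
        (α_ _ _ _).inv := by monoidal
    _ = inc P.M Q.M ≫ a.i ▷ Q.M.X ≫ a.O.X ◁ (Q.M.right ≫ b.i ▷ E.X) ≫ (α_ _ _ _).inv := by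
      rw [whisker_exchange]; monoidal
    _ = _ := by rw [b.right_i]; simp

lemma tensor_left_i : (comp P.M Q.M).left ≫ (β_ C.X (comp P.M Q.M).X).hom ≫ a.tensorI b ▷ C.X =
    a.tensorI b ≫ a.tensorΔ b ≫ (a.O.X ⊗ b.O.X) ◁ a.kL b a.κs := by
  have h := comp_left_inc P.M Q.M
  have n := BraidedCategory.braiding_naturality_right C.X (inc P.M Q.M)
  have n' := BraidedCategory.braiding_naturality_right C.X b.i
  rw [tensorΔ_kL, tensorI, comp_whiskerRight, ← reassoc_of% n, reassoc_of% h]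
  calc _ = inc P.M Q.M ≫ (P.M.left ≫ (β_ C.X P.M.X).hom) ▷ Q.M.X ≫ (α_ _ _ _).hom ≫
        (P.M.X ◁ (β_ C.X Q.M.X).hom ≫ a.i ▷ _) ≫ a.O.X ◁ b.i ▷ C.X ≫ (α_ _ _ _).inv := by
        rw [BraidedCategory.braiding_tensor_right_hom]; monoidal
    _ = inc P.M Q.M ≫ (P.M.left ≫ (β_ C.X P.M.X).hom ≫ a.i ▷ C.X) ▷ Q.M.X ≫ (α_ _ _ _).hom ≫
          a.O.X ◁ ((β_ C.X Q.M.X).hom ≫ b.i ▷ C.X) ≫ (α_ _ _ _).inv := by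
      rw [whisker_exchange]; monoidal
    _ = inc P.M Q.M ≫ a.i ▷ Q.M.X ≫ ((a.O.comon.comul ≫ a.O.X ◁ a.κs) ▷ Q.M.X ≫
          (a.O.X ⊗ C.X) ◁ b.i) ≫ (α_ _ _ _).hom ≫ a.O.X ◁ (β_ C.X b.O.X).hom ≫
          (α_ _ _ _).inv := by
      rw [← n', a.left_i]; monoidal
    _ = _ := by rw [← whisker_exchange]; simp

lemma tensorI_kL {K : V} (κ : a.O.X ⟶ K) : a.tensorI b ≫ a.tensorΔ b ≫ (a.O.X ⊗ b.O.X) ◁ a.kL b κ =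
    inc P.M Q.M ≫ (a.i ≫ a.O.comon.comul ≫ a.O.X ◁ κ) ▷ Q.M.X ≫ (α_ _ _ _).hom ≫
      a.O.X ◁ (K ◁ b.i ≫ (β_ K b.O.X).hom) ≫ (α_ _ _ _).inv := by
  rw [tensorΔ_kL, tensorI, Category.assoc, Category.assoc, whisker_exchange_assoc]
  monoidal

lemma tensorI_kR {K : V} (κ : b.O.X ⟶ K) : a.tensorI b ≫ a.tensorΔ b ≫ (a.O.X ⊗ b.O.X) ◁ a.kR b κ =
    inc P.M Q.M ≫ a.i ▷ Q.M.X ≫ a.O.X ◁ (b.i ≫ b.O.comon.comul ≫ b.O.X ◁ κ) ≫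
      (α_ _ _ _).inv := by
  rw [tensorΔ_kR, tensorI]; simp

lemma tensor_mid : a.tensorI b ≫ a.tensorΔ b ≫ (a.O.X ⊗ b.O.X) ◁ a.kL b a.κt =
    a.tensorI b ≫ a.tensorΔ b ≫ (a.O.X ⊗ b.O.X) ◁ a.kR b b.κs := by
  have n := BraidedCategory.braiding_naturality_right D.X b.i
  rw [tensorI_kL, tensorI_kR, ← a.right_i, ← b.left_i, n]
  calc _ = (inc P.M Q.M ≫ P.M.right ▷ Q.M.X ≫ (α_ _ _ _).hom) ≫ a.i ▷ _ ≫ a.O.X ◁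
        ((β_ D.X Q.M.X).hom ≫ b.i ▷ D.X) ≫ (α_ _ _ _).inv := by monoidal
    _ = _ := by rw [inc_cond, Category.assoc, whisker_exchange_assoc]; simp

lemma RepPair.compL {x : CoactPair P.M} {κ₁ κ₂ : a.O.X ⟶ x.K} (h : RepPair a.O a.i a.d x κ₁ κ₂) :
    RepPair (tensorComon a.O b.O) (a.tensorI b) (a.tensorD b) (x.compL Q.M) (a.kL b κ₁)
      (a.kL b κ₂) where
  l₁ := a.tensorD_kL b κ₁ x.l₁ h.l₁
  l₂ := a.tensorD_kL b κ₂ x.l₂ h.l₂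
  eq := by
    refine (a.tensorI_kL b κ₁).trans (Eq.trans ?_ (a.tensorI_kL b κ₂).symm)
    rw [h.eq]

lemma RepPair.compR {x : CoactPair Q.M} {κ₁ κ₂ : b.O.X ⟶ x.K} (h : RepPair b.O b.i b.d x κ₁ κ₂) :
    RepPair (tensorComon a.O b.O) (a.tensorI b) (a.tensorD b) (x.compR P.M) (a.kR b κ₁)
      (a.kR b κ₂) where
  l₁ := a.tensorD_kR b κ₁ x.l₁ h.l₁
  l₂ := a.tensorD_kR b κ₂ x.l₂ h.l₂
  eq := by
    refine (a.tensorI_kR b κ₁).trans (Eq.trans ?_ (a.tensorI_kR b κ₂).symm)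
    rw [h.eq]

lemma RepPair.mid : RepPair (tensorComon a.O b.O) (a.tensorI b) (a.tensorD b)
    ⟨D.X, P.t.compL Q.M, Q.s.compR P.M⟩ (a.kL b a.κt) (a.kR b b.κs) where
  l₁ := a.tensorD_kL b a.κt P.t a.t_eq
  l₂ := a.tensorD_kR b b.κs Q.s b.s_eq
  eq := a.tensor_mid b

lemma tensor_lift {W A Z : V} (z : W ⟶ A ⊗ ((a.O.X ⊗ b.O.X) ⊗ Z))
    (h : ∀ x ∈ (P.tensor Q).pairs, ∀ κ₁ κ₂,
      RepPair (tensorComon a.O b.O) (a.tensorI b) (a.tensorD b) x κ₁ κ₂ →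
        z ≫ A ◁ (a.tensorΔ b ≫ (a.O.X ⊗ b.O.X) ◁ κ₁) ▷ Z =
          z ≫ A ◁ (a.tensorΔ b ≫ (a.O.X ⊗ b.O.X) ◁ κ₂) ▷ Z) :
    ∃ z' : W ⟶ A ⊗ ((comp P.M Q.M).X ⊗ Z), z' ≫ A ◁ a.tensorI b ▷ Z = z := by
  obtain ⟨z₁, hz₁⟩ := a.lift (z ≫ A ◁ (α_ a.O.X b.O.X Z).hom) (fun x hx κ₁ κ₂ hr => by
    have e : ∀ κ : a.O.X ⟶ x.K, (z ≫ A ◁ (α_ a.O.X b.O.X Z).hom) ≫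
        A ◁ (a.O.comon.comul ≫ a.O.X ◁ κ) ▷ (b.O.X ⊗ Z) =
        (z ≫ A ◁ (a.tensorΔ b ≫ (a.O.X ⊗ b.O.X) ◁ a.kL b κ) ▷ Z) ≫ A ◁ ((α_ _ _ _).hom ≫
          a.O.X ◁ (β_ x.K b.O.X).inv ≫ (α_ _ _ _).inv) ▷ Z ≫ A ◁ (α_ _ _ _).hom := fun κ => by
      have e₁ : ((α_ a.O.X x.K b.O.X).hom ≫ a.O.X ◁ (β_ x.K b.O.X).hom ≫ (α_ _ _ _).inv) ≫
          ((α_ _ _ _).hom ≫ a.O.X ◁ (β_ x.K b.O.X).inv ≫ (α_ _ _ _).inv) = 𝟙 _ := by simp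
      calc _ = z ≫ A ◁ ((a.O.comon.comul ≫ a.O.X ◁ κ) ▷ b.O.X ≫
            (((α_ a.O.X x.K b.O.X).hom ≫ a.O.X ◁ (β_ x.K b.O.X).hom ≫ (α_ _ _ _).inv) ≫
          ((α_ _ _ _).hom ≫ a.O.X ◁ (β_ x.K b.O.X).inv ≫ (α_ _ _ _).inv))) ▷ Z ≫
            A ◁ (α_ _ _ _).hom := by rw [e₁]; monoidal
        _ = _ := by rw [tensorΔ_kL]; simp only [Category.assoc, whiskerLeft_comp, comp_whiskerRight]
    rw [e, e, h _ (.inl ⟨x, hx, rfl⟩) _ _ (RepPair.compL a b hr)])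
  have hz : z = z₁ ≫ A ◁ a.i ▷ (b.O.X ⊗ Z) ≫ A ◁ (α_ a.O.X b.O.X Z).inv := by
    rw [reassoc_of% hz₁, ← whiskerLeft_comp, Iso.hom_inv_id, whiskerLeft_id, Category.comp_id]
  have hzm : z₁ ≫ A ◁ a.i ▷ (b.O.X ⊗ Z) = z₁ ≫ (α_ _ _ _).inv ≫ (A ◁ a.i) ▷ (b.O.X ⊗ Z) ≫
      (α_ _ _ _).hom := by simp
  obtain ⟨z₂, hz₂⟩ := b.lift (A := A ⊗ P.M.X) (z₁ ≫ (α_ _ _ _).inv) (fun x hx κ₁ κ₂ hr => by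
    have e : ∀ κ : b.O.X ⟶ x.K, (z₁ ≫ (α_ _ _ _).inv) ≫
        (A ⊗ P.M.X) ◁ (b.O.comon.comul ≫ b.O.X ◁ κ) ▷ Z ≫ (A ◁ a.i) ▷ _ =
        (z ≫ A ◁ (a.tensorΔ b ≫ (a.O.X ⊗ b.O.X) ◁ a.kR b κ) ▷ Z) ≫ A ◁ (α_ _ _ _).hom ▷ Z ≫
          A ◁ (α_ _ _ _).hom ≫ (α_ _ _ _).inv := fun κ =>
      calc _ = (z₁ ≫ A ◁ a.i ▷ (b.O.X ⊗ Z) ≫ A ◁ (α_ a.O.X b.O.X Z).inv) ≫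
            A ◁ (a.O.X ◁ (b.O.comon.comul ≫ b.O.X ◁ κ)) ▷ Z ≫
            A ◁ (α_ _ _ _).hom ≫ (α_ _ _ _).inv := by
            rw [whisker_exchange]; monoidal
        _ = _ := by rw [← hz, tensorΔ_kR]; monoidal
    have mi : Mono ((A ◁ a.i) ▷ ((b.O.X ⊗ x.K) ⊗ Z)) := by
      have : (A ◁ a.i) ▷ ((b.O.X ⊗ x.K) ⊗ Z) = (α_ _ _ _).hom ≫ A ◁ a.i ▷ ((b.O.X ⊗ x.K) ⊗ Z) ≫
        (α_ _ _ _).inv := by simp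
      rw [this]; infer_instance
    rw [← cancel_mono ((A ◁ a.i) ▷ ((b.O.X ⊗ x.K) ⊗ Z))]
    refine (Category.assoc _ _ _).trans ((e κ₁).trans (Eq.trans ?_ ((Category.assoc _ _ _).trans
      (e κ₂)).symm))
    rw [h _ (.inr (.inr ⟨x, hx, rfl⟩)) _ _ (RepPair.compR a b hr)])
  have hz' : z = z₂ ≫ (α_ _ _ _).hom ≫ A ◁ (α_ _ _ _).inv ≫ A ◁ (a.i ▷ Q.M.X ≫ a.O.X ◁ b.i) ▷ Z := by
    rw [hz]
    calc _ = (z₁ ≫ (α_ _ _ _).inv) ≫ (α_ _ _ _).hom ≫ A ◁ (α_ _ _ _).inv ≫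
          A ◁ (a.i ▷ b.O.X) ▷ Z := by monoidal
      _ = z₂ ≫ (α_ _ _ _).hom ≫ A ◁ (α_ _ _ _).inv ≫ A ◁ (P.M.X ◁ b.i ≫ a.i ▷ b.O.X) ▷ Z := by
        rw [← hz₂]; monoidal
      _ = _ := by rw [whisker_exchange]
  have m₂ : Mono (A ◁ ((a.i ▷ (D.X ⊗ Q.M.X) ≫ a.O.X ◁ D.X ◁ b.i) ▷ Z)) := by
    have m₁ : Mono (A ◁ a.i ▷ ((D.X ⊗ Q.M.X) ⊗ Z)) := inferInstance
    have m₂ : Mono ((((A ⊗ a.O.X) ⊗ D.X) ◁ b.i ▷ Z)) := inferInstance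
    have : A ◁ ((a.i ▷ (D.X ⊗ Q.M.X) ≫ a.O.X ◁ D.X ◁ b.i) ▷ Z) =
        (A ◁ (α_ _ _ _).hom ≫ A ◁ a.i ▷ ((D.X ⊗ Q.M.X) ⊗ Z) ≫ A ◁ (α_ _ _ _).inv) ≫
        (𝟙 _ ⊗≫ (((A ⊗ a.O.X) ⊗ D.X) ◁ b.i ▷ Z) ⊗≫ 𝟙 _) := by monoidal
    have m₃ : Mono (𝟙 (A ⊗ (a.O.X ⊗ D.X ⊗ Q.M.X) ⊗ Z) ⊗≫ ((A ⊗ a.O.X) ⊗ D.X) ◁ b.i ▷ Z ⊗≫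
        𝟙 (A ⊗ (a.O.X ⊗ D.X ⊗ b.O.X) ⊗ Z)) := by
      dsimp only [monoidalComp]
      infer_instance
    rw [this]
    apply mono_comp
  obtain ⟨z₃, hz₃⟩ := exists_facLR P.M Q.M (A := A) (Z := Z)
    (z₂ ≫ (α_ _ _ _).hom ≫ A ◁ (α_ _ _ _).inv) (by
      rw [← cancel_mono (A ◁ ((a.i ▷ (D.X ⊗ Q.M.X) ≫ a.O.X ◁ D.X ◁ b.i) ▷ Z))]
      have hm := h _ (.inr (.inl rfl)) _ _ (RepPair.mid a b)
      change z ≫ A ◁ (a.tensorΔ b ≫ (a.O.X ⊗ b.O.X) ◁ a.kL b a.κt) ▷ Z =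
        z ≫ A ◁ (a.tensorΔ b ≫ (a.O.X ⊗ b.O.X) ◁ a.kR b b.κs) ▷ Z at hm
      have n := BraidedCategory.braiding_naturality_right D.X b.i
      have e₁ : (z₂ ≫ (α_ _ _ _).hom ≫ A ◁ (α_ _ _ _).inv) ≫
          A ◁ (P.M.right ▷ Q.M.X ≫ (α_ _ _ _).hom) ▷ Z ≫
          A ◁ ((a.i ▷ (D.X ⊗ Q.M.X) ≫ a.O.X ◁ D.X ◁ b.i) ▷ Z) =
        (z ≫ A ◁ (a.tensorΔ b ≫ (a.O.X ⊗ b.O.X) ◁ a.kL b a.κt) ▷ Z) ≫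
          A ◁ ((α_ _ _ _).hom ≫ a.O.X ◁ (β_ D.X b.O.X).inv) ▷ Z := by
        calc _ = (z₂ ≫ (α_ _ _ _).hom ≫ A ◁ (α_ _ _ _).inv) ≫
            A ◁ ((P.M.right ≫ a.i ▷ D.X) ▷ Q.M.X ≫ (a.O.X ⊗ D.X) ◁ b.i ≫ (α_ _ _ _).hom) ▷ Z := by
              monoidal
          _ = (z₂ ≫ (α_ _ _ _).hom ≫ A ◁ (α_ _ _ _).inv ≫
              A ◁ (a.i ▷ Q.M.X ≫ a.O.X ◁ b.i) ▷ Z) ≫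
              A ◁ ((a.O.comon.comul ≫ a.O.X ◁ a.κt) ▷ b.O.X ≫ (α_ _ _ _).hom ≫
                a.O.X ◁ 𝟙 (D.X ⊗ b.O.X)) ▷ Z := by
            rw [a.right_i]
            refine Eq.trans (b := (z₂ ≫ (α_ _ _ _).hom ≫ A ◁ (α_ _ _ _).inv) ≫
              A ◁ (a.i ▷ _ ≫ ((a.O.comon.comul ≫ a.O.X ◁ a.κt) ▷ Q.M.X ≫
                (a.O.X ⊗ D.X) ◁ b.i) ≫ (α_ _ _ _).hom) ▷ Z) (by monoidal) ?_
            rw [← whisker_exchange]; monoidal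
          _ = _ := by
            rw [← hz', tensorΔ_kL, ← Iso.hom_inv_id (β_ D.X b.O.X)]
            simp only [Category.assoc, whiskerLeft_comp, comp_whiskerRight]
            simp
      have e₂ : (z₂ ≫ (α_ _ _ _).hom ≫ A ◁ (α_ _ _ _).inv) ≫
          A ◁ (P.M.X ◁ Q.M.left) ▷ Z ≫
          A ◁ ((a.i ▷ (D.X ⊗ Q.M.X) ≫ a.O.X ◁ D.X ◁ b.i) ▷ Z) =
        (z ≫ A ◁ (a.tensorΔ b ≫ (a.O.X ⊗ b.O.X) ◁ a.kR b b.κs) ▷ Z) ≫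
          A ◁ ((α_ _ _ _).hom ≫ a.O.X ◁ (β_ D.X b.O.X).inv) ▷ Z := by
        calc _ = (z₂ ≫ (α_ _ _ _).hom ≫ A ◁ (α_ _ _ _).inv) ≫
            A ◁ ((P.M.X ◁ Q.M.left ≫ a.i ▷ (D.X ⊗ Q.M.X)) ≫
              a.O.X ◁ (D.X ◁ b.i ≫ (β_ D.X b.O.X).hom ≫ (β_ D.X b.O.X).inv)) ▷ Z := by
              rw [Iso.hom_inv_id]; monoidal
          _ = (z₂ ≫ (α_ _ _ _).hom ≫ A ◁ (α_ _ _ _).inv) ≫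
            A ◁ (a.i ▷ _ ≫ a.O.X ◁ (Q.M.left ≫ (β_ D.X Q.M.X).hom ≫ b.i ▷ D.X)) ▷ Z ≫
              A ◁ (a.O.X ◁ (β_ D.X b.O.X).inv) ▷ Z := by
            rw [whisker_exchange, reassoc_of% n]; monoidal
          _ = (z₂ ≫ (α_ _ _ _).hom ≫ A ◁ (α_ _ _ _).inv ≫
              A ◁ (a.i ▷ Q.M.X ≫ a.O.X ◁ b.i) ▷ Z) ≫
              A ◁ (a.O.X ◁ (b.O.comon.comul ≫ b.O.X ◁ b.κs)) ▷ Z ≫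
                A ◁ (a.O.X ◁ (β_ D.X b.O.X).inv) ▷ Z := by
            rw [b.left_i]; monoidal
          _ = _ := by
            rw [← hz', tensorΔ_kR]
            monoidal
      refine (Category.assoc _ _ _).trans (e₁.trans (Eq.trans ?_ ((Category.assoc _ _ _).trans
        e₂).symm))
      rw [hm])
  refine ⟨z₃, ?_⟩
  rw [hz', tensorI]
  calc _ = (z₃ ≫ A ◁ inc P.M Q.M ▷ Z) ≫ A ◁ (a.i ▷ Q.M.X ≫ a.O.X ◁ b.i) ▷ Z := by simp
    _ = _ := by rw [hz₃]; simp

/-- The embedding of a tensor product in the tensor product of the comonoids. -/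
noncomputable def tensor : Amb (P.tensor Q) where
  O := tensorComon a.O b.O
  i := a.tensorI b
  d := a.tensorD b
  κs := a.kL b a.κs
  κt := a.kR b b.κt
  mono A Z := by
    have m₁ : Mono (A ◁ a.i ▷ (Q.M.X ⊗ Z)) := inferInstance
    have m₂ : Mono ((A ⊗ a.O.X) ◁ b.i ▷ Z) := inferInstance
    have m₃ : Mono (A ◁ inc P.M Q.M ▷ Z) := inferInstance
    have e : A ◁ a.tensorI b ▷ Z = A ◁ inc P.M Q.M ▷ Z ≫ (A ◁ (α_ _ _ _).hom ≫
      A ◁ a.i ▷ (Q.M.X ⊗ Z) ≫ (α_ _ _ _).inv) ≫ ((A ⊗ a.O.X) ◁ b.i ▷ Z ≫ (α_ _ _ _).hom ≫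
        A ◁ (α_ _ _ _).inv) := by
      rw [tensorI]; monoidal
    have m₄ : Mono (A ◁ a.tensorI b ▷ Z) := by rw [e]; apply mono_comp
    exact m₄
  d_i := a.tensorD_tensorI b
  s_eq := a.tensorD_kL b a.κs P.s a.s_eq
  t_eq := a.tensorD_kR b b.κt Q.t b.t_eq
  right_i := a.tensor_right_i b
  left_i := a.tensor_left_i b
  pairs x hx := by
    rcases hx with ⟨x, hx, rfl⟩ | rfl | ⟨x, hx, rfl⟩
    · obtain ⟨κ₁, κ₂, hr⟩ := a.pairs x hx
      exact ⟨_, _, RepPair.compL a b hr⟩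
    · exact ⟨_, _, RepPair.mid a b⟩
    · obtain ⟨κ₁, κ₂, hr⟩ := b.pairs x hx
      exact ⟨_, _, RepPair.compR a b hr⟩
  lift z h := a.tensor_lift b z h

end Amb

end QuantumModules

namespace QuantumModules
open Comodule

variable {V : Type u} [Category.{v} V] [MonoidalCategory V] [BraidedCategory V]

section oneCast
variable (C D : Comon V)

instance : Epi (oneCast C D) := inferInstanceAs (Epi (𝟙 (C.X ⊗ D.X)))

/-- The identity of `C ⊗ D`, in the direction opposite to `oneCast`. -/
def oneUncast : (Cell.flat (one (opTensor C D))).X ⟶ C.X ⊗ D.X := 𝟙 (C.X ⊗ D.X)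

lemma oneCast_oneUncast : oneCast C D ≫ oneUncast C D = 𝟙 _ := Category.id_comp _

lemma oneUncast_oneCast : oneUncast C D ≫ oneCast C D = 𝟙 _ := Category.id_comp _

/-- The counit of `C^o ⊗ D`. -/
def oneε : (Cell.flat (one (opTensor C D))).X ⟶ 𝟙_ V := (opTensor C D).comon.counit

lemma oneCast_oneε : oneCast C D ≫ oneε C D = (C.comon.counit ⊗ₘ D.comon.counit) ≫ (λ_ _).hom :=
  oneCast_counit C D

lemma oneUncast_eq : oneUncast C D = (Cell.flat (one (opTensor C D))).right ≫
    ((Cell.flat (one (opTensor C D))).left ≫ C.X ◁ oneε C D ≫ (ρ_ _).hom) ▷ D.X := by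
  have h₁ := C.comon.comul_counit
  have h₂ := D.comon.counit_comul
  rw [← cancel_epi (oneCast C D), oneCast_oneUncast, reassoc_of% oneCast_right,
    ← comp_whiskerRight, reassoc_of% oneCast_left, ← whiskerLeft_comp_assoc, oneCast_oneε,
    MonoidalCategory.tensorHom_def]
  symm
  calc _ = C.X ◁ D.comon.comul ≫ (α_ _ _ _).inv ≫ ((C.comon.comul ≫ C.X ◁ C.comon.counit) ▷ D.X
        ⊗≫ C.X ◁ D.comon.counit ⊗≫ 𝟙 _) ▷ D.X := by monoidal
    _ = C.X ◁ (D.comon.comul ≫ D.comon.counit ▷ D.X) ⊗≫ 𝟙 _ := by rw [h₁]; monoidal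
    _ = _ := by rw [h₂]; monoidal

end oneCast

variable [HasCoreflexiveEqualizers V]
  [∀ X : V, Comonad.PreservesLimitOfIsCoreflexivePair (tensorLeft X)]

variable {C D E F : Comon V}

/-- The comultiplication of a comonad on the flattened comodule. -/
noncomputable def Cell.Δ (Y : Cell C D) (y : ComonadStr Y) : Y.flat.X ⟶ Y.flat.X ⊗ Y.flat.X :=
  ComonadStr.Δ y

/-- The counit of a comonad on the flattened comodule. -/
def Cell.ε (Y : Cell C D) (y : ComonadStr Y) : Y.flat.X ⟶ 𝟙_ V := ComonadStr.ε y

lemma Cell.flatMap_comul_inc (Y : Cell C D) (y : ComonadStr Y) :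
    (Cell.flatMap y.comul).hom ≫ flatInc Y Y = Y.Δ y := rfl

lemma Cell.flatMap_counit (Y : Cell C D) (y : ComonadStr Y) :
    (Cell.flatMap y.counit).hom ≫ oneε C D = Y.ε y := rfl

namespace Amb
variable {P : Multi C D} (a : Amb P) {Y Z : Cell C D} (y : ComonadStr Y) (z : ComonadStr Z)

/-- `f` is a map of comonads from (the comonad embedded in) `O` to `Y`. -/
structure IsCom (f : P.M ⟶ Y.flat) : Prop where
  comul : ∃ w : P.M.X ⟶ P.M.X ⊗ Y.flat.X, w ≫ a.i ▷ Y.flat.X = a.d ≫ a.O.X ◁ f.hom ∧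
    w ≫ f.hom ▷ Y.flat.X = f.hom ≫ Y.Δ y
  counit : f.hom ≫ Y.ε y = a.e

variable {y z} {f : P.M ⟶ Y.flat}

lemma IsCom.w_eq {a : Amb P} (h : a.IsCom y f) (hf : P.IsMor Y.multi f) :
    a.w hf ≫ f.hom ▷ Y.flat.X = f.hom ≫ Y.Δ y := by
  obtain ⟨w, h₁, h₂⟩ := h.comul
  rw [a.w_unique hf h₁, h₂]

lemma eq_kap (g : P.M ⟶ Cell.flat (one (opTensor C D))) (h : g.hom ≫ oneε C D = a.e) :
    g = a.kap := by
  ext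
  have hl := g.left_comm
  have hr := g.right_comm
  rw [← Category.comp_id g.hom, ← oneUncast_oneCast, ← Category.assoc, oneUncast_eq, kap_hom]
  congr 1
  rw [reassoc_of% hr, ← comp_whiskerRight, reassoc_of% hl, ← whiskerLeft_comp_assoc, h, kap₀]

lemma kap_ε : a.kap.hom ≫ oneε C D = a.e := by
  have h₁ := P.M.left_counit
  have h₂ := P.M.right_counit
  rw [kap_hom, Category.assoc, oneCast_oneε, kap₀]
  calc _ = (P.M.right ≫ P.M.X ◁ D.comon.counit) ⊗≫ P.M.left ⊗≫ (C.comon.counit ▷ P.M.X ≫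
        _ ◁ a.e) ⊗≫ 𝟙 _ := by
        rw [← whisker_exchange, MonoidalCategory.tensorHom_def']
        simp only [comp_whiskerRight, Category.assoc]
        rw [← whisker_exchange_assoc, ← whisker_exchange_assoc, ← whisker_exchange_assoc]
        monoidal
    _ = (P.M.left ≫ C.comon.counit ▷ P.M.X) ≫ _ ◁ a.e ⊗≫ 𝟙 _ := by rw [h₂]; monoidal
    _ = _ := by rw [h₁]; monoidal

lemma isCom_iff (hf : P.IsMor Y.multi f) :
    a.IsCom y f ↔ f ≫ Cell.flatMap y.comul = a.conv hf hf ∧ f ≫ Cell.flatMap y.counit = a.kap := by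
  constructor
  · intro h
    refine ⟨?_, a.eq_kap _ ((Category.assoc _ _ _).trans h.counit)⟩
    ext
    rw [← cancel_mono (flatInc Y Y), conv_inc, h.w_eq hf]
    exact Category.assoc _ _ _
  · rintro ⟨h₁, h₂⟩
    refine ⟨⟨a.w hf, a.w_i hf, ?_⟩, ?_⟩
    · rw [← conv_inc a hf hf, ← h₁]; exact Category.assoc _ _ _
    · rw [← kap_ε, ← h₂]; exact (Category.assoc _ _ _).symm

lemma IsCom.comp {a : Amb P} (h : a.IsCom y f) (hf : P.IsMor Y.multi f) {g : Y ⟶ Z} (hg : y.IsMap z g) :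
    a.IsCom z (f ≫ Cell.flatMap g) := by
  have hfg : P.IsMor Z.multi (f ≫ Cell.flatMap g) := hf.comp (flatMap_isMor g)
  rw [isCom_iff _ hf] at h
  rw [isCom_iff _ hfg, a.conv_comp hf hf g g hfg hfg, ← h.1, ← h.2]
  constructor
  · rw [Category.assoc, Category.assoc, ← Cell.flatMap_comp, ← Cell.flatMap_comp, hg.comul]
  · rw [Category.assoc, ← Cell.flatMap_comp, hg.counit]

end Amb

/-- Data that make precomposition with `φ` preserve maps of comonads. -/
structure AmbMap {P R : Multi C D} (a : Amb P) (b : Amb R) (φ : P.M ⟶ R.M) where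
  N : V
  j : P.M.X ⟶ N
  k : N ⟶ a.O.X
  ψ : N ⟶ b.O.X
  w : P.M.X ⟶ N ⊗ R.M.X
  mono : ∀ A Z : V, Mono (A ◁ k ▷ Z)
  j_k : j ≫ k = a.i
  j_ψ : j ≫ ψ = φ.hom ≫ b.i
  w_k : w ≫ k ▷ R.M.X = a.d ≫ a.O.X ◁ φ.hom
  w_ψ : w ≫ ψ ▷ R.M.X = φ.hom ≫ b.d
  counit : ψ ≫ b.O.comon.counit = k ≫ a.O.comon.counit

namespace AmbMap

lemma mono_right {P R : Multi C D} {a : Amb P} {b : Amb R} {φ : P.M ⟶ R.M} (m : AmbMap a b φ)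
    (Z : V) : Mono (m.k ▷ Z) := by
  have e : m.k ▷ Z = (λ_ _).inv ≫ 𝟙_ V ◁ m.k ▷ Z ≫ (λ_ _).hom := by simp
  have := m.mono (𝟙_ V) Z
  rw [e]; infer_instance

variable {P R : Multi C D} {a : Amb P} {b : Amb R} {φ : P.M ⟶ R.M} (m : AmbMap a b φ)

lemma isCom (m : AmbMap a b φ) {Y : Cell C D} {y : ComonadStr Y} {f : R.M ⟶ Y.flat} (hφ : P.IsMor R φ)
    (hf : R.IsMor Y.multi f) (h : b.IsCom y f) : a.IsCom y (φ ≫ f) := by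
  have hφf := hφ.comp hf
  have m₁ := m.mono_right Y.flat.X
  have e₁ : a.w hφf ≫ m.j ▷ Y.flat.X = m.w ≫ m.N ◁ f.hom := by
    rw [← cancel_mono (m.k ▷ Y.flat.X), Category.assoc, Category.assoc, ← comp_whiskerRight, m.j_k,
      a.w_i, whisker_exchange, reassoc_of% m.w_k]
    simp
  have e₂ : a.w hφf ≫ φ.hom ▷ Y.flat.X = φ.hom ≫ b.w hf := by
    rw [← cancel_mono (b.i ▷ Y.flat.X), Category.assoc, Category.assoc, ← comp_whiskerRight, ← m.j_ψ,
      b.w_i, comp_whiskerRight, reassoc_of% e₁, whisker_exchange, reassoc_of% m.w_ψ]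
  refine ⟨⟨a.w hφf, a.w_i hφf, ?_⟩, ?_⟩
  · rw [comp_hom, comp_whiskerRight, reassoc_of% e₂, h.w_eq hf, Category.assoc]
  · rw [comp_hom, Category.assoc, h.counit, Amb.e, Amb.e, ← reassoc_of% m.j_ψ, m.counit,
      reassoc_of% m.j_k]

lemma w_right : P.M.right ≫ m.w ▷ D.X ≫ (α_ _ _ _).hom = m.w ≫ m.N ◁ R.M.right := by
  have m₁ := m.mono_right (R.M.X ⊗ D.X)
  rw [← cancel_mono (m.k ▷ (R.M.X ⊗ D.X))]
  calc _ = P.M.right ≫ (m.w ≫ m.k ▷ R.M.X) ▷ D.X ≫ (α_ _ _ _).hom := by simp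
    _ = (P.M.right ≫ a.d ▷ D.X ≫ (α_ _ _ _).hom) ≫ a.O.X ◁ φ.hom ▷ D.X := by rw [m.w_k]; simp
    _ = a.d ≫ a.O.X ◁ (P.M.right ≫ φ.hom ▷ D.X) := by rw [a.right_d]; simp
    _ = (m.w ≫ m.k ▷ R.M.X) ≫ a.O.X ◁ R.M.right := by rw [← φ.right_comm, m.w_k]; simp
    _ = _ := by rw [Category.assoc, Category.assoc, whisker_exchange]

lemma w_left : P.M.left ≫ C.X ◁ m.w ≫ (α_ _ _ _).inv ≫ (β_ C.X m.N).hom ▷ R.M.X ≫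
    (α_ _ _ _).hom = m.w ≫ m.N ◁ R.M.left := by
  have m₁ := m.mono_right (C.X ⊗ R.M.X)
  have n := BraidedCategory.braiding_naturality_right C.X m.k
  rw [← cancel_mono (m.k ▷ (C.X ⊗ R.M.X))]
  calc _ = P.M.left ≫ C.X ◁ m.w ≫ (α_ _ _ _).inv ≫ ((β_ C.X m.N).hom ≫ m.k ▷ C.X) ▷ R.M.X ≫
          (α_ _ _ _).hom := by monoidal
    _ = P.M.left ≫ C.X ◁ (m.w ≫ m.k ▷ R.M.X) ≫ (α_ _ _ _).inv ≫
          (β_ C.X a.O.X).hom ▷ R.M.X ≫ (α_ _ _ _).hom := by rw [← n]; monoidal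
    _ = P.M.left ≫ C.X ◁ a.d ≫ (α_ _ _ _).inv ≫ ((C.X ⊗ a.O.X) ◁ φ.hom ≫
          (β_ C.X a.O.X).hom ▷ R.M.X) ≫ (α_ _ _ _).hom := by rw [m.w_k]; simp
    _ = (P.M.left ≫ C.X ◁ a.d ≫ (α_ _ _ _).inv ≫ (β_ C.X a.O.X).hom ▷ P.M.X ≫
          (α_ _ _ _).hom) ≫ a.O.X ◁ C.X ◁ φ.hom := by rw [whisker_exchange]; simp
    _ = a.d ≫ a.O.X ◁ (P.M.left ≫ C.X ◁ φ.hom) := by rw [a.left_d]; simp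
    _ = (m.w ≫ m.k ▷ R.M.X) ≫ a.O.X ◁ R.M.left := by rw [← φ.left_comm, m.w_k]; simp
    _ = _ := by rw [Category.assoc, Category.assoc, whisker_exchange]

/-- Maps induced by maps of the ambient comonoids. -/
def ofComonHom (ψ : a.O.X ⟶ b.O.X) (h₁ : ψ ≫ b.O.comon.comul = a.O.comon.comul ≫ (ψ ⊗ₘ ψ))
    (h₂ : ψ ≫ b.O.comon.counit = a.O.comon.counit) (h : a.i ≫ ψ = φ.hom ≫ b.i) :
    AmbMap a b φ where
  N := a.O.X
  j := a.i
  k := 𝟙 _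
  ψ := ψ
  w := a.d ≫ a.O.X ◁ φ.hom
  mono A Z := by rw [id_whiskerRight, whiskerLeft_id]; infer_instance
  j_k := by simp
  j_ψ := h
  w_k := by simp
  w_ψ := by
    rw [← cancel_mono (b.O.X ◁ b.i)]
    calc _ = a.d ≫ a.O.X ◁ (φ.hom ≫ b.i) ≫ ψ ▷ b.O.X := by
          simp only [Category.assoc]; rw [← whisker_exchange]; simp
      _ = (a.d ≫ a.O.X ◁ a.i) ≫ a.O.X ◁ ψ ≫ ψ ▷ b.O.X := by rw [← h]; simp
      _ = a.i ≫ ψ ≫ b.O.comon.comul := by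
        rw [a.d_i, h₁, MonoidalCategory.tensorHom_def', Category.assoc]
      _ = _ := by rw [reassoc_of% h, Category.assoc, b.d_i]
  counit := by rw [h₂, Category.id_comp]

/-- The identity. -/
def id (a : Amb P) : AmbMap a a (𝟙 P.M) :=
  ofComonHom (𝟙 _) (by simp) (by simp) (by simp)

/-- Maps of comonads. -/
noncomputable def ofCom {Y : Cell C D} {y : ComonadStr Y} {f : P.M ⟶ Y.flat} (h : a.IsCom y f) :
    AmbMap a (Y.amb y) f where
  N := P.M.X
  j := 𝟙 _
  k := a.i
  ψ := f.hom
  w := h.comul.choose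
  mono A Z := inferInstance
  j_k := Category.id_comp _
  j_ψ := (Category.id_comp _).trans (Category.comp_id _).symm
  w_k := h.comul.choose_spec.1
  w_ψ := h.comul.choose_spec.2
  counit := h.counit

/-- The tensor product of two such maps. -/
noncomputable def tensor {Q S : Multi D E} {c : Amb Q} {d : Amb S} {χ : Q.M ⟶ S.M}
    (m : AmbMap a b φ) (n : AmbMap c d χ) :
    AmbMap (a.tensor c) (b.tensor d) (compMap φ χ) where
  N := m.N ⊗ n.N
  j := inc P.M Q.M ≫ (m.j ⊗ₘ n.j)
  k := m.k ⊗ₘ n.k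
  ψ := m.ψ ⊗ₘ n.ψ
  w := tensorLift m.w n.w m.w_right n.w_left
  mono A Z := by
    have m₁ := m.mono A (n.N ⊗ Z)
    have m₂ := n.mono (A ⊗ a.O.X) Z
    have e : A ◁ (m.k ⊗ₘ n.k) ▷ Z = (A ◁ (α_ _ _ _).hom ≫
      A ◁ m.k ▷ (n.N ⊗ Z) ≫ (α_ _ _ _).inv) ≫ ((A ⊗ a.O.X) ◁ n.k ▷ Z ≫ (α_ _ _ _).hom ≫
        A ◁ (α_ _ _ _).inv) := by
      rw [MonoidalCategory.tensorHom_def]; monoidal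
    have m₄ : Mono (A ◁ (m.k ⊗ₘ n.k) ▷ Z) := by rw [e]; apply mono_comp
    exact m₄
  j_k := by
    change (inc P.M Q.M ≫ (m.j ⊗ₘ n.j)) ≫ (m.k ⊗ₘ n.k) = inc P.M Q.M ≫ a.i ▷ Q.M.X ≫ a.O.X ◁ c.i
    rw [Category.assoc, tensorHom_comp_tensorHom, m.j_k, n.j_k, MonoidalCategory.tensorHom_def]
  j_ψ := by
    change (inc P.M Q.M ≫ (m.j ⊗ₘ n.j)) ≫ (m.ψ ⊗ₘ n.ψ) = (compMap φ χ).hom ≫ inc R.M S.M ≫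
      b.i ▷ S.M.X ≫ b.O.X ◁ d.i
    have := compMap_inc φ χ
    rw [Category.assoc, tensorHom_comp_tensorHom, m.j_ψ, n.j_ψ, reassoc_of% this,
      whisker_exchange_assoc, ← comp_whiskerRight_assoc, ← whiskerLeft_comp,
      MonoidalCategory.tensorHom_def]
  w_k := by
    change tensorLift m.w n.w _ _ ≫ (m.k ⊗ₘ n.k) ▷ (comp R.M S.M).X =
      a.tensorD c ≫ (a.O.X ⊗ c.O.X) ◁ (compMap φ χ).hom
    have h := compMap_inc φ χ
    have h₁ := tensorμ_comp m.w n.w m.k n.k (𝟙 _) (𝟙 _)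
    have h₂ := tensorμ_comp a.d c.d (𝟙 _) (𝟙 _) φ.hom χ.hom
    rw [id_tensorHom_id, tensorHom_id, tensorHom_id, tensorHom_id, m.w_k, n.w_k] at h₁
    rw [id_tensorHom_id, id_tensorHom, id_tensorHom, id_tensorHom, ← h₁, Category.assoc,
      Category.assoc] at h₂
    rw [← cancel_mono ((a.O.X ⊗ c.O.X) ◁ inc R.M S.M), Category.assoc, ← whisker_exchange,
      reassoc_of% tensorLift_inc, Category.assoc, ← whiskerLeft_comp, h,
      ← MonoidalCategory.tensorHom_def, whiskerLeft_comp, reassoc_of% a.tensorD_inc c, h₂]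
  w_ψ := by
    change tensorLift m.w n.w _ _ ≫ (m.ψ ⊗ₘ n.ψ) ▷ (comp R.M S.M).X =
      (compMap φ χ).hom ≫ b.tensorD d
    have h := compMap_inc φ χ
    have h₁ := tensorμ_comp m.w n.w m.ψ n.ψ (𝟙 _) (𝟙 _)
    rw [id_tensorHom_id, tensorHom_id, tensorHom_id, tensorHom_id, m.w_ψ, n.w_ψ,
      Category.assoc] at h₁
    rw [← cancel_mono ((b.O.X ⊗ d.O.X) ◁ inc R.M S.M), Category.assoc, ← whisker_exchange,
      reassoc_of% tensorLift_inc, h₁, Category.assoc, b.tensorD_inc d, reassoc_of% h,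
      ← MonoidalCategory.tensorHom_def_assoc, tensorHom_comp_tensorHom_assoc]
  counit := by
    change (m.ψ ⊗ₘ n.ψ) ≫ (b.O.comon.counit ⊗ₘ d.O.comon.counit) ≫ (λ_ _).hom =
      (m.k ⊗ₘ n.k) ≫ (a.O.comon.counit ⊗ₘ c.O.comon.counit) ≫ (λ_ _).hom
    rw [tensorHom_comp_tensorHom_assoc, m.counit, n.counit, tensorHom_comp_tensorHom_assoc]

end AmbMap

lemma tensorμ_comul_assoc {A B K : V} (a : A ⟶ A ⊗ A) (b : B ⟶ B ⊗ B) (c : K ⟶ K ⊗ K) :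
    ((((a ⊗ₘ b) ≫ tensorμ A A B B) ⊗ₘ c) ≫ tensorμ (A ⊗ B) (A ⊗ B) K K) ≫
      ((α_ A B K).hom ⊗ₘ (α_ A B K).hom) =
    (α_ A B K).hom ≫ (a ⊗ₘ ((b ⊗ₘ c) ≫ tensorμ B B K K)) ≫ tensorμ A A (B ⊗ K) (B ⊗ K) := by
  have h := tensor_associativity A A B B K K
  have e₁ : (((a ⊗ₘ b) ≫ tensorμ A A B B) ⊗ₘ c) = ((a ⊗ₘ b) ⊗ₘ c) ≫ tensorμ A A B B ▷ (K ⊗ K) := by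
    rw [← tensorHom_id, tensorHom_comp_tensorHom, Category.comp_id]
  have e₂ : (a ⊗ₘ ((b ⊗ₘ c) ≫ tensorμ B B K K)) =
      (a ⊗ₘ (b ⊗ₘ c)) ≫ (A ⊗ A) ◁ tensorμ B B K K := by
    rw [← id_tensorHom, tensorHom_comp_tensorHom, Category.comp_id]
  rw [e₁, e₂]
  simp only [Category.assoc]
  rw [h, associator_naturality_assoc]

lemma inv_comul {A B : V} (e : A ≅ B) {a : A ⟶ A ⊗ A} {b : B ⟶ B ⊗ B}
    (h : a ≫ (e.hom ⊗ₘ e.hom) = e.hom ≫ b) : e.inv ≫ a = b ≫ (e.inv ⊗ₘ e.inv) := by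
  rw [Iso.inv_comp_eq, ← reassoc_of% h, tensorHom_comp_tensorHom, Iso.hom_inv_id, id_tensorHom_id,
    Category.comp_id]

lemma comp_hom_of_comp_inv {A B A' B' : V} (e : A ≅ B) {f : A' ⟶ B'} {g : B' ⟶ A'} {x : B' ⟶ A}
    {y : A' ⟶ B} (h : f ≫ x = y ≫ e.inv) (h' : g ≫ f = 𝟙 _) : x ≫ e.hom = g ≫ y := by
  rw [← cancel_mono e.inv, Category.assoc, Category.assoc, ← h, reassoc_of% h', Iso.hom_inv_id,
    Category.comp_id]

section assoc
variable {P : Multi C D} {Q : Multi D E} {R : Multi E F} (a : Amb P) (b : Amb Q) (c : Amb R)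

lemma tensorComon_assoc (A B C : Comon V) :
    (tensorComon (tensorComon A B) C).comon.comul ≫ ((α_ A.X B.X C.X).hom ⊗ₘ (α_ A.X B.X C.X).hom) =
      (α_ A.X B.X C.X).hom ≫ (tensorComon A (tensorComon B C)).comon.comul :=
  tensorμ_comul_assoc _ _ _

lemma tensorComon_assoc_counit (A B C : Comon V) :
    (α_ A.X B.X C.X).hom ≫ (tensorComon A (tensorComon B C)).comon.counit =
      (tensorComon (tensorComon A B) C).comon.counit := by
  change _ ≫ (A.comon.counit ⊗ₘ ((B.comon.counit ⊗ₘ C.comon.counit) ≫ (λ_ _).hom)) ≫ (λ_ _).hom =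
    (((A.comon.counit ⊗ₘ B.comon.counit) ≫ (λ_ _).hom) ⊗ₘ C.comon.counit) ≫ (λ_ _).hom
  simp only [MonoidalCategory.tensorHom_def]
  monoidal

lemma assoc_tensorI : (assocInv P.M Q.M R.M).hom ≫ (a.tensor b).tensorI c =
    a.tensorI (b.tensor c) ≫ (α_ a.O.X b.O.X c.O.X).inv := by
  change (assocInv P.M Q.M R.M).hom ≫ inc (comp P.M Q.M) R.M ≫
      (inc P.M Q.M ≫ a.i ▷ Q.M.X ≫ a.O.X ◁ b.i) ▷ R.M.X ≫ (a.O.X ⊗ b.O.X) ◁ c.i =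
    (inc P.M (comp Q.M R.M) ≫ a.i ▷ _ ≫ a.O.X ◁ (inc Q.M R.M ≫ b.i ▷ R.M.X ≫ b.O.X ◁ c.i)) ≫ _
  have h := assocInv_inc P.M Q.M R.M
  rw [comp_whiskerRight, Category.assoc, reassoc_of% h, whiskerLeft_comp, ← whisker_exchange_assoc]
  monoidal

/-- Rebracketing. -/
noncomputable def AmbMap.assocInv :
    AmbMap (a.tensor (b.tensor c)) ((a.tensor b).tensor c) (Comodule.assocInv P.M Q.M R.M) :=
  .ofComonHom (α_ a.O.X b.O.X c.O.X).inv
    (inv_comul (α_ a.O.X b.O.X c.O.X) (tensorComon_assoc a.O b.O c.O))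
    ((Iso.inv_comp_eq _).2 (tensorComon_assoc_counit a.O b.O c.O).symm)
    (assoc_tensorI a b c).symm

/-- Rebracketing. -/
noncomputable def AmbMap.assocHom :
    AmbMap ((a.tensor b).tensor c) (a.tensor (b.tensor c)) (assocIso P.M Q.M R.M).inv :=
  .ofComonHom (α_ a.O.X b.O.X c.O.X).hom (tensorComon_assoc a.O b.O c.O).symm
    (tensorComon_assoc_counit a.O b.O c.O)
    (comp_hom_of_comp_inv (α_ a.O.X b.O.X c.O.X) (assoc_tensorI a b c)
      (congrArg Hom.hom (assocIso P.M Q.M R.M).inv_hom_id))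

end assoc

end QuantumModules

namespace QuantumModules
open Comodule

variable {V : Type u} [Category.{v} V] [MonoidalCategory V] [BraidedCategory V]
  [HasCoreflexiveEqualizers V]
  [∀ X : V, Comonad.PreservesLimitOfIsCoreflexivePair (tensorLeft X)]

lemma eta_comul_aux_right {X O B C R : V} {ι : R ⟶ X ⊗ B} {η : C ⟶ B} {s : B ⟶ C ⊗ B}
    {Δ : B ⟶ B ⊗ B} {r : X ⟶ X ⊗ C} {d : X ⟶ O ⊗ X} {ηR : X ⟶ R} {S : R ⟶ C ⊗ R}
    {D : R ⟶ (O ⊗ B) ⊗ R} (h₁ : D ≫ (O ⊗ B) ◁ ι = ι ≫ (d ⊗ₘ Δ) ≫ tensorμ O X B B)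
    (h₂ : S ≫ C ◁ ι = ι ≫ X ◁ s ≫ (α_ _ _ _).inv ≫ (β_ X C).hom ▷ B ≫ (α_ _ _ _).hom)
    (h₃ : η ≫ Δ = η ≫ s ≫ η ▷ B) (h₄ : r ≫ d ▷ C ≫ (α_ _ _ _).hom = d ≫ O ◁ r)
    (h₅ : ηR ≫ ι = r ≫ X ◁ η) : (ηR ≫ D) ≫ (O ⊗ B) ◁ ι =
      (d ≫ O ◁ (ηR ≫ S ≫ η ▷ R) ≫ (α_ O B R).inv) ≫ (O ⊗ B) ◁ ι := by
  have n := BraidedCategory.braiding_naturality_right X η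
  have e : ηR ≫ S ≫ η ▷ R ≫ B ◁ ι = r ≫ X ◁ (η ≫ s ≫ η ▷ B) ≫ (α_ _ _ _).inv ≫
      (β_ X B).hom ▷ B ≫ (α_ _ _ _).hom :=
    calc _ = ηR ≫ (S ≫ C ◁ ι) ≫ η ▷ (X ⊗ B) := by rw [← whisker_exchange]; simp
      _ = (r ≫ X ◁ η) ≫ X ◁ s ≫ (α_ _ _ _).inv ≫ ((β_ X C).hom ≫ η ▷ X) ▷ B ≫ (α_ _ _ _).hom := by
        rw [h₂, ← h₅]; monoidal
      _ = _ := by rw [← n]; monoidal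
  symm
  calc _ = d ≫ O ◁ (ηR ≫ S ≫ η ▷ R ≫ B ◁ ι) ≫ (α_ _ _ _).inv := by monoidal
    _ = (r ≫ d ▷ C ≫ (α_ _ _ _).hom) ≫ O ◁ (X ◁ (η ≫ Δ) ≫ (α_ _ _ _).inv ≫
      (β_ X B).hom ▷ B ≫ (α_ _ _ _).hom) ≫ (α_ _ _ _).inv := by rw [e, h₃, h₄]; monoidal
    _ = r ≫ (d ▷ C ≫ (O ⊗ X) ◁ η) ≫ (O ⊗ X) ◁ Δ ≫ tensorμ O X B B := by rw [tensorμ]; monoidal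
    _ = _ := by
      rw [← whisker_exchange, Category.assoc ηR, h₁, MonoidalCategory.tensorHom_def, reassoc_of% h₅]
      simp

lemma eta_comul_aux_left {X O B C R : V} {ι : R ⟶ B ⊗ X} {η : C ⟶ B} {t : B ⟶ C ⊗ B}
    {Δ : B ⟶ B ⊗ B} {l : X ⟶ C ⊗ X} {d : X ⟶ O ⊗ X} {ηL : X ⟶ R} {S : R ⟶ C ⊗ R}
    {D : R ⟶ (B ⊗ O) ⊗ R} (h₁ : D ≫ (B ⊗ O) ◁ ι = ι ≫ (Δ ⊗ₘ d) ≫ tensorμ B B O X)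
    (h₂ : S ≫ C ◁ ι = ι ≫ t ▷ X ≫ (α_ _ _ _).hom)
    (h₃ : η ≫ Δ = η ≫ t ≫ η ▷ B)
    (h₄ : l ≫ C ◁ d ≫ (α_ _ _ _).inv ≫ (β_ C O).hom ▷ X ≫ (α_ _ _ _).hom = d ≫ O ◁ l)
    (h₅ : ηL ≫ ι = l ≫ η ▷ X) : (ηL ≫ D) ≫ (B ⊗ O) ◁ ι =
      (d ≫ O ◁ (ηL ≫ S ≫ η ▷ R) ≫ (α_ O B R).inv ≫ (β_ B O).inv ▷ R) ≫ (B ⊗ O) ◁ ι := by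
  have n := BraidedCategory.braiding_naturality_left (η ≫ t ≫ η ▷ B) O
  have e : ηL ≫ S ≫ η ▷ R ≫ B ◁ ι = l ≫ (η ≫ t ≫ η ▷ B) ▷ X ≫ (α_ _ _ _).hom :=
    calc _ = ηL ≫ (S ≫ C ◁ ι) ≫ η ▷ (B ⊗ X) := by rw [← whisker_exchange]; simp
      _ = (l ≫ η ▷ X) ≫ t ▷ X ≫ (α_ _ _ _).hom ≫ η ▷ (B ⊗ X) := by rw [h₂, ← h₅]; monoidal
      _ = _ := by monoidal
  symm
  calc _ = d ≫ O ◁ (ηL ≫ S ≫ η ▷ R ≫ B ◁ ι) ≫ (α_ _ _ _).inv ≫ (β_ B O).inv ▷ (B ⊗ X) := by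
        simp only [Category.assoc]; rw [← whisker_exchange (β_ B O).inv ι]; monoidal
    _ = (l ≫ C ◁ d ≫ (α_ _ _ _).inv ≫ (β_ C O).hom ▷ X ≫ (α_ _ _ _).hom) ≫
          O ◁ ((η ≫ t ≫ η ▷ B) ▷ X ≫ (α_ _ _ _).hom) ≫ (α_ _ _ _).inv ≫
            (β_ B O).inv ▷ (B ⊗ X) := by rw [e, h₄]; monoidal
    _ = l ≫ C ◁ d ⊗≫ ((β_ C O).hom ≫ O ◁ (η ≫ t ≫ η ▷ B)) ▷ X ⊗≫ (β_ B O).inv ▷ B ▷ X ⊗≫ 𝟙 _ := by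
      monoidal
    _ = l ≫ (C ◁ d ≫ (η ≫ t ≫ η ▷ B) ▷ (O ⊗ X)) ⊗≫ (B ◁ (β_ B O).hom ⊗≫
          ((β_ B O).hom ≫ (β_ B O).inv) ▷ B ⊗≫ 𝟙 ((B ⊗ O) ⊗ B)) ▷ X ⊗≫
            𝟙 _ := by
      rw [← n, BraidedCategory.braiding_tensor_left_hom]; monoidal
    _ = l ≫ η ▷ X ≫ Δ ▷ X ≫ (B ⊗ B) ◁ d ≫ tensorμ B B O X := by
      rw [whisker_exchange, ← h₃, Iso.hom_inv_id, tensorμ]; monoidal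
    _ = _ := by
      rw [Category.assoc ηL, h₁, MonoidalCategory.tensorHom_def, reassoc_of% h₅]
      simp

lemma eta_w_aux {X O B C R N Z : V} {I : R ⟶ N} {D : R ⟶ N ⊗ R} {f : R ⟶ Z} {w : X ⟶ X ⊗ Z}
    {W : R ⟶ R ⊗ Z} {i : X ⟶ O} {δ : O ⟶ O ⊗ O} {k : O ⟶ C} {η : C ⟶ B} {d : X ⟶ O ⊗ X}
    {T : X ⟶ C ⊗ X} {S : R ⟶ C ⊗ R} {φ : X ⟶ R} {τ : O ⊗ B ⟶ N}
    (hI : φ ≫ I = i ≫ δ ≫ O ◁ (k ≫ η) ≫ τ) (hW : W ≫ I ▷ Z = D ≫ N ◁ f)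
    (hw : w ≫ i ▷ Z = d ≫ O ◁ (φ ≫ f)) (hd : d ≫ O ◁ d = d ≫ δ ▷ X ≫ (α_ _ _ _).hom)
    (hT : T = d ≫ k ▷ X) (hS : T ≫ C ◁ (φ ≫ f) = (φ ≫ S) ≫ C ◁ f)
    (hD : φ ≫ D = d ≫ O ◁ (φ ≫ S ≫ η ▷ R) ≫ (α_ _ _ _).inv ≫ τ ▷ R) :
    (w ≫ φ ▷ Z) ≫ I ▷ Z = (φ ≫ W) ≫ I ▷ Z :=
  calc _ = w ≫ (φ ≫ I) ▷ Z := by simp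
    _ = (w ≫ i ▷ Z) ≫ (δ ≫ O ◁ (k ≫ η) ≫ τ) ▷ Z := by rw [hI]; simp
    _ = (d ≫ δ ▷ X ≫ (α_ _ _ _).hom) ≫ (α_ _ _ _).inv ≫ (O ◁ (k ≫ η) ≫ τ) ▷ X ≫
        N ◁ (φ ≫ f) := by
      rw [hw, Category.assoc, whisker_exchange, Category.assoc, Category.assoc,
        Iso.hom_inv_id_assoc, comp_whiskerRight, Category.assoc]
    _ = d ≫ O ◁ ((d ≫ k ▷ X) ≫ η ▷ X) ≫ (α_ _ _ _).inv ≫ (τ ▷ X ≫ N ◁ (φ ≫ f)) := by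
      rw [← hd]; monoidal
    _ = d ≫ O ◁ (T ≫ (η ▷ X ≫ B ◁ (φ ≫ f))) ≫ (α_ _ _ _).inv ≫ τ ▷ Z := by
      rw [← hT, ← whisker_exchange]; monoidal
    _ = d ≫ O ◁ ((T ≫ C ◁ (φ ≫ f)) ≫ η ▷ Z) ≫ (α_ _ _ _).inv ≫ τ ▷ Z := by
      rw [← whisker_exchange, Category.assoc]
    _ = d ≫ O ◁ (φ ≫ S ≫ (C ◁ f ≫ η ▷ Z)) ≫ (α_ _ _ _).inv ≫ τ ▷ Z := by rw [hS]; simp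
    _ = d ≫ O ◁ (φ ≫ S ≫ η ▷ R) ≫ (α_ _ _ _).inv ≫ ((O ⊗ B) ◁ f ≫ τ ▷ Z) := by
      rw [whisker_exchange]; monoidal
    _ = _ := by rw [whisker_exchange, Category.assoc, hW, reassoc_of% hD]

lemma eta_counit_aux_right {X O B C R : V} {I : R ⟶ O ⊗ B} {i : X ⟶ O} {η : C ⟶ B}
    {φ : X ⟶ R} {r : X ⟶ X ⊗ C} {c : O ⟶ 𝟙_ V} {ε : B ⟶ 𝟙_ V} {e : C ⟶ 𝟙_ V}
    (hI : φ ≫ I = r ≫ i ▷ C ≫ O ◁ η) (hε : η ≫ ε = e) (hr : r ≫ X ◁ e = (ρ_ X).inv) :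
    φ ≫ I ≫ (c ⊗ₘ ε) ≫ (λ_ _).hom = i ≫ c :=
  calc _ = r ≫ (i ▷ C ≫ O ◁ (η ≫ ε)) ≫ (ρ_ _).hom ≫ c := by
        rw [reassoc_of% hI, MonoidalCategory.tensorHom_def']; monoidal
    _ = (r ≫ X ◁ (η ≫ ε)) ≫ (ρ_ _).hom ≫ i ≫ c := by rw [← whisker_exchange]; monoidal
    _ = _ := by rw [hε, hr, Iso.inv_hom_id_assoc]

lemma eta_counit_aux_left {X O B C R : V} {I : R ⟶ B ⊗ O} {i : X ⟶ O} {η : C ⟶ B}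
    {φ : X ⟶ R} {l : X ⟶ C ⊗ X} {c : O ⟶ 𝟙_ V} {ε : B ⟶ 𝟙_ V} {e : C ⟶ 𝟙_ V}
    (hI : φ ≫ I = l ≫ C ◁ i ≫ η ▷ O) (hε : η ≫ ε = e) (hl : l ≫ e ▷ X = (λ_ X).inv) :
    φ ≫ I ≫ (ε ⊗ₘ c) ≫ (λ_ _).hom = i ≫ c :=
  calc _ = l ≫ (C ◁ i ≫ (η ≫ ε) ▷ O) ≫ (λ_ _).hom ≫ c := by
        rw [reassoc_of% hI, MonoidalCategory.tensorHom_def]; monoidal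
    _ = (l ≫ (η ≫ ε) ▷ X) ≫ (λ_ _).hom ≫ i ≫ c := by rw [whisker_exchange]; monoidal
    _ = _ := by rw [hε, hl, Iso.inv_hom_id_assoc]

namespace QuantumCategory
variable (b : QuantumCategory V) {D E : Comon V}

/-- The unit as a map in `𝒱`. -/
def eta : b.C.X ⟶ b.A.flat.X := b.η.hom

lemma eta_act : b.eta ≫ b.A.multi.t.act = b.eta ≫ b.A.multi.s.act := b.η_cell

lemma eta_Δ : b.eta ≫ b.A.Δ b.str = b.eta ≫ b.A.multi.t.act ≫ b.eta ▷ b.A.flat.X :=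
  b.η_comul.trans (Category.assoc _ _ _)

lemma eta_ε : b.eta ≫ b.A.ε b.str = b.C.comon.counit := b.η_counit

lemma etaL_inc (N : Comodule b.C D) :
    (b.etaL N).hom ≫ inc b.A.flat N = N.left ≫ b.eta ▷ N.X := by
  have h₁ : (compMap b.η (𝟙 N)).hom ≫ inc b.A.flat N = inc (one b.C) N ≫ b.η.hom ▷ N.X := by
    have := compMap_inc b.η (𝟙 N)
    rw [this]; simp
  have h₂ : (unitL N).hom ≫ inc (one b.C) N = N.left := unitLMap_inc N
  refine (Category.assoc _ _ _).trans ((congrArg (_ ≫ ·) h₁).trans ?_)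
  exact (Category.assoc _ _ _).symm.trans (congrArg (· ≫ _) h₂)

lemma etaR_inc (N : Comodule D b.C) :
    (b.etaR N).hom ≫ inc N b.A.flat = N.right ≫ N.X ◁ b.eta := by
  have h₁ : (compMap (𝟙 N) b.η).hom ≫ inc N b.A.flat = inc N (one b.C) ≫ N.X ◁ b.η.hom := by
    have := compMap_inc (𝟙 N) b.η
    rw [this]; simp
  have h₂ : (unitR N).hom ≫ inc N (one b.C) = N.right := unitRMap_inc N
  refine (Category.assoc _ _ _).trans ((congrArg (_ ≫ ·) h₁).trans ?_)
  exact (Category.assoc _ _ _).symm.trans (congrArg (· ≫ _) h₂)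

lemma etaL_eqv {K : V} {N : Comodule b.C D} (y : Coact K N) :
    y.Eqv (b.etaL N) (y.compR b.A.flat) := by
  have h := y.comm_left
  have n := BraidedCategory.braiding_naturality_left b.eta K
  rw [Coact.Eqv, ← cancel_mono (K ◁ inc b.A.flat N), Category.assoc, ← whiskerLeft_comp, etaL_inc,
    Category.assoc, Coact.compR_inc, reassoc_of% b.etaL_inc]
  calc _ = (y.act ≫ K ◁ N.left) ≫ K ◁ b.eta ▷ N.X := by simp
    _ = N.left ≫ b.C.X ◁ y.act ≫ (α_ _ _ _).inv ≫ ((β_ b.C.X K).hom ≫ K ◁ b.eta) ▷ N.X ≫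
        (α_ _ _ _).hom := by rw [h]; monoidal
    _ = N.left ≫ (b.C.X ◁ y.act ≫ b.eta ▷ (K ⊗ N.X)) ≫ (α_ _ _ _).inv ≫
        (β_ b.A.flat.X K).hom ▷ N.X ≫ (α_ _ _ _).hom := by rw [← n]; monoidal
    _ = _ := by rw [whisker_exchange]; monoidal

lemma etaR_eqv {K : V} {N : Comodule D b.C} (x : Coact K N) :
    x.Eqv (b.etaR N) (x.compL b.A.flat) := by
  have h := x.comm_right
  rw [Coact.Eqv, ← cancel_mono (K ◁ inc N b.A.flat), Category.assoc, ← whiskerLeft_comp, etaR_inc,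
    Category.assoc, Coact.compL_inc, reassoc_of% b.etaR_inc]
  calc _ = (x.act ≫ K ◁ N.right) ≫ K ◁ N.X ◁ b.eta := by simp
    _ = N.right ≫ (x.act ▷ b.C.X ≫ (K ⊗ N.X) ◁ b.eta) ≫ (α_ _ _ _).hom := by rw [h]; simp
    _ = _ := by rw [← whisker_exchange]; simp

lemma etaL_act (N : Comodule b.C D) : (b.etaL N).hom ≫ (b.A.multi.t.compL N).act =
    (b.etaL N).hom ≫ (b.A.multi.s.compL N).act := by
  have h := b.eta_act
  rw [← cancel_mono (b.C.X ◁ inc b.A.flat N), Category.assoc, Category.assoc]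
  erw [Coact.compL_inc, Coact.compL_inc]
  rw [reassoc_of% b.etaL_inc, reassoc_of% b.etaL_inc, ← comp_whiskerRight_assoc, h,
    comp_whiskerRight_assoc]

lemma etaR_act (N : Comodule D b.C) : (b.etaR N).hom ≫ (b.A.multi.t.compR N).act =
    (b.etaR N).hom ≫ (b.A.multi.s.compR N).act := by
  have h := b.eta_act
  rw [← cancel_mono (b.C.X ◁ inc N b.A.flat), Category.assoc, Category.assoc]
  erw [Coact.compR_inc, Coact.compR_inc]
  rw [reassoc_of% b.etaR_inc, reassoc_of% b.etaR_inc, ← whiskerLeft_comp_assoc, h,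
    whiskerLeft_comp_assoc]

section right
variable {P : Multi D b.C} {Y : Cell D b.C} {f : comp P.M b.A.flat ⟶ Y.flat}

lemma etaR_t (hf : (P.tensor b.A.multi).IsMor Y.multi f) :
    P.t.act ≫ b.C.X ◁ (b.etaR P.M ≫ f).hom =
      ((b.etaR P.M).hom ≫ (b.A.multi.s.compR P.M).act) ≫ b.C.X ◁ f.hom := by
  have hb : CoactPair.Bal ⟨b.C.X, P.t.compL b.A.flat, b.A.multi.s.compR P.M⟩ f := by
    rcases hf.pairs ⟨b.C.X, P.t.compL b.A.flat, b.A.multi.s.compR P.M⟩ (.inr (.inl rfl)) with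
      ⟨_, hy, _⟩ | hb
    exacts [hy.elim, hb]
  have h := b.etaR_eqv P.t
  rw [Coact.Eqv] at h
  change (P.t.compL b.A.flat).act ≫ b.C.X ◁ f.hom = (b.A.multi.s.compR P.M).act ≫ b.C.X ◁ f.hom at hb
  rw [comp_hom, whiskerLeft_comp, reassoc_of% h, hb, Category.assoc]

lemma etaR_isMor (hf : (P.tensor b.A.multi).IsMor Y.multi f) :
    P.IsMor Y.multi (b.etaR P.M ≫ f) where
  s := (b.etaR_eqv P.s).comp hf.s
  t := by
    refine (b.etaR_t hf).trans ?_
    rw [← etaR_act, Category.assoc]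
    exact (congrArg (_ ≫ ·) hf.t).trans (Category.assoc _ _ _).symm
  pairs x hx := by
    refine .inr (CoactPair.Rel.bal (y := x.compL b.A.flat) ⟨b.etaR_eqv x.l₁, b.etaR_eqv x.l₂⟩ ?_)
    rcases hf.pairs (x.compL b.A.flat) (.inl ⟨x, hx, rfl⟩) with ⟨_, hy, _⟩ | hb
    exacts [hy.elim, hb]

lemma etaR_d (p : Amb P) : (b.etaR P.M).hom ≫ p.tensorD (b.A.amb b.str) =
    p.d ≫ p.O.X ◁ ((b.etaR P.M).hom ≫ (b.A.multi.s.compR P.M).act ≫ b.eta ▷ _) ≫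
      (α_ p.O.X b.A.flat.X (comp P.M b.A.flat).X).inv := by
  have h₃ := b.eta_Δ
  rw [← Category.assoc, eta_act, Category.assoc] at h₃
  exact (cancel_mono ((p.O.X ⊗ b.A.flat.X) ◁ inc P.M b.A.flat)).1
    (eta_comul_aux_right (p.tensorD_inc (b.A.amb b.str)) (Coact.compR_inc P.M b.A.multi.s) h₃ p.right_d
      (b.etaR_inc P.M))

lemma etaR_i (p : Amb P) : (b.etaR P.M).hom ≫ (p.tensor (b.A.amb b.str)).i =
    P.M.right ≫ p.i ▷ b.C.X ≫ p.O.X ◁ b.eta := by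
  have hI : (p.tensor (b.A.amb b.str)).i = inc P.M b.A.flat ≫ p.i ▷ b.A.flat.X :=
    congrArg (_ ≫ ·) ((congrArg (_ ≫ ·) (whiskerLeft_id _ _)).trans (Category.comp_id _))
  have h := (b.etaR_inc P.M =≫ p.i ▷ b.A.flat.X)
  rw [Category.assoc, Category.assoc, whisker_exchange] at h
  exact (congrArg (_ ≫ ·) hI).trans h

lemma etaR_isCom (p : Amb P) {y : ComonadStr Y} (hf : (P.tensor b.A.multi).IsMor Y.multi f)
    (h : (p.tensor (b.A.amb b.str)).IsCom y f) : p.IsCom y (b.etaR P.M ≫ f) := by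
  have hφ := b.etaR_isMor hf
  have e : p.w hφ ≫ (b.etaR P.M).hom ▷ Y.flat.X =
      (b.etaR P.M).hom ≫ (p.tensor (b.A.amb b.str)).w hf := by
    refine (cancel_mono ((p.tensor (b.A.amb b.str)).i ▷ Y.flat.X)).1 ?_
    refine eta_w_aux (k := p.κt) (η := b.eta) (τ := 𝟙 _) ?_ ((p.tensor (b.A.amb b.str)).w_i hf)
      (p.w_i hφ) p.d_coassoc p.t_eq (b.etaR_t hf) ?_
    · have h₁ := p.right_i
      refine (b.etaR_i p).trans ?_
      rw [reassoc_of% h₁, ← whiskerLeft_comp]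
      exact congrArg (fun g => p.i ≫ p.O.comon.comul ≫ g) (Category.comp_id _).symm
    · refine (b.etaR_d p).trans ?_
      exact congrArg (fun g => p.d ≫ _ ≫ g)
        ((Category.comp_id _).symm.trans (congrArg (_ ≫ ·) (id_whiskerRight _ _).symm))
  refine ⟨⟨p.w hφ, p.w_i hφ, ?_⟩, ?_⟩
  · rw [comp_hom, comp_whiskerRight, reassoc_of% e, h.w_eq hf, Category.assoc]
  · rw [comp_hom, Category.assoc, h.counit]
    exact eta_counit_aux_right (b.etaR_i p) b.eta_ε P.M.right_counit

end right

section left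
variable {P : Multi b.C D} {Y : Cell b.C D} {f : comp b.A.flat P.M ⟶ Y.flat}

lemma etaL_s (hf : (b.A.multi.tensor P).IsMor Y.multi f) :
    P.s.act ≫ b.C.X ◁ (b.etaL P.M ≫ f).hom =
      ((b.etaL P.M).hom ≫ (b.A.multi.t.compL P.M).act) ≫ b.C.X ◁ f.hom := by
  have hb : CoactPair.Bal ⟨b.C.X, b.A.multi.t.compL P.M, P.s.compR b.A.flat⟩ f := by
    rcases hf.pairs ⟨b.C.X, b.A.multi.t.compL P.M, P.s.compR b.A.flat⟩ (.inr (.inl rfl)) with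
      ⟨_, hy, _⟩ | hb
    exacts [hy.elim, hb]
  have h := b.etaL_eqv P.s
  rw [Coact.Eqv] at h
  change (b.A.multi.t.compL P.M).act ≫ b.C.X ◁ f.hom = (P.s.compR b.A.flat).act ≫ b.C.X ◁ f.hom at hb
  rw [comp_hom, whiskerLeft_comp, reassoc_of% h, ← hb, Category.assoc]

lemma etaL_isMor (hf : (b.A.multi.tensor P).IsMor Y.multi f) :
    P.IsMor Y.multi (b.etaL P.M ≫ f) where
  s := by
    refine (b.etaL_s hf).trans ?_
    rw [etaL_act, Category.assoc]
    exact (congrArg (_ ≫ ·) hf.s).trans (Category.assoc _ _ _).symm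
  t := (b.etaL_eqv P.t).comp hf.t
  pairs x hx := by
    refine .inr (CoactPair.Rel.bal (y := x.compR b.A.flat) ⟨b.etaL_eqv x.l₁, b.etaL_eqv x.l₂⟩ ?_)
    rcases hf.pairs (x.compR b.A.flat) (.inr (.inr ⟨x, hx, rfl⟩)) with ⟨_, hy, _⟩ | hb
    exacts [hy.elim, hb]

lemma etaL_d (p : Amb P) : (b.etaL P.M).hom ≫ (b.A.amb b.str).tensorD p =
    p.d ≫ p.O.X ◁ ((b.etaL P.M).hom ≫ (b.A.multi.t.compL P.M).act ≫ b.eta ▷ _) ≫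
      (α_ p.O.X b.A.flat.X (comp b.A.flat P.M).X).inv ≫ (β_ b.A.flat.X p.O.X).inv ▷ _ := by
  have h₃ := b.eta_Δ
  exact (cancel_mono ((b.A.flat.X ⊗ p.O.X) ◁ inc b.A.flat P.M)).1
    (eta_comul_aux_left ((b.A.amb b.str).tensorD_inc p) (Coact.compL_inc b.A.multi.t P.M) h₃ p.left_d
      (b.etaL_inc P.M))

lemma etaL_i (p : Amb P) : (b.etaL P.M).hom ≫ ((b.A.amb b.str).tensor p).i =
    P.M.left ≫ b.C.X ◁ p.i ≫ b.eta ▷ p.O.X := by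
  have hI : ((b.A.amb b.str).tensor p).i = inc b.A.flat P.M ≫ b.A.flat.X ◁ p.i :=
    congrArg (_ ≫ ·) ((congrArg (· ≫ _) (id_whiskerRight _ _)).trans (Category.id_comp _))
  have h := (b.etaL_inc P.M =≫ b.A.flat.X ◁ p.i)
  rw [Category.assoc, Category.assoc, ← whisker_exchange] at h
  exact (congrArg (_ ≫ ·) hI).trans h

lemma etaL_isCom (p : Amb P) {y : ComonadStr Y} (hf : (b.A.multi.tensor P).IsMor Y.multi f)
    (h : ((b.A.amb b.str).tensor p).IsCom y f) : p.IsCom y (b.etaL P.M ≫ f) := by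
  have hφ := b.etaL_isMor hf
  have e : p.w hφ ≫ (b.etaL P.M).hom ▷ Y.flat.X =
      (b.etaL P.M).hom ≫ ((b.A.amb b.str).tensor p).w hf := by
    refine (cancel_mono (((b.A.amb b.str).tensor p).i ▷ Y.flat.X)).1 ?_
    refine eta_w_aux (k := p.κs) (η := b.eta) (τ := (β_ b.A.flat.X p.O.X).inv) ?_
      (((b.A.amb b.str).tensor p).w_i hf) (p.w_i hφ) p.d_coassoc p.s_eq (b.etaL_s hf) (b.etaL_d p)
    have h₁ := p.left_i
    have n₁ := BraidedCategory.braiding_naturality_right b.C.X p.i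
    have n₂ := BraidedCategory.braiding_inv_naturality_right p.O.X b.eta
    have h₂ : P.M.left ≫ b.C.X ◁ p.i = p.i ≫ p.O.comon.comul ≫ p.O.X ◁ p.κs ≫
        (β_ b.C.X p.O.X).inv := by
      rw [← n₁] at h₁
      rw [← cancel_mono (β_ b.C.X p.O.X).hom, Category.assoc, h₁]
      simp
    refine (b.etaL_i p).trans ?_
    rw [reassoc_of% h₂, ← n₂, ← whiskerLeft_comp_assoc]
    rfl
  refine ⟨⟨p.w hφ, p.w_i hφ, ?_⟩, ?_⟩
  · rw [comp_hom, comp_whiskerRight, reassoc_of% e, h.w_eq hf, Category.assoc]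
  · rw [comp_hom, Category.assoc, h.counit]
    exact eta_counit_aux_left (b.etaL_i p) b.eta_ε P.M.left_counit

end left

lemma compR_congr {C' : Comon V} (M : Comodule C' D) {N N' : Comodule D E} {φ : N ⟶ N'} {K : V}
    {x y : Coact K N'} (h : φ.hom ≫ x.act = φ.hom ≫ y.act) :
    (compMap (𝟙 M) φ).hom ≫ (x.compR M).act = (compMap (𝟙 M) φ).hom ≫ (y.compR M).act := by
  have e := compMap_inc (𝟙 M) φ
  rw [← cancel_mono (K ◁ inc M N'), Category.assoc, Category.assoc, Coact.compR_inc,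
    Coact.compR_inc, reassoc_of% e, reassoc_of% e, ← whiskerLeft_comp_assoc, h,
    whiskerLeft_comp_assoc]

/-- Precomposition with the unit in the middle preserves 2-cells. -/
lemma whiskerLeft_etaL_isMor {P : Multi D b.C} {Q : Multi b.C E} {Y : Cell D E}
    {f : comp P.M (comp b.A.flat Q.M) ⟶ Y.flat}
    (hf : (P.tensor (b.A.multi.tensor Q)).IsMor Y.multi f) :
    (P.tensor Q).IsMor Y.multi (compMap (𝟙 P.M) (b.etaL Q.M) ≫ f) where
  s := (Coact.Eqv.compL (Multi.Coact.Eqv.id P.s) (b.etaL Q.M)).comp hf.s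
  t := (Coact.Eqv.compR (𝟙 P.M) (b.etaL_eqv Q.t)).comp hf.t
  pairs x hx := by
    refine .inr ?_
    have hp : ∀ z ∈ (P.tensor (b.A.multi.tensor Q)).pairs, z.Bal f := fun z hz => by
      rcases hf.pairs z hz with ⟨_, hy, _⟩ | hb
      exacts [hy.elim, hb]
    rcases hx with ⟨x, hx, rfl⟩ | rfl | ⟨x, hx, rfl⟩
    · exact CoactPair.Rel.bal
        (CoactPair.Rel.compL ⟨Multi.Coact.Eqv.id x.l₁, Multi.Coact.Eqv.id x.l₂⟩ _)
        (hp _ (.inl ⟨x, hx, rfl⟩))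
    · have h₁ := hp _ (.inr (.inl rfl))
      have h₂ := hp _ (.inr (.inr ⟨_, .inr (.inl rfl), rfl⟩))
      have e₁ := Coact.Eqv.compL (Multi.Coact.Eqv.id P.t) (b.etaL Q.M)
      have e₂ := Coact.Eqv.compR (𝟙 P.M) (b.etaL_eqv Q.s)
      have e₃ := compR_congr P.M (b.etaL_act Q.M)
      simp only [CoactPair.Bal, Coact.Eqv] at h₁ h₂ e₁ e₂ ⊢
      rw [comp_hom, whiskerLeft_comp, reassoc_of% e₁, reassoc_of% e₂, h₁, ← h₂,
        reassoc_of% e₃]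
    · exact CoactPair.Rel.bal (CoactPair.Rel.compR (𝟙 P.M) ⟨b.etaL_eqv x.l₁, b.etaL_eqv x.l₂⟩)
        (hp _ (.inr (.inr ⟨_, .inr (.inr ⟨x, hx, rfl⟩), rfl⟩)))

end QuantumCategory

end QuantumModules

namespace QuantumModules
open Comodule

variable {V : Type u} [Category.{v} V] [MonoidalCategory V] [BraidedCategory V]
  [HasCoreflexiveEqualizers V]
  [∀ X : V, Comonad.PreservesLimitOfIsCoreflexivePair (tensorLeft X)]

lemma Multi.IsMor.of_mk_eq {C D : Comon V} {M : Comodule C D} {s : Coact C.X M} {t : Coact D.X M}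
    {S S' : Set (CoactPair M)} (h : Multi.mk M s t S = Multi.mk M s t S') :
    Multi.IsMor ⟨M, s, t, S⟩ ⟨M, s, t, S'⟩ (𝟙 M) := by
  have e : S = S' := by injection h
  subst e
  exact .id _

lemma Multi.IsMor.congr {C D : Comon V} {P Q : Multi C D} {φ ψ : P.M ⟶ Q.M} (h : P.IsMor Q φ)
    (e : φ = ψ) : P.IsMor Q ψ := e ▸ h

namespace Path

/-- The comodule `X₁ ⊗ (X₂ ⊗ ⋯)` with its coactions. -/
noncomputable def mm : {C D : Comon V} → Path C D → Multi C D
  | _, _, single X => X.multi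
  | _, _, cons X p => X.multi.tensor p.mm

/-- The identity. -/
noncomputable def domIso : {C D : Comon V} → (p : Path C D) → (p.dom ≅ p.mm.M)
  | _, _, single _ => Iso.refl _
  | _, _, cons X p => whiskerLeftComodIso X.flat p.domIso

lemma domIso_hom_isMor : {C D : Comon V} → (p : Path C D) → p.mc.IsMor p.mm p.domIso.hom
  | _, _, single X => .of_mk_eq (single_mc X)
  | _, _, cons X p => by
    exact ((Multi.IsMor.of_mk_eq (cons_mc X p)).comp ((Multi.IsMor.id X.multi).tensor
      p.domIso_hom_isMor)).congr (Category.id_comp _)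

lemma domIso_inv_isMor : {C D : Comon V} → (p : Path C D) → p.mm.IsMor p.mc p.domIso.inv
  | _, _, single X => .of_mk_eq (single_mc X).symm
  | _, _, cons X p => by
    exact (((Multi.IsMor.id X.multi).tensor p.domIso_inv_isMor).comp
      (Multi.IsMor.of_mk_eq (cons_mc X p).symm)).congr (Category.comp_id _)

end Path

section boundary
variable {C D E F : Comon V}

lemma isCell_two {X : Cell C D} {Y : Cell D E} {Z : Cell C E} {f : comp X.flat Y.flat ⟶ Z.flat} :
    IsCell₂ (.two X Y) Z f ↔ (X.multi.tensor Y.multi).IsMor Z.multi f := by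
  have e : (Path.two X Y).domIso = Iso.refl _ := by
    ext1; exact compMap_id _ _
  have h₁ := (Path.two X Y).domIso_hom_isMor
  have h₂ := (Path.two X Y).domIso_inv_isMor
  rw [e] at h₁ h₂
  exact isCell₂_iff.trans ⟨fun h => (h₂.comp h).congr (Category.id_comp _),
    fun h => (h₁.comp h).congr (Category.id_comp _)⟩

lemma isCell_three {X : Cell C D} {Y : Cell D E} {Z : Cell E F} {W : Cell C F}
    {f : comp X.flat (comp Y.flat Z.flat) ⟶ W.flat} : IsCell₂ (.three X Y Z) W f ↔
      (X.multi.tensor (Y.multi.tensor Z.multi)).IsMor W.multi f := by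
  have e : (Path.three X Y Z).domIso = Iso.refl _ := by
    ext1
    have : compMap (𝟙 Y.flat) (𝟙 Z.flat) = 𝟙 _ := compMap_id _ _
    exact (congrArg (compMap (𝟙 X.flat)) this).trans (compMap_id _ _)
  have h₁ := (Path.three X Y Z).domIso_hom_isMor
  have h₂ := (Path.three X Y Z).domIso_inv_isMor
  rw [e] at h₁ h₂
  exact isCell₂_iff.trans ⟨fun h => (h₂.comp h).congr (Category.id_comp _),
    fun h => (h₁.comp h).congr (Category.id_comp _)⟩

lemma isComonadCell_two {X : Cell C D} {Y : Cell D E} {Z : Cell C E} {k : ComonadStr X}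
    {l : ComonadStr Y} {z : ComonadStr Z} {f : comp X.flat Y.flat ⟶ Z.flat} :
    IsComonadCell (.two X Y) (k, l) Z z f ↔ ((X.amb k).tensor (Y.amb l)).IsCom z f := by
  have hi : (Path.two X Y).incl = ((X.amb k).tensor (Y.amb l)).i := by
    refine congrArg (inc X.flat Y.flat ≫ ·) ?_
    exact (Category.id_comp _).symm.trans (congrArg (· ≫ _) (id_whiskerRight _ _).symm)
  constructor
  · rintro ⟨⟨d, w, h₁, h₂, h₃⟩, h₄⟩
    rw [hi] at h₁ h₂ h₄
    have hd : d = ((X.amb k).tensor (Y.amb l)).d :=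
      (cancel_mono (((X.amb k).tensor (Y.amb l)).O.X ◁ ((X.amb k).tensor (Y.amb l)).i)).1
        (h₁.trans ((X.amb k).tensor (Y.amb l)).d_i.symm)
    subst hd
    exact ⟨⟨w, h₂, h₃⟩, h₄⟩
  · rintro ⟨⟨w, h₂, h₃⟩, h₄⟩
    refine ⟨⟨((X.amb k).tensor (Y.amb l)).d, w, ?_, ?_, h₃⟩, ?_⟩
    · rw [hi]; exact ((X.amb k).tensor (Y.amb l)).d_i
    · rw [hi]; exact h₂
    · rw [hi]; exact h₄

lemma isComonadCell_three {X : Cell C D} {Y : Cell D E} {Z : Cell E F} {W : Cell C F}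
    {k : ComonadStr X} {l : ComonadStr Y} {m : ComonadStr Z} {z : ComonadStr W}
    {f : comp X.flat (comp Y.flat Z.flat) ⟶ W.flat} :
    IsComonadCell (.three X Y Z) (k, l, m) W z f ↔
      ((X.amb k).tensor ((Y.amb l).tensor (Z.amb m))).IsCom z f := by
  have hj : (Path.two Y Z).incl = ((Y.amb l).tensor (Z.amb m)).i := by
    refine congrArg (inc Y.flat Z.flat ≫ ·) ?_
    exact (Category.id_comp _).symm.trans (congrArg (· ≫ _) (id_whiskerRight _ _).symm)
  have hi : (Path.three X Y Z).incl = ((X.amb k).tensor ((Y.amb l).tensor (Z.amb m))).i := by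
    refine congrArg (inc X.flat (comp Y.flat Z.flat) ≫ ·) ?_
    refine (congrArg (X.X ◁ ·) hj).trans ?_
    exact (Category.id_comp _).symm.trans (congrArg (· ≫ _) (id_whiskerRight _ _).symm)
  constructor
  · rintro ⟨⟨d, w, h₁, h₂, h₃⟩, h₄⟩
    rw [hi] at h₁ h₂ h₄
    have hd : d = ((X.amb k).tensor ((Y.amb l).tensor (Z.amb m))).d :=
      (cancel_mono (((X.amb k).tensor ((Y.amb l).tensor (Z.amb m))).O.X ◁
        ((X.amb k).tensor ((Y.amb l).tensor (Z.amb m))).i)).1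
        (h₁.trans ((X.amb k).tensor ((Y.amb l).tensor (Z.amb m))).d_i.symm)
    subst hd
    exact ⟨⟨w, h₂, h₃⟩, h₄⟩
  · rintro ⟨⟨w, h₂, h₃⟩, h₄⟩
    refine ⟨⟨((X.amb k).tensor ((Y.amb l).tensor (Z.amb m))).d, w, ?_, ?_, h₃⟩, ?_⟩
    · rw [hi]; exact ((X.amb k).tensor ((Y.amb l).tensor (Z.amb m))).d_i
    · rw [hi]; exact h₂
    · rw [hi]; exact h₄

/-- `T` is universal among the targets of 2-cells out of `P`. -/
structure Multi.IsLan (P : Multi C D) (T : Cell C D) (u : P.M ⟶ T.flat) : Prop where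
  cell : P.IsMor T.multi u
  desc : ∀ (Y : Cell C D) (f : P.M ⟶ Y.flat), P.IsMor Y.multi f →
    ∃! φ : T ⟶ Y, u ≫ Cell.flatMap φ = f

lemma Path.isLan_iff {p : Path C D} {T : Cell C D} {u : p.mm.M ⟶ T.flat} :
    p.mm.IsLan T u ↔ QuantumModules.IsLan p T (p.domIso.hom ≫ u) := by
  have e : ∀ {Y : Cell C D} {f : p.mm.M ⟶ Y.flat},
      p.mm.IsMor Y.multi f ↔ IsCell₂ p Y (p.domIso.hom ≫ f) := fun {Y f} => by
    rw [isCell₂_iff]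
    exact ⟨fun h => p.domIso_hom_isMor.comp h, fun h => (p.domIso_inv_isMor.comp h).congr
      ((Category.assoc _ _ _).symm.trans
        ((congrArg (· ≫ f) p.domIso.inv_hom_id).trans (Category.id_comp _)))⟩
  constructor
  · intro h
    refine ⟨e.1 h.cell, fun Y f hf => ?_⟩
    obtain ⟨φ, h₁, h₂⟩ := h.desc Y (p.domIso.inv ≫ f) (e.2 (by rwa [Iso.hom_inv_id_assoc]))
    refine ⟨φ, ?_, fun ψ hψ => h₂ ψ ?_⟩
    · dsimp only
      rw [Category.assoc, h₁, Iso.hom_inv_id_assoc]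
    · dsimp only at hψ ⊢
      rw [← hψ, Category.assoc, Iso.inv_hom_id_assoc]
  · intro h
    refine ⟨e.2 h.cell, fun Y f hf => ?_⟩
    obtain ⟨φ, h₁, h₂⟩ := h.desc Y (p.domIso.hom ≫ f) (e.1 hf)
    refine ⟨φ, ?_, fun ψ hψ => h₂ ψ ?_⟩
    · rw [Category.assoc] at h₁
      exact (cancel_epi _).1 h₁
    · dsimp only at hψ ⊢
      rw [Category.assoc, hψ]

lemma Multi.IsLan.hom_ext {P : Multi C D} {T : Cell C D} {u : P.M ⟶ T.flat} (h : P.IsLan T u)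
    {Y : Cell C D} {φ ψ : T ⟶ Y} (e : u ≫ Cell.flatMap φ = u ≫ Cell.flatMap ψ) : φ = ψ := by
  obtain ⟨_, _, h₂⟩ := h.desc Y (u ≫ Cell.flatMap ψ) (h.cell.comp (flatMap_isMor ψ))
  exact (h₂ φ e).trans (h₂ ψ rfl).symm

end boundary

/-- Strings with a hole. -/
inductive Ctx (C D : Comon V) : Comon V → Comon V → Type (max u v)
  | hole : Ctx C D C D
  | app {E : Comon V} (q : Path D E) : Ctx C D C E
  | cons {B A E : Comon V} (X : Cell B A) (c : Ctx C D A E) : Ctx C D B E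

namespace Ctx
variable {C D : Comon V}

/-- Put a string into the hole. -/
def fill (p : Path C D) : {A B : Comon V} → Ctx C D A B → Path A B
  | _, _, hole => p
  | _, _, app q => p.append q
  | _, _, cons X c => .cons X (c.fill p)

/-- All members of the string are in `𝒳`. -/
def All (𝒳 : ∀ C D : Comon V, Cell C D → Prop) : {A B : Comon V} → Ctx C D A B → Prop
  | _, _, hole => True
  | _, _, app q => q.All 𝒳
  | _, _, cons X c => 𝒳 _ _ X ∧ c.All 𝒳

/-- Put a comodule with coactions into the hole. -/
noncomputable def multi (P : Multi C D) : {A B : Comon V} → Ctx C D A B → Multi A B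
  | _, _, hole => P
  | _, _, app q => P.tensor q.mm
  | _, _, cons X c => X.multi.tensor (c.multi P)

/-- Put a map into the hole. -/
noncomputable def map {P Q : Multi C D} (φ : P.M ⟶ Q.M) : {A B : Comon V} → (c : Ctx C D A B) →
    ((c.multi P).M ⟶ (c.multi Q).M)
  | _, _, hole => φ
  | _, _, app q => compMap φ (𝟙 q.mm.M)
  | _, _, cons X c => compMap (𝟙 X.flat) (c.map φ)

lemma map_comp {P Q R : Multi C D} (φ : P.M ⟶ Q.M) (ψ : Q.M ⟶ R.M) : {A B : Comon V} →
    (c : Ctx C D A B) → c.map (P := P) (Q := R) (φ ≫ ψ) = c.map φ ≫ c.map ψ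
  | _, _, hole => rfl
  | _, _, app q => by
    have := compMap_comp φ ψ (𝟙 q.mm.M) (𝟙 q.mm.M)
    rw [Category.comp_id] at this
    exact this
  | _, _, cons X c => by
    have := compMap_comp (𝟙 X.flat) (𝟙 X.flat) (c.map φ) (c.map ψ)
    rw [Category.comp_id, ← map_comp] at this
    exact this

lemma map_isMor {P Q : Multi C D} {φ : P.M ⟶ Q.M} (h : P.IsMor Q φ) : {A B : Comon V} →
    (c : Ctx C D A B) → (c.multi P).IsMor (c.multi Q) (c.map φ)
  | _, _, hole => h
  | _, _, app q => h.tensor (.id _)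
  | _, _, cons X c => (Multi.IsMor.id X.multi).tensor (c.map_isMor h)

lemma fill_all {𝒳 : ∀ C D : Comon V, Cell C D → Prop} {p : Path C D} (hp : p.All 𝒳) :
    {A B : Comon V} → (c : Ctx C D A B) → c.All 𝒳 → (c.fill p).All 𝒳
  | _, _, hole, _ => hp
  | _, _, app q, h => by
    induction p with
    | single X => exact ⟨hp, h⟩
    | cons X p ih => exact ⟨hp.1, ih hp.2 q h⟩
  | _, _, cons X c, h => ⟨h.1, c.fill_all hp h.2⟩

end Ctx

namespace Path

/-- Rebracketing of a concatenated string into two blocks. -/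
noncomputable def appendIso : {C D E : Comon V} → (p : Path C D) → (q : Path D E) →
    ((p.append q).mm.M ≅ (p.mm.tensor q.mm).M)
  | _, _, _, single X, q => Iso.refl (comp X.flat q.mm.M)
  | _, _, _, cons X p, q =>
    whiskerLeftComodIso X.flat (appendIso p q) ≪≫ assocIso X.flat p.mm.M q.mm.M

lemma appendIso_hom_isMor : {C D E : Comon V} → (p : Path C D) → (q : Path D E) →
    (p.append q).mm.IsMor (p.mm.tensor q.mm) (appendIso p q).hom
  | _, _, _, single X, q => .id _
  | _, _, _, cons X p, q => ((Multi.IsMor.id X.multi).tensor (appendIso_hom_isMor p q)).comp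
      (.assocInv _ _ _)

lemma appendIso_inv_isMor : {C D E : Comon V} → (p : Path C D) → (q : Path D E) →
    (p.mm.tensor q.mm).IsMor (p.append q).mm (appendIso p q).inv
  | _, _, _, single X, q => .id _
  | _, _, _, cons X p, q => (Multi.IsMor.assocHom _ _ _).comp
      ((Multi.IsMor.id X.multi).tensor (appendIso_inv_isMor p q))

lemma appendHom_domIso : {C D E : Comon V} → (p : Path C D) → (q : Path D E) →
    appendHom p q ≫ compMap p.domIso.hom q.domIso.hom = (p.append q).domIso.hom ≫ (appendIso p q).hom
  | _, _, _, single X, q => (Category.id_comp _).trans (Category.comp_id _).symm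
  | _, _, _, cons X p, q => by
    have ih := appendHom_domIso p q
    have n := assocInv_naturality (𝟙 X.flat) p.domIso.hom q.domIso.hom
    change (compMap (𝟙 X.flat) (appendHom p q) ≫ assocInv X.flat p.dom q.dom) ≫
      compMap (compMap (𝟙 X.flat) p.domIso.hom) q.domIso.hom =
      compMap (𝟙 X.flat) (p.append q).domIso.hom ≫ compMap (𝟙 X.flat) (appendIso p q).hom ≫
        assocInv X.flat p.mm.M q.mm.M
    rw [Category.assoc, ← n, ← Category.assoc, ← Category.assoc, ← compMap_comp, ← compMap_comp]
    exact congrArg (fun g => compMap (𝟙 _ ≫ 𝟙 _) g ≫ _) ih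

/-- The trivial substitution. -/
noncomputable def idSubst : {C D : Comon V} → (p : Path C D) → Subst p p
  | _, _, single X => .single (p := .single X) (𝟙 X.flat)
  | _, _, cons X p => .cons (p := .single X) (𝟙 X.flat) (idSubst p)

lemma idSubst_map : {C D : Comon V} → (p : Path C D) → p.idSubst.map = 𝟙 p.dom
  | _, _, single X => rfl
  | _, _, cons X p => by
    change 𝟙 _ ≫ compMap (𝟙 X.flat) p.idSubst.map = _
    rw [idSubst_map p, compMap_id]
    exact Category.id_comp _

end Path

lemma isLan_id {C D : Comon V} (X : Cell C D) : IsLan (.single X) X (𝟙 X.flat) := by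
  have e : (Path.single X).domIso.hom ≫ 𝟙 X.flat = 𝟙 X.flat := Category.id_comp _
  exact e ▸ (Path.isLan_iff (p := .single X) (T := X) (u := 𝟙 X.flat)).1
    ⟨.id _, fun Y f hf => ⟨Cell.homOfFlat f hf, Category.id_comp _, fun ψ hψ =>
      Cell.flatMap_injective ((Category.id_comp _).symm.trans hψ)⟩⟩

lemma Path.idSubst_allLan : {C D : Comon V} → (p : Path C D) → p.idSubst.AllLan
  | _, _, single X => isLan_id X
  | _, _, cons X p => ⟨isLan_id X, p.idSubst_allLan⟩

namespace Ctx
variable {C D : Comon V}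

/-- The comodule underlying a filled string. -/
noncomputable def fillIso (p : Path C D) : {A B : Comon V} → (c : Ctx C D A B) →
    ((c.fill p).mm.M ≅ (c.multi p.mm).M)
  | _, _, hole => Iso.refl _
  | _, _, app q => p.appendIso q
  | _, _, cons X c => whiskerLeftComodIso X.flat (c.fillIso p)

lemma fillIso_hom_isMor (p : Path C D) : {A B : Comon V} → (c : Ctx C D A B) →
    (c.fill p).mm.IsMor (c.multi p.mm) (c.fillIso p).hom
  | _, _, hole => .id _
  | _, _, app q => p.appendIso_hom_isMor q
  | _, _, cons X c => (Multi.IsMor.id X.multi).tensor (c.fillIso_hom_isMor p)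

lemma fillIso_inv_isMor (p : Path C D) : {A B : Comon V} → (c : Ctx C D A B) →
    (c.multi p.mm).IsMor (c.fill p).mm (c.fillIso p).inv
  | _, _, hole => .id _
  | _, _, app q => p.appendIso_inv_isMor q
  | _, _, cons X c => (Multi.IsMor.id X.multi).tensor (c.fillIso_inv_isMor p)

/-- Substitution in the hole. -/
noncomputable def subst {p : Path C D} {T : Cell C D} (u : p.mm.M ⟶ T.flat) : {A B : Comon V} →
    (c : Ctx C D A B) → Subst (c.fill p) (c.fill (.single T))
  | _, _, hole => .single (p.domIso.hom ≫ u)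
  | _, _, app q => .cons (p.domIso.hom ≫ u) q.idSubst
  | _, _, cons X c => .cons (p := .single X) (𝟙 X.flat) (c.subst u)

lemma subst_allLan {p : Path C D} {T : Cell C D} {u : p.mm.M ⟶ T.flat} (h : p.mm.IsLan T u) :
    {A B : Comon V} → (c : Ctx C D A B) → (c.subst u).AllLan
  | _, _, hole => Path.isLan_iff.1 h
  | _, _, app q => ⟨Path.isLan_iff.1 h, q.idSubst_allLan⟩
  | _, _, cons X c => ⟨isLan_id X, c.subst_allLan h⟩

lemma subst_map {p : Path C D} {T : Cell C D} (u : p.mm.M ⟶ T.flat) :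
    {A B : Comon V} → (c : Ctx C D A B) →
    (c.subst u).map ≫ (c.fill (.single T)).domIso.hom ≫ (c.fillIso (.single T)).hom =
      (c.fill p).domIso.hom ≫ (c.fillIso p).hom ≫ c.map (P := p.mm) (Q := T.multi) u
  | _, _, hole => by
    change (p.domIso.hom ≫ u) ≫ 𝟙 _ ≫ 𝟙 _ = p.domIso.hom ≫ 𝟙 _ ≫ u
    simp
  | _, _, app q => by
    have h := p.appendHom_domIso q
    change (p.appendHom q ≫ compMap (p.domIso.hom ≫ u) q.idSubst.map) ≫
      compMap (𝟙 T.flat) q.domIso.hom ≫ 𝟙 _ = (p.append q).domIso.hom ≫ (p.appendIso q).hom ≫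
        compMap u (𝟙 q.mm.M)
    rw [Path.idSubst_map, ← Category.assoc _ (p.appendIso q).hom, ← h, Category.comp_id, Category.assoc,
      Category.assoc, ← compMap_comp, ← compMap_comp, Category.comp_id, Category.comp_id,
      Category.id_comp]
  | _, _, cons X c => by
    have ih := subst_map u c
    change (𝟙 _ ≫ compMap (𝟙 X.flat) (c.subst u).map) ≫
      compMap (𝟙 X.flat) (c.fill (.single T)).domIso.hom ≫
        compMap (𝟙 X.flat) (c.fillIso (.single T)).hom =
      compMap (𝟙 X.flat) (c.fill p).domIso.hom ≫ compMap (𝟙 X.flat) (c.fillIso p).hom ≫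
        compMap (𝟙 X.flat) (c.map u)
    refine (congrArg (· ≫ _) (Category.id_comp _)).trans ?_
    rw [← compMap_comp, ← compMap_comp, ← compMap_comp, ← compMap_comp, ih]
    rfl

/-- Kan extensions may be computed in a part of a string. -/
theorem isLan_map {𝒳 : ∀ C D : Comon V, Cell C D → Prop} (h𝒳 : Admissible 𝒳) {p : Path C D}
    (hp : p.All 𝒳) {T : Cell C D} (hT : 𝒳 C D T) {u : p.mm.M ⟶ T.flat} (hu : p.mm.IsLan T u)
    {A B : Comon V} (c : Ctx C D A B) (hc : c.All 𝒳) {Y : Cell A B}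
    {f : (c.multi p.mm).M ⟶ Y.flat} (hf : (c.multi p.mm).IsMor Y.multi f) :
    ∃! g : (c.multi T.multi).M ⟶ Y.flat, (c.multi T.multi).IsMor Y.multi g ∧
      c.map (P := p.mm) (Q := T.multi) u ≫ g = f := by
  obtain ⟨W, w, hw⟩ := h𝒳.lan (c.fill p) (c.fill_all hp hc)
  obtain ⟨W', w', hw'⟩ := h𝒳.lan (c.fill (.single T)) (c.fill_all (p := .single T) hT hc)
  obtain ⟨b, hb⟩ := h𝒳.assoc _ _ (c.subst u) (c.fill_all hp hc) (c.subst_allLan hu) W W' w w' hw hw'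
  obtain ⟨j, hs, i₃, i₄⟩ : ∃ j : (c.fill (.single T)).mm.M ≅ (c.multi T.multi).M,
      (c.subst u).map ≫ (c.fill (.single T)).domIso.hom ≫ j.hom =
        (c.fill p).domIso.hom ≫ (c.fillIso p).hom ≫ c.map (P := p.mm) (Q := T.multi) u ∧
      (c.fill (.single T)).mm.IsMor (c.multi T.multi) j.hom ∧
      (c.multi T.multi).IsMor (c.fill (.single T)).mm j.inv :=
    ⟨c.fillIso (.single T), c.subst_map u, c.fillIso_hom_isMor (.single T),
      c.fillIso_inv_isMor (.single T)⟩
  have hmc : IsCell₂ (c.fill p) Y ((c.fill p).domIso.hom ≫ (c.fillIso p).hom ≫ f) :=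
    isCell₂_iff.2 ((c.fill p).domIso_hom_isMor.comp ((c.fillIso_hom_isMor p).comp hf))
  obtain ⟨φ, hφ, hφ'⟩ := hw.desc Y _ hmc
  have i₁ := (c.fill (.single T)).domIso_hom_isMor
  have i₂ := (c.fill (.single T)).domIso_inv_isMor
  have hcell : ∀ g : (c.multi T.multi).M ⟶ Y.flat, (c.multi T.multi).IsMor Y.multi g →
      ∃ ψ : W ⟶ Y, (c.fill (.single T)).domIso.hom ≫ j.hom ≫ g =
        w' ≫ Cell.flatMap b.inv ≫ Cell.flatMap ψ := fun g hg => by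
    obtain ⟨ψ, hψ, _⟩ := hw'.desc Y _ (isCell₂_iff.2 (i₁.comp (i₃.comp hg)))
    refine ⟨b.hom ≫ ψ, hψ.symm.trans ?_⟩
    rw [← Cell.flatMap_comp, Iso.inv_hom_id_assoc]
  have key : ∀ (g : (c.multi T.multi).M ⟶ Y.flat) (ψ : W ⟶ Y),
      (c.fill (.single T)).domIso.hom ≫ j.hom ≫ g =
        w' ≫ Cell.flatMap b.inv ≫ Cell.flatMap ψ →
      (c.fill p).domIso.hom ≫ (c.fillIso p).hom ≫ c.map (P := p.mm) (Q := T.multi) u ≫ g =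
        w ≫ Cell.flatMap ψ := fun g ψ h => by
    have h' := hs =≫ g
    simp only [Category.assoc] at h'
    rw [h] at h'
    refine h'.symm.trans ?_
    rw [← Category.assoc, ← hb, Category.assoc, ← Category.assoc (Cell.flatMap b.hom),
      ← Cell.flatMap_comp, Iso.hom_inv_id, Cell.flatMap_id, Category.id_comp]
  let g₀ : (c.multi T.multi).M ⟶ Y.flat := j.inv ≫
    (c.fill (.single T)).domIso.inv ≫ w' ≫ Cell.flatMap b.inv ≫ Cell.flatMap φ
  have hg₀ : (c.fill (.single T)).domIso.hom ≫ j.hom ≫ g₀ =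
      w' ≫ Cell.flatMap b.inv ≫ Cell.flatMap φ := by simp [g₀]
  refine ⟨g₀, ⟨?_, ?_⟩, ?_⟩
  · exact i₄.comp (i₂.comp ((isCell₂_iff.1 hw'.cell).comp ((flatMap_isMor _).comp (flatMap_isMor _))))
  · have := (key _ _ hg₀).trans hφ
    rwa [cancel_epi, cancel_epi] at this
  · rintro g ⟨hg, hg'⟩
    obtain ⟨ψ, hψ⟩ := hcell g hg
    have h₁ := key g ψ hψ
    rw [hg'] at h₁
    have h₂ := hφ' ψ h₁.symm
    subst h₂
    rw [← hg₀, cancel_epi, cancel_epi] at hψ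
    exact hψ

end Ctx

end QuantumModules

namespace QuantumModules
open Comodule

variable {V : Type u} [Category.{v} V] [MonoidalCategory V]

namespace Comodule
variable {C D E F : Comon V}

/-- Forget the right coaction. -/
def forgetR (M : Comodule C D) : Comodule C (Comon.trivial V) where
  X := M.X
  left := M.left
  right := (ρ_ _).inv
  left_counit := M.left_counit
  left_coassoc := M.left_coassoc
  right_counit := (congrArg (_ ≫ ·) (whiskerLeft_id _ _)).trans (Category.comp_id _)
  right_coassoc := by
    change (ρ_ M.X).inv ≫ (ρ_ M.X).inv ▷ 𝟙_ V = (ρ_ M.X).inv ≫ M.X ◁ (λ_ (𝟙_ V)).inv ≫ (α_ _ _ _).inv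
    monoidal
  left_right := by
    change M.left ≫ C.X ◁ (ρ_ M.X).inv = (ρ_ M.X).inv ≫ M.left ▷ 𝟙_ V ≫ (α_ _ _ _).hom
    monoidal

/-- Forget the left coaction. -/
def forgetL (M : Comodule C D) : Comodule (Comon.trivial V) D where
  X := M.X
  left := (λ_ _).inv
  right := M.right
  left_counit := (congrArg (_ ≫ ·) (id_whiskerRight _ _)).trans (Category.comp_id _)
  left_coassoc := by
    change (λ_ M.X).inv ≫ 𝟙_ V ◁ (λ_ M.X).inv = (λ_ M.X).inv ≫ (λ_ (𝟙_ V)).inv ▷ M.X ≫ (α_ _ _ _).hom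
    monoidal
  right_counit := M.right_counit
  right_coassoc := M.right_coassoc
  left_right := by
    change (λ_ M.X).inv ≫ 𝟙_ V ◁ M.right = M.right ≫ (λ_ M.X).inv ▷ D.X ≫ (α_ _ _ _).hom
    monoidal

/-- Forget the right coaction. -/
def forgetRMap {M N : Comodule C D} (f : M ⟶ N) : M.forgetR ⟶ N.forgetR where
  hom := f.hom
  left_comm := f.left_comm
  right_comm := by
    change f.hom ≫ (ρ_ N.X).inv = (ρ_ M.X).inv ≫ f.hom ▷ 𝟙_ V
    monoidal

/-- Forget the left coaction. -/
def forgetLMap {M N : Comodule C D} (f : M ⟶ N) : M.forgetL ⟶ N.forgetL where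
  hom := f.hom
  left_comm := by
    change f.hom ≫ (λ_ N.X).inv = (λ_ M.X).inv ≫ 𝟙_ V ◁ f.hom
    monoidal
  right_comm := f.right_comm

/-- A reflexive coequalizer of comodules that is preserved by the forgetful functor to `𝒱`. -/
structure RCoeq {M N L : Comodule C D} (f g : M ⟶ N) (π : N ⟶ L) : Prop where
  w : f ≫ π = g ≫ π
  refl : ∃ s : N ⟶ M, s ≫ f = 𝟙 N ∧ s ≫ g = 𝟙 N
  desc : ∀ {W : V} (k : N.X ⟶ W), f.hom ≫ k = g.hom ≫ k → ∃! k' : L.X ⟶ W, π.hom ≫ k' = k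

namespace RCoeq
variable {M N L : Comodule C D} {f g : M ⟶ N} {π : N ⟶ L}

lemma w_hom (h : RCoeq f g π) : f.hom ≫ π.hom = g.hom ≫ π.hom := congrArg Hom.hom h.w

lemma epi (h : RCoeq f g π) : Epi π.hom where
  left_cancellation k k' e :=
    (h.desc (π.hom ≫ k') (by rw [reassoc_of% h.w_hom])).unique e rfl

lemma exists_desc (h : RCoeq f g π) {Z : Comodule C D} (k : N ⟶ Z) (hk : f ≫ k = g ≫ k) :
    ∃ k' : L ⟶ Z, π ≫ k' = k := by
  obtain ⟨k', e, _⟩ := h.desc k.hom (congrArg Hom.hom hk)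
  have := h.epi
  have h₁ := π.left_comm
  have h₂ := π.right_comm
  have h₃ := k.left_comm
  have h₄ := k.right_comm
  exact ⟨⟨k', by
    rw [← cancel_epi π.hom, reassoc_of% e, reassoc_of% h₁, ← whiskerLeft_comp, e, h₃], by
    rw [← cancel_epi π.hom, reassoc_of% e, reassoc_of% h₂, ← comp_whiskerRight, e, h₄]⟩, hom_ext e⟩

lemma hom_ext (h : RCoeq f g π) {Z : Comodule C D} {k k' : L ⟶ Z} (e : π ≫ k = π ≫ k') : k = k' := by
  have := h.epi
  exact Comodule.hom_ext ((cancel_epi π.hom).1 (congrArg Hom.hom e))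

lemma of_iso {M' N' L' : Comodule C D} {f' g' : M' ⟶ N'} {π' : N' ⟶ L'} (h : RCoeq f g π)
    (a : M ≅ M') (b : N ≅ N') (c : L ≅ L') (hf : a.hom ≫ f' = f ≫ b.hom)
    (hg : a.hom ≫ g' = g ≫ b.hom) (hπ : b.hom ≫ π' = π ≫ c.hom) : RCoeq f' g' π' := by
  have hf' : f' = a.inv ≫ f ≫ b.hom := by rw [← hf, Iso.inv_hom_id_assoc]
  have hg' : g' = a.inv ≫ g ≫ b.hom := by rw [← hg, Iso.inv_hom_id_assoc]
  have hπ' : π' = b.inv ≫ π ≫ c.hom := by rw [← hπ, Iso.inv_hom_id_assoc]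
  have c₁ : c.hom.hom ≫ c.inv.hom = 𝟙 _ := congrArg Hom.hom c.hom_inv_id
  have c₂ : c.inv.hom ≫ c.hom.hom = 𝟙 _ := congrArg Hom.hom c.inv_hom_id
  have b₁ : b.hom.hom ≫ b.inv.hom = 𝟙 _ := congrArg Hom.hom b.hom_inv_id
  have b₂ : b.inv.hom ≫ b.hom.hom = 𝟙 _ := congrArg Hom.hom b.inv_hom_id
  have a₁ : a.hom.hom ≫ a.inv.hom = 𝟙 _ := congrArg Hom.hom a.hom_inv_id
  refine ⟨?_, ?_, fun {W} k hk => ?_⟩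
  · rw [hf', hg', hπ']
    simp only [Category.assoc, Iso.hom_inv_id_assoc, reassoc_of% h.w]
  · obtain ⟨s, h₁, h₂⟩ := h.refl
    exact ⟨b.inv ≫ s ≫ a.hom, by rw [hf']; simp [reassoc_of% h₁],
      by rw [hg']; simp [reassoc_of% h₂]⟩
  · have e₁ : f.hom ≫ b.hom.hom = a.hom.hom ≫ f'.hom := congrArg Hom.hom hf.symm
    have e₂ : g.hom ≫ b.hom.hom = a.hom.hom ≫ g'.hom := congrArg Hom.hom hg.symm
    have e₃ : b.hom.hom ≫ π'.hom = π.hom ≫ c.hom.hom := congrArg Hom.hom hπ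
    obtain ⟨k', h₁, h₂⟩ := h.desc (b.hom.hom ≫ k) (by
      rw [reassoc_of% e₁, reassoc_of% e₂, hk])
    refine ⟨c.inv.hom ≫ k', ?_, fun l hl => ?_⟩
    · dsimp only
      have : Epi b.hom.hom := ⟨fun x y e => by
        have := congrArg (b.inv.hom ≫ ·) e
        simpa [reassoc_of% b₂] using this⟩
      rw [← cancel_epi b.hom.hom, reassoc_of% e₃, reassoc_of% c₁, h₁]
    · have := h₂ (c.hom.hom ≫ l) (by
        dsimp only at hl ⊢
        rw [← reassoc_of% e₃, hl])
      rw [← this, reassoc_of% c₂]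

lemma isColimit (h : RCoeq f g π) : Nonempty (IsColimit (Cofork.ofπ π h.w)) :=
  ⟨Cofork.IsColimit.ofExistsUnique fun s => by
    obtain ⟨k, hk⟩ := h.exists_desc s.π s.condition
    exact ⟨k, hk, fun l hl => h.hom_ext (hl.trans hk.symm)⟩⟩

lemma forgetR (h : RCoeq f g π) : RCoeq (forgetRMap f) (forgetRMap g) (forgetRMap π) where
  w := Comodule.hom_ext h.w_hom
  refl := by
    obtain ⟨s, h₁, h₂⟩ := h.refl
    exact ⟨forgetRMap s, Comodule.hom_ext (congrArg Hom.hom h₁ :),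
      Comodule.hom_ext (congrArg Hom.hom h₂ :)⟩
  desc := h.desc

lemma forgetL (h : RCoeq f g π) : RCoeq (forgetLMap f) (forgetLMap g) (forgetLMap π) where
  w := Comodule.hom_ext h.w_hom
  refl := by
    obtain ⟨s, h₁, h₂⟩ := h.refl
    exact ⟨forgetLMap s, Comodule.hom_ext (congrArg Hom.hom h₁ :),
      Comodule.hom_ext (congrArg Hom.hom h₂ :)⟩
  desc := h.desc

lemma exists_map (h : RCoeq f g π) (G : Comodule C D ⥤ V) [Monad.PreservesColimitOfIsReflexivePair G]
    {W : V} (k : G.obj N ⟶ W) (hk : G.map f ≫ k = G.map g ≫ k) :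
    ∃! k' : G.obj L ⟶ W, G.map π ≫ k' = k := by
  obtain ⟨s, h₁, h₂⟩ := h.refl
  have : IsReflexivePair f g := .mk' s h₁ h₂
  have := Monad.PreservesColimitOfIsReflexivePair.out (G := G) f g
  obtain ⟨c⟩ := h.isColimit
  exact Cofork.IsColimit.existsUnique (isColimitCoforkMapOfIsColimit G h.w c) k hk

variable [HasCoreflexiveEqualizers V] [BraidedCategory V]
  [∀ X : V, Comonad.PreservesLimitOfIsCoreflexivePair (tensorLeft X)]

lemma whiskerLeft (h : RCoeq f g π) {B : Comon V} (X : Comodule B C)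
    [Monad.PreservesColimitOfIsReflexivePair (tensorOnRight X)] :
    RCoeq (compMap (𝟙 X) f) (compMap (𝟙 X) g) (compMap (𝟙 X) π) where
  w := by rw [← compMap_comp, h.w, compMap_comp]
  refl := by
    obtain ⟨s, h₁, h₂⟩ := h.refl
    exact ⟨compMap (𝟙 X) s, by rw [← compMap_comp, h₁, Category.id_comp, compMap_id],
      by rw [← compMap_comp, h₂, Category.id_comp, compMap_id]⟩
  desc k hk := h.forgetR.exists_map (tensorOnRight X) k hk

lemma whiskerRight (h : RCoeq f g π) {B : Comon V} (X : Comodule D B)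
    [Monad.PreservesColimitOfIsReflexivePair (tensorOnLeft X)] :
    RCoeq (compMap f (𝟙 X)) (compMap g (𝟙 X)) (compMap π (𝟙 X)) where
  w := by rw [← compMap_comp, h.w, compMap_comp]
  refl := by
    obtain ⟨s, h₁, h₂⟩ := h.refl
    exact ⟨compMap s (𝟙 X), by rw [← compMap_comp, h₁, Category.id_comp, compMap_id],
      by rw [← compMap_comp, h₂, Category.id_comp, compMap_id]⟩
  desc k hk := h.forgetL.exists_map (tensorOnLeft X) k hk

end RCoeq

/-- A reflexive pair of comodule maps has a coequalizer preserved by the forgetful functor. -/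
lemma exists_rcoeq [HasReflexiveCoequalizers V] {M N : Comodule C D} (f g : M ⟶ N) (s : N ⟶ M)
    (h₁ : s ≫ f = 𝟙 N) (h₂ : s ≫ g = 𝟙 N) : ∃ (L : Comodule C D) (π : N ⟶ L), RCoeq f g π := by
  have r : IsReflexivePair f.hom g.hom :=
    .mk' s.hom (congrArg Hom.hom h₁) (congrArg Hom.hom h₂)
  have hc := HasReflexiveCoequalizers.has_coeq f.hom g.hom
  let p := coequalizer.π f.hom g.hom
  have hp : f.hom ≫ p = g.hom ≫ p := coequalizer.condition _ _
  have hd : ∀ {W : V} (k : N.X ⟶ W), f.hom ≫ k = g.hom ≫ k →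
      ∃! k' : coequalizer f.hom g.hom ⟶ W, p ≫ k' = k := fun k hk =>
    ⟨coequalizer.desc k hk, coequalizer.π_desc _ _, fun l hl => coequalizer.hom_ext
      (hl.trans (coequalizer.π_desc _ _).symm)⟩
  have hf₁ := f.left_comm
  have hg₁ := g.left_comm
  have hf₂ := f.right_comm
  have hg₂ := g.right_comm
  obtain ⟨l, hl, _⟩ := hd (N.left ≫ C.X ◁ p) (by
    rw [reassoc_of% hf₁, reassoc_of% hg₁, ← whiskerLeft_comp, hp, whiskerLeft_comp])
  obtain ⟨r, hr, _⟩ := hd (N.right ≫ p ▷ D.X) (by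
    rw [reassoc_of% hf₂, reassoc_of% hg₂, ← comp_whiskerRight, hp, comp_whiskerRight])
  have n₁ := N.left_counit
  have n₂ := N.left_coassoc
  have n₃ := N.right_counit
  have n₄ := N.right_coassoc
  have n₅ := N.left_right
  refine ⟨⟨coequalizer f.hom g.hom, l, r, ?_, ?_, ?_, ?_, ?_⟩, ⟨p, hl, hr⟩,
    ⟨Comodule.hom_ext hp, ⟨s, h₁, h₂⟩, hd⟩⟩
  · rw [← cancel_epi p, reassoc_of% hl, whisker_exchange, reassoc_of% n₁]; simp
  · rw [← cancel_epi p, reassoc_of% hl, reassoc_of% hl, ← whiskerLeft_comp, hl, whiskerLeft_comp,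
      reassoc_of% n₂, whisker_exchange_assoc]; simp
  · rw [← cancel_epi p, reassoc_of% hr, ← whisker_exchange, reassoc_of% n₃]; simp
  · rw [← cancel_epi p, reassoc_of% hr, reassoc_of% hr, ← comp_whiskerRight, hr, comp_whiskerRight,
      reassoc_of% n₄, ← whisker_exchange_assoc]; simp
  · rw [← cancel_epi p, reassoc_of% hl, reassoc_of% hr, ← whiskerLeft_comp, hr, whiskerLeft_comp,
      ← comp_whiskerRight_assoc, hl, comp_whiskerRight, reassoc_of% n₅]; simp

end Comodule

end QuantumModules

namespace QuantumModules
open Comodule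

variable {V : Type u} [Category.{v} V] [MonoidalCategory V] [BraidedCategory V]
  [HasCoreflexiveEqualizers V]
  [∀ X : V, Comonad.PreservesLimitOfIsCoreflexivePair (tensorLeft X)]

section rcoeq
variable {𝒳 : ∀ C D : Comon V, Cell C D → Prop} (h𝒳 : Admissible 𝒳) {B C D E : Comon V}
include h𝒳

lemma rcoeq_whiskerLeft {M N L : Comodule C D} {f g : M ⟶ N} {π : N ⟶ L} (h : RCoeq f g π)
    {X : Cell B C} (hX : 𝒳 B C X) :
    RCoeq (compMap (𝟙 X.flat) f) (compMap (𝟙 X.flat) g) (compMap (𝟙 X.flat) π) := by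
  have := h𝒳.tensor_right X hX
  exact h.whiskerLeft X.flat

lemma rcoeq_whiskerRight {M N L : Comodule C D} {f g : M ⟶ N} {π : N ⟶ L} (h : RCoeq f g π)
    {X : Cell D E} (hX : 𝒳 D E X) :
    RCoeq (compMap f (𝟙 X.flat)) (compMap g (𝟙 X.flat)) (compMap π (𝟙 X.flat)) := by
  have := h𝒳.tensor_left X hX
  exact h.whiskerRight X.flat

lemma rcoeq_path : {D E : Comon V} → (q : Path D E) → q.All 𝒳 → ∀ {M N L : Comodule C D}
    {f g : M ⟶ N} {π : N ⟶ L}, RCoeq f g π →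
      RCoeq (compMap f (𝟙 q.mm.M)) (compMap g (𝟙 q.mm.M)) (compMap π (𝟙 q.mm.M))
  | _, _, .single X, hq, _, _, _, _, _, _, h => rcoeq_whiskerRight h𝒳 h hq
  | _, _, .cons X q, hq, M, N, L, f, g, π, h => by
    have h' := rcoeq_path q hq.2 (rcoeq_whiskerRight h𝒳 h hq.1)
    have n : ∀ {M N : Comodule C _} (f : M ⟶ N), (assocIso M X.flat q.mm.M).inv ≫
        compMap f (𝟙 (comp X.flat q.mm.M)) =
        compMap (compMap f (𝟙 X.flat)) (𝟙 q.mm.M) ≫ (assocIso N X.flat q.mm.M).inv := fun f => by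
      have := assocInv_naturality f (𝟙 X.flat) (𝟙 q.mm.M)
      rw [compMap_id] at this
      rw [Iso.inv_comp_eq, ← Category.assoc, Iso.eq_comp_inv]
      exact this
    exact h'.of_iso (assocIso M X.flat q.mm.M).symm (assocIso N X.flat q.mm.M).symm
      (assocIso L X.flat q.mm.M).symm (n f) (n g) (n π)

lemma Ctx.rcoeq {P Q R : Multi C D} {f g : P.M ⟶ Q.M} {π : Q.M ⟶ R.M} (h : RCoeq f g π) :
    {A B : Comon V} → (c : Ctx C D A B) → c.All 𝒳 →
      RCoeq (c.map (P := P) (Q := Q) f) (c.map (P := P) (Q := Q) g) (c.map (P := Q) (Q := R) π)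
  | _, _, hole, _ => h
  | _, _, app q, hq => rcoeq_path h𝒳 q hq h
  | _, _, cons X c, hc => rcoeq_whiskerLeft h𝒳 (c.rcoeq h hc.2) hc.1

end rcoeq

variable {C D : Comon V}

/-- 2-cells out of `R` are determined by their restrictions along `φ`. -/
def Multi.CellEpi {P R : Multi C D} (φ : P.M ⟶ R.M) : Prop :=
  ∀ ⦃Y : Cell C D⦄ ⦃g g' : R.M ⟶ Y.flat⦄, R.IsMor Y.multi g → R.IsMor Y.multi g' →
    φ ≫ g = φ ≫ g' → g = g'

namespace Amb
variable {P R : Multi C D} (a : Amb P) {Y Y' : Cell C D} {f f' : P.M ⟶ Y.flat} {g g' : P.M ⟶ Y'.flat}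

lemma conv_congr (hg : P.IsMor Y'.multi g) (hf : P.IsMor Y.multi f) (hg' : P.IsMor Y'.multi g')
    (hf' : P.IsMor Y.multi f') (e : g = g') (e' : f = f') : a.conv hg hf = a.conv hg' hf' := by
  subst e e'; rfl

end Amb

namespace AmbMap
variable {P R : Multi C D} {a : Amb P} {b : Amb R} {φ : P.M ⟶ R.M} {Y Y' : Cell C D}
  {f : R.M ⟶ Y.flat} {g : R.M ⟶ Y'.flat}

lemma w_comp (m : AmbMap a b φ) (hf : R.IsMor Y.multi f) (hφf : P.IsMor Y.multi (φ ≫ f)) :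
    a.w hφf ≫ φ.hom ▷ Y.flat.X = φ.hom ≫ b.w hf := by
  have m₁ := m.mono_right Y.flat.X
  have e₁ : a.w hφf ≫ m.j ▷ Y.flat.X = m.w ≫ m.N ◁ f.hom := by
    rw [← cancel_mono (m.k ▷ Y.flat.X), Category.assoc, Category.assoc, ← comp_whiskerRight, m.j_k,
      a.w_i, whisker_exchange, reassoc_of% m.w_k]
    simp
  rw [← cancel_mono (b.i ▷ Y.flat.X), Category.assoc, Category.assoc, ← comp_whiskerRight, ← m.j_ψ,
    b.w_i, comp_whiskerRight, reassoc_of% e₁, whisker_exchange, reassoc_of% m.w_ψ]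

lemma conv_comp (m : AmbMap a b φ) (hg : R.IsMor Y'.multi g) (hf : R.IsMor Y.multi f)
    (hφg : P.IsMor Y'.multi (φ ≫ g)) (hφf : P.IsMor Y.multi (φ ≫ f)) :
    a.conv hφg hφf = φ ≫ b.conv hg hf := by
  ext
  have h := m.w_comp hf hφf
  rw [← cancel_mono (flatInc Y' Y), a.conv_inc, comp_hom φ g, comp_whiskerRight, reassoc_of% h,
    ← b.conv_inc]
  exact (Category.assoc _ _ _).symm

lemma kap_comp (m : AmbMap a b φ) : φ ≫ b.kap = a.kap := by
  refine a.eq_kap _ ?_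
  rw [comp_hom, Category.assoc, b.kap_ε, Amb.e, Amb.e, ← reassoc_of% m.j_ψ, m.counit,
    reassoc_of% m.j_k]

lemma isCom_of_comp (m : AmbMap a b φ) (hφ : P.IsMor R φ) (he : Multi.CellEpi φ) {y : ComonadStr Y}
    (hf : R.IsMor Y.multi f) (h : a.IsCom y (φ ≫ f)) : b.IsCom y f := by
  rw [Amb.isCom_iff _ hf]
  rw [Amb.isCom_iff _ (hφ.comp hf)] at h
  refine ⟨he (hf.comp (flatMap_isMor _)) (b.conv_cell hf hf) ?_,
    he (hf.comp (flatMap_isMor _)) b.kap_cell ?_⟩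
  · rw [← m.conv_comp hf hf (hφ.comp hf) (hφ.comp hf), ← h.1, Category.assoc]
  · rw [m.kap_comp, ← h.2, Category.assoc]

end AmbMap

namespace Cell
variable {X Y : Cell C D} {x : ComonadStr X} {y : ComonadStr Y}

lemma isCom_iff {f : X ⟶ Y} : (X.amb x).IsCom y (Cell.flatMap f) ↔ x.IsMap y f := by
  rw [Amb.isCom_iff _ (flatMap_isMor f)]
  have e₁ : (X.amb x).conv (flatMap_isMor f) (flatMap_isMor f) =
      Cell.flatMap (x.comul ≫ compMap f f) := by
    have h : X.multi.IsMor X.multi (Cell.flatMap (𝟙 X)) := flatMap_isMor _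
    have h₁ := (X.amb x).conv_comp h h f f
      (show X.multi.IsMor Y.multi (Cell.flatMap (𝟙 X) ≫ Cell.flatMap f) from
        h.comp (flatMap_isMor f)) (h.comp (flatMap_isMor f))
    have h₂ : (X.amb x).conv h h = Cell.flatMap x.comul := by
      ext
      rw [← cancel_mono (flatInc X X), Amb.conv_inc, Cell.flatMap_comul_inc]
      have h₃ := (X.amb x).w_i h
      refine (congrArg (_ ≫ ·) (id_whiskerRight _ _)).trans ?_
      refine (congrArg (_ ≫ ·) (id_whiskerRight _ _).symm).trans (h₃.trans ?_)
      exact (congrArg (_ ≫ ·) (whiskerLeft_id _ _)).trans (Category.comp_id _)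
    refine ((X.amb x).conv_congr _ _ (h.comp (flatMap_isMor f)) (h.comp (flatMap_isMor f))
      (Category.id_comp _).symm (Category.id_comp _).symm).trans (h₁.trans ?_)
    exact (congrArg (· ≫ Cell.flatMap (compMap f f)) h₂).trans (Cell.flatMap_comp _ _).symm
  have e₂ : (X.amb x).kap = Cell.flatMap x.counit := by
    refine ((X.amb x).eq_kap _ ?_).symm
    rw [Cell.flatMap_counit]
    exact (Category.id_comp _).symm
  rw [e₁, e₂, ← Cell.flatMap_comp, ← Cell.flatMap_comp]
  exact ⟨fun h => ⟨Cell.flatMap_injective h.1, Cell.flatMap_injective h.2⟩,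
    fun h => ⟨congrArg Cell.flatMap h.1, congrArg Cell.flatMap h.2⟩⟩

end Cell

namespace Multi.IsLan
variable {P : Multi C D} {T : Cell C D} {u : P.M ⟶ T.flat}

lemma cellEpi (h : P.IsLan T u) : Multi.CellEpi (P := P) (R := T.multi) u := fun Y g g' hg hg' e => by
  have : Cell.homOfFlat g hg = Cell.homOfFlat g' hg' := h.hom_ext e
  exact congrArg Cell.flatMap this

/-- The universal target of a comonad is a comonad. -/
lemma exists_comonadStr (h : P.IsLan T u) (a : Amb P) : ∃ k : ComonadStr T, a.IsCom k u := by
  obtain ⟨δ, hδ, _⟩ := h.desc _ _ (a.conv_cell h.cell h.cell)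
  obtain ⟨ε, hε, _⟩ := h.desc _ _ a.kap_cell
  have hid : P.IsMor T.multi (u ≫ Cell.flatMap (𝟙 T)) := h.cell.comp (flatMap_isMor _)
  have eid : u ≫ Cell.flatMap (𝟙 T) = u := Category.comp_id _
  have cε : P.IsMor (Cell.multi (one _)) (u ≫ Cell.flatMap ε) := h.cell.comp (flatMap_isMor _)
  have cδ : P.IsMor (Cell.multi (comp T T)) (u ≫ Cell.flatMap δ) := h.cell.comp (flatMap_isMor _)
  have hcc := a.conv_cell h.cell h.cell
  refine ⟨⟨δ, ε, h.hom_ext ?_, h.hom_ext ?_, h.hom_ext ?_⟩, (a.isCom_iff h.cell).2 ⟨hδ, hε⟩⟩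
  · rw [Cell.flatMap_comp, ← Category.assoc, hδ, ← a.conv_comp h.cell h.cell ε (𝟙 T) cε hid,
      a.conv_congr cε hid a.kap_cell h.cell hε eid, a.conv_kap_left]
  · rw [Cell.flatMap_comp, ← Category.assoc, hδ, ← a.conv_comp h.cell h.cell (𝟙 T) ε hid cε,
      a.conv_congr hid cε h.cell a.kap_cell eid hε, a.conv_kap_right]
  · rw [Cell.flatMap_comp, Cell.flatMap_comp, Cell.flatMap_comp, ← Category.assoc, ← Category.assoc, hδ,
      ← a.conv_comp h.cell h.cell (𝟙 T) δ hid cδ, a.conv_congr hid cδ h.cell hcc eid hδ,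
      a.conv_assoc h.cell h.cell h.cell, ← Category.assoc, hδ,
      ← a.conv_comp h.cell h.cell δ (𝟙 T) cδ hid, a.conv_congr cδ hid hcc h.cell hδ eid]

/-- A map out of the universal target is a map of comonads if its restriction is. -/
lemma isMap (h : P.IsLan T u) {a : Amb P} {k : ComonadStr T} (hk : a.IsCom k u) {Y : Cell C D}
    {y : ComonadStr Y} {φ : T ⟶ Y} (hφ : a.IsCom y (u ≫ Cell.flatMap φ)) : k.IsMap y φ :=
  Cell.isCom_iff.1 ((AmbMap.ofCom hk).isCom_of_comp h.cell h.cellEpi (flatMap_isMor φ) hφ)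

end Multi.IsLan

end QuantumModules

namespace QuantumModules

section bimodules

local infixr:81 " ◀ " => Bicategory.whiskerLeft
local infixl:81 " ▶ " => Bicategory.whiskerRight
local notation "αᵇ" => Bicategory.associator
local notation "λᵇ" => Bicategory.leftUnitor
local notation "ρᵇ" => Bicategory.rightUnitor
local infixr:80 " ≫ᵇ " => bicategoricalComp

universe w₁ w₂ w₃
variable {𝓑 : Type w₁} [Bicategory.{w₃, w₂} 𝓑] {c d e : 𝓑}

/-- A monad in a bicategory, on a given endomorphism. -/
structure Mnd (A : c ⟶ c) where
  μ : A ≫ A ⟶ A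
  η : 𝟙 c ⟶ A
  one_mul : ((λᵇ A).inv ≫ η ▶ A) ≫ μ = 𝟙 A
  mul_one : ((ρᵇ A).inv ≫ A ◀ η) ≫ μ = 𝟙 A
  mul_assoc : (αᵇ A A A).inv ≫ μ ▶ A ≫ μ = A ◀ μ ≫ μ

namespace Mnd
variable {A : c ⟶ c} (a : Mnd A) {B : d ⟶ d} (b : Mnd B)

/-- `N ⟶ A ≫ N`, induced by the unit. -/
def etaL (N : c ⟶ d) : N ⟶ A ≫ N := (λᵇ N).inv ≫ a.η ▶ N

/-- `N ⟶ N ≫ B`, induced by the unit. -/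
def etaR (N : c ⟶ d) : N ⟶ N ≫ B := (ρᵇ N).inv ≫ N ◀ b.η

lemma etaL_naturality {N N' : c ⟶ d} (f : N ⟶ N') : a.etaL N ≫ A ◀ f = f ≫ a.etaL N' := by
  rw [etaL, etaL, Category.assoc, ← Bicategory.whisker_exchange, Bicategory.leftUnitor_inv_naturality_assoc]

lemma etaR_naturality {N N' : c ⟶ d} (f : N ⟶ N') : b.etaR N ≫ f ▶ B = f ≫ b.etaR N' := by
  rw [etaR, etaR, Category.assoc, Bicategory.whisker_exchange, Bicategory.rightUnitor_inv_naturality_assoc]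

lemma etaL_comp (N : c ⟶ d) (L : d ⟶ e) :
    a.etaL (N ≫ L) = a.etaL N ▶ L ≫ (αᵇ A N L).hom := by
  simp only [etaL]; bicategory

lemma etaR_comp (L : e ⟶ c) (N : c ⟶ d) :
    b.etaR (L ≫ N) = L ◀ b.etaR N ≫ (αᵇ L N B).inv := by
  simp only [etaR]; bicategory

lemma whiskerLeft_etaL (L : d ⟶ c) (N : c ⟶ e) :
    L ◀ a.etaL N = a.etaR L ▶ N ≫ (αᵇ L A N).hom := by
  simp only [etaL, etaR]; bicategory

lemma etaL_mul : a.etaL A ≫ a.μ = 𝟙 A := a.one_mul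

lemma etaR_mul : a.etaR A ≫ a.μ = 𝟙 A := a.mul_one

/-- An action of a pair of monads. -/
structure IsAct {M : c ⟶ d} (x : A ≫ M ≫ B ⟶ M) : Prop where
  assoc : (αᵇ A A (M ≫ B ≫ B)).inv ≫ a.μ ▶ (M ≫ B ≫ B) ≫ A ◀ M ◀ b.μ ≫ x =
    A ◀ (A ◀ (αᵇ M B B).inv ≫ (αᵇ A (M ≫ B) B).inv ≫ x ▶ B) ≫ x
  unit : b.etaR M ≫ a.etaL (M ≫ B) ≫ x = 𝟙 M

/-- The left action. -/
def actL {M : c ⟶ d} (x : A ≫ M ≫ B ⟶ M) : A ≫ M ⟶ M := A ◀ b.etaR M ≫ x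

/-- The right action. -/
def actR {M : c ⟶ d} (x : A ≫ M ≫ B ⟶ M) : M ≫ B ⟶ M := a.etaL (M ≫ B) ≫ x

namespace IsAct
variable {a b} {M : c ⟶ d} {x : A ≫ M ≫ B ⟶ M} (h : IsAct a b x)
include h

lemma whiskerLeft_act : A ◀ x ≫ b.actL x = (αᵇ A A (M ≫ B)).inv ≫ a.μ ▶ (M ≫ B) ≫ x := by
  have e := congrArg (A ◀ A ◀ M ◀ b.etaR B ≫ ·) h.assoc
  have n := b.etaR_naturality x
  rw [etaR_comp, etaR_comp] at n
  calc _ = A ◀ (x ≫ b.etaR M) ≫ x := by simp [actL]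
    _ = A ◀ A ◀ M ◀ b.etaR B ≫ A ◀ (A ◀ (αᵇ M B B).inv ≫ (αᵇ A (M ≫ B) B).inv ≫ x ▶ B) ≫ x := by
      rw [← n]; simp
    _ = A ◀ A ◀ M ◀ b.etaR B ≫ (αᵇ A A (M ≫ B ≫ B)).inv ≫
          a.μ ▶ (M ≫ B ≫ B) ≫ A ◀ M ◀ b.μ ≫ x := e.symm
    _ = (αᵇ A A (M ≫ B)).inv ≫ ((A ≫ A) ◀ M ◀ b.etaR B ≫
          a.μ ▶ (M ≫ B ≫ B)) ≫ A ◀ M ◀ b.μ ≫ x := by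
      simp
    _ = (αᵇ A A (M ≫ B)).inv ≫ a.μ ▶ (M ≫ B) ≫ A ◀ M ◀ (b.etaR B ≫ b.μ) ≫ x := by
      rw [Bicategory.whisker_exchange]; simp
    _ = _ := by rw [etaR_mul]; simp

lemma act_whiskerRight :
    x ▶ B ≫ a.actR x = (αᵇ A (M ≫ B) B).hom ≫ A ◀ ((αᵇ M B B).hom ≫ M ◀ b.μ) ≫ x := by
  have e := congrArg (a.etaL (A ≫ M ≫ B ≫ B) ≫ ·) h.assoc
  have n := a.etaL_naturality (A ◀ (αᵇ M B B).inv ≫ (αᵇ A (M ≫ B) B).inv ≫ x ▶ B)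
  have k : a.etaL (A ≫ M ≫ B ≫ B) ≫ (αᵇ A A (M ≫ B ≫ B)).inv ≫ a.μ ▶ (M ≫ B ≫ B) = 𝟙 _ := by
    rw [etaL_comp]
    simp only [Category.assoc, Iso.hom_inv_id_assoc]
    rw [← Bicategory.comp_whiskerRight, etaL_mul, Bicategory.id_whiskerRight]
  calc _ = (αᵇ A (M ≫ B) B).hom ≫ A ◀ (αᵇ M B B).hom ≫
        ((A ◀ (αᵇ M B B).inv ≫ (αᵇ A (M ≫ B) B).inv ≫ x ▶ B) ≫ a.etaL (M ≫ B)) ≫ x := by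
          simp [actR]
    _ = (αᵇ A (M ≫ B) B).hom ≫ A ◀ (αᵇ M B B).hom ≫ (a.etaL (A ≫ M ≫ B ≫ B) ≫
          (αᵇ A A (M ≫ B ≫ B)).inv ≫ a.μ ▶ (M ≫ B ≫ B) ≫ A ◀ M ◀ b.μ ≫ x) := by
      rw [← n, Category.assoc, ← e]
    _ = _ := by rw [reassoc_of% k]; simp

lemma whiskerLeft_actR : A ◀ a.actR x ≫ b.actL x = x := by
  calc _ = A ◀ a.etaL (M ≫ B) ≫ A ◀ x ≫ b.actL x := by simp [actR]
    _ = (a.etaR A ≫ a.μ) ▶ (M ≫ B) ≫ x := by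
      rw [h.whiskerLeft_act, whiskerLeft_etaL]; simp
    _ = x := by rw [etaR_mul]; simp

lemma actL_whiskerRight : b.actL x ▶ B ≫ a.actR x = (αᵇ A M B).hom ≫ x := by
  calc _ = (A ◀ b.etaR M) ▶ B ≫ x ▶ B ≫ a.actR x := by simp [actL]
    _ = (αᵇ A M B).hom ≫ A ◀ ((b.etaR M ▶ B ≫ (αᵇ M B B).hom) ≫ M ◀ b.μ) ≫ x := by
      rw [h.act_whiskerRight]; simp
    _ = (αᵇ A M B).hom ≫ A ◀ M ◀ (b.etaL B ≫ b.μ) ≫ x := by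
      rw [← whiskerLeft_etaL]; simp
    _ = _ := by rw [etaL_mul]; simp

lemma actL_assoc : A ◀ b.actL x ≫ b.actL x = (αᵇ A A M).inv ≫ a.μ ▶ M ≫ b.actL x := by
  calc _ = A ◀ A ◀ b.etaR M ≫ A ◀ x ≫ b.actL x := by simp [actL]
    _ = (αᵇ A A M).inv ≫ ((A ≫ A) ◀ b.etaR M ≫ a.μ ▶ (M ≫ B)) ≫ x := by
      rw [h.whiskerLeft_act]; simp
    _ = _ := by rw [Bicategory.whisker_exchange]; simp [actL]

lemma actR_assoc : a.actR x ▶ B ≫ a.actR x = (αᵇ M B B).hom ≫ M ◀ b.μ ≫ a.actR x := by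
  have n := a.etaL_naturality ((αᵇ M B B).hom ≫ M ◀ b.μ)
  calc _ = a.etaL (M ≫ B) ▶ B ≫ x ▶ B ≫ a.actR x := by simp [actR]
    _ = (a.etaL ((M ≫ B) ≫ B) ≫ A ◀ ((αᵇ M B B).hom ≫ M ◀ b.μ)) ≫ x := by
      rw [h.act_whiskerRight, etaL_comp a (M ≫ B) B]; simp
    _ = _ := by rw [n]; simp [actR]

lemma etaL_actL : a.etaL M ≫ b.actL x = 𝟙 M := by
  rw [actL, ← Category.assoc, etaL_naturality, Category.assoc, h.unit]

lemma etaR_actR : b.etaR M ≫ a.actR x = 𝟙 M := h.unit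

lemma inv_actL_whiskerRight : (αᵇ A M B).inv ≫ b.actL x ▶ B ≫ a.actR x = x := by
  rw [h.actL_whiskerRight, Iso.inv_hom_id_assoc]

end IsAct

/-- A monad acts on itself on both sides. -/
lemma isAct_self : IsAct a a (A ◀ a.μ ≫ a.μ) where
  assoc := by
    have h := a.mul_assoc
    have h' : a.μ ▶ A ≫ a.μ = (αᵇ A A A).hom ≫ A ◀ a.μ ≫ a.μ := by
      rw [← h, Iso.hom_inv_id_assoc]
    calc _ = (αᵇ A A (A ≫ A ≫ A)).inv ≫ (A ≫ A) ◀ A ◀ a.μ ≫ (A ≫ A) ◀ a.μ ≫ a.μ ▶ A ≫ a.μ := by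
          rw [Bicategory.whisker_exchange_assoc, Bicategory.whisker_exchange_assoc]
      _ = A ◀ A ◀ A ◀ a.μ ≫ A ◀ A ◀ a.μ ≫ A ◀ a.μ ≫ a.μ := by
          rw [h']; simp
      _ = A ◀ A ◀ ((αᵇ A A A).inv ≫ a.μ ▶ A ≫ a.μ) ≫ A ◀ a.μ ≫ a.μ := by
          rw [h]; simp
      _ = A ◀ (A ◀ (αᵇ A A A).inv ≫ (αᵇ A (A ≫ A) A).inv ≫ (A ◀ a.μ) ▶ A ≫
            ((αᵇ A A A).hom ≫ A ◀ a.μ ≫ a.μ)) ≫ a.μ := by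
          simp
      _ = _ := by rw [← h']; simp
  unit := by
    have := a.etaL_naturality a.μ
    rw [reassoc_of% this, etaL_mul, Category.comp_id, etaR_mul]

lemma actL_self : a.actL (A ◀ a.μ ≫ a.μ) = a.μ := by
  rw [actL, ← Category.assoc, ← Bicategory.whiskerLeft_comp, etaR_mul, Bicategory.whiskerLeft_id, Category.id_comp]

lemma actR_self : a.actR (A ◀ a.μ ≫ a.μ) = a.μ := by
  have := a.etaL_naturality a.μ
  rw [actR, reassoc_of% this, etaL_mul, Category.comp_id]

section tensor
variable {C : e ⟶ e} (k : Mnd C) {M : c ⟶ d} {N : d ⟶ e} {x : A ≫ M ≫ B ⟶ M} {y : B ≫ N ≫ C ⟶ N}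

/-- The action on the composite of two bimodules. -/
def tensorAct (x : A ≫ M ≫ B ⟶ M) (y : B ≫ N ≫ C ⟶ N) : A ≫ (M ≫ N) ≫ C ⟶ M ≫ N :=
  A ◀ (αᵇ M N C).hom ≫ (αᵇ A M (N ≫ C)).inv ≫ b.actL x ▶ (N ≫ C) ≫ M ◀ b.actR y

variable {a b k}

lemma isAct_tensorAct (hx : IsAct a b x) (hy : IsAct b k y) : IsAct a k (b.tensorAct x y) where
  assoc := by
    have h₁ := hx.actL_assoc
    have h₂ := hy.actR_assoc
    simp only [tensorAct]
    symm
    calc _ = A ◀ A ◀ (M ≫ N) ◀ (𝟙 (C ≫ C)) ≫ᵇ A ◀ b.actL x ▶ (N ≫ C ≫ C) ≫ᵇ A ◀ M ◀ b.actR y ▶ C ≫ᵇ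
            b.actL x ▶ (N ≫ C) ≫ M ◀ b.actR y := by bicategory
      _ = 𝟙 _ ≫ᵇ A ◀ b.actL x ▶ (N ≫ C ≫ C) ≫ᵇ ((A ≫ M) ◀ b.actR y ▶ C ≫
            b.actL x ▶ (N ≫ C)) ≫ M ◀ b.actR y := by bicategory
      _ = 𝟙 _ ≫ᵇ (A ◀ b.actL x ≫ b.actL x) ▶ (N ≫ C ≫ C) ≫ᵇ
            M ◀ (b.actR y ▶ C ≫ b.actR y) := by rw [Bicategory.whisker_exchange]; bicategory
      _ = 𝟙 _ ≫ᵇ a.μ ▶ M ▶ (N ≫ C ≫ C) ≫ᵇ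
            (b.actL x ▶ (N ≫ C ≫ C) ≫ M ◀ N ◀ k.μ) ≫ᵇ M ◀ b.actR y := by
          rw [h₁, h₂]; bicategory
      _ = _ := by rw [← Bicategory.whisker_exchange]; bicategory
  unit := by
    have h₁ := hx.etaL_actL
    have h₂ := hy.etaR_actR
    rw [etaR_comp, etaL_comp, etaL_comp, tensorAct]
    calc _ = M ◀ k.etaR N ≫ a.etaL M ▶ (N ≫ C) ≫ b.actL x ▶ (N ≫ C) ≫ M ◀ b.actR y := by
          bicategory
      _ = M ◀ k.etaR N ≫ (a.etaL M ≫ b.actL x) ▶ (N ≫ C) ≫ M ◀ b.actR y := by simp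
      _ = _ := by rw [h₁, Bicategory.id_whiskerRight, Category.id_comp, ← Bicategory.whiskerLeft_comp, h₂, Bicategory.whiskerLeft_id]

/-- The two maps that are coequalized in a composite of bimodules are compatible with actions. -/
lemma tensorAct_balanced (hx : IsAct a b x) (hy : IsAct b k y) {Q : c ⟶ e} {q : M ≫ N ⟶ Q}
    (hq : M ◀ k.actL y ≫ q = (αᵇ M B N).inv ≫ a.actR x ▶ N ≫ q) :
    A ◀ (M ◀ k.actL y) ▶ C ≫ b.tensorAct x y ≫ q =
      A ◀ ((αᵇ M B N).inv ≫ a.actR x ▶ N) ▶ C ≫ b.tensorAct x y ≫ q := by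
  have h₁ := hx.whiskerLeft_actR
  have h₂ : k.actL y ▶ C ≫ b.actR y = (αᵇ B N C).hom ≫ B ◀ b.actR y ≫ k.actL y := by
    rw [hy.actL_whiskerRight, hy.whiskerLeft_actR]
  have h₄ := hx.inv_actL_whiskerRight
  simp only [tensorAct, Category.assoc]
  calc _ = 𝟙 _ ≫ᵇ ((A ≫ M) ◀ (k.actL y ▶ C) ≫ b.actL x ▶ (N ≫ C)) ≫ M ◀ b.actR y ≫ q := by
        bicategory
    _ = 𝟙 _ ≫ᵇ b.actL x ▶ ((B ≫ N) ≫ C) ≫ M ◀ (k.actL y ▶ C ≫ b.actR y) ≫ q := by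
        rw [Bicategory.whisker_exchange]; bicategory
    _ = 𝟙 _ ≫ᵇ b.actL x ▶ (B ≫ N ≫ C) ≫ M ◀ B ◀ b.actR y ≫ (M ◀ k.actL y ≫ q) := by
        rw [h₂]; bicategory
    _ = 𝟙 _ ≫ᵇ b.actL x ▶ (B ≫ N ≫ C) ≫ᵇ ((M ≫ B) ◀ b.actR y ≫ a.actR x ▶ N) ≫ q := by
        rw [hq]; bicategory
    _ = 𝟙 _ ≫ᵇ ((αᵇ A M B).inv ≫ b.actL x ▶ B ≫ a.actR x) ▶ (N ≫ C) ≫ M ◀ b.actR y ≫ q := by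
        rw [Bicategory.whisker_exchange]; bicategory
    _ = 𝟙 _ ≫ᵇ (A ◀ a.actR x ≫ b.actL x) ▶ (N ≫ C) ≫ M ◀ b.actR y ≫ q := by
        rw [h₄, h₁]
    _ = _ := by bicategory

end tensor

end Mnd

end bimodules

end QuantumModules

namespace QuantumModules
open Comodule

variable {V : Type u} [Category.{v} V] [MonoidalCategory V] [BraidedCategory V]
  [HasCoreflexiveEqualizers V]
  [∀ X : V, Comonad.PreservesLimitOfIsCoreflexivePair (tensorLeft X)]

section
variable {𝒞 : Type*} [Category* 𝒞] {P Q R S T : 𝒞}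

lemma comp_assoc₄ (f : P ⟶ Q) (g : Q ⟶ R) (h : R ⟶ S) (k : S ⟶ T) :
    (f ≫ g ≫ h) ≫ k = f ≫ g ≫ h ≫ k := by simp

lemma comp_eq_comp_inv (e : P ≅ Q) {x : R ⟶ Q} {y : R ⟶ P} (h : x = y ≫ e.hom) (f : P ⟶ T) :
    y ≫ f = x ≫ e.inv ≫ f := by simp [h]

end

section
variable {C D E F : Comon V}

lemma compMap_eq {M M' : Comodule C D} {N N' : Comodule D E} (f : M ⟶ M') (g : N ⟶ N') :
    compMap f g = compMap f (𝟙 N) ≫ compMap (𝟙 M') g := by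
  rw [← compMap_comp, Category.comp_id, Category.id_comp]

lemma append_two (M : Cell C D) (N : Cell D E) (q : Path E F) :
    Path.appendHom (.two M N) q = assocInv M.flat N.flat q.dom := by
  refine (congrArg (· ≫ _) (compMap_id M.flat (comp N.flat q.dom))).trans (Category.id_comp _)

lemma append_three {G : Comon V} (M : Cell C D) (N : Cell D E) (L : Cell E F) (q : Path F G) :
    Path.appendHom (.three M N L) q = compMap (𝟙 M.flat) (assocInv N.flat L.flat q.dom) ≫
      assocInv M.flat (comp N.flat L.flat) q.dom :=
  congrArg (fun x => compMap (𝟙 M.flat) x ≫ assocInv M.flat (comp N.flat L.flat) q.dom)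
    (append_two N L q)

lemma subst_two {p : Path C D} {X : Cell C D} {Y : Cell D E} (f : p.dom ⟶ X.flat) :
    (Subst.cons (p := p) f (.single (p := .single Y) (𝟙 Y.flat))).map =
      Path.appendHom p (.single Y) ≫ compMap f (𝟙 Y.flat) := rfl

lemma subst_single_cons {X : Cell C D} {p q : Path D E} (σ : Subst p q) :
    (Subst.cons (p := .single X) (𝟙 X.flat) σ).map = compMap (𝟙 X.flat) σ.map :=
  Category.id_comp _

end

namespace QuantumCategory
variable (a : QuantumCategory V)

/-- The comonoid of objects, as an object of `Comod 𝒱`. -/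
def base : ComodBicat V := a.C

/-- The monad in `Comod 𝒱` underlying a quantum category. -/
def mnd : Mnd (𝓑 := ComodBicat V) (c := a.base) a.A.flat where
  μ := a.μ
  η := a.η
  one_mul := a.one_mul
  mul_one := a.mul_one
  mul_assoc := by
    have h := a.mul_assoc
    rw [subst_two, append_two, subst_single_cons] at h
    exact (Category.assoc _ _ _).symm.trans h

lemma μ_isMor : (a.A.multi.tensor a.A.multi).IsMor a.A.multi a.μ := isCell_two.1 a.μ_cell

lemma μ_isCom : ((a.A.amb a.str).tensor (a.A.amb a.str)).IsCom a.str a.μ :=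
  isComonadCell_two.1 a.μ_comonad

end QuantumCategory

lemma isQModule_iff {a b : QuantumCategory V} {m : QModuleData a b} : IsQModule m ↔
    (a.A.multi.tensor (m.M.multi.tensor b.A.multi)).IsMor m.M.multi m.α ∧
    ((a.A.amb a.str).tensor ((m.M.amb m.str).tensor (b.A.amb b.str))).IsCom m.str m.α ∧
    a.mnd.IsAct b.mnd (M := m.M.flat) m.α := by
  have e₁ : (Subst.cons (p := .two a.A a.A) a.μ
      (.cons (p := .single m.M) (𝟙 m.M.flat) (.single (p := .two b.A b.A) b.μ))).map =
      assocInv a.A.flat a.A.flat (comp m.M.flat (comp b.A.flat b.A.flat)) ≫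
        compMap a.μ (𝟙 _) ≫ compMap (𝟙 _) (compMap (𝟙 _) b.μ) := by
    refine (congrArg (· ≫ _) (append_two _ _ _)).trans (congrArg (_ ≫ ·) ?_)
    refine Eq.trans ?_ (compMap_eq _ _)
    exact congrArg (compMap a.μ) (subst_single_cons (.single (p := .two b.A b.A) b.μ))
  have e₂ : (Subst.cons (p := .single a.A) (𝟙 a.A.flat)
      (.cons (p := .three a.A m.M b.A) m.α (.single (p := .single b.A) (𝟙 b.A.flat)))).map =
      compMap (𝟙 a.A.flat) (compMap (𝟙 a.A.flat) (assocInv m.M.flat b.A.flat b.A.flat) ≫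
        assocInv a.A.flat (comp m.M.flat b.A.flat) b.A.flat ≫ compMap m.α (𝟙 _)) := by
    refine (subst_single_cons (.cons (p := .three a.A m.M b.A) m.α
      (.single (p := .single b.A) (𝟙 b.A.flat)))).trans (congrArg _ ?_)
    exact (congrArg (· ≫ _) (append_three _ _ _ _)).trans (Category.assoc _ _ _)
  have e : (Subst.cons (p := .two a.A a.A) a.μ
      (.cons (p := .single m.M) (𝟙 m.M.flat) (.single (p := .two b.A b.A) b.μ))).map ≫ m.α =
    (Subst.cons (p := .single a.A) (𝟙 a.A.flat)
      (.cons (p := .three a.A m.M b.A) m.α (.single (p := .single b.A) (𝟙 b.A.flat)))).map ≫ m.α ↔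
    (assocInv a.A.flat a.A.flat (comp m.M.flat (comp b.A.flat b.A.flat)) ≫
        compMap a.μ (𝟙 _) ≫ compMap (𝟙 _) (compMap (𝟙 _) b.μ)) ≫ m.α =
      compMap (𝟙 a.A.flat) (compMap (𝟙 a.A.flat) (assocInv m.M.flat b.A.flat b.A.flat) ≫
        assocInv a.A.flat (comp m.M.flat b.A.flat) b.A.flat ≫ compMap m.α (𝟙 _)) ≫ m.α := by
    rw [← e₁, ← e₂]; rfl
  constructor
  · intro h
    refine ⟨isCell_three.1 h.cell, isComonadCell_three.1 h.comonad, ⟨?_, h.unit⟩⟩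
    exact (comp_assoc₄ _ _ _ _).symm.trans (e.1 h.assoc)
  · rintro ⟨h₁, h₂, h₃⟩
    refine ⟨isCell_three.2 h₁, isComonadCell_three.2 h₂, e.2 ?_, h₃.unit⟩
    exact (comp_assoc₄ _ _ _ _).trans h₃.assoc

namespace QModule
variable {a b : QuantumCategory V} (m : QModule a b)

lemma α_isMor : (a.A.multi.tensor (m.M.multi.tensor b.A.multi)).IsMor m.M.multi m.α :=
  (isQModule_iff.1 m.isQModule).1

lemma α_isCom : ((a.A.amb a.str).tensor ((m.M.amb m.str).tensor (b.A.amb b.str))).IsCom m.str m.α :=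
  (isQModule_iff.1 m.isQModule).2.1

lemma isAct : a.mnd.IsAct b.mnd (M := m.M.flat) m.α := (isQModule_iff.1 m.isQModule).2.2

lemma αL_eq : m.αL = b.etaR (comp a.A.flat m.M.flat) ≫
    (assocIso a.A.flat m.M.flat b.A.flat).inv ≫ m.α := by
  have h := b.mnd.etaR_comp (𝓑 := ComodBicat V) (e := a.base) (c := a.base) a.A.flat m.M.flat
  have h' : b.etaR (comp a.A.flat m.M.flat) = compMap (𝟙 a.A.flat) (b.etaR m.M.flat) ≫
      (assocIso a.A.flat m.M.flat b.A.flat).hom := h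
  exact comp_eq_comp_inv _ h' _

lemma αL_isMor : (a.A.multi.tensor m.M.multi).IsMor m.M.multi m.αL := by
  rw [αL_eq]
  exact b.etaR_isMor ((Multi.IsMor.assocHom _ _ _).comp m.α_isMor)

lemma αL_isCom : ((a.A.amb a.str).tensor (m.M.amb m.str)).IsCom m.str m.αL := by
  rw [αL_eq]
  have h := (Multi.IsMor.assocHom a.A.multi m.M.multi b.A.multi)
  exact b.etaR_isCom _ (h.comp m.α_isMor) ((AmbMap.assocHom _ _ _).isCom h m.α_isMor m.α_isCom)

lemma αR_isMor : (m.M.multi.tensor b.A.multi).IsMor m.M.multi m.αR := a.etaL_isMor m.α_isMor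

lemma αR_isCom : ((m.M.amb m.str).tensor (b.A.amb b.str)).IsCom m.str m.αR :=
  a.etaL_isCom _ m.α_isMor m.α_isCom

end QModule

lemma isQModule_unitData (a : QuantumCategory V) : IsQModule (unitData a) := by
  have h : (a.A.multi.tensor (a.A.multi.tensor a.A.multi)).IsMor (a.A.multi.tensor a.A.multi)
    (compMap (𝟙 a.A.flat) a.μ) := (Multi.IsMor.id _).tensor a.μ_isMor
  exact isQModule_iff.2 ⟨h.comp a.μ_isMor, (AmbMap.tensor (.id (a.A.amb a.str))
    (.ofCom a.μ_isCom)).isCom h a.μ_isMor a.μ_isCom, a.mnd.isAct_self⟩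

end QuantumModules

namespace QuantumModules
open Comodule

variable {V : Type u} [Category.{v} V] [MonoidalCategory V] [BraidedCategory V]

section
variable {C E X : V}

lemma left_coassoc_aux {δ : C ⟶ C ⊗ C} {d : E ⟶ E ⊗ E} {s : X ⟶ C ⊗ X} {t : X ⟶ E ⊗ X}
    (hs : s ≫ C ◁ s = s ≫ δ ▷ X ≫ (α_ _ _ _).hom) (ht : t ≫ E ◁ t = t ≫ d ▷ X ≫ (α_ _ _ _).hom)
    (hst : t ≫ E ◁ s = s ≫ C ◁ t ≫ (α_ _ _ _).inv ≫ (β_ C E).hom ▷ X ≫ (α_ _ _ _).hom) :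
    (s ≫ C ◁ t ≫ (α_ _ _ _).inv) ≫ (C ⊗ E) ◁ (s ≫ C ◁ t ≫ (α_ _ _ _).inv) =
      (s ≫ C ◁ t ≫ (α_ _ _ _).inv) ≫ ((δ ⊗ₘ d) ≫ tensorμ C C E E) ▷ X ≫ (α_ _ _ _).hom := by
  calc _ = s ≫ C ◁ (t ≫ E ◁ s) ⊗≫ (C ⊗ E ⊗ C) ◁ t ⊗≫ 𝟙 _ := by monoidal
    _ = (s ≫ C ◁ s) ⊗≫ (C ⊗ C) ◁ t ⊗≫ C ◁ ((β_ C E).hom ▷ X ≫ (E ⊗ C) ◁ t) ⊗≫ 𝟙 _ := by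
        rw [hst]; monoidal
    _ = (s ≫ C ◁ s) ⊗≫ (C ⊗ C) ◁ (t ≫ E ◁ t) ⊗≫ C ◁ (β_ C E).hom ▷ (E ⊗ X) ⊗≫ 𝟙 _ := by
        rw [← whisker_exchange]; monoidal
    _ = s ≫ (δ ▷ X ≫ (C ⊗ C) ◁ t) ⊗≫ (C ⊗ C) ◁ d ▷ X ⊗≫ C ◁ (β_ C E).hom ▷ (E ⊗ X) ⊗≫ 𝟙 _ := by
        rw [hs, ht]; monoidal
    _ = s ≫ C ◁ t ⊗≫ (δ ▷ E ≫ (C ⊗ C) ◁ d) ▷ X ⊗≫ C ◁ (β_ C E).hom ▷ (E ⊗ X) ⊗≫ 𝟙 _ := by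
        rw [← whisker_exchange]; monoidal
    _ = _ := by rw [← MonoidalCategory.tensorHom_def, tensorμ]; monoidal

lemma right_coassoc_aux {δ : C ⟶ C ⊗ C} {d : E ⟶ E ⊗ E} {r : X ⟶ X ⊗ C} {q : X ⟶ X ⊗ E}
    (hr : r ≫ r ▷ C = r ≫ X ◁ δ ≫ (α_ _ _ _).inv) (hq : q ≫ q ▷ E = q ≫ X ◁ d ≫ (α_ _ _ _).inv)
    (hrq : r ≫ q ▷ C = q ≫ r ▷ E ≫ (α_ _ _ _).hom ≫ X ◁ (β_ C E).hom ≫ (α_ _ _ _).inv) :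
    (q ≫ r ▷ E ≫ (α_ _ _ _).hom) ≫ (q ≫ r ▷ E ≫ (α_ _ _ _).hom) ▷ (C ⊗ E) =
      (q ≫ r ▷ E ≫ (α_ _ _ _).hom) ≫ X ◁ ((δ ⊗ₘ d) ≫ tensorμ C C E E) ≫ (α_ _ _ _).inv := by
  calc _ = q ≫ (r ≫ q ▷ C) ▷ E ⊗≫ r ▷ (E ⊗ C ⊗ E) ⊗≫ 𝟙 _ := by monoidal
    _ = (q ≫ q ▷ E) ⊗≫ r ▷ (E ⊗ E) ⊗≫ (X ◁ (β_ C E).hom ≫ r ▷ (E ⊗ C)) ▷ E ⊗≫ 𝟙 _ := by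
        rw [hrq]; monoidal
    _ = (q ≫ q ▷ E) ⊗≫ (r ≫ r ▷ C) ▷ (E ⊗ E) ⊗≫ (X ⊗ C) ◁ (β_ C E).hom ▷ E ⊗≫ 𝟙 _ := by
        rw [whisker_exchange]; monoidal
    _ = q ≫ (X ◁ d ≫ r ▷ (E ⊗ E)) ⊗≫ X ◁ δ ▷ (E ⊗ E) ⊗≫ (X ⊗ C) ◁ (β_ C E).hom ▷ E ⊗≫ 𝟙 _ := by
        rw [hr, hq]; monoidal
    _ = q ≫ r ▷ E ⊗≫ X ◁ (C ◁ d ≫ δ ▷ (E ⊗ E)) ⊗≫ (X ⊗ C) ◁ (β_ C E).hom ▷ E ⊗≫ 𝟙 _ := by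
        rw [whisker_exchange]; monoidal
    _ = _ := by rw [← MonoidalCategory.tensorHom_def', tensorμ]; monoidal

variable {L R : V}

lemma left_right_aux_left {s : X ⟶ C ⊗ X} {t : X ⟶ E ⊗ X} {r : X ⟶ X ⊗ R}
    (hs : s ≫ C ◁ r = r ≫ s ▷ R ≫ (α_ _ _ _).hom) (ht : t ≫ E ◁ r = r ≫ t ▷ R ≫ (α_ _ _ _).hom) :
    (s ≫ C ◁ t ≫ (α_ _ _ _).inv) ≫ (C ⊗ E) ◁ r =
      r ≫ (s ≫ C ◁ t ≫ (α_ _ _ _).inv) ▷ R ≫ (α_ _ _ _).hom := by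
  calc _ = s ≫ C ◁ (t ≫ E ◁ r) ⊗≫ 𝟙 _ := by monoidal
    _ = (s ≫ C ◁ r) ⊗≫ C ◁ t ▷ R ⊗≫ 𝟙 _ := by rw [ht]; monoidal
    _ = _ := by rw [hs]; monoidal

lemma left_right_aux_right {l : X ⟶ L ⊗ X} {r : X ⟶ X ⊗ C} {q : X ⟶ X ⊗ E}
    (hr : l ≫ L ◁ r = r ≫ l ▷ C ≫ (α_ _ _ _).hom) (hq : l ≫ L ◁ q = q ≫ l ▷ E ≫ (α_ _ _ _).hom) :
    l ≫ L ◁ (q ≫ r ▷ E ≫ (α_ _ _ _).hom) =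
      (q ≫ r ▷ E ≫ (α_ _ _ _).hom) ≫ l ▷ (C ⊗ E) ≫ (α_ _ _ _).hom := by
  calc _ = (l ≫ L ◁ q) ⊗≫ L ◁ r ▷ E ⊗≫ 𝟙 _ := by monoidal
    _ = q ≫ (l ≫ L ◁ r) ▷ E ⊗≫ 𝟙 _ := by rw [hq]; monoidal
    _ = _ := by rw [hr]; monoidal

lemma braid_comm_aux {l : X ⟶ C ⊗ X} {s : X ⟶ E ⊗ X}
    (h : s ≫ E ◁ l = l ≫ C ◁ s ≫ (α_ _ _ _).inv ≫ (β_ C E).hom ▷ X ≫ (α_ _ _ _).hom) :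
    s ≫ E ◁ (l ≫ (β_ C X).hom) = (l ≫ (β_ C X).hom) ≫ s ▷ C ≫ (α_ _ _ _).hom := by
  have n := BraidedCategory.braiding_naturality_right C s
  rw [Category.assoc, ← reassoc_of% n, whiskerLeft_comp, reassoc_of% h,
    BraidedCategory.braiding_tensor_right_hom]
  simp

lemma braid_coassoc_aux {δ : C ⟶ C ⊗ C} {l : X ⟶ C ⊗ X}
    (h : l ≫ C ◁ l = l ≫ δ ▷ X ≫ (α_ _ _ _).hom) :
    (l ≫ (β_ C X).hom) ≫ (l ≫ (β_ C X).hom) ▷ C =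
      (l ≫ (β_ C X).hom) ≫ X ◁ (δ ≫ (β_ C C).hom) ≫ (α_ _ _ _).inv := by
  have n := BraidedCategory.braiding_naturality_right C (l ≫ (β_ C X).hom)
  have n' := BraidedCategory.braiding_naturality_left δ X
  calc _ = (l ≫ C ◁ l) ≫ C ◁ (β_ C X).hom ≫ (β_ C (X ⊗ C)).hom := by
        rw [Category.assoc, ← n]; simp
    _ = l ≫ (δ ▷ X ≫ (β_ (C ⊗ C) X).hom) ≫ X ◁ (β_ C C).hom ≫ (α_ _ _ _).inv := by
        rw [h, BraidedCategory.braiding_tensor_right_hom, BraidedCategory.braiding_tensor_left_hom]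
        simp
    _ = _ := by rw [n']; simp

lemma braid_right_aux {l : X ⟶ C ⊗ X} {q : X ⟶ X ⊗ E}
    (h : l ≫ C ◁ q = q ≫ l ▷ E ≫ (α_ _ _ _).hom) :
    (l ≫ (β_ C X).hom) ≫ q ▷ C = q ≫ (l ≫ (β_ C X).hom) ▷ E ≫ (α_ _ _ _).hom ≫
      X ◁ (β_ C E).hom ≫ (α_ _ _ _).inv := by
  have n := BraidedCategory.braiding_naturality_right C q
  rw [Category.assoc, ← n, reassoc_of% h, BraidedCategory.braiding_tensor_right_hom]
  simp

lemma braid_counit_aux {l : X ⟶ C ⊗ X} {e : C ⟶ 𝟙_ V} (h : l ≫ e ▷ X = (λ_ X).inv) :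
    (l ≫ (β_ C X).hom) ≫ X ◁ e = (ρ_ X).inv := by
  rw [Category.assoc, ← BraidedCategory.braiding_naturality_left, reassoc_of% h]
  simp

lemma comp_hom_inv {P Q R : V} (l : P ⟶ Q) (e : Q ≅ R) : (l ≫ e.hom) ≫ e.inv = l := by simp

lemma id_comm_left {l l' : X ⟶ C ⊗ X} (h : l = l') : 𝟙 X ≫ l = l' ≫ C ◁ 𝟙 X := by
  subst h; simp

lemma id_comm_right {r r' : X ⟶ X ⊗ C} (h : r = r') : 𝟙 X ≫ r = r' ≫ 𝟙 X ▷ C := by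
  subst h; simp

lemma left_proj₁ {s : X ⟶ C ⊗ X} {t : X ⟶ E ⊗ X} {e : E ⟶ 𝟙_ V} (h : t ≫ e ▷ X = (λ_ X).inv) :
    (s ≫ C ◁ t ≫ (α_ _ _ _).inv) ≫ (C ◁ e ≫ (ρ_ _).hom) ▷ X = s :=
  calc _ = s ≫ C ◁ (t ≫ e ▷ X) ⊗≫ 𝟙 _ := by monoidal
    _ = _ := by rw [h]; monoidal

lemma left_proj₂ {s : X ⟶ C ⊗ X} {t : X ⟶ E ⊗ X} {e : C ⟶ 𝟙_ V} (h : s ≫ e ▷ X = (λ_ X).inv) :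
    (s ≫ C ◁ t ≫ (α_ _ _ _).inv) ≫ (e ▷ E ≫ (λ_ _).hom) ▷ X = t :=
  calc _ = s ≫ (C ◁ t ≫ e ▷ (E ⊗ X)) ⊗≫ 𝟙 _ := by monoidal
    _ = (s ≫ e ▷ X) ⊗≫ t ⊗≫ 𝟙 _ := by rw [whisker_exchange]; monoidal
    _ = _ := by rw [h]; monoidal

lemma right_proj₁ {r : X ⟶ X ⊗ C} {q : X ⟶ X ⊗ E} {e : E ⟶ 𝟙_ V} (h : q ≫ X ◁ e = (ρ_ X).inv) :
    (q ≫ r ▷ E ≫ (α_ _ _ _).hom) ≫ X ◁ (C ◁ e ≫ (ρ_ _).hom) = r :=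
  calc _ = q ≫ (r ▷ E ≫ (X ⊗ C) ◁ e) ⊗≫ 𝟙 _ := by monoidal
    _ = (q ≫ X ◁ e) ⊗≫ r ⊗≫ 𝟙 _ := by rw [← whisker_exchange]; monoidal
    _ = _ := by rw [h]; monoidal

lemma right_proj₂ {r : X ⟶ X ⊗ C} {q : X ⟶ X ⊗ E} {e : C ⟶ 𝟙_ V} (h : r ≫ X ◁ e = (ρ_ X).inv) :
    (q ≫ r ▷ E ≫ (α_ _ _ _).hom) ≫ X ◁ (e ▷ E ≫ (λ_ _).hom) = q :=
  calc _ = q ≫ (r ≫ X ◁ e) ▷ E ⊗≫ 𝟙 _ := by monoidal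
    _ = _ := by rw [h]; monoidal

end

namespace Cell
variable {C D : Comon V}

/-- A comodule `C ⇸ D` with commuting left coactions by `C^o` and `D` is a comodule
`C^o ⊗ D ⇸ C^o ⊗ D`. -/
def ofFlat (W : Comodule C D) (s : LeftCoaction (opp C) W) (t : LeftCoaction D W)
    (h : t.act ≫ D.X ◁ s.act = s.act ≫ C.X ◁ t.act ≫ (α_ C.X D.X W.X).inv ≫
      (β_ C.X D.X).hom ▷ W.X ≫ (α_ D.X C.X W.X).hom) : Cell C D where
  X := W.X
  left := s.act ≫ C.X ◁ t.act ≫ (α_ C.X D.X W.X).inv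
  right := W.right ≫ (W.left ≫ (β_ C.X W.X).hom) ▷ D.X ≫ (α_ W.X C.X D.X).hom
  left_counit := by
    rw [← p₂_counit, comp_whiskerRight]
    exact ((Category.assoc _ _ _).symm.trans (congrArg (· ≫ D.comon.counit ▷ W.X)
      (left_proj₂ s.counit))).trans t.counit
  left_coassoc := left_coassoc_aux s.coassoc t.coassoc h
  right_counit := by
    rw [← p₂_counit, MonoidalCategory.whiskerLeft_comp]
    refine ((Category.assoc _ _ _).symm.trans (congrArg (· ≫ W.X ◁ D.comon.counit)
      (right_proj₂ (braid_counit_aux W.left_counit)))).trans W.right_counit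
  right_coassoc := right_coassoc_aux (braid_coassoc_aux W.left_coassoc) W.right_coassoc
    (braid_right_aux W.left_right)
  left_right := left_right_aux_right (left_right_aux_left (braid_comm_aux s.comm_left)
    (braid_comm_aux t.comm_left)) (left_right_aux_left s.comm_right t.comm_right)

lemma ofFlat_r₁ (W : Comodule C D) (s t h) : (ofFlat W s t h).r₁ = W.left ≫ (β_ C.X W.X).hom :=
  right_proj₁ W.right_counit

lemma ofFlat_r₂ (W : Comodule C D) (s t h) : (ofFlat W s t h).r₂ = W.right :=
  right_proj₂ (braid_counit_aux W.left_counit)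

/-- The comodule underlying `ofFlat`. -/
def ofFlatIso (W : Comodule C D) (s t h) : W ≅ (ofFlat W s t h).flat := by
  have h₁ : (ofFlat W s t h).flat.left = W.left :=
    (congrArg (· ≫ (β_ C.X W.X).inv) (ofFlat_r₁ W s t h)).trans (comp_hom_inv _ _)
  have h₂ : (ofFlat W s t h).flat.right = W.right := ofFlat_r₂ W s t h
  exact ⟨⟨𝟙 W.X, id_comm_left h₁, id_comm_right h₂⟩,
    ⟨𝟙 W.X, id_comm_left h₁.symm, id_comm_right h₂.symm⟩,
    hom_ext (Category.id_comp _), hom_ext (Category.id_comp _)⟩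

lemma ofFlat_l₁ (W : Comodule C D) (s t h) : (ofFlat W s t h).l₁ = s.act := left_proj₁ t.counit

lemma ofFlat_l₂ (W : Comodule C D) (s t h) : (ofFlat W s t h).l₂ = t.act := left_proj₂ s.counit

end Cell

lemma compL_compR_aux {M N Z B E : V} {i : Z ⟶ M ⊗ N} [Mono (E ◁ B ◁ i)]
    {s : M ⟶ B ⊗ M} {t : N ⟶ E ⊗ N}
    {S : Z ⟶ B ⊗ Z} {T : Z ⟶ E ⊗ Z} (hS : S ≫ B ◁ i = i ≫ s ▷ N ≫ (α_ _ _ _).hom)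
    (hT : T ≫ E ◁ i = i ≫ M ◁ t ≫ (α_ _ _ _).inv ≫ (β_ M E).hom ▷ N ≫ (α_ _ _ _).hom) :
    T ≫ E ◁ S = S ≫ B ◁ T ≫ (α_ _ _ _).inv ≫ (β_ B E).hom ▷ Z ≫ (α_ _ _ _).hom := by
  have n := BraidedCategory.braiding_naturality_left s E
  rw [← cancel_mono (E ◁ B ◁ i)]
  calc _ = T ≫ E ◁ (S ≫ B ◁ i) := by simp
    _ = (T ≫ E ◁ i) ≫ E ◁ (s ▷ N ≫ (α_ _ _ _).hom) := by rw [hS]; simp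
    _ = i ≫ M ◁ t ⊗≫ ((β_ M E).hom ≫ E ◁ s) ▷ N ⊗≫ 𝟙 _ := by rw [hT]; monoidal
    _ = i ≫ (M ◁ t ≫ s ▷ (E ⊗ N)) ⊗≫ B ◁ (β_ M E).hom ▷ N ⊗≫ (β_ B E).hom ▷ (M ⊗ N) ⊗≫ 𝟙 _ := by
        rw [← n, BraidedCategory.braiding_tensor_left_hom]; monoidal
    _ = (i ≫ s ▷ N ≫ (α_ _ _ _).hom) ≫ B ◁ (M ◁ t ≫ (α_ _ _ _).inv ≫ (β_ M E).hom ▷ N ≫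
          (α_ _ _ _).hom) ≫ (α_ _ _ _).inv ≫ (β_ B E).hom ▷ (M ⊗ N) ≫ (α_ _ _ _).hom := by
        rw [whisker_exchange]; monoidal
    _ = S ≫ B ◁ (i ≫ M ◁ t ≫ (α_ _ _ _).inv ≫ (β_ M E).hom ▷ N ≫ (α_ _ _ _).hom) ≫
          (α_ _ _ _).inv ≫ (β_ B E).hom ▷ (M ⊗ N) ≫ (α_ _ _ _).hom := by
        rw [← hS]; monoidal
    _ = S ≫ B ◁ T ≫ (α_ _ _ _).inv ≫ ((B ⊗ E) ◁ i ≫ (β_ B E).hom ▷ (M ⊗ N)) ≫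
          (α_ _ _ _).hom := by
        rw [← hT]; monoidal
    _ = _ := by rw [whisker_exchange]; monoidal

variable [HasCoreflexiveEqualizers V]
  [∀ X : V, Comonad.PreservesLimitOfIsCoreflexivePair (tensorLeft X)]

/-- Universal targets of pairs are in `𝒳`. -/
lemma Admissible.mem_of_isLan {𝒳 : ∀ C D : Comon V, Cell C D → Prop} (h𝒳 : Admissible 𝒳)
    {C D E : Comon V} {X : Cell C D} {Y : Cell D E} (hX : 𝒳 C D X) (hY : 𝒳 D E Y) {T : Cell C E}
    {u : comp X.flat Y.flat ⟶ T.flat} (hu : (X.multi.tensor Y.multi).IsLan T u) : 𝒳 C E T := by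
  let s := X.s.compL Y.flat
  let t := Y.t.compR X.flat
  have h : t.act ≫ E.X ◁ s.act = s.act ≫ C.X ◁ t.act ≫ (α_ C.X E.X _).inv ≫
      (β_ C.X E.X).hom ▷ _ ≫ (α_ E.X C.X _).hom := by
    have m : Mono (E.X ◁ C.X ◁ inc X.flat Y.flat) := inferInstance
    exact compL_compR_aux (X.s.compLMap_inc Y.flat) (Y.t.compRMap_inc X.flat)
  let Z := Cell.ofFlat (comp X.flat Y.flat) s t h
  let e : comp X.flat Y.flat ≅ Z.flat := Cell.ofFlatIso _ s t h
  have e₁ : s.act ≫ (opp C).X ◁ e.hom.hom = e.hom.hom ≫ Z.s.act := by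
    have := Cell.ofFlat_l₁ (comp X.flat Y.flat) s t h
    refine Eq.trans ?_ (Category.id_comp _).symm
    refine (congrArg (s.act ≫ ·) (whiskerLeft_id _ _)).trans ((Category.comp_id _).trans this.symm)
  have e₂ : t.act ≫ E.X ◁ e.hom.hom = e.hom.hom ≫ Z.t.act := by
    have := Cell.ofFlat_l₂ (comp X.flat Y.flat) s t h
    refine Eq.trans ?_ (Category.id_comp _).symm
    refine (congrArg (t.act ≫ ·) (whiskerLeft_id _ _)).trans ((Category.comp_id _).trans this.symm)
  have hZ : 𝒳 C E Z := h𝒳.tensor X Y Z e ⟨e₁, e₂⟩ hX hY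
  have e₁' : Coact.Eqv Z.multi.s e.inv (X.multi.tensor Y.multi).s :=
    Coact.Eqv.inv (a := (X.multi.tensor Y.multi).s) (b := Z.multi.s) e₁
  have e₂' : Coact.Eqv Z.multi.t e.inv (X.multi.tensor Y.multi).t :=
    Coact.Eqv.inv (a := (X.multi.tensor Y.multi).t) (b := Z.multi.t) e₂
  have hv : Z.multi.IsMor T.multi (e.inv ≫ u) :=
    ⟨e₁'.comp hu.cell.s, e₂'.comp hu.cell.t, fun x hx => hx.elim⟩
  let v : Z ⟶ T := Cell.homOfFlat (e.inv ≫ u) hv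
  refine h𝒳.epi Z T v ⟨fun {W} f g hfg => hu.hom_ext ?_⟩ hZ
  have h₁ : Cell.flatMap v ≫ Cell.flatMap f = Cell.flatMap v ≫ Cell.flatMap g :=
    congrArg Cell.flatMap hfg
  have h₂ : e.hom ≫ Cell.flatMap v = u := e.hom_inv_id_assoc u
  rw [← h₂, Category.assoc, Category.assoc, h₁]

end QuantumModules

namespace QuantumModules
open Comodule

variable {V : Type u} [Category.{v} V] [MonoidalCategory V] [BraidedCategory V]
  [HasCoreflexiveEqualizers V]
  [∀ X : V, Comonad.PreservesLimitOfIsCoreflexivePair (tensorLeft X)]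

namespace Multi
variable {C D E : Comon V}

/-- A morphism whose target has no more pairs of coactions than its source. -/
structure IsQuot (P Q : Multi C D) (φ : P.M ⟶ Q.M) : Prop where
  isMor : P.IsMor Q φ
  pairs : ∀ y ∈ Q.pairs, ∃ x ∈ P.pairs, CoactPair.Rel φ x y

lemma IsQuot.id (P : Multi C D) : IsQuot P P (𝟙 P.M) :=
  ⟨.id P, fun y hy => ⟨y, hy, ⟨Coact.Eqv.id y.l₁, Coact.Eqv.id y.l₂⟩⟩⟩

lemma isQuot_of_cell {X Y : Cell C D} (f : X ⟶ Y) : IsQuot X.multi Y.multi (Cell.flatMap f) :=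
  ⟨flatMap_isMor f, fun y hy => hy.elim⟩

lemma IsQuot.tensor {P P' : Multi C D} {Q Q' : Multi D E} {φ : P.M ⟶ P'.M} {ψ : Q.M ⟶ Q'.M}
    (h : IsQuot P P' φ) (h' : IsQuot Q Q' ψ) :
    IsQuot (P.tensor Q) (P'.tensor Q') (compMap φ ψ) where
  isMor := h.isMor.tensor h'.isMor
  pairs z hz := by
    rcases hz with ⟨x, hx, rfl⟩ | rfl | ⟨y, hy, rfl⟩
    · obtain ⟨y, hy, hxy⟩ := h.pairs x hx
      exact ⟨_, .inl ⟨y, hy, rfl⟩, hxy.compL ψ⟩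
    · exact ⟨_, .inr (.inl rfl), ⟨h.isMor.t.compL ψ, h'.isMor.s.compR φ⟩⟩
    · obtain ⟨z, hz, hyz⟩ := h'.pairs y hy
      exact ⟨_, .inr (.inr ⟨z, hz, rfl⟩), hyz.compR φ⟩

lemma IsQuot.isMor_of_comp {P Q : Multi C D} {φ : P.M ⟶ Q.M} (h : IsQuot P Q φ) [Epi φ.hom]
    {Y : Cell C D} {g : Q.M ⟶ Y.flat} (hg : P.IsMor Y.multi (φ ≫ g)) : Q.IsMor Y.multi g := by
  have key : ∀ {K : V} {a b : Coact K P.M} {a' b' : Coact K Q.M}, a.Eqv φ a' → b.Eqv φ b' →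
      a.act ≫ K ◁ (φ ≫ g).hom = b.act ≫ K ◁ (φ ≫ g).hom →
      a'.act ≫ K ◁ g.hom = b'.act ≫ K ◁ g.hom := fun {K a b a' b'} h₁ h₂ e => by
    rw [Coact.Eqv] at h₁ h₂
    rwa [comp_hom, whiskerLeft_comp, reassoc_of% h₁, reassoc_of% h₂, cancel_epi] at e
  have key' : ∀ {K : V} {a : Coact K P.M} {a' : Coact K Q.M} {y : Coact K Y.flat}, a.Eqv φ a' →
      a.Eqv (φ ≫ g) y → a'.Eqv g y := fun {K a a' y} h₁ e => by
    rw [Coact.Eqv] at h₁ e ⊢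
    rwa [comp_hom, whiskerLeft_comp, reassoc_of% h₁, Category.assoc, cancel_epi] at e
  refine ⟨key' h.isMor.s hg.s, key' h.isMor.t hg.t, fun y hy => .inr ?_⟩
  obtain ⟨x, hx, hxy⟩ := h.pairs y hy
  rcases hg.pairs x hx with ⟨z, hz, _⟩ | hb
  · exact hz.elim
  · cases hxy with | mk h₁ h₂ => exact key h₁ h₂ hb

end Multi

lemma Ctx.map_isQuot {C D : Comon V} {P Q : Multi C D} {φ : P.M ⟶ Q.M} (h : P.IsQuot Q φ) :
    {A B : Comon V} → (c : Ctx C D A B) →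
      (c.multi P).IsQuot (c.multi Q) (c.map (P := P) (Q := Q) φ)
  | _, _, hole => h
  | _, _, app q => h.tensor (.id _)
  | _, _, cons X c => (Multi.IsQuot.id X.multi).tensor (c.map_isQuot h)

namespace Comodule.RCoeq
variable {D : Comon V} {M N L : Comodule D D} {f g : M ⟶ N} {π : N ⟶ L}
  {k₁ : ComonadStr M} {k₂ : ComonadStr N}

/-- A reflexive coequalizer of comonads is a comonad. -/
lemma exists_comonadStr (h : RCoeq f g π) (hf : k₁.IsMap k₂ f) (hg : k₁.IsMap k₂ g) :
    ∃ k : ComonadStr L, k₂.IsMap k π := by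
  obtain ⟨δ, hδ⟩ := h.exists_desc (k₂.comul ≫ compMap π π) (by
    rw [← Category.assoc, ← Category.assoc, hf.comul, hg.comul, Category.assoc, Category.assoc,
      ← compMap_comp, ← compMap_comp, h.w])
  obtain ⟨ε, hε⟩ := h.exists_desc k₂.counit (by rw [hf.counit, hg.counit])
  refine ⟨⟨δ, ε, h.hom_ext ?_, h.hom_ext ?_, h.hom_ext ?_⟩, ⟨hδ, hε⟩⟩
  · rw [← Category.assoc, hδ, Category.assoc, ← compMap_comp, hε, Category.comp_id,
      unitL_naturality, ← k₂.counit_left, Category.assoc, ← compMap_comp, Category.id_comp,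
      Category.comp_id]
  · rw [← Category.assoc, hδ, Category.assoc, ← compMap_comp, hε, Category.comp_id,
      unitR_naturality, ← k₂.counit_right, Category.assoc, ← compMap_comp, Category.id_comp,
      Category.comp_id]
  · calc _ = k₂.comul ≫ compMap (𝟙 _ ≫ π) (k₂.comul ≫ compMap π π) ≫ assocInv L L L := by
          rw [← Category.assoc, hδ, Category.assoc, ← Category.assoc (compMap π π), ← compMap_comp,
            hδ, Category.comp_id, Category.id_comp]
      _ = (k₂.comul ≫ compMap (𝟙 _) k₂.comul ≫ assocInv N N N) ≫ compMap (compMap π π) π := by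
          rw [compMap_comp, Category.assoc, assocInv_naturality, Category.assoc, Category.assoc]
      _ = _ := by
          rw [k₂.coassoc, ← Category.assoc π, hδ, Category.assoc, Category.assoc, ← compMap_comp,
            ← compMap_comp, hδ, Category.id_comp, Category.comp_id]

lemma isMap_of_comp (h : RCoeq f g π) {k : ComonadStr L} (hk : k₂.IsMap k π) {Y : Comodule D D}
    {y : ComonadStr Y} {φ : L ⟶ Y} (hφ : k₂.IsMap y (π ≫ φ)) : k.IsMap y φ where
  comul := h.hom_ext (by
    rw [← Category.assoc, hφ.comul, ← Category.assoc, hk.comul, Category.assoc, ← compMap_comp])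
  counit := h.hom_ext (by rw [← Category.assoc, hφ.counit, hk.counit])

/-- Reflexive coequalizers of comonads are computed on the underlying comodules. -/
lemma isColimit_comonadOn (h : RCoeq f g π) (hf : k₁.IsMap k₂ f) (hg : k₁.IsMap k₂ g)
    {k : ComonadStr L} (hk : k₂.IsMap k π) :
    let F : ComonadOn.mk M k₁ ⟶ ComonadOn.mk N k₂ := ⟨f, hf⟩
    let G : ComonadOn.mk M k₁ ⟶ ComonadOn.mk N k₂ := ⟨g, hg⟩
    let P : ComonadOn.mk N k₂ ⟶ ComonadOn.mk L k := ⟨π, hk⟩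
    ∃ w : F ≫ P = G ≫ P, Nonempty (IsColimit (Cofork.ofπ P w)) := by
  intro F G P
  refine ⟨ComonadOn.Hom.ext h.w, ⟨Cofork.IsColimit.ofExistsUnique fun s => ?_⟩⟩
  obtain ⟨l, hl⟩ := h.exists_desc (s.π : ComonadOn.Hom _ _).hom
    (congrArg ComonadOn.Hom.hom s.condition)
  have hs := (s.π : ComonadOn.Hom _ _).isMap
  rw [← hl] at hs
  refine ⟨⟨l, h.isMap_of_comp hk hs⟩, ComonadOn.Hom.ext hl, fun l' hl' => ComonadOn.Hom.ext ?_⟩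
  exact h.hom_ext ((congrArg ComonadOn.Hom.hom hl').trans hl.symm)

lemma flatMap {C D : Comon V} {M N L : Cell C D} {f g : M ⟶ N} {π : N ⟶ L} (h : RCoeq f g π) :
    RCoeq (Cell.flatMap f) (Cell.flatMap g) (Cell.flatMap π) where
  w := congrArg Cell.flatMap h.w
  refl := by
    obtain ⟨s, h₁, h₂⟩ := h.refl
    exact ⟨Cell.flatMap s, congrArg Cell.flatMap h₁, congrArg Cell.flatMap h₂⟩
  desc := h.desc

end Comodule.RCoeq

end QuantumModules

namespace QuantumModules
open Comodule

variable {V : Type u} [Category.{v} V] [MonoidalCategory V] [BraidedCategory V]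
  [HasCoreflexiveEqualizers V]
  [∀ X : V, Comonad.PreservesLimitOfIsCoreflexivePair (tensorLeft X)]

section
variable {C D E F : Comon V}

lemma isLan_two {X : Cell C D} {Y : Cell D E} {T : Cell C E} {u : comp X.flat Y.flat ⟶ T.flat} :
    IsLan (.two X Y) T u ↔ (X.multi.tensor Y.multi).IsLan T u :=
  ⟨fun h => ⟨isCell_two.1 h.cell, fun Z f hf => h.desc Z f (isCell_two.2 hf)⟩,
    fun h => ⟨isCell_two.2 h.cell, fun Z f hf => h.desc Z f (isCell_two.1 hf)⟩⟩

lemma isLan_three {X : Cell C D} {Y : Cell D E} {Z : Cell E F} {T : Cell C F}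
    {u : comp X.flat (comp Y.flat Z.flat) ⟶ T.flat} :
    IsLan (.three X Y Z) T u ↔ (X.multi.tensor (Y.multi.tensor Z.multi)).IsLan T u :=
  ⟨fun h => ⟨isCell_three.1 h.cell, fun Z f hf => h.desc Z f (isCell_three.2 hf)⟩,
    fun h => ⟨isCell_three.2 h.cell, fun Z f hf => h.desc Z f (isCell_three.1 hf)⟩⟩

lemma Admissible.exists_isLan {𝒳 : ∀ C D : Comon V, Cell C D → Prop} (h𝒳 : Admissible 𝒳)
    {X : Cell C D} {Y : Cell D E} (hX : 𝒳 C D X) (hY : 𝒳 D E Y) :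
    ∃ (T : Cell C E) (u : comp X.flat Y.flat ⟶ T.flat),
      (X.multi.tensor Y.multi).IsLan T u ∧ 𝒳 C E T := by
  obtain ⟨T, u, h⟩ := h𝒳.lan (.two X Y) ⟨hX, hY⟩
  exact ⟨T, u, isLan_two.1 h, h𝒳.mem_of_isLan hX hY (isLan_two.1 h)⟩

lemma compMap_id_comp {M : Comodule C D} {N N' N'' : Comodule D E} (f : N ⟶ N') (g : N' ⟶ N'') :
    compMap (𝟙 M) f ≫ compMap (𝟙 M) g = compMap (𝟙 M) (f ≫ g) := by
  rw [← compMap_comp, Category.comp_id]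

lemma compMap_comp_id {M M' M'' : Comodule C D} {N : Comodule D E} (f : M ⟶ M') (g : M' ⟶ M'') :
    compMap f (𝟙 N) ≫ compMap g (𝟙 N) = compMap (f ≫ g) (𝟙 N) := by
  rw [← compMap_comp, Category.comp_id]

end

namespace QModule
variable {a b c : QuantumCategory V} (m : QModule a b) (n : QModule b c)

lemma etaL_αL : a.etaL m.M.flat ≫ m.αL = 𝟙 _ := m.isAct.etaL_actL

lemma etaR_αR : b.etaR m.M.flat ≫ m.αR = 𝟙 _ := m.isAct.etaR_actR

/-- The first of the two maps that are coequalized in `M • N`, given by the left action on `N`. -/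
noncomputable def actN : comp m.M.flat (comp b.A.flat n.M.flat) ⟶ comp m.M.flat n.M.flat :=
  compMap (𝟙 _) n.αL

/-- The second of the two maps that are coequalized in `M • N`, given by the right action on `M`. -/
noncomputable def actM : comp m.M.flat (comp b.A.flat n.M.flat) ⟶ comp m.M.flat n.M.flat :=
  assocInv _ _ _ ≫ compMap m.αR (𝟙 _)

lemma actN_isMor : (m.M.multi.tensor (b.A.multi.tensor n.M.multi)).IsMor
    (m.M.multi.tensor n.M.multi) (m.actN n) := (Multi.IsMor.id _).tensor n.αL_isMor

lemma actM_isMor : (m.M.multi.tensor (b.A.multi.tensor n.M.multi)).IsMor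
    (m.M.multi.tensor n.M.multi) (m.actM n) :=
  (Multi.IsMor.assocInv _ _ _).comp (m.αR_isMor.tensor (.id _))

lemma etaL_actN : compMap (𝟙 m.M.flat) (b.etaL n.M.flat) ≫ m.actN n = 𝟙 _ :=
  (compMap_id_comp _ _).trans ((congrArg _ n.etaL_αL).trans (compMap_id _ _))

lemma etaL_actM : compMap (𝟙 m.M.flat) (b.etaL n.M.flat) ≫ m.actM n = 𝟙 _ := by
  have h := b.mnd.whiskerLeft_etaL (𝓑 := ComodBicat V) (d := a.base) (e := c.base)
    m.M.flat n.M.flat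
  have h' : compMap (𝟙 m.M.flat) (b.etaL n.M.flat) = compMap (b.etaR m.M.flat) (𝟙 n.M.flat) ≫
      (assocIso m.M.flat b.A.flat n.M.flat).inv := h
  have e' : compMap (b.etaR m.M.flat) (𝟙 n.M.flat) ≫ compMap m.αR (𝟙 _) = 𝟙 _ :=
    (compMap_comp_id _ _).trans ((congrArg (compMap · _) m.etaR_αR).trans (compMap_id _ _))
  rw [h', Category.assoc]
  exact (congrArg (_ ≫ ·) (Iso.inv_hom_id_assoc (assocIso m.M.flat b.A.flat n.M.flat) _)).trans e'

end QModule

/-- The composite `M • N` of the underlying comonads, with the universal property that it has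
inside strings in `𝒳`. -/
structure Bullet (𝒳 : ∀ C D : Comon V, Cell C D → Prop) {a b c : QuantumCategory V}
    (m : QModule a b) (n : QModule b c) where
  Q : Cell a.C c.C
  str : ComonadStr Q
  q : comp m.M.flat n.M.flat ⟶ Q.flat
  mem : 𝒳 _ _ Q
  isMor : (m.M.multi.tensor n.M.multi).IsMor Q.multi q
  isCom : ((m.M.amb m.str).tensor (n.M.amb n.str)).IsCom str q
  bal : m.actN n ≫ q = m.actM n ≫ q
  cellEpi {A B : Comon V} (x : Ctx a.C c.C A B) (hx : x.All 𝒳) :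
    Multi.CellEpi (P := x.multi (m.M.multi.tensor n.M.multi)) (R := x.multi Q.multi)
      (x.map (P := m.M.multi.tensor n.M.multi) (Q := Q.multi) q)
  desc {A B : Comon V} (x : Ctx a.C c.C A B) (hx : x.All 𝒳) {Y : Cell A B}
    {f : (x.multi (m.M.multi.tensor n.M.multi)).M ⟶ Y.flat}
    (hf : (x.multi (m.M.multi.tensor n.M.multi)).IsMor Y.multi f)
    (e : x.map (P := m.M.multi.tensor (b.A.multi.tensor n.M.multi))
        (Q := m.M.multi.tensor n.M.multi) (m.actN n) ≫ f =
      x.map (P := m.M.multi.tensor (b.A.multi.tensor n.M.multi))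
        (Q := m.M.multi.tensor n.M.multi) (m.actM n) ≫ f) :
    ∃ g : (x.multi Q.multi).M ⟶ Y.flat, (x.multi Q.multi).IsMor Y.multi g ∧
      x.map (P := m.M.multi.tensor n.M.multi) (Q := Q.multi) q ≫ g = f
  coequalizer : ∃ (T₃ T₂ : ComonadOn (opTensor a.C c.C))
    (u₃ : (Path.three m.M b.A n.M).dom ⟶ Cell.flat T₃.M)
    (u₂ : (Path.two m.M n.M).dom ⟶ Cell.flat T₂.M)
    (d₀ d₁ : T₃ ⟶ T₂) (π : T₂ ⟶ ComonadOn.mk Q str) (h : d₀ ≫ π = d₁ ≫ π),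
    IsLan (.three m.M b.A n.M) T₃.M u₃ ∧
    IsComonadCell (.three m.M b.A n.M) (m.str, b.str, n.str) T₃.M T₃.str u₃ ∧
    IsLan (.two m.M n.M) T₂.M u₂ ∧
    IsComonadCell (.two m.M n.M) (m.str, n.str) T₂.M T₂.str u₂ ∧
    u₃ ≫ Cell.flatMap d₀.hom = compMap (𝟙 m.M.flat) n.αL ≫ u₂ ∧
    u₃ ≫ Cell.flatMap d₁.hom =
      (Subst.cons (p := .two m.M b.A) m.αR (.single (p := .single n.M) (𝟙 n.M.flat))).map ≫ u₂ ∧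
    u₂ ≫ Cell.flatMap π.hom = q ∧
    Nonempty (IsColimit (Cofork.ofπ π h))

theorem nonempty_bullet [HasReflexiveCoequalizers V] {𝒳 : ∀ C D : Comon V, Cell C D → Prop}
    (h𝒳 : Admissible 𝒳) {a b c : QuantumCategory V} (hb : 𝒳 _ _ b.A) {m : QModule a b}
    {n : QModule b c} (hm : 𝒳 _ _ m.M) (hn : 𝒳 _ _ n.M) : Nonempty (Bullet 𝒳 m n) := by
  obtain ⟨T₂, u₂, hu₂, mT₂⟩ := h𝒳.exists_isLan hm hn
  obtain ⟨R, v, hv, mR⟩ := h𝒳.exists_isLan hb hn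
  obtain ⟨T₃, w, hw, mT₃⟩ := h𝒳.exists_isLan hm mR
  let u₃ : comp m.M.flat (comp b.A.flat n.M.flat) ⟶ T₃.flat := compMap (𝟙 m.M.flat) v ≫ w
  have hu₃ : (m.M.multi.tensor (b.A.multi.tensor n.M.multi)).IsLan T₃ u₃ := by
    refine ⟨((Multi.IsMor.id _).tensor hv.cell).comp hw.cell, fun Y f hf => ?_⟩
    obtain ⟨g, ⟨hg, e⟩, hg'⟩ := Ctx.isLan_map h𝒳 (p := .two b.A n.M) ⟨hb, hn⟩ mR hv
      (.cons m.M .hole) ⟨hm, trivial⟩ hf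
    obtain ⟨φ, hφ, hφ'⟩ := hw.desc Y g hg
    refine ⟨φ, ?_, fun ψ hψ => hφ' ψ (hg' _ ⟨hw.cell.comp (flatMap_isMor ψ), ?_⟩)⟩
    · refine Eq.trans ?_ e
      exact (Category.assoc _ _ _).trans (congrArg (_ ≫ ·) hφ)
    · exact (Category.assoc _ _ _).symm.trans hψ
  obtain ⟨k₂, hk₂⟩ := hu₂.exists_comonadStr ((m.M.amb m.str).tensor (n.M.amb n.str))
  obtain ⟨k₃, hk₃⟩ := hu₃.exists_comonadStr
    ((m.M.amb m.str).tensor ((b.A.amb b.str).tensor (n.M.amb n.str)))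
  have hN := m.actN_isMor n
  have hM := m.actM_isMor n
  have cN := (AmbMap.tensor (.id (m.M.amb m.str)) (.ofCom n.αL_isCom)).isCom hN hu₂.cell hk₂
  have cM : ((m.M.amb m.str).tensor ((b.A.amb b.str).tensor (n.M.amb n.str))).IsCom k₂
      (m.actM n ≫ u₂) := by
    have h := m.αR_isMor.tensor (.id n.M.multi)
    have := (AmbMap.assocInv (m.M.amb m.str) (b.A.amb b.str) (n.M.amb n.str)).isCom
      (Multi.IsMor.assocInv _ _ _) (h.comp hu₂.cell)
      ((AmbMap.tensor (.ofCom m.αR_isCom) (.id (n.M.amb n.str))).isCom h hu₂.cell hk₂)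
    rw [QModule.actM, Category.assoc]
    exact this
  obtain ⟨d₀, e₀, _⟩ := hu₃.desc T₂ (m.actN n ≫ u₂) (hN.comp hu₂.cell)
  obtain ⟨d₁, e₁, _⟩ := hu₃.desc T₂ (m.actM n ≫ u₂) (hM.comp hu₂.cell)
  obtain ⟨σ, eσ, _⟩ := hu₂.desc T₃ (compMap (𝟙 m.M.flat) (b.etaL n.M.flat) ≫ u₃)
    (b.whiskerLeft_etaL_isMor hu₃.cell)
  have s₀ : σ ≫ d₀ = 𝟙 T₂ := hu₂.hom_ext (by
    rw [Cell.flatMap_comp, ← Category.assoc, eσ, Category.assoc, e₀, ← Category.assoc]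
    exact ((congrArg (· ≫ u₂) (m.etaL_actN n)).trans (Category.id_comp _)).trans
      (Category.comp_id _).symm)
  have s₁ : σ ≫ d₁ = 𝟙 T₂ := hu₂.hom_ext (by
    rw [Cell.flatMap_comp, ← Category.assoc, eσ, Category.assoc, e₁, ← Category.assoc]
    exact ((congrArg (· ≫ u₂) (m.etaL_actM n)).trans (Category.id_comp _)).trans
      (Category.comp_id _).symm)
  have m₀ : k₃.IsMap k₂ d₀ := hu₃.isMap hk₃ (e₀ ▸ cN)
  have m₁ : k₃.IsMap k₂ d₁ := hu₃.isMap hk₃ (e₁ ▸ cM)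
  obtain ⟨Q, π, h⟩ : ∃ (Q : Cell a.C c.C) (π : T₂ ⟶ Q), RCoeq d₀ d₁ π := exists_rcoeq d₀ d₁ σ s₀ s₁
  obtain ⟨k, hk⟩ := h.exists_comonadStr m₀ m₁
  let N₂ := m.M.multi.tensor n.M.multi
  let N₃ := m.M.multi.tensor (b.A.multi.tensor n.M.multi)
  let q : N₂.M ⟶ Q.flat := u₂ ≫ Cell.flatMap π
  have hq : N₂.IsMor Q.multi q := hu₂.cell.comp (flatMap_isMor π)
  have mapq : ∀ {A B : Comon V} (x : Ctx a.C c.C A B), x.map (P := N₂) (Q := Q.multi) q =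
      x.map (P := N₂) (Q := T₂.multi) u₂ ≫ x.map (P := T₂.multi) (Q := Q.multi) (Cell.flatMap π) :=
    fun x => Ctx.map_comp (P := N₂) (Q := T₂.multi) (R := Q.multi) u₂ (Cell.flatMap π) x
  refine ⟨⟨Q, k, q, ?_, hq, ?_, ?_, ?_, ?_, ?_⟩⟩
  · exact h𝒳.epi T₂ Q π ⟨fun f g e => h.hom_ext e⟩ mT₂
  · exact hk₂.comp hu₂.cell hk
  · have key : ∀ {d : T₃ ⟶ T₂} {ν : N₃.M ⟶ N₂.M}, u₃ ≫ Cell.flatMap d = ν ≫ u₂ →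
        ν ≫ q = u₃ ≫ Cell.flatMap d ≫ Cell.flatMap π := fun {d ν} hd =>
      (Category.assoc _ _ _).symm.trans ((congrArg (· ≫ Cell.flatMap π) hd.symm).trans
        (Category.assoc _ _ _))
    exact (key e₀).trans ((congrArg (u₃ ≫ ·) h.flatMap.w).trans (key e₁).symm)
  · intro A B x hx Y g g' hg hg' e
    have hπ := x.map_isMor (P := T₂.multi) (Q := Q.multi) (flatMap_isMor π)
    rw [mapq, Category.assoc, Category.assoc] at e
    refine (x.rcoeq h𝒳 (P := T₃.multi) (Q := T₂.multi) (R := Q.multi) h.flatMap hx).hom_ext ?_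
    have hu := x.map_isMor (P := N₂) (Q := T₂.multi) hu₂.cell
    exact (Ctx.isLan_map h𝒳 (p := .two m.M n.M) ⟨hm, hn⟩ mT₂ hu₂ x hx
      (hu.comp (hπ.comp hg'))).unique ⟨hπ.comp hg, e⟩ ⟨hπ.comp hg', rfl⟩
  · intro A B x hx Y f hf e
    obtain ⟨g, ⟨hg, eg⟩, _⟩ := Ctx.isLan_map h𝒳 (p := .two m.M n.M) ⟨hm, hn⟩ mT₂ hu₂ x hx hf
    have hN' := x.map_isMor (P := N₃) (Q := N₂) hN
    have hd₀ := x.map_isMor (P := T₃.multi) (Q := T₂.multi) (flatMap_isMor d₀)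
    have hd₁ := x.map_isMor (P := T₃.multi) (Q := T₂.multi) (flatMap_isMor d₁)
    have key : ∀ {d : T₃ ⟶ T₂} {ν : N₃.M ⟶ N₂.M}, u₃ ≫ Cell.flatMap d = ν ≫ u₂ →
        x.map (P := N₃) (Q := T₃.multi) u₃ ≫
          x.map (P := T₃.multi) (Q := T₂.multi) (Cell.flatMap d) ≫ g =
        x.map (P := N₃) (Q := N₂) ν ≫ f := fun {d ν} hd => by
      have h₁ := Ctx.map_comp (P := N₃) (Q := T₃.multi) (R := T₂.multi) u₃ (Cell.flatMap d) x
      have h₂ := Ctx.map_comp (P := N₃) (Q := N₂) (R := T₂.multi) ν u₂ x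
      refine (Category.assoc _ _ _).symm.trans ?_
      refine (congrArg (· ≫ g) (h₁.symm.trans
        ((congrArg (x.map (P := N₃) (Q := T₂.multi)) hd).trans h₂))).trans ?_
      exact (Category.assoc _ _ _).trans (congrArg (_ ≫ ·) eg)
    have hd := (Ctx.isLan_map h𝒳 (p := .three m.M b.A n.M) ⟨hm, hb, hn⟩ mT₃ hu₃ x hx
      (hN'.comp hf)).unique ⟨hd₀.comp hg, key e₀⟩ ⟨hd₁.comp hg, (key e₁).trans e.symm⟩
    have r := x.rcoeq h𝒳 (P := T₃.multi) (Q := T₂.multi) (R := Q.multi) h.flatMap hx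
    obtain ⟨g', eg'⟩ := r.exists_desc g hd
    have := r.epi
    refine ⟨g', (x.map_isQuot (P := T₂.multi) (Q := Q.multi)
      (Multi.isQuot_of_cell π)).isMor_of_comp (eg' ▸ hg), ?_⟩
    rw [mapq, Category.assoc, eg']; exact eg
  · obtain ⟨wc, hc⟩ := h.isColimit_comonadOn m₀ m₁ hk
    refine ⟨⟨T₃, k₃⟩, ⟨T₂, k₂⟩, u₃, u₂, ⟨d₀, m₀⟩, ⟨d₁, m₁⟩, ⟨π, hk⟩, wc, isLan_three.2 hu₃,
      isComonadCell_three.2 hk₃, isLan_two.2 hu₂, isComonadCell_two.2 hk₂, e₀, e₁.trans ?_, rfl, hc⟩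
    exact congrArg (· ≫ u₂) ((subst_two _).trans (congrArg (· ≫ _) (append_two _ _ _))).symm

end QuantumModules

namespace QuantumModules

section bimodules

local infixr:81 " ◀ " => Bicategory.whiskerLeft
local infixl:81 " ▶ " => Bicategory.whiskerRight
local notation "αᵇ" => Bicategory.associator

universe w₁ w₂ w₃
variable {𝓑 : Type w₁} [Bicategory.{w₃, w₂} 𝓑] {c d e : 𝓑}

namespace Mnd
variable {A : c ⟶ c} {a : Mnd A} {B : d ⟶ d} {b : Mnd B}

/-- The associativity law of an action descends along an equivariant map. -/
lemma IsAct.assoc_of_comp {M Q : c ⟶ d} {x : A ≫ M ≫ B ⟶ M} {y : A ≫ Q ≫ B ⟶ Q} {q : M ⟶ Q}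
    (hx : IsAct a b x) (h : A ◀ q ▶ B ≫ y = x ≫ q) :
    A ◀ A ◀ q ▶ (B ≫ B) ≫ (αᵇ A A (Q ≫ B ≫ B)).inv ≫ a.μ ▶ (Q ≫ B ≫ B) ≫ A ◀ Q ◀ b.μ ≫ y =
      A ◀ A ◀ q ▶ (B ≫ B) ≫ A ◀ (A ◀ (αᵇ Q B B).inv ≫ (αᵇ A (Q ≫ B) B).inv ≫ y ▶ B) ≫ y := by
  calc _ = (αᵇ A A (M ≫ B ≫ B)).inv ≫ ((A ≫ A) ◀ q ▶ (B ≫ B) ≫ a.μ ▶ (Q ≫ B ≫ B)) ≫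
        A ◀ Q ◀ b.μ ≫ y := by simp
    _ = (αᵇ A A (M ≫ B ≫ B)).inv ≫ a.μ ▶ (M ≫ B ≫ B) ≫ A ◀ (q ▶ (B ≫ B) ≫ Q ◀ b.μ) ≫ y := by
      rw [Bicategory.whisker_exchange]; simp
    _ = (αᵇ A A (M ≫ B ≫ B)).inv ≫ a.μ ▶ (M ≫ B ≫ B) ≫ A ◀ M ◀ b.μ ≫ (A ◀ q ▶ B ≫ y) := by
      rw [← Bicategory.whisker_exchange]; simp
    _ = A ◀ (A ◀ (αᵇ M B B).inv ≫ (αᵇ A (M ≫ B) B).inv ≫ x ▶ B) ≫ A ◀ q ▶ B ≫ y := by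
      have := hx.assoc
      rw [h, reassoc_of% this]
    _ = A ◀ (A ◀ (αᵇ M B B).inv ≫ (αᵇ A (M ≫ B) B).inv ≫ (x ≫ q) ▶ B) ≫ y := by simp
    _ = _ := by rw [← h]; simp

lemma IsAct.unit_of_comp {M Q : c ⟶ d} {x : A ≫ M ≫ B ⟶ M} {y : A ≫ Q ≫ B ⟶ Q} {q : M ⟶ Q}
    (hx : IsAct a b x) (h : A ◀ q ▶ B ≫ y = x ≫ q) :
    q ≫ b.etaR Q ≫ a.etaL (Q ≫ B) ≫ y = q := by
  rw [← reassoc_of% b.etaR_naturality q, ← reassoc_of% a.etaL_naturality (q ▶ B), h,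
    ← Category.assoc, ← Category.assoc, Category.assoc (b.etaR M), hx.unit, Category.id_comp]

lemma equivariant_of_comp {M Q Y : c ⟶ d} {x : A ≫ M ≫ B ⟶ M} {y : A ≫ Q ≫ B ⟶ Q}
    {z : A ≫ Y ≫ B ⟶ Y} {q : M ⟶ Q} {f : M ⟶ Y} {g : Q ⟶ Y} (h : A ◀ q ▶ B ≫ y = x ≫ q)
    (hf : A ◀ f ▶ B ≫ z = x ≫ f) (hg : q ≫ g = f) :
    A ◀ q ▶ B ≫ y ≫ g = A ◀ q ▶ B ≫ A ◀ g ▶ B ≫ z := by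
  rw [reassoc_of% h, hg, ← hf, ← hg]; simp

end Mnd
end bimodules

open Comodule

variable {V : Type u} [Category.{v} V] [MonoidalCategory V] [BraidedCategory V]
  [HasCoreflexiveEqualizers V]
  [∀ X : V, Comonad.PreservesLimitOfIsCoreflexivePair (tensorLeft X)]

namespace QModule
variable {a b c : QuantumCategory V} (m : QModule a b) (n : QModule b c)

/-- The action on the composite of the underlying comodules. -/
noncomputable def tensorAct : comp a.A.flat (comp (comp m.M.flat n.M.flat) c.A.flat) ⟶
    comp m.M.flat n.M.flat :=
  compMap (𝟙 _) (assocIso m.M.flat n.M.flat c.A.flat).inv ≫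
    assocInv a.A.flat m.M.flat (comp n.M.flat c.A.flat) ≫ compMap m.αL (𝟙 _) ≫ compMap (𝟙 _) n.αR

lemma isAct_tensorAct : a.mnd.IsAct c.mnd (𝓑 := ComodBicat V) (c := a.base) (d := c.base)
    (M := comp m.M.flat n.M.flat) (m.tensorAct n) := by
  have h := Mnd.isAct_tensorAct (𝓑 := ComodBicat V) (c := a.base) (d := b.base) (e := c.base)
    (M := m.M.flat) (N := n.M.flat) (x := m.α) (y := n.α) m.isAct n.isAct
  exact h

lemma assoc_tensorAct : compMap (𝟙 _) (assocInv m.M.flat n.M.flat c.A.flat) ≫ m.tensorAct n =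
    assocInv a.A.flat m.M.flat (comp n.M.flat c.A.flat) ≫ compMap m.αL n.αR := by
  have h : compMap (𝟙 a.A.flat) (assocInv m.M.flat n.M.flat c.A.flat) ≫
      compMap (𝟙 _) (assocIso m.M.flat n.M.flat c.A.flat).inv = 𝟙 _ :=
    (compMap_id_comp _ _).trans
      ((congrArg _ (assocIso m.M.flat n.M.flat c.A.flat).hom_inv_id).trans (compMap_id _ _))
  rw [tensorAct, ← Category.assoc, h, Category.id_comp]
  exact congrArg (_ ≫ ·) (compMap_eq _ _).symm

lemma tensorAct_isMor :
    (a.A.multi.tensor ((m.M.multi.tensor n.M.multi).tensor c.A.multi)).IsMor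
      (m.M.multi.tensor n.M.multi) (m.tensorAct n) :=
  ((Multi.IsMor.id a.A.multi).tensor (Multi.IsMor.assocHom _ _ _)).comp
    ((Multi.IsMor.assocInv _ _ _).comp ((m.αL_isMor.tensor (.id _)).comp
      ((Multi.IsMor.id _).tensor n.αR_isMor)))

lemma tensorAct_isCom {Y : Cell a.C c.C} {y : ComonadStr Y} {f : comp m.M.flat n.M.flat ⟶ Y.flat}
    (hf : (m.M.multi.tensor n.M.multi).IsMor Y.multi f)
    (h : ((m.M.amb m.str).tensor (n.M.amb n.str)).IsCom y f) :
    ((a.A.amb a.str).tensor (((m.M.amb m.str).tensor (n.M.amb n.str)).tensor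
      (c.A.amb c.str))).IsCom y (m.tensorAct n ≫ f) := by
  have h₄ : (m.M.multi.tensor (n.M.multi.tensor c.A.multi)).IsMor (m.M.multi.tensor n.M.multi)
    (compMap (𝟙 m.M.flat) n.αR) := (Multi.IsMor.id _).tensor n.αR_isMor
  have h₃ : ((a.A.multi.tensor m.M.multi).tensor (n.M.multi.tensor c.A.multi)).IsMor
    (m.M.multi.tensor (n.M.multi.tensor c.A.multi)) (compMap m.αL (𝟙 _)) :=
      m.αL_isMor.tensor (.id _)
  have h₂ := Multi.IsMor.assocInv a.A.multi m.M.multi (n.M.multi.tensor c.A.multi)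
  have h₁ : (a.A.multi.tensor ((m.M.multi.tensor n.M.multi).tensor c.A.multi)).IsMor
      (a.A.multi.tensor (m.M.multi.tensor (n.M.multi.tensor c.A.multi)))
      (compMap (𝟙 a.A.flat) (assocIso m.M.flat n.M.flat c.A.flat).inv) :=
    (Multi.IsMor.id a.A.multi).tensor (Multi.IsMor.assocHom _ _ _)
  have c₄ := (AmbMap.tensor (.id (m.M.amb m.str)) (.ofCom n.αR_isCom)).isCom h₄ hf h
  have c₃ := (AmbMap.tensor (.ofCom m.αL_isCom)
    (.id ((n.M.amb n.str).tensor (c.A.amb c.str)))).isCom h₃ (h₄.comp hf) c₄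
  have c₂ := (AmbMap.assocInv (a.A.amb a.str) (m.M.amb m.str)
    ((n.M.amb n.str).tensor (c.A.amb c.str))).isCom h₂ (h₃.comp (h₄.comp hf)) c₃
  have c₁ := (AmbMap.tensor (.id (a.A.amb a.str))
    (.assocHom (m.M.amb m.str) (n.M.amb n.str) (c.A.amb c.str))).isCom h₁
      (h₂.comp (h₃.comp (h₄.comp hf))) c₂
  rw [tensorAct, Category.assoc, Category.assoc, Category.assoc]
  exact c₁

end QModule

namespace Bullet
variable {𝒳 : ∀ C D : Comon V, Cell C D → Prop} {a b c : QuantumCategory V}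
  {m : QModule a b} {n : QModule b c}

lemma exists_act (x : Bullet 𝒳 m n) (ha : 𝒳 _ _ a.A) (hc : 𝒳 _ _ c.A) :
    ∃ α : comp a.A.flat (comp x.Q.flat c.A.flat) ⟶ x.Q.flat,
      (a.A.multi.tensor (x.Q.multi.tensor c.A.multi)).IsMor x.Q.multi α ∧
      compMap (𝟙 a.A.flat) (compMap x.q (𝟙 c.A.flat)) ≫ α = m.tensorAct n ≫ x.q :=
  x.desc (.cons a.A (.app (.single c.A))) ⟨ha, hc⟩ ((m.tensorAct_isMor n).comp x.isMor)
    (Mnd.tensorAct_balanced m.isAct n.isAct (x.bal.trans (Category.assoc _ _ _)))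

variable (x : Bullet 𝒳 m n) (ha : 𝒳 _ _ a.A) (hc : 𝒳 _ _ c.A)

/-- The composite of quantum modules. -/
noncomputable def mod : QModule a c where
  M := x.Q
  str := x.str
  α := (x.exists_act ha hc).choose
  isQModule := by
    obtain ⟨h, e⟩ := (x.exists_act ha hc).choose_spec
    generalize (x.exists_act ha hc).choose = α at h e
    refine isQModule_iff.2 ⟨h, ?_, ⟨?_, ?_⟩⟩
    · refine (AmbMap.tensor (.id (a.A.amb a.str)) (.tensor (.ofCom x.isCom)
        (.id (c.A.amb c.str)))).isCom_of_comp
          ((Multi.IsMor.id a.A.multi).tensor (x.isMor.tensor (.id _)))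
          (x.cellEpi (.cons a.A (.app (.single c.A))) ⟨ha, hc⟩) h ?_
      rw [e]
      exact m.tensorAct_isCom n x.isMor x.isCom
    · have h₁ : (a.A.multi.tensor (a.A.multi.tensor (x.Q.multi.tensor (c.A.multi.tensor
          c.A.multi)))).IsMor x.Q.multi _ := (Multi.IsMor.assocInv a.A.multi a.A.multi
            (x.Q.multi.tensor (c.A.multi.tensor c.A.multi))).comp ((a.μ_isMor.tensor (.id _)).comp
              (((Multi.IsMor.id a.A.multi).tensor ((Multi.IsMor.id x.Q.multi).tensor c.μ_isMor)).comp
                h))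
      have h₂ : (a.A.multi.tensor (a.A.multi.tensor (x.Q.multi.tensor (c.A.multi.tensor
          c.A.multi)))).IsMor x.Q.multi _ := ((Multi.IsMor.id a.A.multi).tensor
            (((Multi.IsMor.id a.A.multi).tensor (Multi.IsMor.assocInv x.Q.multi c.A.multi
              c.A.multi)).comp ((Multi.IsMor.assocInv a.A.multi (x.Q.multi.tensor c.A.multi)
                c.A.multi).comp (h.tensor (.id _))))).comp h
      exact x.cellEpi (.cons a.A (.cons a.A (.app (.two c.A c.A)))) ⟨ha, ha, hc, hc⟩ h₁ h₂
        (Mnd.IsAct.assoc_of_comp (m.isAct_tensorAct n) e)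
    · have h₁ : x.Q.multi.IsMor x.Q.multi (c.etaR x.Q.flat ≫ a.etaL (comp x.Q.flat c.A.flat) ≫ α) :=
        c.etaR_isMor (a.etaL_isMor h)
      exact x.cellEpi .hole trivial h₁ (.id _)
        ((Mnd.IsAct.unit_of_comp (m.isAct_tensorAct n) e).trans (Category.comp_id _).symm)

lemma mod_α : compMap (𝟙 a.A.flat) (compMap x.q (𝟙 c.A.flat)) ≫ (x.mod ha hc).α =
    m.tensorAct n ≫ x.q := (x.exists_act ha hc).choose_spec.2

lemma isBullet : IsBullet m n (x.mod ha hc) x.q where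
  coequalizer := x.coequalizer
  action := by
    refine (congrArg (· ≫ (x.mod ha hc).α) ((subst_single_cons
      (.cons (p := .two m.M n.M) x.q (.single (p := .single c.A) (𝟙 c.A.flat)))).trans
        (congrArg _ ((subst_two _).trans (congrArg (· ≫ _) (append_two _ _ _)))))).trans ?_
    refine (congrArg (· ≫ (x.mod ha hc).α) (compMap_id_comp _ _).symm).trans ?_
    refine (Category.assoc _ _ _).trans ((congrArg (_ ≫ ·) (x.mod_α ha hc)).trans ?_)
    refine (Category.assoc _ _ _).symm.trans (congrArg (· ≫ x.q) ((m.assoc_tensorAct n).trans ?_))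
    exact congrArg (· ≫ compMap m.αL n.αR) (append_two _ _ _).symm

/-- Maps out of a composite. -/
lemma exists_hom {y : QModule a c} {f : comp m.M.flat n.M.flat ⟶ y.M.flat}
    (hf : (m.M.multi.tensor n.M.multi).IsMor y.M.multi f)
    (hc' : ((m.M.amb m.str).tensor (n.M.amb n.str)).IsCom y.str f)
    (hbal : m.actN n ≫ f = m.actM n ≫ f)
    (hact : compMap (𝟙 a.A.flat) (compMap f (𝟙 c.A.flat)) ≫ y.α = m.tensorAct n ≫ f) :
    ∃ φ : x.mod ha hc ⟶ y, x.q ≫ Cell.flatMap φ.hom = f := by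
  obtain ⟨g, hg, e⟩ := x.desc .hole trivial hf hbal
  let φ : x.Q ⟶ y.M := Cell.homOfFlat g hg
  have he : x.q ≫ Cell.flatMap φ = f := e
  refine ⟨⟨φ, ?_, ?_⟩, he⟩
  · refine Cell.isCom_iff.1 ((AmbMap.ofCom x.isCom).isCom_of_comp x.isMor
      (x.cellEpi .hole trivial) (flatMap_isMor φ) ?_)
    rw [← he] at hc'; exact hc'
  · refine x.cellEpi (.cons a.A (.app (.single c.A))) ⟨ha, hc⟩
      ((x.mod ha hc).α_isMor.comp hg) (Multi.IsMor.comp (Q := a.A.multi.tensor (y.M.multi.tensor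
        c.A.multi)) ((Multi.IsMor.id a.A.multi).tensor
        (hg.tensor (.id _))) y.α_isMor) ?_
    exact Mnd.equivariant_of_comp (𝓑 := ComodBicat V) (c := a.base) (d := c.base)
      (x.mod_α ha hc) hact he

lemma hom_ext {y : QModule a c} {φ ψ : x.mod ha hc ⟶ y}
    (h : x.q ≫ Cell.flatMap φ.hom = x.q ≫ Cell.flatMap ψ.hom) : φ = ψ :=
  QModule.Hom.ext (Cell.flatMap_injective (x.cellEpi .hole trivial (flatMap_isMor φ.hom)
    (flatMap_isMor ψ.hom) h))

end Bullet

end QuantumModules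

namespace QuantumModules

section bimodules

local infixr:81 " ◀ " => Bicategory.whiskerLeft
local infixl:81 " ▶ " => Bicategory.whiskerRight
local notation "αᵇ" => Bicategory.associator
local infixr:80 " ≫ᵇ " => bicategoricalComp

universe w₁ w₂ w₃
variable {𝓑 : Type w₁} [Bicategory.{w₃, w₂} 𝓑] {c d e o : 𝓑}

namespace Mnd
variable {A : c ⟶ c} {a : Mnd A} {B : d ⟶ d} {b : Mnd B} {C : e ⟶ e} {k : Mnd C}

lemma actL_of_comp {M Q : c ⟶ d} {x : A ≫ M ≫ B ⟶ M} {y : A ≫ Q ≫ B ⟶ Q} {q : M ⟶ Q}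
    (h : A ◀ q ▶ B ≫ y = x ≫ q) : A ◀ q ≫ b.actL y = b.actL x ≫ q := by
  rw [actL, ← Category.assoc, ← Bicategory.whiskerLeft_comp, ← b.etaR_naturality,
    Bicategory.whiskerLeft_comp, Category.assoc, h, actL, Category.assoc]

lemma actR_of_comp {M Q : c ⟶ d} {x : A ≫ M ≫ B ⟶ M} {y : A ≫ Q ≫ B ⟶ Q} {q : M ⟶ Q}
    (h : A ◀ q ▶ B ≫ y = x ≫ q) : q ▶ B ≫ a.actR y = a.actR x ≫ q := by
  rw [actR, ← reassoc_of% a.etaL_naturality (q ▶ B), h, actR, Category.assoc]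

section
variable {M : c ⟶ d} {N : d ⟶ e} {x : A ≫ M ≫ B ⟶ M} {y : B ≫ N ≫ C ⟶ N}

lemma actL_tensorAct (hy : IsAct b k y) :
    k.actL (b.tensorAct x y) = (αᵇ A M N).inv ≫ b.actL x ▶ N := by
  have h := hy.etaR_actR
  calc _ = 𝟙 _ ≫ᵇ ((A ≫ M) ◀ k.etaR N ≫ b.actL x ▶ (N ≫ C)) ≫ M ◀ b.actR y := by
        rw [actL, tensorAct, etaR_comp]; bicategory
    _ = 𝟙 _ ≫ᵇ b.actL x ▶ N ≫ M ◀ (k.etaR N ≫ b.actR y) := by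
        rw [Bicategory.whisker_exchange]; bicategory
    _ = _ := by rw [h]; bicategory

lemma actR_tensorAct (hx : IsAct a b x) :
    a.actR (b.tensorAct x y) = (αᵇ M N C).hom ≫ M ◀ b.actR y := by
  have h := hx.etaL_actL
  have n := a.etaL_naturality (αᵇ M N C).hom
  calc _ = (αᵇ M N C).hom ≫ (a.etaL M ≫ b.actL x) ▶ (N ≫ C) ≫ M ◀ b.actR y := by
        rw [actR, tensorAct, reassoc_of% n, etaL_comp]; simp
    _ = _ := by rw [h]; simp

lemma tensorAct_naturality {M' : c ⟶ d} {N' : d ⟶ e} {x' : A ≫ M' ≫ B ⟶ M'}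
    {y' : B ≫ N' ≫ C ⟶ N'} {f : M ⟶ M'} {g : N ⟶ N'} (hf : A ◀ f ▶ B ≫ x' = x ≫ f)
    (hg : B ◀ g ▶ C ≫ y' = y ≫ g) :
    A ◀ (f ▶ N ≫ M' ◀ g) ▶ C ≫ b.tensorAct x' y' = b.tensorAct x y ≫ f ▶ N ≫ M' ◀ g := by
  have h₁ := actL_of_comp (b := b) hf
  have h₂ := actR_of_comp (a := b) hg
  calc _ = 𝟙 _ ≫ᵇ (A ◀ f) ▶ (N ≫ C) ≫ᵇ ((A ≫ M') ◀ g ▶ C ≫ b.actL x' ▶ (N' ≫ C)) ≫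
        M' ◀ b.actR y' := by simp only [tensorAct]; bicategory
    _ = 𝟙 _ ≫ᵇ (A ◀ f ≫ b.actL x') ▶ (N ≫ C) ≫ M' ◀ (g ▶ C ≫ b.actR y') := by
        rw [Bicategory.whisker_exchange]; bicategory
    _ = 𝟙 _ ≫ᵇ b.actL x ▶ (N ≫ C) ≫ (f ▶ (N ≫ C) ≫ M' ◀ b.actR y) ≫ M' ◀ g := by
        rw [h₁, h₂]; bicategory
    _ = _ := by rw [← Bicategory.whisker_exchange]; simp only [tensorAct]; bicategory

end

section
variable {M M' X : c ⟶ d} {N N' : d ⟶ e} {nL : B ≫ N ⟶ N} {nL' : B ≫ N' ⟶ N'} {mR : M ≫ B ⟶ M}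
  {mR' : M' ≫ B ⟶ M'} {f : M ⟶ M'} {g : N ⟶ N'}

lemma balL_naturality (hg : B ◀ g ≫ nL' = nL ≫ g) :
    M ◀ nL ≫ f ▶ N ≫ M' ◀ g = (f ▶ (B ≫ N) ≫ M' ◀ B ◀ g) ≫ M' ◀ nL' := by
  rw [Category.assoc, ← Bicategory.whiskerLeft_comp, hg, Bicategory.whisker_exchange_assoc,
    Bicategory.whiskerLeft_comp]

lemma balR_naturality (hf : f ▶ B ≫ mR' = mR ≫ f) :
    ((αᵇ M B N).inv ≫ mR ▶ N) ≫ f ▶ N ≫ M' ◀ g =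
      (f ▶ (B ≫ N) ≫ M' ◀ B ◀ g) ≫ (αᵇ M' B N').inv ≫ mR' ▶ N' :=
  calc _ = 𝟙 _ ≫ᵇ (mR ≫ f) ▶ N ≫ M' ◀ g := by bicategory
    _ = 𝟙 _ ≫ᵇ (f ▶ B) ▶ N ≫ (mR' ▶ N ≫ M' ◀ g) := by rw [← hf]; bicategory
    _ = _ := by rw [← Bicategory.whisker_exchange]; bicategory

end

section
variable {L : e ⟶ o} {M : c ⟶ d} {N : d ⟶ e} {X : c ⟶ e} {Y : d ⟶ o} {W Z : c ⟶ o}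
  {mR : M ≫ B ⟶ M} {nL : B ≫ N ⟶ N} {nR : N ≫ C ⟶ N} {lL : C ≫ L ⟶ L} {xR : X ≫ C ⟶ X}
  {yL : B ≫ Y ⟶ Y} {q : M ≫ N ⟶ X} {p : N ≫ L ⟶ Y} {w : M ≫ Y ⟶ W} {z : X ≫ L ⟶ Z}

lemma assoc_balanced₁ (hy : B ◀ p ≫ yL = ((αᵇ B N L).inv ≫ nL ▶ L) ≫ p)
    (hw : M ◀ yL ≫ w = (αᵇ M B Y).inv ≫ mR ▶ Y ≫ w) :
    (M ◀ nL) ▶ L ≫ (αᵇ M N L).hom ≫ M ◀ p ≫ w =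
      ((αᵇ M B N).inv ≫ mR ▶ N) ▶ L ≫ (αᵇ M N L).hom ≫ M ◀ p ≫ w :=
  calc _ = 𝟙 _ ≫ᵇ M ◀ (((αᵇ B N L).inv ≫ nL ▶ L) ≫ p) ≫ w := by bicategory
    _ = 𝟙 _ ≫ᵇ M ◀ B ◀ p ≫ (M ◀ yL ≫ w) := by rw [← hy]; bicategory
    _ = 𝟙 _ ≫ᵇ ((M ≫ B) ◀ p ≫ mR ▶ Y) ≫ w := by rw [hw]; bicategory
    _ = _ := by rw [Bicategory.whisker_exchange]; bicategory

lemma assoc_balanced₂ {f : X ≫ L ⟶ W} (hx : q ▶ C ≫ xR = ((αᵇ M N C).hom ≫ M ◀ nR) ≫ q)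
    (hp : N ◀ lL ≫ p = (αᵇ N C L).inv ≫ nR ▶ L ≫ p)
    (hf : q ▶ L ≫ f = (αᵇ M N L).hom ≫ M ◀ p ≫ w) :
    q ▶ (C ≫ L) ≫ X ◀ lL ≫ f = q ▶ (C ≫ L) ≫ ((αᵇ X C L).inv ≫ xR ▶ L) ≫ f := by
  calc _ = (M ≫ N) ◀ lL ≫ q ▶ L ≫ f := by rw [Bicategory.whisker_exchange_assoc]
    _ = 𝟙 _ ≫ᵇ M ◀ (N ◀ lL ≫ p) ≫ w := by rw [hf]; bicategory
    _ = 𝟙 _ ≫ᵇ M ◀ nR ▶ L ≫ᵇ (αᵇ M N L).hom ≫ M ◀ p ≫ w := by rw [hp]; bicategory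
    _ = 𝟙 _ ≫ᵇ (((αᵇ M N C).hom ≫ M ◀ nR) ≫ q) ▶ L ≫ f := by rw [← hf]; bicategory
    _ = _ := by rw [← hx]; bicategory

lemma assoc_balanced₃ (hx : q ▶ C ≫ xR = ((αᵇ M N C).hom ≫ M ◀ nR) ≫ q)
    (hz : X ◀ lL ≫ z = (αᵇ X C L).inv ≫ xR ▶ L ≫ z) :
    M ◀ N ◀ lL ≫ (αᵇ M N L).inv ≫ q ▶ L ≫ z =
      M ◀ ((αᵇ N C L).inv ≫ nR ▶ L) ≫ (αᵇ M N L).inv ≫ q ▶ L ≫ z :=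
  calc _ = 𝟙 _ ≫ᵇ ((M ≫ N) ◀ lL ≫ q ▶ L) ≫ z := by bicategory
    _ = 𝟙 _ ≫ᵇ q ▶ (C ≫ L) ≫ (X ◀ lL ≫ z) := by rw [Bicategory.whisker_exchange]; bicategory
    _ = 𝟙 _ ≫ᵇ (q ▶ C ≫ xR) ▶ L ≫ z := by rw [hz]; bicategory
    _ = _ := by rw [hx]; bicategory

lemma assoc_balanced₄ {f : M ≫ Y ⟶ Z} (hy : B ◀ p ≫ yL = ((αᵇ B N L).inv ≫ nL ▶ L) ≫ p)
    (hq : M ◀ nL ≫ q = (αᵇ M B N).inv ≫ mR ▶ N ≫ q)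
    (hf : M ◀ p ≫ f = (αᵇ M N L).inv ≫ q ▶ L ≫ z) :
    M ◀ B ◀ p ≫ M ◀ yL ≫ f = M ◀ B ◀ p ≫ ((αᵇ M B Y).inv ≫ mR ▶ Y) ≫ f :=
  calc _ = M ◀ (B ◀ p ≫ yL) ≫ f := by bicategory
    _ = 𝟙 _ ≫ᵇ M ◀ nL ▶ L ≫ (M ◀ p ≫ f) := by rw [hy]; bicategory
    _ = 𝟙 _ ≫ᵇ (M ◀ nL ≫ q) ▶ L ≫ z := by rw [hf]; bicategory
    _ = 𝟙 _ ≫ᵇ mR ▶ N ▶ L ≫ᵇ ((αᵇ M N L).inv ≫ q ▶ L ≫ z) := by rw [hq]; bicategory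
    _ = 𝟙 _ ≫ᵇ (mR ▶ (N ≫ L) ≫ M ◀ p) ≫ f := by rw [← hf]; bicategory
    _ = _ := by rw [← Bicategory.whisker_exchange]; bicategory

end

section
variable {D : o ⟶ o} {l : Mnd D} {M : c ⟶ d} {N : d ⟶ e} {L : e ⟶ o} {X : c ⟶ e} {Y : d ⟶ o}
  {W : c ⟶ o} {x : A ≫ M ≫ B ⟶ M} {y : B ≫ N ≫ C ⟶ N} {z : C ≫ L ≫ D ⟶ L} {s : A ≫ X ≫ C ⟶ X}
  {t : B ≫ Y ≫ D ⟶ Y} {r : A ≫ W ≫ D ⟶ W} {q : M ≫ N ⟶ X} {p : N ≫ L ⟶ Y} {w : M ≫ Y ⟶ W}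
  {f : X ≫ L ⟶ W}

lemma assoc_equivariant (hx : IsAct a b x) (hy : IsAct b k y) (hz : IsAct k l z)
    (hq : A ◀ q ▶ C ≫ s = b.tensorAct x y ≫ q) (hp : B ◀ p ▶ D ≫ t = k.tensorAct y z ≫ p)
    (hw : A ◀ w ▶ D ≫ r = b.tensorAct x t ≫ w) (hf : q ▶ L ≫ f = (αᵇ M N L).hom ≫ M ◀ p ≫ w) :
    A ◀ q ▶ (L ≫ D) ≫ A ◀ (αᵇ X L D).inv ≫ A ◀ f ▶ D ≫ r =
      A ◀ q ▶ (L ≫ D) ≫ A ◀ (αᵇ X L D).inv ≫ k.tensorAct s z ≫ f := by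
  have h₁ := actL_of_comp (b := k) hq
  rw [actL_tensorAct hy] at h₁
  have h₂ := actR_of_comp (a := b) hp
  rw [actR_tensorAct hy] at h₂
  calc _ = 𝟙 _ ≫ᵇ A ◀ (q ▶ L ≫ f) ▶ D ≫ r := by bicategory
    _ = 𝟙 _ ≫ᵇ A ◀ M ◀ p ▶ D ≫ᵇ (A ◀ w ▶ D ≫ r) := by rw [hf]; bicategory
    _ = 𝟙 _ ≫ᵇ ((A ≫ M) ◀ (p ▶ D) ≫ b.actL x ▶ (Y ≫ D)) ≫ M ◀ b.actR t ≫ w := by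
        rw [hw, tensorAct]; bicategory
    _ = 𝟙 _ ≫ᵇ b.actL x ▶ ((N ≫ L) ≫ D) ≫ M ◀ (p ▶ D ≫ b.actR t) ≫ w := by
        rw [Bicategory.whisker_exchange]; bicategory
    _ = 𝟙 _ ≫ᵇ b.actL x ▶ (N ≫ L ≫ D) ≫ᵇ (M ≫ N) ◀ k.actR z ≫ᵇ
          ((αᵇ M N L).hom ≫ M ◀ p ≫ w) := by rw [h₂]; bicategory
    _ = 𝟙 _ ≫ᵇ b.actL x ▶ (N ≫ L ≫ D) ≫ᵇ ((M ≫ N) ◀ k.actR z ≫ q ▶ L) ≫ f := by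
        rw [← hf]; bicategory
    _ = 𝟙 _ ≫ᵇ (((αᵇ A M N).inv ≫ b.actL x ▶ N) ≫ q) ▶ (L ≫ D) ≫ X ◀ k.actR z ≫ f := by
        rw [Bicategory.whisker_exchange]; bicategory
    _ = _ := by rw [← h₁, tensorAct]; bicategory

end
end Mnd
end bimodules

end QuantumModules

namespace QuantumModules
open Comodule

variable {V : Type u} [Category.{v} V] [MonoidalCategory V] [BraidedCategory V]
  [HasCoreflexiveEqualizers V]
  [∀ X : V, Comonad.PreservesLimitOfIsCoreflexivePair (tensorLeft X)]

lemma square_inv {𝒞 : Type*} [Category* 𝒞] {P Q X Y : 𝒞} {F : P ⟶ Q} {G : Q ⟶ P} {x : P ⟶ X}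
    {y : Q ⟶ Y} {f : X ⟶ Y} {g : Y ⟶ X} (h : F ≫ y = x ≫ f) (hF : G ≫ F = 𝟙 _) (hf : f ≫ g = 𝟙 _) :
    y ≫ g = G ≫ x := by
  rw [← Category.id_comp (y ≫ g), ← hF, Category.assoc, reassoc_of% h, hf, Category.comp_id]

lemma fork_comp {𝒞 : Type*} [Category* 𝒞] {P Q X Y Z : 𝒞} {u v : P ⟶ Q} {u' v' : X ⟶ Y} {f : Q ⟶ Y}
    {F : P ⟶ X} {g : Y ⟶ Z} (h₁ : u ≫ f = F ≫ u') (h₂ : v ≫ f = F ≫ v') (h : u' ≫ g = v' ≫ g) :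
    u ≫ f ≫ g = v ≫ f ≫ g := by
  rw [reassoc_of% h₁, h, reassoc_of% h₂]

lemma square_paste {𝒞 : Type*} [Category* 𝒞] {P Q R X Y Z : 𝒞} {F : P ⟶ Q} {G : Q ⟶ R} {x : P ⟶ X}
    {y : Q ⟶ Y} {z : R ⟶ Z} {f : X ⟶ Y} {g : Y ⟶ Z} (h : F ≫ y = x ≫ f) (h' : G ≫ z = y ≫ g) :
    (F ≫ G) ≫ z = x ≫ f ≫ g := by
  rw [Category.assoc, h', reassoc_of% h]

lemma whisker_comp {C D E F : Comon V} {M : Comodule C D} {N₁ N₂ N₃ : Comodule D E}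
    {L : Comodule E F} (f : N₁ ⟶ N₂) (g : N₂ ⟶ N₃) : compMap (𝟙 M) (compMap (f ≫ g) (𝟙 L)) =
      compMap (𝟙 M) (compMap f (𝟙 L)) ≫ compMap (𝟙 M) (compMap g (𝟙 L)) := by
  rw [compMap_id_comp, compMap_comp_id]

namespace QModule
variable {a b c : QuantumCategory V} {m n : QModule a b}

lemma hom_isMor (φ : m ⟶ n) : m.M.multi.IsMor n.M.multi (Cell.flatMap φ.hom) := flatMap_isMor φ.hom

lemma hom_isCom (φ : m ⟶ n) : (m.M.amb m.str).IsCom n.str (Cell.flatMap φ.hom) :=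
  Cell.isCom_iff.2 φ.isMap

lemma hom_act (φ : m ⟶ n) : compMap (𝟙 a.A.flat) (compMap (Cell.flatMap φ.hom) (𝟙 b.A.flat)) ≫ n.α =
    m.α ≫ Cell.flatMap φ.hom := φ.action.symm

lemma hom_αL (φ : m ⟶ n) : compMap (𝟙 a.A.flat) (Cell.flatMap φ.hom) ≫ n.αL =
    m.αL ≫ Cell.flatMap φ.hom := by
  have h := Mnd.actL_of_comp (𝓑 := ComodBicat V) (c := a.base) (d := b.base)
    (b := b.mnd) (hom_act φ)
  exact h

lemma hom_αR (φ : m ⟶ n) : compMap (Cell.flatMap φ.hom) (𝟙 b.A.flat) ≫ n.αR =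
    m.αR ≫ Cell.flatMap φ.hom := by
  have h := Mnd.actR_of_comp (𝓑 := ComodBicat V) (c := a.base) (d := b.base)
    (a := a.mnd) (hom_act φ)
  exact h

/-- A map of quantum modules is invertible if the underlying comodule map is. -/
noncomputable def isoOfInv (φ : m ⟶ n) (g : n.M.flat ⟶ m.M.flat) (hg : n.M.multi.IsMor m.M.multi g)
    (h₁ : Cell.flatMap φ.hom ≫ g = 𝟙 _) (h₂ : g ≫ Cell.flatMap φ.hom = 𝟙 _) : m ≅ n where
  hom := φ
  inv := ⟨Cell.homOfFlat g hg, by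
    refine Cell.isCom_iff.1 ((AmbMap.ofCom (hom_isCom φ)).isCom_of_comp (hom_isMor φ) ?_
      (flatMap_isMor _) ?_)
    · intro Y f f' _ _ e
      have := congrArg (g ≫ ·) e
      simpa only [← Category.assoc, h₂, Category.id_comp] using this
    · have := Cell.isCom_iff.2 (ComonadStr.IsMap.id m.str)
      rw [Cell.flatMap_id, ← h₁] at this
      exact this, by
    have e : compMap (𝟙 a.A.flat) (compMap g (𝟙 b.A.flat)) ≫
        compMap (𝟙 a.A.flat) (compMap (Cell.flatMap φ.hom) (𝟙 b.A.flat)) = 𝟙 _ := by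
      rw [compMap_id_comp, compMap_comp_id, h₂, compMap_id, compMap_id]
    exact square_inv (hom_act φ) e h₁⟩
  hom_inv_id := Hom.ext (Cell.flatMap_injective ((Cell.flatMap_comp _ _).trans
    (h₁.trans (Cell.flatMap_id _).symm)))
  inv_hom_id := Hom.ext (Cell.flatMap_injective ((Cell.flatMap_comp _ _).trans
    (h₂.trans (Cell.flatMap_id _).symm)))

end QModule

namespace Bullet
variable {𝒳 : ∀ C D : Comon V, Cell C D → Prop} {a b c : QuantumCategory V}
  {m m' : QModule a b} {n n' : QModule b c} (x : Bullet 𝒳 m n) (x' : Bullet 𝒳 m' n')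
  (ha : 𝒳 _ _ a.A) (hc : 𝒳 _ _ c.A)

lemma αL_mod : compMap (𝟙 a.A.flat) x.q ≫ (x.mod ha hc).αL =
    (assocInv a.A.flat m.M.flat n.M.flat ≫ compMap m.αL (𝟙 _)) ≫ x.q := by
  have h := Mnd.actL_of_comp (𝓑 := ComodBicat V) (c := a.base) (d := c.base)
    (b := c.mnd) (x.mod_α ha hc)
  have e := Mnd.actL_tensorAct (𝓑 := ComodBicat V) (c := a.base) (d := b.base) (e := c.base)
    (k := c.mnd) (x := m.α) n.isAct
  have e' : c.mnd.actL (𝓑 := ComodBicat V) (c := a.base) (d := c.base)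
      (M := comp m.M.flat n.M.flat) (m.tensorAct n) =
      assocInv a.A.flat m.M.flat n.M.flat ≫ compMap m.αL (𝟙 _) := e
  exact h.trans (congrArg (· ≫ x.q) e')

lemma αR_mod : compMap x.q (𝟙 c.A.flat) ≫ (x.mod ha hc).αR =
    ((assocIso m.M.flat n.M.flat c.A.flat).inv ≫ compMap (𝟙 _) n.αR) ≫ x.q := by
  have h := Mnd.actR_of_comp (𝓑 := ComodBicat V) (c := a.base) (d := c.base)
    (a := a.mnd) (x.mod_α ha hc)
  have e := Mnd.actR_tensorAct (𝓑 := ComodBicat V) (c := a.base) (d := b.base) (e := c.base)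
    (a := a.mnd) (y := n.α) m.isAct
  have e' : a.mnd.actR (𝓑 := ComodBicat V) (c := a.base) (d := c.base)
      (M := comp m.M.flat n.M.flat) (m.tensorAct n) =
      (assocIso m.M.flat n.M.flat c.A.flat).inv ≫ compMap (𝟙 _) n.αR := e
  exact h.trans (congrArg (· ≫ x.q) e')

lemma exists_map (φ : m ⟶ m') (ψ : n ⟶ n') : ∃ θ : x.mod ha hc ⟶ x'.mod ha hc,
    x.q ≫ Cell.flatMap θ.hom = compMap (Cell.flatMap φ.hom) (Cell.flatMap ψ.hom) ≫ x'.q := by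
  have hm := (QModule.hom_isMor φ).tensor (QModule.hom_isMor ψ)
  refine x.exists_hom ha hc (hm.comp x'.isMor)
    ((AmbMap.tensor (.ofCom (QModule.hom_isCom φ)) (.ofCom (QModule.hom_isCom ψ))).isCom hm
      x'.isMor x'.isCom) ?_ ?_
  · rw [compMap_eq]
    have h₁ : m.actN n ≫ compMap (Cell.flatMap φ.hom) (𝟙 _) ≫ compMap (𝟙 _) (Cell.flatMap ψ.hom) =
        (compMap (Cell.flatMap φ.hom) (𝟙 _) ≫ compMap (𝟙 _) (compMap (𝟙 _) (Cell.flatMap ψ.hom))) ≫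
          m'.actN n' :=
      Mnd.balL_naturality (𝓑 := ComodBicat V) (c := a.base) (d := b.base) (e := c.base)
        (QModule.hom_αL ψ)
    have h₂ : m.actM n ≫ compMap (Cell.flatMap φ.hom) (𝟙 _) ≫ compMap (𝟙 _) (Cell.flatMap ψ.hom) =
        (compMap (Cell.flatMap φ.hom) (𝟙 _) ≫ compMap (𝟙 _) (compMap (𝟙 _) (Cell.flatMap ψ.hom))) ≫
          m'.actM n' :=
      Mnd.balR_naturality (𝓑 := ComodBicat V) (c := a.base) (d := b.base) (e := c.base)
        (QModule.hom_αR φ)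
    exact fork_comp h₁ h₂ x'.bal
  · have h := Mnd.tensorAct_naturality (𝓑 := ComodBicat V) (c := a.base) (d := b.base)
      (e := c.base) (b := b.mnd) (QModule.hom_act φ) (QModule.hom_act ψ)
    have h' : compMap (𝟙 a.A.flat) (compMap (compMap (Cell.flatMap φ.hom) (Cell.flatMap ψ.hom))
        (𝟙 c.A.flat)) ≫ m'.tensorAct n' =
        m.tensorAct n ≫ compMap (Cell.flatMap φ.hom) (Cell.flatMap ψ.hom) := by
      rw [compMap_eq (Cell.flatMap φ.hom)]
      exact h
    exact (congrArg (· ≫ (x'.mod ha hc).α) (whisker_comp _ x'.q)).trans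
      (square_paste h' (x'.mod_α ha hc))

end Bullet

end QuantumModules

namespace QuantumModules
open Comodule

variable {V : Type u} [Category.{v} V] [MonoidalCategory V] [BraidedCategory V]
  [HasCoreflexiveEqualizers V]
  [∀ X : V, Comonad.PreservesLimitOfIsCoreflexivePair (tensorLeft X)]

namespace Bullet
variable {𝒳 : ∀ C D : Comon V, Cell C D → Prop} {a b c d : QuantumCategory V}
  {m : QModule a b} {n : QModule b c} {l : QModule c d}
  {ha : 𝒳 _ _ a.A} {hb : 𝒳 _ _ b.A} {hc : 𝒳 _ _ c.A} {hd : 𝒳 _ _ d.A}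
  (x : Bullet 𝒳 m n) (y : Bullet 𝒳 n l) (z : Bullet 𝒳 (x.mod ha hc) l)
  (w : Bullet 𝒳 m (y.mod hb hd))

lemma exists_desc_assocHom (hl : 𝒳 _ _ l.M) : ∃ f : comp x.Q.flat l.M.flat ⟶ w.Q.flat,
    (x.Q.multi.tensor l.M.multi).IsMor w.Q.multi f ∧ compMap x.q (𝟙 l.M.flat) ≫ f =
      (assocIso m.M.flat n.M.flat l.M.flat).inv ≫ compMap (𝟙 m.M.flat) y.q ≫ w.q :=
  x.desc (.app (.single l.M)) hl ((Multi.IsMor.assocHom m.M.multi n.M.multi l.M.multi).comp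
    (((Multi.IsMor.id m.M.multi).tensor y.isMor).comp w.isMor))
    (Mnd.assoc_balanced₁ (𝓑 := ComodBicat V) (c := a.base) (d := b.base) (e := c.base)
      (o := d.base) (y.αL_mod hb hd) (w.bal.trans (Category.assoc _ _ _)))

lemma assoc_act (hl : 𝒳 _ _ l.M) {f : comp x.Q.flat l.M.flat ⟶ w.Q.flat}
    (e : compMap x.q (𝟙 l.M.flat) ≫ f =
      (assocIso m.M.flat n.M.flat l.M.flat).inv ≫ compMap (𝟙 m.M.flat) y.q ≫ w.q)
    (hf : (x.Q.multi.tensor l.M.multi).IsMor w.Q.multi f) :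
    compMap (𝟙 a.A.flat) (compMap f (𝟙 d.A.flat)) ≫ (w.mod ha hd).α =
      (x.mod ha hc).tensorAct l ≫ f := by
  have i := Multi.IsMor.assocInv x.Q.multi l.M.multi d.A.multi
  have k₁ : (a.A.multi.tensor (x.Q.multi.tensor (l.M.multi.tensor d.A.multi))).IsMor w.Q.multi
      (compMap (𝟙 a.A.flat) (assocInv x.Q.flat l.M.flat d.A.flat) ≫
        compMap (𝟙 a.A.flat) (compMap f (𝟙 d.A.flat)) ≫ (w.mod ha hd).α) :=
    ((Multi.IsMor.id a.A.multi).tensor i).comp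
      (((Multi.IsMor.id a.A.multi).tensor (hf.tensor (.id d.A.multi))).comp (w.mod ha hd).α_isMor)
  have k₂ : (a.A.multi.tensor (x.Q.multi.tensor (l.M.multi.tensor d.A.multi))).IsMor w.Q.multi
      (compMap (𝟙 a.A.flat) (assocInv x.Q.flat l.M.flat d.A.flat) ≫
        (x.mod ha hc).tensorAct l ≫ f) :=
    ((Multi.IsMor.id a.A.multi).tensor i).comp (((x.mod ha hc).tensorAct_isMor l).comp hf)
  have h := Mnd.assoc_equivariant (𝓑 := ComodBicat V) (c := a.base) (d := b.base) (e := c.base)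
    (o := d.base) (a := a.mnd) (b := b.mnd) (k := c.mnd) (l := d.mnd) (x := m.α) (y := n.α)
    (z := l.α) (s := (x.mod ha hc).α) (t := (y.mod hb hd).α) (r := (w.mod ha hd).α) (q := x.q)
    (p := y.q) (w := w.q) (f := f) m.isAct n.isAct l.isAct (x.mod_α ha hc) (y.mod_α hb hd)
    (w.mod_α ha hd) e
  have key := x.cellEpi (.cons a.A (.app (.two l.M d.A))) ⟨ha, hl, hd⟩ k₁ k₂ h
  have iso : IsIso (compMap (𝟙 a.A.flat) (assocInv x.Q.flat l.M.flat d.A.flat)) :=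
    ⟨compMap (𝟙 a.A.flat) (assocIso x.Q.flat l.M.flat d.A.flat).inv,
      (compMap_id_comp _ _).trans ((congrArg _ (assocIso x.Q.flat l.M.flat
        d.A.flat).hom_inv_id).trans (compMap_id _ _)),
      (compMap_id_comp _ _).trans ((congrArg _ (assocIso x.Q.flat l.M.flat
        d.A.flat).inv_hom_id).trans (compMap_id _ _))⟩
  exact iso.epi_of_iso.left_cancellation _ _ key

lemma exists_assoc (hl : 𝒳 _ _ l.M) : ∃ φ : z.mod ha hd ⟶ w.mod ha hd,
    compMap x.q (𝟙 l.M.flat) ≫ z.q ≫ Cell.flatMap φ.hom =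
      (assocIso m.M.flat n.M.flat l.M.flat).inv ≫ compMap (𝟙 m.M.flat) y.q ≫ w.q := by
  obtain ⟨f, hf, e⟩ := x.exists_desc_assocHom y w hl
  have h₁ := Multi.IsMor.assocHom m.M.multi n.M.multi l.M.multi
  have h₂ : (m.M.multi.tensor (n.M.multi.tensor l.M.multi)).IsMor (m.M.multi.tensor y.Q.multi)
    (compMap (𝟙 m.M.flat) y.q) := (Multi.IsMor.id m.M.multi).tensor y.isMor
  obtain ⟨φ, hφ⟩ : ∃ φ : z.mod ha hd ⟶ w.mod ha hd, z.q ≫ Cell.flatMap φ.hom = f := by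
    refine z.exists_hom ha hd hf ?_ ?_ ?_
    · refine (AmbMap.tensor (.ofCom x.isCom) (.id (l.M.amb l.str))).isCom_of_comp
        (x.isMor.tensor (.id _)) (x.cellEpi (.app (.single l.M)) hl) hf ?_
      have c₂ := (AmbMap.tensor (.id (m.M.amb m.str)) (.ofCom y.isCom)).isCom h₂ w.isMor w.isCom
      have c₁ := (AmbMap.assocHom (m.M.amb m.str) (n.M.amb n.str) (l.M.amb l.str)).isCom h₁
        (h₂.comp w.isMor) c₂
      exact e ▸ c₁
    · have k₁ := ((x.mod ha hc).actN_isMor l).comp hf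
      have k₂ := ((x.mod ha hc).actM_isMor l).comp hf
      exact x.cellEpi (.app (.two c.A l.M)) ⟨hc, hl⟩ k₁ k₂
        (Mnd.assoc_balanced₂ (𝓑 := ComodBicat V) (c := a.base) (d := b.base) (e := c.base)
          (o := d.base) (x.αR_mod ha hc) (y.bal.trans (Category.assoc _ _ _)) e)
    · exact x.assoc_act y w hl e hf
  exact ⟨φ, (congrArg (_ ≫ ·) hφ).trans e⟩

lemma exists_desc_assocInv (hm : 𝒳 _ _ m.M) : ∃ f : comp m.M.flat y.Q.flat ⟶ z.Q.flat,
    (m.M.multi.tensor y.Q.multi).IsMor z.Q.multi f ∧ compMap (𝟙 m.M.flat) y.q ≫ f =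
      assocInv m.M.flat n.M.flat l.M.flat ≫ compMap x.q (𝟙 l.M.flat) ≫ z.q :=
  y.desc (.cons m.M .hole) ⟨hm, trivial⟩
    ((Multi.IsMor.assocInv m.M.multi n.M.multi l.M.multi).comp
      ((x.isMor.tensor (.id l.M.multi)).comp z.isMor))
    (Mnd.assoc_balanced₃ (𝓑 := ComodBicat V) (c := a.base) (d := b.base) (e := c.base)
      (o := d.base) (x.αR_mod ha hc) (z.bal.trans (Category.assoc _ _ _)))

lemma exists_assoc_inv (hm : 𝒳 _ _ m.M) : ∃ g : w.Q.flat ⟶ z.Q.flat,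
    w.Q.multi.IsMor z.Q.multi g ∧ compMap (𝟙 m.M.flat) y.q ≫ w.q ≫ g =
      assocInv m.M.flat n.M.flat l.M.flat ≫ compMap x.q (𝟙 l.M.flat) ≫ z.q := by
  obtain ⟨f, hf, e⟩ := x.exists_desc_assocInv y z hm
  obtain ⟨g, hg, e'⟩ := w.desc .hole trivial hf (by
    have k₁ := (m.actN_isMor (y.mod hb hd)).comp hf
    have k₂ := (m.actM_isMor (y.mod hb hd)).comp hf
    exact y.cellEpi (.cons m.M (.cons b.A .hole)) ⟨hm, hb, trivial⟩ k₁ k₂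
      (Mnd.assoc_balanced₄ (𝓑 := ComodBicat V) (c := a.base) (d := b.base) (e := c.base)
        (o := d.base) (y.αL_mod hb hd) (x.bal.trans (Category.assoc _ _ _)) e))
  exact ⟨g, hg, (congrArg (_ ≫ ·) e').trans e⟩

end Bullet

end QuantumModules

namespace QuantumModules

section bimodules

local infixr:81 " ◀ " => Bicategory.whiskerLeft
local infixl:81 " ▶ " => Bicategory.whiskerRight
local notation "αᵇ" => Bicategory.associator
local infixr:80 " ≫ᵇ " => bicategoricalComp

universe w₁ w₂ w₃
variable {𝓑 : Type w₁} [Bicategory.{w₃, w₂} 𝓑] {c d e o r : 𝓑}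

namespace Mnd
variable {A : c ⟶ c} {a : Mnd A} {B : d ⟶ d} {b : Mnd B} {M : c ⟶ d} {x : A ≫ M ≫ B ⟶ M}

lemma actL_equivariant (hx : IsAct a b x) :
    A ◀ b.actL x ▶ B ≫ x = a.tensorAct (A ◀ a.μ ≫ a.μ) x ≫ b.actL x := by
  have h₁ := hx.whiskerLeft_actR
  have h₂ := hx.actL_whiskerRight
  have h₃ := hx.actL_assoc
  calc _ = A ◀ (b.actL x ▶ B ≫ a.actR x) ≫ b.actL x := by nth_rw 2 [← h₁]; simp
    _ = A ◀ (αᵇ A M B).hom ≫ A ◀ (A ◀ a.actR x ≫ b.actL x) ≫ b.actL x := by rw [h₂, h₁]; simp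
    _ = 𝟙 _ ≫ᵇ (A ≫ A) ◀ a.actR x ≫ᵇ (A ◀ b.actL x ≫ b.actL x) := by bicategory
    _ = 𝟙 _ ≫ᵇ ((A ≫ A) ◀ a.actR x ≫ a.μ ▶ M) ≫ b.actL x := by rw [h₃]; bicategory
    _ = _ := by rw [Bicategory.whisker_exchange, tensorAct, actL_self]; bicategory

lemma actR_equivariant (hx : IsAct a b x) :
    A ◀ a.actR x ▶ B ≫ x = b.tensorAct x (B ◀ b.μ ≫ b.μ) ≫ a.actR x := by
  have h₁ := hx.whiskerLeft_actR
  have h₂ := hx.inv_actL_whiskerRight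
  have h₃ := hx.actR_assoc
  have h₄ := hx.actL_whiskerRight
  calc _ = 𝟙 _ ≫ᵇ (A ◀ a.actR x ≫ b.actL x) ▶ B ≫ a.actR x := by
        nth_rw 2 [← h₂]; bicategory
    _ = 𝟙 _ ≫ᵇ ((αᵇ A M B).inv ≫ b.actL x ▶ B ≫ a.actR x) ▶ B ≫ a.actR x := by
        rw [h₁, h₂]
    _ = 𝟙 _ ≫ᵇ b.actL x ▶ (B ≫ B) ≫ᵇ (a.actR x ▶ B ≫ a.actR x) := by bicategory
    _ = _ := by rw [h₃, tensorAct, actR_self]; bicategory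

lemma actL_etaL_comp {Q : c ⟶ d} {q : A ≫ M ⟶ Q}
    (hq : A ◀ b.actL x ≫ q = ((αᵇ A A M).inv ≫ a.μ ▶ M) ≫ q) :
    b.actL x ≫ a.etaL M ≫ q = q := by
  have n := a.etaL_naturality (b.actL x)
  rw [← reassoc_of% n, hq, etaL_comp]
  calc _ = (a.etaL A ≫ a.μ) ▶ M ≫ q := by bicategory
    _ = q := by rw [etaL_mul]; simp

lemma actR_etaR_comp {Q : c ⟶ d} {q : M ≫ B ⟶ Q}
    (hq : M ◀ b.μ ≫ q = ((αᵇ M B B).inv ≫ a.actR x ▶ B) ≫ q) :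
    a.actR x ≫ b.etaR M ≫ q = q := by
  have n := b.etaR_naturality (a.actR x)
  have hq' : a.actR x ▶ B ≫ q = (αᵇ M B B).hom ≫ M ◀ b.μ ≫ q := by rw [hq]; simp
  rw [← reassoc_of% n, hq', etaR_comp]
  calc _ = M ◀ (b.etaR B ≫ b.μ) ≫ q := by bicategory
    _ = q := by rw [etaR_mul]; simp

end Mnd

variable {M M' : c ⟶ d} {N N' : d ⟶ e} {L L' : e ⟶ o}

lemma assoc_naturality {X X' : c ⟶ e} {Y Y' : d ⟶ o} {Z Z' W W' : c ⟶ o} {f : M ⟶ M'} {g : N ⟶ N'}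
    {h : L ⟶ L'} {q : M ≫ N ⟶ X} {q' : M' ≫ N' ⟶ X'} {p : N ≫ L ⟶ Y} {p' : N' ≫ L' ⟶ Y'}
    {z : X ≫ L ⟶ Z} {z' : X' ≫ L' ⟶ Z'} {w : M ≫ Y ⟶ W} {w' : M' ≫ Y' ⟶ W'} {s : X ⟶ X'}
    {t : Y ⟶ Y'} {u : Z ⟶ Z'} {v : W ⟶ W'} {i : Z ⟶ W} {i' : Z' ⟶ W'}
    (hs : q ≫ s = (f ▶ N ≫ M' ◀ g) ≫ q') (ht : p ≫ t = (g ▶ L ≫ N' ◀ h) ≫ p')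
    (hu : z ≫ u = (s ▶ L ≫ X' ◀ h) ≫ z') (hv : w ≫ v = (f ▶ Y ≫ M' ◀ t) ≫ w')
    (hi : q ▶ L ≫ z ≫ i = (αᵇ M N L).hom ≫ M ◀ p ≫ w)
    (hi' : q' ▶ L' ≫ z' ≫ i' = (αᵇ M' N' L').hom ≫ M' ◀ p' ≫ w') :
    q ▶ L ≫ z ≫ u ≫ i' = q ▶ L ≫ z ≫ i ≫ v :=
  calc _ = q ▶ L ≫ (z ≫ u) ≫ i' := by simp
    _ = 𝟙 _ ≫ᵇ (q ≫ s) ▶ L ≫ X' ◀ h ≫ z' ≫ i' := by rw [hu]; bicategory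
    _ = 𝟙 _ ≫ᵇ (f ▶ N ≫ M' ◀ g) ▶ L ≫ (q' ▶ L ≫ X' ◀ h) ≫ z' ≫ i' := by rw [hs]; bicategory
    _ = 𝟙 _ ≫ᵇ (f ▶ N ≫ M' ◀ g) ▶ L ≫ (M' ≫ N') ◀ h ≫ (q' ▶ L' ≫ z' ≫ i') := by
        rw [← Bicategory.whisker_exchange q' h]; bicategory
    _ = 𝟙 _ ≫ᵇ f ▶ (N ≫ L) ≫ M' ◀ ((g ▶ L ≫ N' ◀ h) ≫ p') ≫ w' := by rw [hi']; bicategory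
    _ = 𝟙 _ ≫ᵇ (f ▶ (N ≫ L) ≫ M' ◀ p) ≫ M' ◀ t ≫ w' := by rw [← ht]; bicategory
    _ = (αᵇ M N L).hom ≫ M ◀ p ≫ ((f ▶ Y ≫ M' ◀ t) ≫ w') := by
        rw [← Bicategory.whisker_exchange f p]; bicategory
    _ = (q ▶ L ≫ z ≫ i) ≫ v := by rw [← hv, hi]; simp
    _ = _ := by simp

lemma assoc_pentagon {K : o ⟶ r} {X : c ⟶ e} {Z W : c ⟶ o} {Y : d ⟶ o} {R : e ⟶ r} {T T' : d ⟶ r}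
    {P P' U S S' : c ⟶ r} {x : M ≫ N ⟶ X} {y : N ≫ L ⟶ Y} {z : X ≫ L ⟶ Z} {w : M ≫ Y ⟶ W}
    {p : Z ≫ K ⟶ P} {p' : W ≫ K ⟶ P'} {k : L ≫ K ⟶ R} {t : Y ≫ K ⟶ T} {t' : N ≫ R ⟶ T'}
    {u : X ≫ R ⟶ U} {s : M ≫ T ⟶ S} {s' : M ≫ T' ⟶ S'} {i : Z ⟶ W} {i' : P ⟶ P'} {j : P' ⟶ S}
    {l : T ⟶ T'} {l' : S ⟶ S'} {m : P ⟶ U} {n : U ⟶ S'}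
    (hi : x ▶ L ≫ z ≫ i = (αᵇ M N L).hom ≫ M ◀ y ≫ w) (hi' : p ≫ i' = i ▶ K ≫ p')
    (hj : w ▶ K ≫ p' ≫ j = (αᵇ M Y K).hom ≫ M ◀ t ≫ s) (hl' : s ≫ l' = M ◀ l ≫ s')
    (hl : y ▶ K ≫ t ≫ l = (αᵇ N L K).hom ≫ N ◀ k ≫ t')
    (hm : z ▶ K ≫ p ≫ m = (αᵇ X L K).hom ≫ X ◀ k ≫ u)
    (hn : x ▶ R ≫ u ≫ n = (αᵇ M N R).hom ≫ M ◀ t' ≫ s') :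
    x ▶ (L ≫ K) ≫ (αᵇ X L K).inv ≫ z ▶ K ≫ p ≫ i' ≫ j ≫ l' =
      x ▶ (L ≫ K) ≫ (αᵇ X L K).inv ≫ z ▶ K ≫ p ≫ m ≫ n := by
  calc _ = x ▶ (L ≫ K) ≫ (αᵇ X L K).inv ≫ z ▶ K ≫ (p ≫ i') ≫ j ≫ l' := by simp
    _ = 𝟙 _ ≫ᵇ (x ▶ L ≫ z ≫ i) ▶ K ≫ p' ≫ j ≫ l' := by rw [hi']; bicategory
    _ = 𝟙 _ ≫ᵇ (M ◀ y) ▶ K ≫ (w ▶ K ≫ p' ≫ j) ≫ l' := by rw [hi]; bicategory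
    _ = 𝟙 _ ≫ᵇ M ◀ (y ▶ K ≫ t) ≫ (s ≫ l') := by rw [hj]; bicategory
    _ = 𝟙 _ ≫ᵇ M ◀ (y ▶ K ≫ t ≫ l) ≫ s' := by rw [hl']; bicategory
    _ = 𝟙 _ ≫ᵇ (M ≫ N) ◀ k ≫ ((αᵇ M N R).hom ≫ M ◀ t' ≫ s') := by rw [hl]; bicategory
    _ = 𝟙 _ ≫ᵇ ((M ≫ N) ◀ k ≫ x ▶ R) ≫ u ≫ n := by rw [← hn]; bicategory
    _ = 𝟙 _ ≫ᵇ x ▶ (L ≫ K) ≫ᵇ ((αᵇ X L K).hom ≫ X ◀ k ≫ u) ≫ n := by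
        rw [Bicategory.whisker_exchange]; bicategory
    _ = _ := by rw [← hm]; bicategory

lemma assoc_triangle {A : d ⟶ d} {X : c ⟶ d} {Y : d ⟶ e} {N : d ⟶ e} {Z W Q : c ⟶ e}
    {mR : M ≫ A ⟶ M} {nL : A ≫ N ⟶ N}
    {x : M ≫ A ⟶ X} {y : A ≫ N ⟶ Y} {z : X ≫ N ⟶ Z} {w : M ≫ Y ⟶ W} {q : M ≫ N ⟶ Q}
    {i : Z ⟶ W} {l : Y ⟶ N} {l' : W ⟶ Q} {k : X ⟶ M} {k' : Z ⟶ Q}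
    (hi : x ▶ N ≫ z ≫ i = (αᵇ M A N).hom ≫ M ◀ y ≫ w) (hl : y ≫ l = nL) (hl' : w ≫ l' = M ◀ l ≫ q)
    (hk : x ≫ k = mR) (hk' : z ≫ k' = k ▶ N ≫ q)
    (hq : M ◀ nL ≫ q = ((αᵇ M A N).inv ≫ mR ▶ N) ≫ q) :
    x ▶ N ≫ z ≫ i ≫ l' = x ▶ N ≫ z ≫ k' :=
  calc _ = (x ▶ N ≫ z ≫ i) ≫ l' := by simp
    _ = (αᵇ M A N).hom ≫ M ◀ y ≫ w ≫ l' := by rw [hi]; simp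
    _ = (αᵇ M A N).hom ≫ M ◀ nL ≫ q := by rw [hl', ← hl]; simp
    _ = (x ≫ k) ▶ N ≫ q := by rw [hq, hk]; simp
    _ = _ := by rw [hk']; simp

end bimodules

end QuantumModules

namespace QuantumModules
open Comodule

variable {V : Type u} [Category.{v} V] [MonoidalCategory V] [BraidedCategory V]
  [HasCoreflexiveEqualizers V]
  [∀ X : V, Comonad.PreservesLimitOfIsCoreflexivePair (tensorLeft X)]

lemma iso_comp_cancel {𝒞 : Type*} [Category* 𝒞] {P Q X Y Z W : 𝒞} (i : P ≅ Q) {u : P ⟶ X} {v : X ⟶ Z}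
    {u' : Q ⟶ Y} {v' : Y ⟶ W} {f : Z ⟶ W} {g : W ⟶ Z} (hf : u ≫ v ≫ f = i.hom ≫ u' ≫ v')
    (hg : u' ≫ v' ≫ g = i.inv ≫ u ≫ v) : u ≫ v ≫ f ≫ g = u ≫ v ≫ 𝟙 Z := by
  have h : u ≫ v ≫ f ≫ g = (u ≫ v ≫ f) ≫ g := by simp
  rw [h, hf, Category.assoc, Category.assoc, hg]
  simp

/-- A quantum category acting on itself. -/
noncomputable def QModule.unit (a : QuantumCategory V) : QModule a a :=
  ⟨unitData a, isQModule_unitData a⟩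

lemma QModule.αL_unit (a : QuantumCategory V) : (QModule.unit a).αL = a.μ :=
  a.mnd.actL_self

lemma QModule.αR_unit (a : QuantumCategory V) : (QModule.unit a).αR = a.μ :=
  a.mnd.actR_self

namespace Bullet
variable {𝒳 : ∀ C D : Comon V, Cell C D → Prop} {a b c d : QuantumCategory V}
  {m : QModule a b} {n : QModule b c} {l : QModule c d}
  {ha : 𝒳 _ _ a.A} {hb : 𝒳 _ _ b.A} {hc : 𝒳 _ _ c.A} {hd : 𝒳 _ _ d.A}

section
variable (x : Bullet 𝒳 m n) (y : Bullet 𝒳 n l) (z : Bullet 𝒳 (x.mod ha hc) l)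
  (w : Bullet 𝒳 m (y.mod hb hd))

lemma flat_ext_left (hl : 𝒳 _ _ l.M) {Y : Cell a.C d.C} {f g : z.Q.flat ⟶ Y.flat}
    (hf : z.Q.multi.IsMor Y.multi f) (hg : z.Q.multi.IsMor Y.multi g)
    (h : compMap x.q (𝟙 l.M.flat) ≫ z.q ≫ f = compMap x.q (𝟙 l.M.flat) ≫ z.q ≫ g) : f = g :=
  z.cellEpi .hole trivial hf hg
    (x.cellEpi (.app (.single l.M)) hl (z.isMor.comp hf) (z.isMor.comp hg) h)

lemma flat_ext_right (hm : 𝒳 _ _ m.M) {Y : Cell a.C d.C} {f g : w.Q.flat ⟶ Y.flat}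
    (hf : w.Q.multi.IsMor Y.multi f) (hg : w.Q.multi.IsMor Y.multi g)
    (h : compMap (𝟙 m.M.flat) y.q ≫ w.q ≫ f = compMap (𝟙 m.M.flat) y.q ≫ w.q ≫ g) : f = g :=
  w.cellEpi .hole trivial hf hg
    (y.cellEpi (.cons m.M .hole) ⟨hm, trivial⟩ (w.isMor.comp hf) (w.isMor.comp hg) h)

lemma hom_ext_left (hl : 𝒳 _ _ l.M) {k : QModule a d} {φ ψ : z.mod ha hd ⟶ k}
    (h : compMap x.q (𝟙 l.M.flat) ≫ z.q ≫ Cell.flatMap φ.hom =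
      compMap x.q (𝟙 l.M.flat) ≫ z.q ≫ Cell.flatMap ψ.hom) : φ = ψ :=
  QModule.Hom.ext (Cell.flatMap_injective (x.flat_ext_left z hl (flatMap_isMor φ.hom)
    (flatMap_isMor ψ.hom) h))

theorem exists_associator (hm : 𝒳 _ _ m.M) (hl : 𝒳 _ _ l.M) : ∃ φ : z.mod ha hd ≅ w.mod ha hd,
    compMap x.q (𝟙 l.M.flat) ≫ z.q ≫ Cell.flatMap φ.hom.hom =
      (assocIso m.M.flat n.M.flat l.M.flat).inv ≫ compMap (𝟙 m.M.flat) y.q ≫ w.q := by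
  obtain ⟨φ, hφ⟩ := x.exists_assoc y z w hl
  obtain ⟨g, hg, e⟩ := x.exists_assoc_inv y z w hm
  have h₁ : Cell.flatMap φ.hom ≫ g = 𝟙 _ := x.flat_ext_left z hl
    ((flatMap_isMor φ.hom).comp hg) (.id _) (iso_comp_cancel (assocIso _ _ _).symm hφ e)
  have h₂ : g ≫ Cell.flatMap φ.hom = 𝟙 _ := y.flat_ext_right w hm
    (hg.comp (flatMap_isMor φ.hom)) (.id _) (iso_comp_cancel (assocIso _ _ _) e hφ)
  exact ⟨QModule.isoOfInv φ g hg h₁ h₂, hφ⟩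

end

theorem exists_leftUnitor (x : Bullet 𝒳 (QModule.unit a) m) :
    ∃ φ : x.mod ha hb ≅ m, x.q ≫ Cell.flatMap φ.hom.hom = m.αL := by
  have bal : compMap (𝟙 a.A.flat) m.αL ≫ x.q =
      (assocInv a.A.flat a.A.flat m.M.flat ≫ compMap a.μ (𝟙 m.M.flat)) ≫ x.q := by
    rw [← QModule.αR_unit]; exact x.bal
  have hbal : (QModule.unit a).actN m ≫ m.αL = (QModule.unit a).actM m ≫ m.αL := by
    rw [QModule.actM, QModule.αR_unit]
    exact m.isAct.actL_assoc.trans (Category.assoc _ _ _).symm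
  have hact : compMap (𝟙 a.A.flat) (compMap m.αL (𝟙 b.A.flat)) ≫ m.α =
      (QModule.unit a).tensorAct m ≫ m.αL := Mnd.actL_equivariant m.isAct
  obtain ⟨φ, hφ⟩ : ∃ φ : x.mod ha hb ⟶ m, x.q ≫ Cell.flatMap φ.hom = m.αL :=
    x.exists_hom ha hb m.αL_isMor m.αL_isCom hbal hact
  have hg : m.M.multi.IsMor x.Q.multi (a.etaL m.M.flat ≫ x.q) := a.etaL_isMor x.isMor
  refine ⟨QModule.isoOfInv φ (a.etaL m.M.flat ≫ x.q) hg ?_ ?_, hφ⟩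
  · have e : m.αL ≫ a.etaL m.M.flat ≫ x.q = x.q := Mnd.actL_etaL_comp (𝓑 := ComodBicat V)
      (c := a.base) (d := b.base) (a := a.mnd) (b := b.mnd) (x := m.α) bal
    refine x.cellEpi .hole trivial ((flatMap_isMor φ.hom).comp hg) (.id _) ?_
    refine (Category.assoc _ _ _).symm.trans ((congrArg (· ≫ a.etaL m.M.flat ≫ x.q) hφ).trans ?_)
    exact e.trans (Category.comp_id _).symm
  · exact (Category.assoc _ _ _).trans ((congrArg (_ ≫ ·) hφ).trans m.etaL_αL)

theorem exists_rightUnitor (x : Bullet 𝒳 m (QModule.unit b)) :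
    ∃ φ : x.mod ha hb ≅ m, x.q ≫ Cell.flatMap φ.hom.hom = m.αR := by
  have bal : compMap (𝟙 m.M.flat) b.μ ≫ x.q =
      (assocInv m.M.flat b.A.flat b.A.flat ≫ compMap m.αR (𝟙 b.A.flat)) ≫ x.q := by
    rw [← QModule.αL_unit]; exact x.bal
  have hbal : m.actN (QModule.unit b) ≫ m.αR = m.actM (QModule.unit b) ≫ m.αR := by
    have h : compMap m.αR (𝟙 b.A.flat) ≫ m.αR =
      (assocIso m.M.flat b.A.flat b.A.flat).inv ≫ compMap (𝟙 m.M.flat) b.μ ≫ m.αR :=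
        m.isAct.actR_assoc
    rw [QModule.actN, QModule.αL_unit, QModule.actM]
    exact ((Category.assoc _ _ _).trans ((congrArg (_ ≫ ·) h).trans
      (Iso.hom_inv_id_assoc (assocIso m.M.flat b.A.flat b.A.flat) _))).symm
  have hact : compMap (𝟙 a.A.flat) (compMap m.αR (𝟙 b.A.flat)) ≫ m.α =
      m.tensorAct (QModule.unit b) ≫ m.αR := Mnd.actR_equivariant m.isAct
  obtain ⟨φ, hφ⟩ : ∃ φ : x.mod ha hb ⟶ m, x.q ≫ Cell.flatMap φ.hom = m.αR :=
    x.exists_hom ha hb m.αR_isMor m.αR_isCom hbal hact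
  have hg : m.M.multi.IsMor x.Q.multi (b.etaR m.M.flat ≫ x.q) := b.etaR_isMor x.isMor
  refine ⟨QModule.isoOfInv φ (b.etaR m.M.flat ≫ x.q) hg ?_ ?_, hφ⟩
  · have e : m.αR ≫ b.etaR m.M.flat ≫ x.q = x.q := Mnd.actR_etaR_comp (𝓑 := ComodBicat V)
      (c := a.base) (d := b.base) (a := a.mnd) (b := b.mnd) (x := m.α) bal
    refine x.cellEpi .hole trivial ((flatMap_isMor φ.hom).comp hg) (.id _) ?_
    refine (Category.assoc _ _ _).symm.trans ((congrArg (· ≫ b.etaR m.M.flat ≫ x.q) hφ).trans ?_)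
    exact e.trans (Category.comp_id _).symm
  · exact (Category.assoc _ _ _).trans ((congrArg (_ ≫ ·) hφ).trans m.etaR_αR)

end Bullet

end QuantumModules

namespace QuantumModules
open Comodule

variable {V : Type u} [Category.{v} V] [MonoidalCategory V] [BraidedCategory V]
  [HasCoreflexiveEqualizers V] [HasReflexiveCoequalizers V]
  [∀ X : V, Comonad.PreservesLimitOfIsCoreflexivePair (tensorLeft X)]

namespace Admissible
variable {𝒳 : ∀ C D : Comon V, Cell C D → Prop} (h𝒳 : Admissible 𝒳) {a b c d e : QCatIn 𝒳}

/-- The composite of quantum modules in `𝒳`, with its universal property. -/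
noncomputable def bullet (M : QModIn 𝒳 a b) (N : QModIn 𝒳 b c) : Bullet 𝒳 M.mod N.mod :=
  (nonempty_bullet h𝒳 b.mem M.mem N.mem).some

/-- The composite of quantum modules in `𝒳`. -/
noncomputable def comp (M : QModIn 𝒳 a b) (N : QModIn 𝒳 b c) : QModIn 𝒳 a c :=
  ⟨(h𝒳.bullet M N).mod a.mem c.mem, (h𝒳.bullet M N).mem⟩

/-- The universal map to the composite. -/
noncomputable def q (M : QModIn 𝒳 a b) (N : QModIn 𝒳 b c) :
    Comodule.comp M.mod.M.flat N.mod.M.flat ⟶ (h𝒳.comp M N).mod.M.flat :=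
  (h𝒳.bullet M N).q

/-- The identity quantum module. -/
noncomputable def unit (a : QCatIn 𝒳) : QModIn 𝒳 a a := ⟨QModule.unit a.cat, a.mem⟩

lemma flatMap_comp_hom {M N L : QModIn 𝒳 a b} (f : M ⟶ N) (g : N ⟶ L) :
    Cell.flatMap (f ≫ g).hom = Cell.flatMap f.hom ≫ Cell.flatMap g.hom := Cell.flatMap_comp _ _

lemma flatMap_id_hom (M : QModIn 𝒳 a b) : Cell.flatMap (QModule.Hom.hom (𝟙 M)) = 𝟙 M.mod.M.flat :=
  Cell.flatMap_id _

/-- Isomorphisms of quantum modules. -/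
def isoMk {M N : QModIn 𝒳 a b} (φ : M.mod ≅ N.mod) : M ≅ N :=
  ⟨φ.hom, φ.inv, φ.hom_inv_id, φ.inv_hom_id⟩

section
variable {M M' M'' : QModIn 𝒳 a b} {N N' N'' : QModIn 𝒳 b c} {L L' : QModIn 𝒳 c d}

/-- Composition of maps of quantum modules. -/
noncomputable def map (f : M ⟶ M') (g : N ⟶ N') : h𝒳.comp M N ⟶ h𝒳.comp M' N' :=
  ((h𝒳.bullet M N).exists_map (h𝒳.bullet M' N') a.mem c.mem f g).choose

lemma q_map (f : M ⟶ M') (g : N ⟶ N') : h𝒳.q M N ≫ Cell.flatMap (h𝒳.map f g).hom =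
    compMap (Cell.flatMap f.hom) (Cell.flatMap g.hom) ≫ h𝒳.q M' N' :=
  ((h𝒳.bullet M N).exists_map (h𝒳.bullet M' N') a.mem c.mem f g).choose_spec

lemma q_map_eq (f : M ⟶ M') (g : N ⟶ N') : h𝒳.q M N ≫ Cell.flatMap (h𝒳.map f g).hom =
    (compMap (Cell.flatMap f.hom) (𝟙 _) ≫ compMap (𝟙 _) (Cell.flatMap g.hom)) ≫ h𝒳.q M' N' :=
  (h𝒳.q_map f g).trans (congrArg (· ≫ _) (compMap_eq _ _))

lemma q_map_id_left (M : QModIn 𝒳 a b) (g : N ⟶ N') : h𝒳.q M N ≫ Cell.flatMap (h𝒳.map (𝟙 M) g).hom =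
    compMap (𝟙 _) (Cell.flatMap g.hom) ≫ h𝒳.q M N' := by
  rw [q_map, flatMap_id_hom]

lemma q_map_id_right (f : M ⟶ M') (N : QModIn 𝒳 b c) : h𝒳.q M N ≫ Cell.flatMap (h𝒳.map f (𝟙 N)).hom =
    compMap (Cell.flatMap f.hom) (𝟙 _) ≫ h𝒳.q M' N := by
  rw [q_map, flatMap_id_hom]

lemma hom_ext {K : QModIn 𝒳 a c} {φ ψ : h𝒳.comp M N ⟶ K}
    (h : h𝒳.q M N ≫ Cell.flatMap φ.hom = h𝒳.q M N ≫ Cell.flatMap ψ.hom) : φ = ψ :=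
  (h𝒳.bullet M N).hom_ext a.mem c.mem h

lemma hom_ext_left {K : QModIn 𝒳 a d} {φ ψ : h𝒳.comp (h𝒳.comp M N) L ⟶ K}
    (h : compMap (h𝒳.q M N) (𝟙 L.mod.M.flat) ≫ h𝒳.q (h𝒳.comp M N) L ≫ Cell.flatMap φ.hom =
      compMap (h𝒳.q M N) (𝟙 L.mod.M.flat) ≫ h𝒳.q (h𝒳.comp M N) L ≫ Cell.flatMap ψ.hom) : φ = ψ :=
  (h𝒳.bullet M N).hom_ext_left (ha := a.mem) (hc := c.mem) (hd := d.mem)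
    (h𝒳.bullet (h𝒳.comp M N) L) L.mem h

lemma map_id (M : QModIn 𝒳 a b) (N : QModIn 𝒳 b c) : h𝒳.map (𝟙 M) (𝟙 N) = 𝟙 _ :=
  h𝒳.hom_ext (by
    rw [q_map_id_left, flatMap_id_hom, compMap_id, flatMap_id_hom, Category.id_comp,
      Category.comp_id])

lemma map_comp (f : M ⟶ M') (f' : M' ⟶ M'') (g : N ⟶ N') (g' : N' ⟶ N'') :
    h𝒳.map (f ≫ f') (g ≫ g') = h𝒳.map f g ≫ h𝒳.map f' g' :=
  h𝒳.hom_ext (by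
    rw [q_map, flatMap_comp_hom, flatMap_comp_hom, flatMap_comp_hom, compMap_comp,
      Category.assoc, ← q_map, ← Category.assoc, ← q_map, Category.assoc])

/-- The associativity constraint. -/
noncomputable def associator (M : QModIn 𝒳 a b) (N : QModIn 𝒳 b c) (L : QModIn 𝒳 c d) :
    h𝒳.comp (h𝒳.comp M N) L ≅ h𝒳.comp M (h𝒳.comp N L) :=
  isoMk ((h𝒳.bullet M N).exists_associator (ha := a.mem) (hb := b.mem) (hc := c.mem) (hd := d.mem)
    (h𝒳.bullet N L) (h𝒳.bullet (h𝒳.comp M N) L)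
    (h𝒳.bullet M (h𝒳.comp N L)) M.mem L.mem).choose

lemma q_assoc (M : QModIn 𝒳 a b) (N : QModIn 𝒳 b c) (L : QModIn 𝒳 c d) :
    compMap (h𝒳.q M N) (𝟙 L.mod.M.flat) ≫ h𝒳.q (h𝒳.comp M N) L ≫
      Cell.flatMap (h𝒳.associator M N L).hom.hom =
      (assocIso M.mod.M.flat N.mod.M.flat L.mod.M.flat).inv ≫
        compMap (𝟙 M.mod.M.flat) (h𝒳.q N L) ≫ h𝒳.q M (h𝒳.comp N L) :=
  ((h𝒳.bullet M N).exists_associator (ha := a.mem) (hb := b.mem) (hc := c.mem) (hd := d.mem)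
    (h𝒳.bullet N L) (h𝒳.bullet (h𝒳.comp M N) L)
    (h𝒳.bullet M (h𝒳.comp N L)) M.mem L.mem).choose_spec

/-- The left unit constraint. -/
noncomputable def leftUnitor (M : QModIn 𝒳 a b) : h𝒳.comp (unit a) M ≅ M :=
  isoMk ((h𝒳.bullet (unit a) M).exists_leftUnitor (ha := a.mem) (hb := b.mem)).choose

lemma q_leftUnitor (M : QModIn 𝒳 a b) :
    h𝒳.q (unit a) M ≫ Cell.flatMap (h𝒳.leftUnitor M).hom.hom = M.mod.αL :=
  ((h𝒳.bullet (unit a) M).exists_leftUnitor (ha := a.mem) (hb := b.mem)).choose_spec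

/-- The right unit constraint. -/
noncomputable def rightUnitor (M : QModIn 𝒳 a b) : h𝒳.comp M (unit b) ≅ M :=
  isoMk ((h𝒳.bullet M (unit b)).exists_rightUnitor (ha := a.mem) (hb := b.mem)).choose

lemma q_rightUnitor (M : QModIn 𝒳 a b) :
    h𝒳.q M (unit b) ≫ Cell.flatMap (h𝒳.rightUnitor M).hom.hom = M.mod.αR :=
  ((h𝒳.bullet M (unit b)).exists_rightUnitor (ha := a.mem) (hb := b.mem)).choose_spec

lemma assoc_naturality (f : M ⟶ M') (g : N ⟶ N') (h : L ⟶ L') :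
    h𝒳.map (h𝒳.map f g) h ≫ (h𝒳.associator M' N' L').hom =
      (h𝒳.associator M N L).hom ≫ h𝒳.map f (h𝒳.map g h) := by
  refine h𝒳.hom_ext_left ?_
  rw [flatMap_comp_hom, flatMap_comp_hom]
  have k := QuantumModules.assoc_naturality (𝓑 := ComodBicat V) (c := a.cat.base)
    (d := b.cat.base) (e := c.cat.base) (o := d.cat.base) (h𝒳.q_map_eq f g) (h𝒳.q_map_eq g h)
    (h𝒳.q_map_eq (h𝒳.map f g) h) (h𝒳.q_map_eq f (h𝒳.map g h)) (h𝒳.q_assoc M N L)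
    (h𝒳.q_assoc M' N' L')
  exact k

lemma leftUnitor_naturality (f : M ⟶ M') :
    h𝒳.map (𝟙 (unit a)) f ≫ (h𝒳.leftUnitor M').hom = (h𝒳.leftUnitor M).hom ≫ f := by
  refine h𝒳.hom_ext ?_
  rw [flatMap_comp_hom, flatMap_comp_hom, ← Category.assoc, q_map_id_left, ← Category.assoc,
    q_leftUnitor, Category.assoc, q_leftUnitor]
  exact QModule.hom_αL f

lemma rightUnitor_naturality (f : M ⟶ M') :
    h𝒳.map f (𝟙 (unit b)) ≫ (h𝒳.rightUnitor M').hom = (h𝒳.rightUnitor M).hom ≫ f := by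
  refine h𝒳.hom_ext ?_
  rw [flatMap_comp_hom, flatMap_comp_hom, ← Category.assoc, q_map_id_right, ← Category.assoc,
    q_rightUnitor, Category.assoc, q_rightUnitor]
  exact QModule.hom_αR f

end

lemma pentagon (M : QModIn 𝒳 a b) (N : QModIn 𝒳 b c) (L : QModIn 𝒳 c d) (K : QModIn 𝒳 d e) :
    h𝒳.map (h𝒳.associator M N L).hom (𝟙 K) ≫ (h𝒳.associator M (h𝒳.comp N L) K).hom ≫
        h𝒳.map (𝟙 M) (h𝒳.associator N L K).hom =
      (h𝒳.associator (h𝒳.comp M N) L K).hom ≫ (h𝒳.associator M N (h𝒳.comp L K)).hom := by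
  refine h𝒳.hom_ext_left ?_
  have k := QuantumModules.assoc_pentagon (𝓑 := ComodBicat V) (c := a.cat.base)
    (d := b.cat.base) (e := c.cat.base) (o := d.cat.base) (r := e.cat.base) (h𝒳.q_assoc M N L)
    (h𝒳.q_map_id_right (h𝒳.associator M N L).hom K) (h𝒳.q_assoc M (h𝒳.comp N L) K)
    (h𝒳.q_map_id_left M (h𝒳.associator N L K).hom) (h𝒳.q_assoc N L K)
    (h𝒳.q_assoc (h𝒳.comp M N) L K) (h𝒳.q_assoc M N (h𝒳.comp L K))
  have i := Multi.IsMor.assocInv (h𝒳.comp M N).mod.M.multi L.mod.M.multi K.mod.M.multi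
  have t := (h𝒳.bullet (h𝒳.comp M N) L).isMor.tensor (.id K.mod.M.multi)
  have t' := (h𝒳.bullet (h𝒳.comp (h𝒳.comp M N) L) K).isMor
  have key := (h𝒳.bullet M N).cellEpi (.app (.two L.mod.M K.mod.M)) ⟨L.mem, K.mem⟩
    (i.comp (t.comp (t'.comp ((flatMap_isMor (h𝒳.map (h𝒳.associator M N L).hom (𝟙 K)).hom).comp
      ((flatMap_isMor (h𝒳.associator M (h𝒳.comp N L) K).hom.hom).comp
        (flatMap_isMor (h𝒳.map (𝟙 M) (h𝒳.associator N L K).hom).hom))))))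
    (i.comp (t.comp (t'.comp ((flatMap_isMor (h𝒳.associator (h𝒳.comp M N) L K).hom.hom).comp
      (flatMap_isMor (h𝒳.associator M N (h𝒳.comp L K)).hom.hom))))) k
  have key' := (cancel_epi (assocIso (h𝒳.comp M N).mod.M.flat L.mod.M.flat K.mod.M.flat).hom).1 key
  rw [flatMap_comp_hom, flatMap_comp_hom, flatMap_comp_hom]
  exact key'

lemma triangle (M : QModIn 𝒳 a b) (N : QModIn 𝒳 b c) :
    (h𝒳.associator M (unit b) N).hom ≫ h𝒳.map (𝟙 M) (h𝒳.leftUnitor N).hom =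
      h𝒳.map (h𝒳.rightUnitor M).hom (𝟙 N) := by
  refine h𝒳.hom_ext_left ?_
  rw [flatMap_comp_hom]
  have k := QuantumModules.assoc_triangle (𝓑 := ComodBicat V) (c := a.cat.base)
    (d := b.cat.base) (e := c.cat.base) (h𝒳.q_assoc M (unit b) N) (h𝒳.q_leftUnitor N)
    (h𝒳.q_map_id_left M (h𝒳.leftUnitor N).hom) (h𝒳.q_rightUnitor M)
    (h𝒳.q_map_id_right (h𝒳.rightUnitor M).hom N) (h𝒳.bullet M N).bal
  exact k

/-- The bicategory of quantum categories and quantum modules in `𝒳`. -/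
noncomputable def bicategoryOn : BicategoryOn (QCatIn 𝒳) (QModIn 𝒳) unit where
  comp := h𝒳.comp
  whiskerLeft M _ _ f := h𝒳.map (𝟙 M) f
  whiskerRight f N := h𝒳.map f (𝟙 N)
  associator := h𝒳.associator
  leftUnitor := h𝒳.leftUnitor
  rightUnitor := h𝒳.rightUnitor
  whiskerLeft_id := h𝒳.map_id
  whiskerLeft_comp f _ _ _ g h := by rw [← map_comp, Category.comp_id]
  id_whiskerLeft f := by
    rw [← Category.assoc, ← leftUnitor_naturality, Category.assoc, Iso.hom_inv_id, Category.comp_id]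
  comp_whiskerLeft M N _ _ f := by
    rw [← Category.assoc, ← assoc_naturality, map_id, Category.assoc, Iso.hom_inv_id,
      Category.comp_id]
  id_whiskerRight := h𝒳.map_id
  comp_whiskerRight f g _ := by rw [← map_comp, Category.comp_id]
  whiskerRight_id f := by
    rw [← Category.assoc, ← rightUnitor_naturality, Category.assoc, Iso.hom_inv_id,
      Category.comp_id]
  whiskerRight_comp f N L := by
    rw [assoc_naturality, Iso.inv_hom_id_assoc, map_id]
  whisker_assoc M _ _ f L := by
    rw [← Category.assoc, ← assoc_naturality, Category.assoc, Iso.hom_inv_id, Category.comp_id]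
  whisker_exchange f g := by
    rw [← map_comp, ← map_comp, Category.comp_id, Category.comp_id, Category.id_comp,
      Category.id_comp]
  pentagon := h𝒳.pentagon
  triangle := h𝒳.triangle

end Admissible

end QuantumModules

theorem theorem11 {V : Type u} [Category.{v} V] [MonoidalCategory V] [BraidedCategory V]
    [HasCoreflexiveEqualizers V] [HasReflexiveCoequalizers V]
    [∀ X : V, Comonad.PreservesLimitOfIsCoreflexivePair (tensorLeft X)]
    (𝒳 : ∀ C D : Comon V, Cell C D → Prop) (h𝒳 : Admissible 𝒳) :
    ∃ (hunit : ∀ a : QCatIn 𝒳, IsQModule (unitData a.cat))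
      (S : BicategoryOn (QCatIn 𝒳) (QModIn 𝒳) (fun a => ⟨⟨unitData a.cat, hunit a⟩, a.mem⟩))
      (q : ∀ {a b c : QCatIn 𝒳} (M : QModIn 𝒳 a b) (N : QModIn 𝒳 b c),
        (Path.two M.mod.M N.mod.M).dom ⟶ (S.comp M N).mod.M.flat),
      (∀ {a b c : QCatIn 𝒳} (M : QModIn 𝒳 a b) (N : QModIn 𝒳 b c),
        IsBullet M.mod N.mod (S.comp M N).mod (q M N)) ∧
      (∀ {a b c : QCatIn 𝒳} (M : QModIn 𝒳 a b) {N N' : QModIn 𝒳 b c} (f : N ⟶ N'),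
        q M N ≫ Cell.flatMap (S.whiskerLeft M f).hom =
          Comodule.compMap (𝟙 M.mod.M.flat) (Cell.flatMap f.hom) ≫ q M N') ∧
      (∀ {a b c : QCatIn 𝒳} {M M' : QModIn 𝒳 a b} (f : M ⟶ M') (N : QModIn 𝒳 b c),
        q M N ≫ Cell.flatMap (S.whiskerRight f N).hom =
          Comodule.compMap (Cell.flatMap f.hom) (𝟙 N.mod.M.flat) ≫ q M' N) ∧
      (∀ {a b c d : QCatIn 𝒳} (M : QModIn 𝒳 a b) (N : QModIn 𝒳 b c) (L : QModIn 𝒳 c d),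
        (Subst.cons (p := .two M.mod.M N.mod.M) (q M N)
            (.single (p := .single L.mod.M) (𝟙 L.mod.M.flat))).map ≫ q (S.comp M N) L ≫
              Cell.flatMap (S.associator M N L).hom.hom =
          Comodule.compMap (𝟙 M.mod.M.flat) (q N L) ≫ q M (S.comp N L)) ∧
      (∀ {a b : QCatIn 𝒳} (M : QModIn 𝒳 a b),
        q _ M ≫ Cell.flatMap (S.leftUnitor M).hom.hom = M.mod.αL) ∧
      (∀ {a b : QCatIn 𝒳} (M : QModIn 𝒳 a b),
        q M _ ≫ Cell.flatMap (S.rightUnitor M).hom.hom = M.mod.αR) := by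
  refine ⟨fun a => isQModule_unitData a.cat, h𝒳.bicategoryOn, h𝒳.q, ?_, ?_, ?_, ?_, ?_, ?_⟩
  · exact fun {a b c} M N => (h𝒳.bullet M N).isBullet a.mem c.mem
  · exact fun M _ _ f => h𝒳.q_map_id_left M f
  · exact fun f N => h𝒳.q_map_id_right f N
  · intro a b c d M N L
    have e := (subst_two (Y := L.mod.M) (p := .two M.mod.M N.mod.M) (h𝒳.q M N)).trans
      (congrArg (· ≫ Comodule.compMap (h𝒳.q M N) (𝟙 L.mod.M.flat)) (append_two M.mod.M N.mod.M _))
    refine (congrArg (· ≫ _) e).trans ((Category.assoc _ _ _).trans ?_)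
    refine (congrArg (_ ≫ ·) (h𝒳.q_assoc M N L)).trans ?_
    exact Iso.hom_inv_id_assoc (Comodule.assocIso M.mod.M.flat N.mod.M.flat L.mod.M.flat) _
  · exact fun M => h𝒳.q_leftUnitor M
  · exact fun M => h𝒳.q_rightUnitor M
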